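/- Let $m_i,m_e,\nu_i,\nu_e,e,c>0$ be constants. For vector fields on $\mathbb R^3$ consider the electromagnetic part of the linearized two-fluid Euler–Maxwell system with collisions $$ \begin{aligned} &m_{i}\partial_t u_{i,\perp}-eE_{\perp}+m_{i}\nu_{i}u_{i,\perp}=0,\qquad m_{e}\partial_t u_{e,\perp}+eE_{\perp}+m_{e}\nu_{e}u_{e,\perp}=0,\\ &\partial_t E_{\perp}-c\nabla\times B+4\pi(eu_{i,\perp}-eu_{e,\perp})=0,\qquad \partial_t B+c\nabla\times E_{\perp}=0, \end{aligned} $$ with initial data $[u_{\alpha,\perp},E_\perp,B]|_{t=0}=[u_{\alpha0,\perp},E_{0,\perp},B_0]$, $\alpha=i,e$, where $U_0=[u_{i0},u_{e0},E_0,B_0]$, $\nabla\cdot B_0=0$, and $w_\perp=(-\Delta)^{-1}\nabla\times(\nabla\times w)$ is the solenoidal part of $w$; solutions are taken in $C([0,\infty);L^2(\mathbb R^3))$ in the sense of distributions. Put $$ \mu_2=\frac{c^{2}m_{i}\nu_{i}m_{e}\nu_{e}}{4\pi e^{2}(m_{i}\nu_{i}+m_{e}\nu_{e})},\qquad \bar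 B(t)=G_{\mu_2}(t,\cdot)*B_0\ (t>0),\quad \bar B(0)=B_0,\qquad G_\mu(t,x)=(4\pi\mu t)^{-3/2}e^{-|x|^2/(4\mu t)}, $$ $$ \bar u_{i,\perp}=\frac{c}{4\pi e}\frac{m_{e}\nu_{e}}{m_{i}\nu_{i}+m_{e}\nu_{e}}\nabla\times\bar B,\quad \bar u_{e,\perp}=-\frac{c}{4\pi e}\frac{m_{i}\nu_{i}}{m_{i}\nu_{i}+m_{e}\nu_{e}}\nabla\times\bar B,\quad \bar E_{\perp}=\frac{c}{4\pi e^2}\frac{m_{i}\nu_{i}m_{e}\nu_{e}}{m_{i}\nu_{i}+m_{e}\nu_{e}}\nabla\times\bar B . $$ For $\ell\ge0$ and $1\le r\le2\le q\le\infty$ let $[\ell+3(\frac1r-\frac1q)]_+=\ell$ if $\ell$ is an integer and $r=q=2$, and let it be the integer part of $\ell+3(\frac1r-\frac1q)$ plus $1$ otherwise. Then there is $\lambda>0$, depending only on the physical constants, such that for all $1\le p,r\le2\le q\le\infty$, all real $\ell\ge0$ and all integers $m\ge1$ there is a constant $C=C(m,p,r,q,\ell)>0$ (depending also on the physical constants)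 such that for every $U_0\in L^p$ as above, every solution as above, all $t\ge0$ and $\alpha=i,e$, $$ \begin{aligned} \|\nabla^{m}(u_{\alpha,\perp}-\bar u_{\alpha,\perp})(t)\|_{L^q}\ \text{ and }\ \|\nabla^{m}(E_{\perp}-\bar E_{\perp})(t)\|_{L^q}\ \le\ & C(1+t)^{-\frac32(\frac1p-\frac1q)-\frac{m+2}{2}}\|U_0\|_{L^p}+Ce^{-\lambda t}\|U_0\|_{L^p}\\ &+C(1+t)^{-\frac{\ell}{2}}\|\nabla^{m+[\ell+3(\frac1r-\frac1q)]_+}U_0\|_{L^r}+Ce^{-\lambda t}\|\nabla^{m+1+[3(\frac1r-\frac1q)]_+}B_0\|_{L^r}, \end{aligned} $$ $$ \begin{aligned} \|\nabla^{m}(B-\bar B)(t)\|_{L^q}\ \le\ & C(1+t)^{-\frac32(\frac1p-\frac1q)-\frac{m+1}{2}}\|U_0\|_{L^p}+Ce^{-\lambda t}\|U_0\|_{L^p}\\ &+C(1+t)^{-\frac{\ell}{2}}\|\nabla^{m+[\ell+3(\frac1r-\frac1q)]_+}U_0\|_{L^r}+Ce^{-\lambda t}\|\nabla^{m+[3(\frac1r-\frac1q)]_+}B_0\|_{L^r}.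 \end{aligned} $$ Derivatives are weak derivatives, and a norm is $+\infty$ if the derivative does not exist as a function in the space. -/

import Mathlib

open MeasureTheory Filter Topology Set
open scoped ENNReal ContDiff

noncomputable section

namespace EulerMaxwell

/-- Physical space `ℝ³` with its Euclidean structure. -/
abbrev V : Type := EuclideanSpace ℝ (Fin 3)

/-- The `j`-th vector of the standard basis of `ℝ³`. -/
def basisVec (j : Fin 3) : V := EuclideanSpace.single j 1

/-- The physical constants: masses, collision frequencies, elementary charge (the ions have
charge `e`, the electrons `-e`) and speed of light. -/
structure Params where
  mi : ℝ
  me : ℝ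
  nui : ℝ
  nue : ℝ
  e : ℝ
  c : ℝ
  mi_pos : 0 < mi
  me_pos : 0 < me
  nui_pos : 0 < nui
  nue_pos : 0 < nue
  e_pos : 0 < e
  c_pos : 0 < c

/-- The magnetic diffusion coefficient. -/
def Params.mu2 (P : Params) : ℝ :=
  P.c ^ 2 * (P.mi * P.nui) * (P.me * P.nue) /
    (4 * Real.pi * P.e ^ 2 * (P.mi * P.nui + P.me * P.nue))

/-! ### Test functions and weak derivatives -/

/-- Smooth compactly supported functions. -/
def IsTest {F : Type} [NormedAddCommGroup F] [NormedSpace ℝ F] (φ : V → F) : Prop :=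
  ContDiff ℝ ∞ φ ∧ HasCompactSupport φ

/-- The partial derivative `∂_j` of the `k`-th component of a vector field. -/
def pd (j k : Fin 3) (φ : V → V) (x : V) : ℝ := fderiv ℝ φ x (basisVec j) k

/-- The classical curl of a differentiable vector field. -/
def curl (φ : V → V) (x : V) : V :=
  !₂[pd 1 2 φ x - pd 2 1 φ x, pd 2 0 φ x - pd 0 2 φ x, pd 0 1 φ x - pd 1 0 φ x]

/-- `g` is the weak partial derivative `∂_{α 0} ⋯ ∂_{α (j-1)} f`. -/
def IsWeakPartial {j : ℕ} (α : Fin j → Fin 3) (f g : V → V) : Prop :=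
  LocallyIntegrable g volume ∧ ∀ φ : V → ℝ, IsTest φ →
    ∫ x, (iteratedFDeriv ℝ j φ x fun i => basisVec (α i)) • f x =
      (-1 : ℝ) ^ j • ∫ x, φ x • g x

/-- `‖∇^j f‖_{L^q}`, the sum of the `L^q` norms of all weak partial derivatives of order `j`.
It is `∞` as soon as one of them does not exist as a locally integrable function. (A weak
derivative is unique up to null sets, so the infimum is over one value or over none.) -/
def gradNorm (j : ℕ) (q : ℝ≥0∞) (f : V → V) : ℝ≥0∞ :=
  ∑ α : Fin j → Fin 3, ⨅ (g : V → V) (_ : IsWeakPartial α f g), eLpNorm g q volume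

/-- `g = ∇ × f` in the sense of distributions. -/
def IsWeakCurl (f g : V → V) : Prop :=
  LocallyIntegrable g volume ∧ ∀ φ : V → V, IsTest φ →
    ∫ x, inner ℝ (g x) (φ x) = ∫ x, inner ℝ (f x) (curl φ x)

open Classical in
/-- The weak curl `∇ × f` (unique up to null sets), or `0` if there is none. -/
def weakCurl (f : V → V) : V → V :=
  if h : ∃ g, IsWeakCurl f g then h.choose else 0

/-- `∇ · f = 0` in the sense of distributions. -/
def IsWeaklyDivFree (f : V → V) : Prop :=
  ∀ φ : V → ℝ, IsTest φ → ∫ x, fderiv ℝ φ x (f x) = 0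

/-- `w = (-Δ)⁻¹ ∇ × (∇ × u)`: the field `w ∈ L²` solves `-Δ w = ∇ × (∇ × u)` in the sense of
distributions. -/
def IsTransversePart (u w : V → V) : Prop :=
  MemLp w 2 volume ∧ ∀ φ : V → V, IsTest φ →
    ∫ x, inner ℝ (w x) (-(Laplacian.laplacian φ x)) = ∫ x, inner ℝ (u x) (curl (curl φ) x)

/-! ### The electromagnetic part of the linearized system -/

/-- A state `[u_i, u_e, E, B]` at a fixed time. -/
structure State where
  ui : V → V
  ue : V → V
  E : V → V
  B : V → V

/-- All components of the state lie in `L^p`. -/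
def State.MemLp (U : State) (p : ℝ≥0∞) : Prop :=
  MeasureTheory.MemLp U.ui p volume ∧ MeasureTheory.MemLp U.ue p volume ∧
    MeasureTheory.MemLp U.E p volume ∧ MeasureTheory.MemLp U.B p volume

/-- `‖[u_i, u_e, E, B]‖_{L^p}`. -/
def State.lpNorm (U : State) (p : ℝ≥0∞) : ℝ≥0∞ :=
  eLpNorm U.ui p volume + eLpNorm U.ue p volume + eLpNorm U.E p volume + eLpNorm U.B p volume

/-- `‖∇^j [u_i, u_e, E, B]‖_{L^r}`. -/
def State.gradNorm (U : State) (j : ℕ) (r : ℝ≥0∞) : ℝ≥0∞ :=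
  EulerMaxwell.gradNorm j r U.ui + EulerMaxwell.gradNorm j r U.ue +
    EulerMaxwell.gradNorm j r U.E + EulerMaxwell.gradNorm j r U.B

/-- `f ∈ C([0,∞); L²)`. -/
def ContinuousInL2 (f : ℝ → V → V) : Prop :=
  (∀ t, 0 ≤ t → MemLp (f t) 2 volume) ∧
    ∀ t, 0 ≤ t → Tendsto (fun s => eLpNorm (f s - f t) 2 volume) (𝓝[Ici 0] t) (𝓝 0)

/-- The equation `a ∂_t f = g` on `[0,∞)` tested against `φ`: here `F t` stands for the pairing
of `f t` and `G t` for the pairing of `g t` with `φ`. -/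
def EvolvesBy (a : ℝ) (F G : ℝ → ℝ) : Prop :=
  ∀ t, 0 ≤ t → ∃ d, HasDerivWithinAt F d (Ici 0) t ∧ a * d = G t

/-- `U = [u_i, u_e, E, B] ∈ C([0,∞); L²)` solves, in the sense of distributions in `x`,
* `m_i ∂_t u_i - e E + m_i ν_i u_i = 0`,
* `m_e ∂_t u_e + e E + m_e ν_e u_e = 0`,
* `∂_t E - c ∇ × B + 4π (e u_i - e u_e) = 0`,
* `∂_t B + c ∇ × E = 0`. -/
structure IsSolution (P : Params) (U : ℝ → State) : Prop where
  cont_ui : ContinuousInL2 fun t => (U t).ui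
  cont_ue : ContinuousInL2 fun t => (U t).ue
  cont_E : ContinuousInL2 fun t => (U t).E
  cont_B : ContinuousInL2 fun t => (U t).B
  eq_ui : ∀ φ : V → V, IsTest φ →
    EvolvesBy P.mi (fun t => ∫ x, inner ℝ ((U t).ui x) (φ x)) fun t =>
      P.e * (∫ x, inner ℝ ((U t).E x) (φ x)) -
        P.mi * P.nui * ∫ x, inner ℝ ((U t).ui x) (φ x)
  eq_ue : ∀ φ : V → V, IsTest φ →
    EvolvesBy P.me (fun t => ∫ x, inner ℝ ((U t).ue x) (φ x)) fun t =>
      -P.e * (∫ x, inner ℝ ((U t).E x) (φ x)) -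
        P.me * P.nue * ∫ x, inner ℝ ((U t).ue x) (φ x)
  eq_E : ∀ φ : V → V, IsTest φ →
    EvolvesBy 1 (fun t => ∫ x, inner ℝ ((U t).E x) (φ x)) fun t =>
      P.c * (∫ x, inner ℝ ((U t).B x) (curl φ x)) -
        4 * Real.pi * (P.e * (∫ x, inner ℝ ((U t).ui x) (φ x)) -
          P.e * ∫ x, inner ℝ ((U t).ue x) (φ x))
  eq_B : ∀ φ : V → V, IsTest φ →
    EvolvesBy 1 (fun t => ∫ x, inner ℝ ((U t).B x) (φ x)) fun t =>
      -P.c * ∫ x, inner ℝ ((U t).E x) (curl φ x)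

/-- The initial condition `[u_α, E, B]|_{t=0} = [u_{α0,⊥}, E_{0,⊥}, B₀]`. -/
structure HasInitialData (U : ℝ → State) (U₀ : State) : Prop where
  ui : IsTransversePart U₀.ui (U 0).ui
  ue : IsTransversePart U₀.ue (U 0).ue
  E : IsTransversePart U₀.E (U 0).E
  B : (U 0).B =ᵐ[volume] U₀.B

/-! ### The asymptotic profile -/

/-- The heat kernel `G_μ(t,x)` on `ℝ³`. -/
def heatKernel (μ t : ℝ) (x : V) : ℝ :=
  (4 * Real.pi * μ * t) ^ (-(3 / 2) : ℝ) * Real.exp (-‖x‖ ^ 2 / (4 * μ * t))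

/-- The magnetic diffusion wave: `G_{μ₂}(t,·) ∗ B₀` for `t > 0`, and `B₀` at `t = 0`. -/
def Bbar (P : Params) (B₀ : V → V) (t : ℝ) (x : V) : V :=
  if 0 < t then ∫ y, heatKernel P.mu2 t (x - y) • B₀ y else B₀ x

/-- The profile `[ū_{i,⊥}, ū_{e,⊥}, Ē_⊥, B̄]` given by Darcy's law. -/
def profile (P : Params) (B₀ : V → V) (t : ℝ) : State where
  ui := (P.c / (4 * Real.pi * P.e) * (P.me * P.nue / (P.mi * P.nui + P.me * P.nue))) •
    weakCurl (Bbar P B₀ t)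
  ue := (-(P.c / (4 * Real.pi * P.e) * (P.mi * P.nui / (P.mi * P.nui + P.me * P.nue)))) •
    weakCurl (Bbar P B₀ t)
  E := (P.c / (4 * Real.pi * P.e ^ 2) *
      (P.mi * P.nui * (P.me * P.nue) / (P.mi * P.nui + P.me * P.nue))) •
    weakCurl (Bbar P B₀ t)
  B := Bbar P B₀ t

/-! ### The decay estimate -/

/-- `1/q` as a real number, with `1/∞ = 0`. -/
def recip (q : ℝ≥0∞) : ℝ := (q⁻¹).toReal

open Classical in
/-- The index `[ℓ + 3 (1/r - 1/q)]_+`. -/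
def lossIndex (ℓ : ℝ) (r q : ℝ≥0∞) : ℕ :=
  if (∃ n : ℕ, ℓ = n) ∧ r = 2 ∧ q = 2 then ⌊ℓ⌋₊
  else ⌊ℓ + 3 * (recip r - recip q)⌋₊ + 1

/-- The right-hand side
`C (1+t)^{-(3/2)(1/p-1/q)-(m+a)/2} ‖U₀‖_{L^p} + C e^{-κt} ‖U₀‖_{L^p}`
`+ C (1+t)^{-ℓ/2} ‖∇^{m+[ℓ+3(1/r-1/q)]_+} U₀‖_{L^r}`
`+ C e^{-κt} ‖∇^{m+b+[3(1/r-1/q)]_+} B₀‖_{L^r}`. -/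
def decayBound (C κ : ℝ) (m : ℕ) (p r q : ℝ≥0∞) (ℓ : ℝ) (a b : ℕ) (U₀ : State) (t : ℝ) :
    ℝ≥0∞ :=
  ENNReal.ofReal (C * (1 + t) ^ (-(3 / 2) * (recip p - recip q) - ((m : ℝ) + a) / 2)) *
      U₀.lpNorm p +
    ENNReal.ofReal (C * Real.exp (-κ * t)) * U₀.lpNorm p +
    ENNReal.ofReal (C * (1 + t) ^ (-ℓ / 2)) * U₀.gradNorm (m + lossIndex ℓ r q) r +
    ENNReal.ofReal (C * Real.exp (-κ * t)) * gradNorm (m + b + lossIndex 0 r q) r U₀.B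

end EulerMaxwell

end

open MeasureTheory Filter Topology Set
open scoped ENNReal ContDiff
open scoped SchwartzMap FourierTransform LineDeriv

noncomputable section

namespace EulerMaxwell

/-! ### Density of compactly supported functions in the Schwartz space -/

/-! On the Fourier side the system is an ordinary differential equation at each frequency ξ. The
divergence constraints are preserved, and on divergence-free amplitudes each component of (û_i, û_e,
Ê, k⁻¹ curl B̂), with k = 2π|ξ|, solves one and the same real 4×4 system `ScalarSys`, so all decay
comes from that system.

For every k an energy corrected by two small cross terms decays at a rate of order (k/(1+k²))²
(`exists_scalar_decay`). This is k² for small k, as for the heat equation, but only k⁻² for large k;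
there e^{-t/k²} is traded for (1+t)^{-ℓ/2} k^ℓ, which is the loss of ℓ derivatives
(`exists_exp_high_le`).

For small k the triple (a, b, E) relaxes exponentially fast to Darcy's law, a fixed multiple of k d,
with a remaining error of order k³ (`exists_deviation_le`). Inserting Darcy's law into d' = -c k E
gives d' = -μ₂ k² d, the heat equation; a corrector shows that the resulting error in d is of order
k (`exists_amplitude_le`). Hence the symbol of B - B̄ gains one factor k and those of the other
differences gain k², up to e^{-pt}; each factor k yields (1+t)^{-1/2}. At high frequencies no
cancellation is needed: the solution has the bound above, and the profile is O(e^{-μ₂k₀²t}), at the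
price of one derivative of B₀ where it is a curl.

The passage between L^p and the frequency side rests on Plancherel and Gaussians alone. Smoothing of
the heat flow from L^p to L² bounds Gaussian-weighted L² norms of f̂ for 1 ≤ p ≤ 2
(`IsFT.lintegral_gauss_le`). Norms in L^q, q ≥ 2, are computed by duality (`eLpNorm_le_of_duality`),
so that only f̂ and φ̂ with φ in L^{q'} occur, and Cauchy–Schwarz separates them. At low frequencies
the weight contains both Gaussians. At high frequencies negative powers of k are superpositions of
Gaussians (`exists_lintegral_high_le`); this costs any exponent above 3(1/r-1/2) for f and above
3(1/2-1/q) for φ, and rounding up the sum gives the index of the theorem.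

Weak solutions are identified with the matrix exponential because their pairings with compactly
supported test functions on the Fourier side are given by their Taylor series in time
(`FourierEvolution.ae_eq`). -/

lemma exists_norm_iteratedFDeriv_bump_sub_one_le (χ : ContDiffBump (0 : V)) (hχ : χ.rIn = 1) (i : ℕ) :
    ∃ C : ℝ, 0 ≤ C ∧ ∀ y : V, ‖iteratedFDeriv ℝ i (fun z => χ z - 1) y‖ ≤ C * ‖y‖ := by
  have hsm : ContDiff ℝ ∞ (χ : V → ℝ) := χ.contDiff
  set ψ : 𝓢(V, ℝ) := χ.hasCompactSupport.toSchwartzMap hsm with hψ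
  obtain ⟨C, hC⟩ := ψ.decay 0 i
  refine ⟨C + 1, by linarith [hC.1], fun y => ?_⟩
  by_cases hy : ‖y‖ < 1
  · have : (fun z => χ z - 1) =ᶠ[𝓝 y] fun _ => (0 : ℝ) := by
      have hb : Metric.ball (0 : V) 1 ∈ 𝓝 y := Metric.isOpen_ball.mem_nhds (by simpa using hy)
      filter_upwards [hb] with z hz
      have : χ z = 1 := χ.one_of_mem_closedBall (by
        rw [hχ]; exact Metric.ball_subset_closedBall hz)
      simp [this]
    rw [(Filter.EventuallyEq.iteratedFDeriv ℝ this i).eq_of_nhds]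
    have h0 : iteratedFDeriv ℝ i (fun _ : V => (0 : ℝ)) y = 0 := by
      simp
    rw [h0, norm_zero]
    have := hC.1
    positivity
  · push Not at hy
    have h1 : ‖iteratedFDeriv ℝ i (fun z => χ z - 1) y‖ ≤ C + 1 := by
      have hs : iteratedFDeriv ℝ i (fun z => χ z - 1) y =
          iteratedFDeriv ℝ i (χ : V → ℝ) y - iteratedFDeriv ℝ i (fun _ : V => (1 : ℝ)) y := by
        have := iteratedFDeriv_sub_apply (𝕜 := ℝ) (i := i) (x := y) (f := (χ : V → ℝ))
          (g := fun _ => (1 : ℝ)) (hsm.of_le (mod_cast le_top)).contDiffAt contDiff_const.contDiffAt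
        exact this
      have h2 := hC.2 y
      simp only [pow_zero, one_mul] at h2
      have h3 : ‖iteratedFDeriv ℝ i (fun _ : V => (1 : ℝ)) y‖ ≤ 1 := by
        rcases Nat.eq_zero_or_pos i with rfl | hi
        · simp
        · rw [iteratedFDeriv_const_of_ne hi.ne']; simp
      rw [hs]
      exact (norm_sub_le _ _).trans (add_le_add h2 h3)
    have := hC.1
    nlinarith

/-- Leibniz' rule for (χ(εx) - 1)φ: every derivative of χ(ε·) - 1 is at most Cε‖x‖, and the extra
power of ‖x‖ is absorbed by raising the weight of the seminorm by one. -/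
lemma exists_tendsto_of_hasCompactSupport (φ : 𝓢(V, ℂ)) :
    ∃ ψ : ℕ → 𝓢(V, ℂ), (∀ n, HasCompactSupport (ψ n)) ∧ Tendsto ψ atTop (𝓝 φ) := by
  obtain ⟨χ, hχ⟩ : ∃ χ : ContDiffBump (0 : V), χ.rIn = 1 := ⟨⟨1, 2, by norm_num, by norm_num⟩, rfl⟩
  have hsm : ContDiff ℝ ∞ (χ : V → ℝ) := χ.contDiff
  set ε : ℕ → ℝ := fun n => ((n : ℝ) + 1)⁻¹ with hε
  have hε0 : ∀ n, 0 < ε n := fun n => by positivity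
  have hε1 : ∀ n, ε n ≤ 1 := fun n => inv_le_one_of_one_le₀ (by linarith [n.cast_nonneg (α := ℝ)])
  have hsupp : ∀ n, HasCompactSupport fun x : V => χ (ε n • x) • φ x := fun n => by
    have h1 : HasCompactSupport fun x : V => χ (ε n • x) :=
      χ.hasCompactSupport.comp_smul (hε0 n).ne'
    exact h1.smul_right
  have hcd : ∀ n, ContDiff ℝ ∞ fun x : V => χ (ε n • x) • φ x := fun n =>
    (hsm.comp (contDiff_const_smul _)).smul (φ.smooth ⊤)
  refine ⟨fun n => (hsupp n).toSchwartzMap (hcd n), fun n => hsupp n, ?_⟩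
  rw [(schwartz_withSeminorms ℂ V ℂ).tendsto_nhds]
  rintro ⟨k, l⟩ δ hδ
  choose C hC0 hC using fun i => exists_norm_iteratedFDeriv_bump_sub_one_le χ hχ i
  set M : ℝ := ∑ i ∈ Finset.range (l + 1),
    (l.choose i : ℝ) * C i * SchwartzMap.seminorm ℂ (k + 1) (l - i) φ with hM
  have hM0 : 0 ≤ M := Finset.sum_nonneg fun i _ => by
    have := hC0 i
    have := apply_nonneg (SchwartzMap.seminorm ℂ (k + 1) (l - i)) φ
    positivity
  have key : ∀ n, SchwartzMap.seminorm ℂ k l ((hsupp n).toSchwartzMap (hcd n) - φ) ≤ ε n * M := by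
    intro n
    refine SchwartzMap.seminorm_le_bound ℂ k l _ (mul_nonneg (hε0 n).le hM0) fun x => ?_
    have hfun : ((hsupp n).toSchwartzMap (hcd n) - φ : V → ℂ) =
        fun x => (χ (ε n • x) - 1) • φ x := by
      ext x; simp [sub_mul]
    have hη : ContDiff ℝ ∞ fun z : V => χ z - 1 := hsm.sub contDiff_const
    have h1 := norm_iteratedFDeriv_smul_le (𝕜 := ℝ) (f := fun x : V => χ (ε n • x) - 1)
      (g := φ) (N := ∞) (hη.comp (contDiff_const_smul (ε n))) (φ.smooth ⊤) x (n := l)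
      (mod_cast le_top)
    have hb : ∀ i, ‖iteratedFDeriv ℝ i (fun x : V => χ (ε n • x) - 1) x‖ ≤ C i * (ε n * ‖x‖) := by
      intro i
      have h2 := iteratedFDeriv_comp_const_smul (𝕜 := ℝ) (i := i) (f := fun z : V => χ z - 1) (ε n)
        (hη.of_le (mod_cast le_top))
      rw [h2]
      simp only [norm_smul, norm_pow, Real.norm_eq_abs, abs_of_pos (hε0 n)]
      calc ε n ^ i * ‖iteratedFDeriv ℝ i (fun z : V => χ z - 1) (ε n • x)‖
          ≤ 1 * ‖iteratedFDeriv ℝ i (fun z : V => χ z - 1) (ε n • x)‖ := by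
            gcongr; exact pow_le_one₀ (hε0 n).le (hε1 n)
        _ ≤ C i * ‖ε n • x‖ := by rw [one_mul]; exact hC i _
        _ = C i * (ε n * ‖x‖) := by rw [norm_smul, Real.norm_eq_abs, abs_of_pos (hε0 n)]
    rw [show (⇑((hsupp n).toSchwartzMap (hcd n) - φ) : V → ℂ) = fun x => (χ (ε n • x) - 1) • φ x from hfun]
    calc ‖x‖ ^ k * ‖iteratedFDeriv ℝ l (fun x => (χ (ε n • x) - 1) • φ x) x‖
        ≤ ‖x‖ ^ k * ∑ i ∈ Finset.range (l + 1), (l.choose i : ℝ) *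
            (C i * (ε n * ‖x‖)) * ‖iteratedFDeriv ℝ (l - i) φ x‖ := by
          gcongr
          refine h1.trans (Finset.sum_le_sum fun i _ => ?_)
          gcongr
          exact hb i
      _ = ∑ i ∈ Finset.range (l + 1), (l.choose i : ℝ) * C i * ε n *
            (‖x‖ ^ (k + 1) * ‖iteratedFDeriv ℝ (l - i) φ x‖) := by
          rw [Finset.mul_sum]; refine Finset.sum_congr rfl fun i _ => ?_; ring
      _ ≤ ∑ i ∈ Finset.range (l + 1), (l.choose i : ℝ) * C i * ε n *
            SchwartzMap.seminorm ℂ (k + 1) (l - i) φ := by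
          refine Finset.sum_le_sum fun i _ => ?_
          have := hC0 i
          have := (hε0 n).le
          gcongr
          exact SchwartzMap.le_seminorm ℂ (k + 1) (l - i) φ x
      _ = ε n * M := by rw [hM, Finset.mul_sum]; refine Finset.sum_congr rfl fun i _ => ?_; ring
  have hlim : Tendsto (fun n => ε n * M) atTop (𝓝 0) := by
    have : Tendsto ε atTop (𝓝 0) := by
      simpa [hε, one_div] using tendsto_one_div_add_atTop_nhds_zero_nat (𝕜 := ℝ)
    simpa using this.mul_const M
  filter_upwards [hlim.eventually (gt_mem_nhds hδ)] with n hn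
  exact (key n).trans_lt hn

/-- Identities known for compactly supported test functions can thus be applied to Fourier
transforms of such functions, which are Schwartz but not compactly supported. -/
lemma clm_eq_of_eq_on_hasCompactSupport {T S : 𝓢(V, ℂ) →L[ℂ] ℂ}
    (h : ∀ φ : 𝓢(V, ℂ), HasCompactSupport φ → T φ = S φ) (φ : 𝓢(V, ℂ)) : T φ = S φ := by
  obtain ⟨ψ, hψ, hlim⟩ := exists_tendsto_of_hasCompactSupport φ
  refine tendsto_nhds_unique ((T.continuous.tendsto φ).comp hlim) ?_
  refine ((S.continuous.tendsto φ).comp hlim).congr fun n => ?_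
  exact (h _ (hψ n)).symm

/-! ### Fourier transforms of functions in `L^p` as locally integrable functions -/

/-- Schwartz functions embed continuously into the Lebesgue space of the conjugate exponent (1 -
p⁻¹)⁻¹, so the Hölder pairing with `f` is continuous. -/
lemma exists_clm_of_memLp {p : ℝ≥0∞} (hp : 1 ≤ p) {f : V → ℂ} (hf : MemLp f p volume) :
    ∃ T : 𝓢(V, ℂ) →L[ℂ] ℂ, ∀ φ : 𝓢(V, ℂ), T φ = ∫ x, φ x * f x := by
  have : Fact (1 ≤ p) := ⟨hp⟩
  have := ENNReal.HolderConjugate.inv_one_sub_inv' hp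
  have : Fact (1 ≤ (1 - p⁻¹)⁻¹) := by simp [fact_iff]
  refine ⟨(ContinuousLinearMap.lsmul ℂ ℂ).flip.lpPairing volume p (1 - p⁻¹)⁻¹ (hf.toLp f) ∘L
    SchwartzMap.toLpCLM ℂ ℂ (1 - p⁻¹)⁻¹ volume, fun φ => ?_⟩
  have h := Lp.toTemperedDistribution_apply (hf.toLp f) φ
  refine Eq.trans (b := Lp.toTemperedDistribution (hf.toLp f) φ) rfl (h.trans ?_)
  refine integral_congr_ae ?_
  filter_upwards [hf.coeFn_toLp] with x hx
  rw [hx, smul_eq_mul]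

lemma integrable_schwartz_mul {p : ℝ≥0∞} (hp : 1 ≤ p) {f : V → ℂ} (hf : MemLp f p volume)
    (φ : 𝓢(V, ℂ)) : Integrable (fun x => φ x * f x) volume := by
  have := ENNReal.HolderConjugate.inv_one_sub_inv' hp
  exact MemLp.integrable_mul (p := (1 - p⁻¹)⁻¹) (q := p) (φ.memLp _) hf

/-- `fh` is the distributional Fourier transform of `f`. -/
def IsFT (f fh : V → ℂ) : Prop :=
  LocallyIntegrable fh volume ∧ ∀ φ : 𝓢(V, ℂ), HasCompactSupport φ →
    ∫ x, 𝓕 φ x * f x = ∫ ξ, φ ξ * fh ξ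

lemma integrable_mul_of_hasCompactSupport {h : V → ℂ} (hh : LocallyIntegrable h volume)
    (φ : 𝓢(V, ℂ)) (hφ : HasCompactSupport φ) : Integrable (fun ξ => φ ξ * h ξ) volume := by
  simpa using hh.integrable_smul_left_of_hasCompactSupport φ.continuous hφ

lemma ae_eq_of_integral_schwartz_mul_eq {g h : V → ℂ} (hg : LocallyIntegrable g volume)
    (hh : LocallyIntegrable h volume)
    (H : ∀ φ : 𝓢(V, ℂ), HasCompactSupport φ → ∫ ξ, φ ξ * g ξ = ∫ ξ, φ ξ * h ξ) :
    g =ᵐ[volume] h := by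
  refine ae_eq_of_integral_contDiff_smul_eq hg hh fun η hη hc => ?_
  have hc' : HasCompactSupport (Complex.ofRealCLM ∘ η) := hc.comp_left rfl
  have hη' : ContDiff ℝ ∞ (Complex.ofRealCLM ∘ η) := by fun_prop
  have := H (hc'.toSchwartzMap hη') hc'
  simpa using this

lemma IsFT.unique {f fh fh' : V → ℂ} (h : IsFT f fh) (h' : IsFT f fh') : fh =ᵐ[volume] fh' :=
  ae_eq_of_integral_schwartz_mul_eq h.1 h'.1 fun φ hφ => by rw [← h.2 φ hφ, ← h'.2 φ hφ]

lemma IsFT.congr {f g fh gh : V → ℂ} (h : IsFT f fh) (hf : f =ᵐ[volume] g)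
    (hh : fh =ᵐ[volume] gh) : IsFT g gh := by
  refine ⟨h.1.congr hh, fun φ hφ => ?_⟩
  rw [← integral_congr_ae (hf.mono fun x hx => by simp only [hx] :
      (fun x => 𝓕 φ x * f x) =ᵐ[volume] fun x => 𝓕 φ x * g x), h.2 φ hφ]
  exact integral_congr_ae (hh.mono fun x hx => by simp only [hx])

lemma IsFT.add {p : ℝ≥0∞} (hp : 1 ≤ p) {f g fh gh : V → ℂ} (hfp : MemLp f p volume)
    (hgp : MemLp g p volume) (hf : IsFT f fh) (hg : IsFT g gh) :
    IsFT (fun x => f x + g x) (fun ξ => fh ξ + gh ξ) := by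
  refine ⟨hf.1.add hg.1, fun φ hφ => ?_⟩
  simp only [mul_add]
  rw [integral_add (integrable_schwartz_mul hp hfp _) (integrable_schwartz_mul hp hgp _),
    integral_add (integrable_mul_of_hasCompactSupport hf.1 φ hφ)
      (integrable_mul_of_hasCompactSupport hg.1 φ hφ), hf.2 φ hφ, hg.2 φ hφ]

lemma IsFT.const_mul {f fh : V → ℂ} (hf : IsFT f fh) (c : ℂ) :
    IsFT (fun x => c * f x) (fun ξ => c * fh ξ) := by
  refine ⟨hf.1.smul c, fun φ hφ => ?_⟩
  simp only [mul_left_comm _ c, integral_const_mul, hf.2 φ hφ]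

lemma IsFT.sub {p : ℝ≥0∞} (hp : 1 ≤ p) {f g fh gh : V → ℂ} (hfp : MemLp f p volume)
    (hgp : MemLp g p volume) (hf : IsFT f fh) (hg : IsFT g gh) :
    IsFT (fun x => f x - g x) (fun ξ => fh ξ - gh ξ) := by
  have := hf.add hp hfp (hgp.const_mul (-1)) (hg.const_mul (-1))
  simpa [sub_eq_add_neg] using this

/-! ### The square integrable case -/

lemma isFT_fourier (f : Lp ℂ 2 (volume : Measure V)) : IsFT f (𝓕 f : Lp ℂ 2 (volume : Measure V)) := by
  refine ⟨(Lp.memLp _).locallyIntegrable (by norm_num), fun φ _ => ?_⟩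
  have h := congrArg (fun T => T φ) (Lp.fourier_toTemperedDistribution_eq f)
  simp only [TemperedDistribution.fourier_apply, Lp.toTemperedDistribution_apply, smul_eq_mul] at h
  exact h

lemma exists_isFT_of_memLp_two {f : V → ℂ} (hf : MemLp f 2 volume) :
    ∃ fh, MemLp fh 2 volume ∧ IsFT f fh ∧ eLpNorm fh 2 volume = eLpNorm f 2 volume := by
  refine ⟨(𝓕 (hf.toLp f) : Lp ℂ 2 (volume : Measure V)), Lp.memLp _,
    (isFT_fourier _).congr hf.coeFn_toLp ae_eq_rfl, ?_⟩
  rw [← Lp.enorm_def, ← eLpNorm_congr_ae hf.coeFn_toLp, ← Lp.enorm_def, ← ofReal_norm,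
    ← ofReal_norm, Lp.norm_fourier_eq]

lemma IsFT.memLp_two {f fh : V → ℂ} (h : IsFT f fh) (hf : MemLp f 2 volume) :
    MemLp fh 2 volume := by
  obtain ⟨g, hg, hfg, -⟩ := exists_isFT_of_memLp_two hf
  exact (memLp_congr_ae (hfg.unique h)).1 hg

lemma IsFT.eLpNorm_two_eq {f fh : V → ℂ} (h : IsFT f fh) (hf : MemLp f 2 volume) :
    eLpNorm fh 2 volume = eLpNorm f 2 volume := by
  obtain ⟨g, hg, hfg, he⟩ := exists_isFT_of_memLp_two hf
  rw [← he, eLpNorm_congr_ae (hfg.unique h)]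

lemma exists_isFT_eq_of_memLp_two {fh : V → ℂ} (hf : MemLp fh 2 volume) :
    ∃ f, MemLp f 2 volume ∧ IsFT f fh := by
  refine ⟨(𝓕⁻ (hf.toLp fh) : Lp ℂ 2 (volume : Measure V)), Lp.memLp _, ?_⟩
  refine (isFT_fourier _).congr ae_eq_rfl ?_
  rw [FourierTransform.fourier_fourierInv_eq]
  exact hf.coeFn_toLp

lemma IsFT.fourier_toLp_ae_eq {f fh : V → ℂ} (h : IsFT f fh) (hf : MemLp f 2 volume) :
    (𝓕 (hf.toLp f) : Lp ℂ 2 (volume : Measure V)) =ᵐ[volume] fh :=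
  ((isFT_fourier _).congr hf.coeFn_toLp ae_eq_rfl).unique h

/-- Polarised Plancherel; it carries the duality pairing for L^q norms to the frequency side. -/
lemma IsFT.integral_conj_mul {f g fh gh : V → ℂ} (hf : IsFT f fh) (hg : IsFT g gh)
    (hf2 : MemLp f 2 volume) (hg2 : MemLp g 2 volume) :
    ∫ x, starRingEnd ℂ (f x) * g x = ∫ ξ, starRingEnd ℂ (fh ξ) * gh ξ := by
  have h := Lp.inner_fourier_eq (hf2.toLp f) (hg2.toLp g)
  rw [L2.inner_def, L2.inner_def] at h
  have h1 : ∫ x, inner ℂ (hf2.toLp f x) (hg2.toLp g x) = ∫ x, starRingEnd ℂ (f x) * g x := by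
    refine integral_congr_ae ?_
    filter_upwards [hf2.coeFn_toLp, hg2.coeFn_toLp] with x h1 h2
    rw [h1, h2, RCLike.inner_apply, mul_comm]
  have h2 : ∫ x, inner ℂ ((𝓕 (hf2.toLp f) : Lp ℂ 2 (volume : Measure V)) x)
      ((𝓕 (hg2.toLp g) : Lp ℂ 2 (volume : Measure V)) x) = ∫ ξ, starRingEnd ℂ (fh ξ) * gh ξ := by
    refine integral_congr_ae ?_
    filter_upwards [hf.fourier_toLp_ae_eq hf2, hg.fourier_toLp_ae_eq hg2] with x h1 h2
    rw [h1, h2, RCLike.inner_apply, mul_comm]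
  rw [← h1, ← h, h2]

/-! ### Derivatives -/

/-- The symbol of `∂^α`. -/
def symb {j : ℕ} (α : Fin j → Fin 3) (ξ : V) : ℂ :=
  ∏ i, (2 * Real.pi * Complex.I * (ξ (α i) : ℂ))

lemma inner_basisVec (ξ : V) (j : Fin 3) : inner ℝ ξ (basisVec j) = ξ j := by
  simp [basisVec, EuclideanSpace.inner_single_right]

lemma hasTemperateGrowth_inner (m : V) : Function.HasTemperateGrowth (fun ξ : V => inner ℝ ξ m) :=
  ((innerSL ℝ).flip m).hasTemperateGrowth

/-- Multiplication of a Schwartz function by `-2πiξ_j`. -/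
def mulCoord (j : Fin 3) (φ : 𝓢(V, ℂ)) : 𝓢(V, ℂ) :=
  -(2 * Real.pi * Complex.I) • SchwartzMap.smulLeftCLM ℂ (inner ℝ · (basisVec j)) φ

lemma mulCoord_apply (j : Fin 3) (φ : 𝓢(V, ℂ)) (ξ : V) :
    mulCoord j φ ξ = -(2 * Real.pi * Complex.I * (ξ j : ℂ)) * φ ξ := by
  rw [mulCoord, smul_apply,
    SchwartzMap.smulLeftCLM_apply_apply (hasTemperateGrowth_inner _), inner_basisVec]
  simp only [smul_eq_mul, Complex.real_smul]
  ring

lemma lineDeriv_fourier (j : Fin 3) (φ : 𝓢(V, ℂ)) : ∂_{basisVec j} (𝓕 φ) = 𝓕 (mulCoord j φ) :=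
  SchwartzMap.lineDerivOp_fourier_eq φ (basisVec j)

lemma hasCompactSupport_mulCoord (j : Fin 3) {φ : 𝓢(V, ℂ)} (hφ : HasCompactSupport φ) :
    HasCompactSupport (mulCoord j φ) := by
  have : (mulCoord j φ : V → ℂ) = fun ξ => -(2 * Real.pi * Complex.I * (ξ j : ℂ)) * φ ξ :=
    funext (mulCoord_apply j φ)
  rw [this]
  exact hφ.mul_left

/-- Differentiating 𝓕φ multiplies φ by -2πiξ_j, while `symb` is built from +2πiξ_j. The resulting
(-1)ⁿ is the sign of the integrations by parts in `IsWeakPartial`. Compact support survives, as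
`IsFT` requires. -/
lemma exists_iteratedLineDeriv_fourier {n : ℕ} (α : Fin n → Fin 3) (φ : 𝓢(V, ℂ))
    (hφ : HasCompactSupport φ) : ∃ ψ : 𝓢(V, ℂ), HasCompactSupport ψ ∧
      (∀ ξ, ψ ξ = (-1) ^ n * symb α ξ * φ ξ) ∧ ∂^{fun i => basisVec (α i)} (𝓕 φ) = 𝓕 ψ := by
  induction n with
  | zero => exact ⟨φ, hφ, fun ξ => by simp [symb], by simp⟩
  | succ n ih =>
    obtain ⟨ψ, hψ, hψe, hψd⟩ := ih (fun i => α i.succ)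
    refine ⟨mulCoord (α 0) ψ, hasCompactSupport_mulCoord _ hψ, fun ξ => ?_, ?_⟩
    · rw [mulCoord_apply, hψe, symb, symb, Fin.prod_univ_succ]; ring
    · rw [LineDeriv.iteratedLineDerivOp_succ_left]
      have : Fin.tail (fun i => basisVec (α i)) = fun i : Fin n => basisVec (α i.succ) := rfl
      rw [this, hψd, lineDeriv_fourier]

/-! ### The heat kernel -/

/-- The wave number `2π|ξ|`. -/
def wn (ξ : V) : ℝ := 2 * Real.pi * ‖ξ‖

lemma wn_nonneg (ξ : V) : 0 ≤ wn ξ := by unfold wn; positivity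

lemma continuous_wn : Continuous wn := by unfold wn; fun_prop

lemma measurable_wn : Measurable wn := continuous_wn.measurable

/-- The heat kernel at time `s` with unit diffusion coefficient. -/
def gk (s : ℝ) (x : V) : ℝ :=
  (4 * Real.pi * s) ^ (-(3 / 2) : ℝ) * Real.exp (-‖x‖ ^ 2 / (4 * s))

lemma heatKernel_eq_gk (μ t : ℝ) (x : V) : heatKernel μ t x = gk (μ * t) x := by
  simp only [heatKernel, gk, mul_assoc]

lemma continuous_gk (s : ℝ) : Continuous (gk s) := by unfold gk; fun_prop

lemma gk_nonneg {s : ℝ} (hs : 0 < s) (x : V) : 0 ≤ gk s x := by unfold gk; positivity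

lemma gk_le {s : ℝ} (hs : 0 < s) (x : V) : gk s x ≤ (4 * Real.pi * s) ^ (-(3 / 2) : ℝ) := by
  unfold gk
  refine mul_le_of_le_one_right (by positivity) (Real.exp_le_one_iff.2 ?_)
  rw [neg_div]
  have : 0 ≤ ‖x‖ ^ 2 / (4 * s) := by positivity
  linarith

lemma gk_sub_comm (s : ℝ) (x y : V) : gk s (x - y) = gk s (y - x) := by
  unfold gk; rw [norm_sub_rev]

/-- Exhibits a translated heat kernel as the transform of a modulated Gaussian. The exponent
4π²s|v|² is s `wn v`², the usual heat symbol. -/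
lemma fourier_gaussian_eq_gk {s : ℝ} (hs : 0 < s) (y w : V) :
    𝓕 (fun v : V => Complex.exp (-((4 * Real.pi ^ 2 * s : ℝ) : ℂ) * ‖v‖ ^ 2 +
      2 * Real.pi * Complex.I * (inner ℝ y v : ℝ))) w = (gk s (y - w) : ℂ) := by
  have hb : 0 < ((4 * Real.pi ^ 2 * s : ℝ) : ℂ).re := by
    rw [Complex.ofReal_re]; positivity
  rw [fourier_gaussian_innerProductSpace' hb]
  have hπ : (Real.pi : ℂ) ≠ 0 := by exact_mod_cast Real.pi_ne_zero
  have hs' : (s : ℂ) ≠ 0 := by exact_mod_cast hs.ne'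
  have h1 : (Real.pi : ℂ) / ((4 * Real.pi ^ 2 * s : ℝ) : ℂ) = (((4 * Real.pi * s)⁻¹ : ℝ) : ℂ) := by
    push_cast
    field_simp
  rw [h1, show (gk s (y - w) : ℂ) = (((4 * Real.pi * s) ^ (-(3 / 2) : ℝ) : ℝ) : ℂ) *
    ((Real.exp (-‖y - w‖ ^ 2 / (4 * s)) : ℝ) : ℂ) by rw [gk, Complex.ofReal_mul]]
  congr 1
  · rw [Real.rpow_neg (by positivity), ← Real.inv_rpow (by positivity),
      Complex.ofReal_cpow (by positivity)]
    congr 1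
    simp
  · rw [Complex.ofReal_exp]
    congr 1
    push_cast
    field_simp

lemma integral_gk {s : ℝ} (hs : 0 < s) : ∫ x, gk s x = 1 := by
  have h := GaussianFourier.integral_rexp_neg_mul_sq_norm (V := V) (b := (4 * s)⁻¹) (by positivity)
  have h2 : ∀ x : V, gk s x = (4 * Real.pi * s) ^ (-(3 / 2) : ℝ) *
      Real.exp (-(4 * s)⁻¹ * ‖x‖ ^ 2) := by
    intro x; unfold gk; congr 2; field_simp
  simp only [h2, integral_const_mul, h]
  have : (Real.pi / (4 * s)⁻¹) = 4 * Real.pi * s := by field_simp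
  rw [this]
  simp only [finrank_euclideanSpace, Fintype.card_fin, Nat.cast_ofNat]
  rw [← Real.rpow_add (by positivity)]
  norm_num

lemma integrable_gk {s : ℝ} (hs : 0 < s) : Integrable (gk s) volume := by
  -- The integral of a non-integrable function is 0 by convention, whereas this one equals 1.
  by_contra h
  have := integral_gk hs
  rw [integral_undef h] at this
  norm_num at this

lemma lintegral_gk {s : ℝ} (hs : 0 < s) : ∫⁻ x, ENNReal.ofReal (gk s x) = 1 := by
  rw [← ofReal_integral_eq_lintegral_ofReal (integrable_gk hs)
    (Eventually.of_forall (gk_nonneg hs)), integral_gk hs, ENNReal.ofReal_one]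

lemma lintegral_gk_sub {s : ℝ} (hs : 0 < s) (y : V) :
    ∫⁻ x, ENNReal.ofReal (gk s (x - y)) = 1 := by
  rw [lintegral_sub_right_eq_self (fun x => ENNReal.ofReal (gk s x)) y, lintegral_gk hs]

lemma lintegral_gk_sub' {s : ℝ} (hs : 0 < s) (x : V) :
    ∫⁻ y, ENNReal.ofReal (gk s (x - y)) = 1 := by
  simp only [gk_sub_comm s x, lintegral_gk_sub hs]

/-! ### Heat convolution and its smoothing from L^p to L² -/

/-- Convolution with the heat kernel. -/
def heat (s : ℝ) (f : V → ℂ) (x : V) : ℂ := ∫ y, (gk s (x - y) : ℂ) * f y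

/-- Convolution of the norm with the heat kernel. -/
def heatE (s : ℝ) (f : V → ℂ) (x : V) : ℝ≥0∞ := ∫⁻ y, ENNReal.ofReal (gk s (x - y)) * ‖f y‖ₑ

lemma enorm_gk_mul {s : ℝ} (hs : 0 < s) (x : V) (z : ℂ) :
    ‖(gk s x : ℂ) * z‖ₑ = ENNReal.ofReal (gk s x) * ‖z‖ₑ := by
  rw [enorm_mul]
  congr 1
  rw [← ofReal_norm, Complex.norm_real, Real.norm_of_nonneg (gk_nonneg hs x)]

lemma enorm_heat_le {s : ℝ} (hs : 0 < s) (f : V → ℂ) (x : V) : ‖heat s f x‖ₑ ≤ heatE s f x := by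
  refine (enorm_integral_le_lintegral_enorm _).trans_eq ?_
  simp only [enorm_gk_mul hs, heatE]

/-- Jensen's inequality for the probability measure gk(x - y) dy, in the form of monotonicity of
Lebesgue norms in the exponent. -/
lemma heatE_rpow_le {s : ℝ} (hs : 0 < s) {p : ℝ} (hp : 1 ≤ p) {f : V → ℂ}
    (hf : AEStronglyMeasurable f volume) (x : V) :
    heatE s f x ^ p ≤ ∫⁻ y, ENNReal.ofReal (gk s (x - y)) * ‖f y‖ₑ ^ p := by
  set ν : Measure V := volume.withDensity fun y => ENNReal.ofReal (gk s (x - y)) with hν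
  have hm : Measurable fun y => ENNReal.ofReal (gk s (x - y)) :=
    (ENNReal.measurable_ofReal.comp (continuous_gk s).measurable).comp (measurable_const.sub measurable_id)
  have : IsProbabilityMeasure ν := ⟨by
    rw [hν, withDensity_apply _ MeasurableSet.univ, setLIntegral_univ, lintegral_gk_sub' hs]⟩
  have hac : ν ≪ volume := withDensity_absolutelyContinuous _ _
  have hfν : AEStronglyMeasurable f ν := hf.mono_ac hac
  have h := eLpNorm_le_eLpNorm_of_exponent_le (μ := ν) (p := 1) (q := ENNReal.ofReal p)
    (by simpa using hp) hfν
  have hp0 : 0 < p := by linarith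
  rw [eLpNorm_one_eq_lintegral_enorm, eLpNorm_eq_lintegral_rpow_enorm_toReal (by simpa using hp0)
    ENNReal.ofReal_ne_top, ENNReal.toReal_ofReal hp0.le] at h
  have h2 := ENNReal.rpow_le_rpow h hp0.le
  rw [← ENNReal.rpow_mul, one_div_mul_cancel hp0.ne', ENNReal.rpow_one] at h2
  rw [hν, lintegral_withDensity_eq_lintegral_mul₀' hm.aemeasurable, 
    lintegral_withDensity_eq_lintegral_mul₀' hm.aemeasurable] at h2
  · exact h2
  · exact (hfν.enorm).pow_const p
  · exact hfν.enorm

lemma measurable_gk_sub (s : ℝ) : Measurable fun z : V × V => ENNReal.ofReal (gk s (z.1 - z.2)) :=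
  ENNReal.measurable_ofReal.comp ((continuous_gk s).comp (continuous_fst.sub continuous_snd)).measurable

lemma measurable_gk_sub_right (s : ℝ) (y : V) :
    Measurable fun x : V => ENNReal.ofReal (gk s (x - y)) :=
  ENNReal.measurable_ofReal.comp ((continuous_gk s).comp (continuous_id.sub continuous_const)).measurable

lemma aestronglyMeasurable_gk_mul (s : ℝ) {f : V → ℂ} (hf : AEStronglyMeasurable f volume) :
    AEStronglyMeasurable (fun z : V × V => (gk s (z.1 - z.2) : ℂ) * f z.2) (volume.prod volume) := by
  refine AEStronglyMeasurable.mul ?_ hf.comp_snd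
  exact (Complex.continuous_ofReal.comp ((continuous_gk s).comp
    (continuous_fst.sub continuous_snd))).aestronglyMeasurable

lemma aestronglyMeasurable_heat (s : ℝ) {f : V → ℂ} (hf : AEStronglyMeasurable f volume) :
    AEStronglyMeasurable (heat s f) volume :=
  (aestronglyMeasurable_gk_mul s hf).integral_prod_right'

lemma lintegral_rpow_enorm_eq {p : ℝ≥0∞} (hp1 : 1 ≤ p) (hp2 : p ≤ 2) (f : V → ℂ) :
    ∫⁻ y, ‖f y‖ₑ ^ p.toReal = eLpNorm f p volume ^ p.toReal := by
  have hp0 : p ≠ 0 := (one_pos.trans_le hp1).ne'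
  have hpt : p ≠ ⊤ := (hp2.trans_lt (by simp)).ne
  rw [eLpNorm_eq_lintegral_rpow_enorm_toReal hp0 hpt, ← ENNReal.rpow_mul,
    one_div_mul_cancel (ENNReal.toReal_pos hp0 hpt).ne', ENNReal.rpow_one]

lemma toReal_mem {p : ℝ≥0∞} (hp1 : 1 ≤ p) (hp2 : p ≤ 2) : 1 ≤ p.toReal ∧ p.toReal ≤ 2 := by
  have hpt : p ≠ ⊤ := (hp2.trans_lt (by simp)).ne
  exact ⟨by simpa using ENNReal.toReal_mono hpt hp1, by simpa using ENNReal.toReal_mono (by simp) hp2⟩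

lemma heatE_le {s : ℝ} (hs : 0 < s) {p : ℝ≥0∞} (hp1 : 1 ≤ p) (hp2 : p ≤ 2) {f : V → ℂ}
    (hf : AEStronglyMeasurable f volume) (x : V) :
    heatE s f x ≤ ENNReal.ofReal ((4 * Real.pi * s) ^ (-(3 / 2) : ℝ)) ^ (p.toReal)⁻¹ *
      eLpNorm f p volume := by
  obtain ⟨h1, h2⟩ := toReal_mem hp1 hp2
  have h0 : 0 < p.toReal := by linarith
  rw [← ENNReal.rpow_le_rpow_iff h0, ENNReal.mul_rpow_of_nonneg _ _ h0.le, ← ENNReal.rpow_mul,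
    inv_mul_cancel₀ h0.ne', ENNReal.rpow_one, ← lintegral_rpow_enorm_eq hp1 hp2]
  refine (heatE_rpow_le hs h1 hf x).trans ?_
  rw [← lintegral_const_mul' _ _ ENNReal.ofReal_ne_top]
  refine lintegral_mono fun y => ?_
  gcongr
  exact gk_le hs _

/-- Interpolation between the uniform bound of `heatE_le` and the L^p contraction that Fubini gives:
the square is the product of the powers 2 - p ≥ 0 and p, and the first is bounded uniformly. -/
lemma lintegral_heatE_sq_le {s : ℝ} (hs : 0 < s) {p : ℝ≥0∞} (hp1 : 1 ≤ p) (hp2 : p ≤ 2) {f : V → ℂ}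
    (hf : AEStronglyMeasurable f volume) :
    ∫⁻ x, heatE s f x ^ (2 : ℝ) ≤
      ENNReal.ofReal ((4 * Real.pi * s) ^ (-(3 / 2) : ℝ)) ^ (2 * (p.toReal)⁻¹ - 1) *
        eLpNorm f p volume ^ (2 : ℝ) := by
  obtain ⟨h1, h2⟩ := toReal_mem hp1 hp2
  have h0 : 0 < p.toReal := by linarith
  set G := ENNReal.ofReal ((4 * Real.pi * s) ^ (-(3 / 2) : ℝ)) with hG
  have hG0 : G ≠ 0 := by
    rw [hG, Ne, ENNReal.ofReal_eq_zero, not_le]; positivity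
  have hGt : G ≠ ⊤ := ENNReal.ofReal_ne_top
  set S := G ^ (p.toReal)⁻¹ * eLpNorm f p volume with hS
  have hint : ∫⁻ x, heatE s f x ^ p.toReal ≤ eLpNorm f p volume ^ p.toReal := by
    refine (lintegral_mono fun x => heatE_rpow_le hs h1 hf x).trans ?_
    rw [lintegral_lintegral_swap, ← lintegral_rpow_enorm_eq hp1 hp2]
    · refine lintegral_mono fun y => ?_
      rw [lintegral_mul_const _ (measurable_gk_sub_right s y), lintegral_gk_sub hs, one_mul]
    · exact (measurable_gk_sub s).aemeasurable.mul (hf.enorm.comp_snd.pow_const _)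
  calc ∫⁻ x, heatE s f x ^ (2 : ℝ)
      ≤ ∫⁻ x, S ^ (2 - p.toReal) * heatE s f x ^ p.toReal := by
        refine lintegral_mono fun x => ?_
        calc heatE s f x ^ (2 : ℝ) = heatE s f x ^ (2 - p.toReal) * heatE s f x ^ p.toReal := by
              rw [← ENNReal.rpow_add_of_nonneg _ _ (by linarith) h0.le]; congr 1; ring
          _ ≤ _ := by
              gcongr
              exact heatE_le hs hp1 hp2 hf x
    _ ≤ S ^ (2 - p.toReal) * eLpNorm f p volume ^ p.toReal := by
        have hm : AEMeasurable (fun x => heatE s f x ^ p.toReal) volume := by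
          refine AEMeasurable.pow_const ?_ _
          exact ((measurable_gk_sub s).aemeasurable.mul hf.enorm.comp_snd).lintegral_prod_right'
        rw [lintegral_const_mul'' _ hm]
        gcongr
    _ = _ := by
        rw [hS, ENNReal.mul_rpow_of_nonneg _ _ (by linarith), ← ENNReal.rpow_mul, mul_assoc,
          ← ENNReal.rpow_add_of_nonneg _ _ (by linarith) h0.le]
        congr 2
        · field_simp
        · ring

/-! ### The Fourier transform of an `L^p` function, `1 ≤ p ≤ 2` -/

/-- The product of a compactly supported Schwartz function with `exp (a |ξ|²)`. -/
def gaussMul (a : ℝ) (φ : 𝓢(V, ℂ)) (hφ : HasCompactSupport φ) : 𝓢(V, ℂ) :=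
  HasCompactSupport.toSchwartzMap (f := fun ξ => Complex.exp ((a : ℂ) * (‖ξ‖ : ℂ) ^ 2) * φ ξ) hφ.mul_left
    (by
      have h1 : ContDiff ℝ ∞ fun ξ : V => ((‖ξ‖ ^ 2 : ℝ) : ℂ) :=
        Complex.ofRealCLM.contDiff.comp (contDiff_norm_sq ℝ)
      have h2 : ContDiff ℝ ∞ fun ξ : V => (a : ℂ) * (‖ξ‖ : ℂ) ^ 2 := by
        simpa using contDiff_const.mul h1
      exact (Complex.contDiff_exp.comp h2).mul (φ.smooth ⊤))

lemma gaussMul_apply (a : ℝ) (φ : 𝓢(V, ℂ)) (hφ : HasCompactSupport φ) (ξ : V) :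
    gaussMul a φ hφ ξ = Complex.exp ((a : ℂ) * (‖ξ‖ : ℂ) ^ 2) * φ ξ := rfl

lemma hasCompactSupport_gaussMul (a : ℝ) (φ : 𝓢(V, ℂ)) (hφ : HasCompactSupport φ) :
    HasCompactSupport (gaussMul a φ hφ) := HasCompactSupport.mul_left hφ

lemma fourier_fourier_apply (ψ : 𝓢(V, ℂ)) (v : V) : 𝓕 (𝓕 ψ) v = ψ (-v) := by
  have h : 𝓕⁻ (𝓕 ψ) = ψ := FourierTransform.fourierInv_fourier_eq ψ
  have h2 : (𝓕⁻ (𝓕 ψ) : 𝓢(V, ℂ)) (-v) = ψ (-v) := by rw [h]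
  rw [← h2, SchwartzMap.fourierInv_coe, Real.fourierInv_eq_fourier_neg, neg_neg]
  rfl

/-- The kernel is itself a Fourier transform, so moving 𝓕 to the other factor leaves 𝓕𝓕ψ = ψ(-·)
against a modulated Gaussian. After v ↦ -v this is the transform of the Gaussian times ψ. -/
lemma integral_fourier_mul_gk {s : ℝ} (hs : 0 < s) (ψ : 𝓢(V, ℂ)) (hψ : HasCompactSupport ψ) (y : V) :
    ∫ x, 𝓕 ψ x * (gk s (x - y) : ℂ) = 𝓕 (gaussMul (-(4 * Real.pi ^ 2 * s)) ψ hψ) y := by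
  have hb : 0 < ((4 * Real.pi ^ 2 * s : ℝ) : ℂ).re := by
    rw [Complex.ofReal_re]; positivity
  set g : V → ℂ := fun v => Complex.exp (-((4 * Real.pi ^ 2 * s : ℝ) : ℂ) * ‖v‖ ^ 2 +
      2 * Real.pi * Complex.I * (inner ℝ y v : ℝ)) with hg
  have hgi : Integrable g volume := GaussianFourier.integrable_cexp_neg_mul_sq_norm_add hb _ _
  have hflip : ∫ x, 𝓕 g x * 𝓕 ψ x = ∫ v, g v * 𝓕 (𝓕 ψ) v := by
    have := VectorFourier.integral_fourierIntegral_smul_eq_flip (L := innerₗ V)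
      Real.continuous_fourierChar continuous_inner hgi ((𝓕 ψ).integrable (μ := volume))
    simpa using! this
  have h1 : ∫ x, 𝓕 ψ x * (gk s (x - y) : ℂ) = ∫ x, 𝓕 g x * 𝓕 ψ x := by
    refine integral_congr_ae (Eventually.of_forall fun x => ?_)
    simp only [hg, fourier_gaussian_eq_gk hs, gk_sub_comm s y x]
    ring
  rw [h1, hflip]
  simp only [fourier_fourier_apply]
  rw [← integral_neg_eq_self, SchwartzMap.fourier_coe, Real.fourier_eq']
  refine integral_congr_ae (Eventually.of_forall fun v => ?_)
  simp only [hg, gaussMul_apply, neg_neg, norm_neg, inner_neg_right, smul_eq_mul]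
  rw [Complex.exp_add, real_inner_comm]
  rw [show Complex.exp (2 * ↑Real.pi * Complex.I * ↑(-inner ℝ v y)) =
    Complex.exp (↑(-2 * Real.pi * inner ℝ v y) * Complex.I) by congr 1; push_cast; ring]
  push_cast
  ring_nf

lemma integrable_gk_mul {s : ℝ} (hs : 0 < s) {p : ℝ≥0∞} (hp1 : 1 ≤ p) (hp2 : p ≤ 2) {f : V → ℂ}
    (hf : MemLp f p volume) (x : V) : Integrable (fun y => (gk s (x - y) : ℂ) * f y) volume := by
  refine ⟨?_, ?_⟩
  · refine AEStronglyMeasurable.mul ?_ hf.1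
    exact (Complex.continuous_ofReal.comp ((continuous_gk s).comp
      (continuous_const.sub continuous_id))).aestronglyMeasurable
  · rw [hasFiniteIntegral_iff_enorm]
    simp only [enorm_gk_mul hs]
    refine (heatE_le hs hp1 hp2 hf.1 x).trans_lt (ENNReal.mul_lt_top ?_ hf.2)
    exact ENNReal.rpow_lt_top_of_nonneg (by positivity) ENNReal.ofReal_ne_top

lemma integral_schwartz_mul_heat {s : ℝ} (hs : 0 < s) {p : ℝ≥0∞} (hp1 : 1 ≤ p) (hp2 : p ≤ 2)
    {f : V → ℂ} (hf : MemLp f p volume) (φ : 𝓢(V, ℂ)) :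
    ∫ x, φ x * heat s f x = ∫ y, (∫ x, φ x * (gk s (x - y) : ℂ)) * f y := by
  have hint : Integrable (Function.uncurry fun x y => φ x * ((gk s (x - y) : ℂ) * f y))
      (volume.prod volume) := by
    have hm : AEStronglyMeasurable (Function.uncurry fun x y => φ x * ((gk s (x - y) : ℂ) * f y))
        (volume.prod volume) :=
      (φ.continuous.aestronglyMeasurable.comp_fst).mul (aestronglyMeasurable_gk_mul s hf.1)
    refine ⟨hm, ?_⟩
    rw [hasFiniteIntegral_iff_enorm, lintegral_prod _ hm.enorm]
    simp only [Function.uncurry, enorm_mul (φ _), enorm_gk_mul hs]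
    set S := ENNReal.ofReal ((4 * Real.pi * s) ^ (-(3 / 2) : ℝ)) ^ (p.toReal)⁻¹ *
      eLpNorm f p volume
    have hS : S < ⊤ := ENNReal.mul_lt_top
      (ENNReal.rpow_lt_top_of_nonneg (by positivity) ENNReal.ofReal_ne_top) hf.2
    calc ∫⁻ x, ∫⁻ y, ‖φ x‖ₑ * (ENNReal.ofReal (gk s (x - y)) * ‖f y‖ₑ)
        ≤ ∫⁻ x, ‖φ x‖ₑ * S := by
          refine lintegral_mono fun x => ?_
          rw [lintegral_const_mul' _ _ enorm_ne_top]
          gcongr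
          exact heatE_le hs hp1 hp2 hf.1 x
      _ = (∫⁻ x, ‖φ x‖ₑ) * S := lintegral_mul_const' _ _ hS.ne
      _ < ⊤ := ENNReal.mul_lt_top (hasFiniteIntegral_iff_enorm.1 φ.integrable.2) hS
  calc ∫ x, φ x * heat s f x = ∫ x, ∫ y, φ x * ((gk s (x - y) : ℂ) * f y) := by
        simp only [heat, integral_const_mul]
    _ = ∫ y, ∫ x, φ x * ((gk s (x - y) : ℂ) * f y) := integral_integral_swap hint
    _ = _ := by simp only [← mul_assoc, integral_mul_const]

lemma integral_fourier_mul_heat {s : ℝ} (hs : 0 < s) {p : ℝ≥0∞} (hp1 : 1 ≤ p) (hp2 : p ≤ 2)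
    {f : V → ℂ} (hf : MemLp f p volume) (ψ : 𝓢(V, ℂ)) (hψ : HasCompactSupport ψ) :
    ∫ x, 𝓕 ψ x * heat s f x = ∫ y, 𝓕 (gaussMul (-(4 * Real.pi ^ 2 * s)) ψ hψ) y * f y := by
  rw [integral_schwartz_mul_heat hs hp1 hp2 hf]
  simp only [integral_fourier_mul_gk hs ψ hψ]

lemma memLp_heat {s : ℝ} (hs : 0 < s) {p : ℝ≥0∞} (hp1 : 1 ≤ p) (hp2 : p ≤ 2)
    {f : V → ℂ} (hf : MemLp f p volume) : MemLp (heat s f) 2 volume := by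
  refine ⟨aestronglyMeasurable_heat s hf.1, ?_⟩
  rw [eLpNorm_lt_top_iff_lintegral_rpow_enorm_lt_top (by norm_num) (by norm_num)]
  obtain ⟨h1, h2⟩ := toReal_mem hp1 hp2
  simp only [ENNReal.toReal_ofNat]
  refine (lintegral_mono fun x => ENNReal.rpow_le_rpow (enorm_heat_le hs f x) (by norm_num)).trans_lt
    ((lintegral_heatE_sq_le hs hp1 hp2 hf.1).trans_lt (ENNReal.mul_lt_top ?_ ?_))
  · refine ENNReal.rpow_lt_top_of_nonneg ?_ ENNReal.ofReal_ne_top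
    have : (p.toReal)⁻¹ ≥ 2⁻¹ := by gcongr
    linarith
  · exact ENNReal.rpow_lt_top_of_nonneg (by norm_num) hf.2.ne

/-- The heat flow multiplies the Fourier transform by a Gaussian. -/
lemma IsFT.heat {s : ℝ} (hs : 0 < s) {p : ℝ≥0∞} (hp1 : 1 ≤ p) (hp2 : p ≤ 2)
    {f fh : V → ℂ} (hf : MemLp f p volume) (h : IsFT f fh) :
    IsFT (heat s f) fun ξ => Complex.exp (-(s * wn ξ ^ 2 : ℝ)) * fh ξ := by
  refine ⟨?_, fun φ hφ => ?_⟩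
  · have hc : Continuous fun ξ : V => Complex.exp (-(s * wn ξ ^ 2 : ℝ)) := by
      unfold wn; fun_prop
    have := (locallyIntegrableOn_univ.2 h.1).continuousOn_mul hc.continuousOn isOpen_univ.isLocallyClosed
    exact locallyIntegrableOn_univ.1 this
  · rw [integral_fourier_mul_heat hs hp1 hp2 hf φ hφ, h.2 _ (hasCompactSupport_gaussMul _ _ _)]
    refine integral_congr_ae (Eventually.of_forall fun ξ => ?_)
    simp only [gaussMul_apply, wn]
    push_cast
    ring_nf

/-- The heat flow at time 1 sends `f` into L², where Plancherel provides a transform; dividing by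
the Gaussian recovers the transform of `f`. The growth of the inverse Gaussian is harmless because
`IsFT` tests only with compact supports on the frequency side. -/
lemma exists_isFT {p : ℝ≥0∞} (hp1 : 1 ≤ p) (hp2 : p ≤ 2) {f : V → ℂ} (hf : MemLp f p volume) :
    ∃ fh, IsFT f fh := by
  obtain ⟨h, hh, hft, -⟩ := exists_isFT_of_memLp_two (memLp_heat one_pos hp1 hp2 hf)
  refine ⟨fun ξ => Complex.exp ((4 * Real.pi ^ 2 * 1 : ℝ) * (‖ξ‖ : ℂ) ^ 2) * h ξ, ?_, fun φ hφ => ?_⟩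
  · have hc : Continuous fun ξ : V => Complex.exp ((4 * Real.pi ^ 2 * 1 : ℝ) * (‖ξ‖ : ℂ) ^ 2) := by
      fun_prop
    have := (locallyIntegrableOn_univ.2 hft.1).continuousOn_mul hc.continuousOn isOpen_univ.isLocallyClosed
    exact locallyIntegrableOn_univ.1 this
  · set ψ := gaussMul (4 * Real.pi ^ 2 * 1) φ hφ with hψ
    have hψc : HasCompactSupport ψ := hasCompactSupport_gaussMul _ _ _
    have h1 : gaussMul (-(4 * Real.pi ^ 2 * 1)) ψ hψc = φ := by
      ext ξ
      rw [gaussMul_apply, hψ, gaussMul_apply, ← mul_assoc, ← Complex.exp_add]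
      push_cast
      ring_nf
      simp
    have h2 := integral_fourier_mul_heat one_pos hp1 hp2 hf ψ hψc
    rw [h1, hft.2 ψ hψc] at h2
    rw [← h2]
    refine integral_congr_ae (Eventually.of_forall fun ξ => ?_)
    simp only [hψ, gaussMul_apply]
    ring

lemma recip_eq (p : ℝ≥0∞) : recip p = (p.toReal)⁻¹ := ENNReal.toReal_inv p

/-- Gaussian weighted bound of the Fourier transform of an `L^p` function. -/
lemma IsFT.lintegral_gauss_le {p : ℝ≥0∞} (hp1 : 1 ≤ p) (hp2 : p ≤ 2) {f fh : V → ℂ}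
    (hf : MemLp f p volume) (h : IsFT f fh) {s : ℝ} (hs : 0 < s) :
    ∫⁻ ξ, ENNReal.ofReal (Real.exp (-2 * s * wn ξ ^ 2)) * ‖fh ξ‖ₑ ^ (2 : ℝ) ≤
      ENNReal.ofReal ((4 * Real.pi * s) ^ (-3 * (recip p - 1 / 2))) * eLpNorm f p volume ^ (2 : ℝ) := by
  obtain ⟨h1, h2⟩ := toReal_mem hp1 hp2
  have he := (h.heat hs hp1 hp2 hf).eLpNorm_two_eq (memLp_heat hs hp1 hp2 hf)
  have e2 : ∀ g : V → ℂ, ∫⁻ x, ‖g x‖ₑ ^ (2 : ℝ) = eLpNorm g 2 volume ^ (2 : ℝ) := fun g => by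
    simpa using lintegral_rpow_enorm_eq (p := 2) (by norm_num) le_rfl g
  calc ∫⁻ ξ, ENNReal.ofReal (Real.exp (-2 * s * wn ξ ^ 2)) * ‖fh ξ‖ₑ ^ (2 : ℝ)
      = ∫⁻ ξ, ‖Complex.exp (-(s * wn ξ ^ 2 : ℝ)) * fh ξ‖ₑ ^ (2 : ℝ) := by
        refine lintegral_congr fun ξ => ?_
        rw [enorm_mul, ENNReal.mul_rpow_of_nonneg _ _ (by norm_num)]
        congr 1
        rw [← ofReal_norm, Complex.norm_exp, ENNReal.ofReal_rpow_of_nonneg (by positivity) (by norm_num),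
          ← Real.exp_mul]
        congr 2
        rw [← Complex.ofReal_neg, Complex.ofReal_re]
        ring
    _ = ∫⁻ x, ‖EulerMaxwell.heat s f x‖ₑ ^ (2 : ℝ) := by rw [e2, e2, he]
    _ ≤ ∫⁻ x, heatE s f x ^ (2 : ℝ) :=
        lintegral_mono fun x => ENNReal.rpow_le_rpow (enorm_heat_le hs f x) (by norm_num)
    _ ≤ _ := by
        refine (lintegral_heatE_sq_le hs hp1 hp2 hf.1).trans_eq ?_
        rw [ENNReal.ofReal_rpow_of_pos (by positivity), ← Real.rpow_mul (by positivity), recip_eq]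
        congr 3
        ring

/-! ### High frequencies -/

lemma lintegral_enorm_sq_eq (g : V → ℂ) :
    ∫⁻ x, ‖g x‖ₑ ^ (2 : ℝ) = eLpNorm g 2 volume ^ (2 : ℝ) := by
  simpa using lintegral_rpow_enorm_eq (p := 2) (by norm_num) le_rfl g

lemma half_le_recip {p : ℝ≥0∞} (hp1 : 1 ≤ p) (hp2 : p ≤ 2) : 1 / 2 ≤ recip p := by
  obtain ⟨h1, h2⟩ := toReal_mem hp1 hp2
  rw [recip_eq, one_div]
  gcongr

lemma lintegral_Ioc_rpow_lt_top {a T : ℝ} (ha : -1 < a) (hT : 0 ≤ T) :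
    ∫⁻ τ in Ioc 0 T, ENNReal.ofReal (τ ^ a) < ⊤ := by
  have h : IntervalIntegrable (fun τ : ℝ => τ ^ a) volume 0 T :=
    intervalIntegral.intervalIntegrable_rpow' ha
  have h2 := (intervalIntegrable_iff_integrableOn_Ioc_of_le hT).1 h
  exact h2.lintegral_lt_top

/-- A negative power is a superposition of Gaussians, by the Gamma integral. The part τ ≤ k⁻²
already suffices: there the Gaussian is at least e⁻², and the integral of τ^{σ-1} is k^{-2σ}/σ. -/
lemma rpow_le_lintegral_gauss {σ k T : ℝ} (hσ : 0 < σ) (hk : 0 < k) (hT : k ^ (-2 : ℝ) ≤ T) :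
    ENNReal.ofReal (k ^ (-2 * σ)) ≤ ENNReal.ofReal (σ * Real.exp 2) *
      ∫⁻ τ in Ioc 0 T, ENNReal.ofReal (τ ^ (σ - 1)) * ENNReal.ofReal (Real.exp (-2 * τ * k ^ 2)) := by
  set t := k ^ (-2 : ℝ) with ht
  have ht0 : 0 < t := Real.rpow_pos_of_pos hk _
  have htk : t * k ^ 2 = 1 := by
    rw [ht, ← Real.rpow_natCast k 2, ← Real.rpow_add hk]; norm_num
  have h1 : ∫⁻ τ in Ioc 0 t, ENNReal.ofReal (τ ^ (σ - 1)) = ENNReal.ofReal (t ^ σ / σ) := by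
    have hint : IntervalIntegrable (fun τ : ℝ => τ ^ (σ - 1)) volume 0 t :=
      intervalIntegral.intervalIntegrable_rpow' (by linarith)
    rw [← ofReal_integral_eq_lintegral_ofReal
      ((intervalIntegrable_iff_integrableOn_Ioc_of_le ht0.le).1 hint)]
    · rw [← intervalIntegral.integral_of_le ht0.le, integral_rpow (Or.inl (by linarith))]
      simp [Real.zero_rpow hσ.ne']
    · refine (ae_restrict_mem measurableSet_Ioc).mono fun τ hτ => ?_
      exact Real.rpow_nonneg hτ.1.le _
  calc ENNReal.ofReal (k ^ (-2 * σ))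
      = ENNReal.ofReal (σ * Real.exp 2) * (ENNReal.ofReal (t ^ σ / σ) * ENNReal.ofReal (Real.exp (-2))) := by
        rw [← ENNReal.ofReal_mul (by positivity), ← ENNReal.ofReal_mul (by positivity)]
        congr 1
        rw [ht, ← Real.rpow_mul hk.le, Real.exp_neg]
        field_simp
    _ = ENNReal.ofReal (σ * Real.exp 2) *
        ∫⁻ τ in Ioc 0 t, ENNReal.ofReal (τ ^ (σ - 1)) * ENNReal.ofReal (Real.exp (-2)) := by
        rw [lintegral_mul_const' _ _ ENNReal.ofReal_ne_top, h1]
    _ ≤ ENNReal.ofReal (σ * Real.exp 2) *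
        ∫⁻ τ in Ioc 0 t, ENNReal.ofReal (τ ^ (σ - 1)) * ENNReal.ofReal (Real.exp (-2 * τ * k ^ 2)) := by
        gcongr 1
        refine setLIntegral_mono' measurableSet_Ioc fun τ hτ => ?_
        gcongr
        have : τ * k ^ 2 ≤ t * k ^ 2 := by gcongr; exact hτ.2
        linarith
    _ ≤ _ := by
        gcongr 1
        exact lintegral_mono_set (Ioc_subset_Ioc_right hT)

lemma measurableSet_high (δ : ℝ) : MeasurableSet {ξ : V | δ ≤ wn ξ} :=
  measurableSet_le measurable_const measurable_wn

/-- The exponent `σ` is large enough for negative powers `|ξ|^{-σ}` to compensate for the passage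
from `L^r` to `L²`. -/
def Admissible (σ : ℝ) (r : ℝ≥0∞) : Prop := 3 * (recip r - 1 / 2) < σ ∨ (σ = 0 ∧ r = 2)

lemma Admissible.nonneg {σ : ℝ} {r : ℝ≥0∞} (h : Admissible σ r) (hr1 : 1 ≤ r) (hr2 : r ≤ 2) :
    0 ≤ σ := by
  rcases h with h | h
  · have := half_le_recip hr1 hr2; linarith
  · exact h.1.ge

/-- Substitute for Hausdorff–Young. Each Gaussian with parameter τ in the superposition costs τ^{-a}
with a = 3(1/r - 1/2), and τ^{σ-1-a} is integrable at 0 exactly because σ > a. The restriction to k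
≥ δ keeps τ ≤ δ⁻², which avoids divergence at infinity. The endpoint σ = 0, r = 2 is Plancherel. -/
lemma exists_lintegral_high_le {r : ℝ≥0∞} (hr1 : 1 ≤ r) (hr2 : r ≤ 2) {σ δ : ℝ} (hδ : 0 < δ)
    (hσ : Admissible σ r) :
    ∃ C : ℝ, 0 ≤ C ∧ ∀ f fh : V → ℂ, MemLp f r volume → IsFT f fh →
      ∫⁻ ξ in {ξ : V | δ ≤ wn ξ}, ENNReal.ofReal (wn ξ ^ (-2 * σ)) * ‖fh ξ‖ₑ ^ (2 : ℝ) ≤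
        ENNReal.ofReal C * eLpNorm f r volume ^ (2 : ℝ) := by
  rcases hσ with hσ | ⟨rfl, rfl⟩
  · have hr := half_le_recip hr1 hr2
    set a := 3 * (recip r - 1 / 2) with ha
    have ha0 : 0 ≤ a := by rw [ha]; linarith
    have hσ0 : 0 < σ := by linarith
    set T := δ ^ (-2 : ℝ) with hT
    have hT0 : 0 < T := Real.rpow_pos_of_pos hδ _
    set I := ∫⁻ τ in Ioc 0 T, ENNReal.ofReal (τ ^ (σ - 1 - a)) with hI
    have hIt : I < ⊤ := lintegral_Ioc_rpow_lt_top (by linarith) hT0.le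
    set C := ENNReal.ofReal (σ * Real.exp 2) * (ENNReal.ofReal ((4 * Real.pi) ^ (-a)) * I) with hC
    have hCt : C < ⊤ := ENNReal.mul_lt_top ENNReal.ofReal_lt_top
      (ENNReal.mul_lt_top ENNReal.ofReal_lt_top hIt)
    refine ⟨C.toReal, ENNReal.toReal_nonneg, fun f fh hf hft => ?_⟩
    rw [ENNReal.ofReal_toReal hCt.ne]
    have hm : AEMeasurable (fun ξ => ‖fh ξ‖ₑ ^ (2 : ℝ)) volume :=
      (hft.1.aestronglyMeasurable.enorm).pow_const _
    have hmexp : Measurable fun z : V × ℝ => ENNReal.ofReal (Real.exp (-2 * z.2 * wn z.1 ^ 2)) := by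
      refine ENNReal.measurable_ofReal.comp (Real.measurable_exp.comp ?_)
      exact (measurable_const.mul measurable_snd).mul ((measurable_wn.comp measurable_fst).pow_const 2)
    calc ∫⁻ ξ in {ξ : V | δ ≤ wn ξ}, ENNReal.ofReal (wn ξ ^ (-2 * σ)) * ‖fh ξ‖ₑ ^ (2 : ℝ)
        ≤ ∫⁻ ξ in {ξ : V | δ ≤ wn ξ}, ENNReal.ofReal (σ * Real.exp 2) *
            ∫⁻ τ in Ioc 0 T, ENNReal.ofReal (τ ^ (σ - 1)) *
              (ENNReal.ofReal (Real.exp (-2 * τ * wn ξ ^ 2)) * ‖fh ξ‖ₑ ^ (2 : ℝ)) := by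
          refine setLIntegral_mono' (measurableSet_high δ) fun ξ hξ => ?_
          have hk : 0 < wn ξ := hδ.trans_le hξ
          have h1 := rpow_le_lintegral_gauss (T := T) hσ0 hk
            (Real.rpow_le_rpow_of_nonpos hδ hξ (by norm_num))
          refine (mul_le_mul_left h1 _).trans_eq ?_
          rw [mul_assoc, ← lintegral_mul_const' _ _ (by finiteness)]
          simp only [mul_assoc]
      _ ≤ ∫⁻ ξ, ENNReal.ofReal (σ * Real.exp 2) *
            ∫⁻ τ in Ioc 0 T, ENNReal.ofReal (τ ^ (σ - 1)) *
              (ENNReal.ofReal (Real.exp (-2 * τ * wn ξ ^ 2)) * ‖fh ξ‖ₑ ^ (2 : ℝ)) :=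
          setLIntegral_le_lintegral _ _
      _ = ENNReal.ofReal (σ * Real.exp 2) * ∫⁻ τ in Ioc 0 T, ENNReal.ofReal (τ ^ (σ - 1)) *
            ∫⁻ ξ, ENNReal.ofReal (Real.exp (-2 * τ * wn ξ ^ 2)) * ‖fh ξ‖ₑ ^ (2 : ℝ) := by
          rw [lintegral_const_mul' _ _ ENNReal.ofReal_ne_top, lintegral_lintegral_swap]
          · simp only [lintegral_const_mul' _ _ ENNReal.ofReal_ne_top]
          · refine AEMeasurable.mul ?_ (hmexp.aemeasurable.mul hm.comp_fst)
            exact (ENNReal.measurable_ofReal.comp (measurable_snd.pow_const _)).aemeasurable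
      _ ≤ ENNReal.ofReal (σ * Real.exp 2) * ∫⁻ τ in Ioc 0 T,
            ENNReal.ofReal ((4 * Real.pi) ^ (-a)) * ENNReal.ofReal (τ ^ (σ - 1 - a)) *
              eLpNorm f r volume ^ (2 : ℝ) := by
          gcongr 1
          refine setLIntegral_mono' measurableSet_Ioc fun τ hτ => ?_
          have h1 := hft.lintegral_gauss_le hr1 hr2 hf hτ.1
          refine (mul_le_mul_right h1 _).trans_eq ?_
          rw [← mul_assoc]
          congr 1
          have hτ0 : 0 < τ := hτ.1
          rw [← ENNReal.ofReal_mul (by positivity), ← ENNReal.ofReal_mul (by positivity)]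
          congr 1
          rw [show -3 * (recip r - 1 / 2) = -a by rw [ha]; ring,
            Real.mul_rpow (by positivity) hτ0.le, sub_eq_add_neg (σ - 1) a, Real.rpow_add hτ0]
          ring
      _ = C * eLpNorm f r volume ^ (2 : ℝ) := by
          rw [lintegral_mul_const' _ _ (by have := hf.2.ne; finiteness),
            lintegral_const_mul' _ _ ENNReal.ofReal_ne_top, hC]
          ring
  · refine ⟨1, zero_le_one, fun f fh hf hft => ?_⟩
    refine (setLIntegral_le_lintegral _ _).trans ?_
    simp only [mul_zero, Real.rpow_zero, ENNReal.ofReal_one, one_mul]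
    rw [lintegral_enorm_sq_eq, hft.eLpNorm_two_eq hf]

/-! ### Duality -/

/-- The conjugate exponent. -/
def conjExp (q : ℝ≥0∞) : ℝ≥0∞ := (1 - q⁻¹)⁻¹

lemma conjExp_bounds {q : ℝ≥0∞} (hq : 2 ≤ q) : 1 ≤ conjExp q ∧ conjExp q ≤ 2 ∧
    recip (conjExp q) = 1 - recip q := by
  have h1 : q⁻¹ ≤ 2⁻¹ := ENNReal.inv_le_inv.2 hq
  have h2 : (2 : ℝ≥0∞)⁻¹ ≤ 1 - q⁻¹ := by
    rw [← ENNReal.one_sub_inv_two]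
    exact tsub_le_tsub_left h1 1
  refine ⟨?_, ?_, ?_⟩
  · unfold conjExp; rw [ENNReal.one_le_inv]; exact tsub_le_self
  · unfold conjExp; rw [ENNReal.inv_le_iff_inv_le]; exact h2
  · unfold conjExp recip
    rw [inv_inv, ENNReal.toReal_sub_of_le (h1.trans (by norm_num)) ENNReal.one_ne_top]
    simp

lemma conj_mul_self_div (z : ℂ) : starRingEnd ℂ (z / (‖z‖ : ℂ)) * z = (‖z‖ : ℂ) := by
  rcases eq_or_ne z 0 with rfl | hz
  · simp
  · rw [map_div₀, Complex.conj_ofReal, div_mul_eq_mul_div, mul_comm, Complex.mul_conj,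
      Complex.normSq_eq_norm_sq]
    have : (‖z‖ : ℂ) ≠ 0 := by simpa using hz
    push_cast
    field_simp

lemma norm_unit_le (z : ℂ) : ‖z / (‖z‖ : ℂ)‖ ≤ 1 := by
  rw [norm_div, Complex.norm_real, norm_norm]
  exact div_self_le_one _

/-- Test function in the converse of Hölder's inequality: the pairing with `ρ(|g|) g/|g|`. -/
lemma enorm_integral_conj_unit_mul {g : V → ℂ} {w : V → ℝ} (hw : ∀ x, 0 ≤ w x)
    (hm : AEStronglyMeasurable (fun x => w x * ‖g x‖) volume)
    (hfin : ∫⁻ x, ENNReal.ofReal (w x) * ‖g x‖ₑ ≠ ⊤) :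
    ‖∫ x, starRingEnd ℂ ((w x : ℂ) * (g x / (‖g x‖ : ℂ))) * g x‖ₑ =
      ∫⁻ x, ENNReal.ofReal (w x) * ‖g x‖ₑ := by
  have h1 : ∀ x, starRingEnd ℂ ((w x : ℂ) * (g x / (‖g x‖ : ℂ))) * g x = ((w x * ‖g x‖ : ℝ) : ℂ) := by
    intro x
    rw [map_mul, Complex.conj_ofReal, mul_assoc, conj_mul_self_div]
    push_cast; rfl
  have h2 : ∀ x, ENNReal.ofReal (w x) * ‖g x‖ₑ = ENNReal.ofReal (w x * ‖g x‖) := by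
    intro x
    rw [ENNReal.ofReal_mul (hw x), ofReal_norm]
  simp only [h1, h2] at hfin ⊢
  have h0 : ∀ x, 0 ≤ w x * ‖g x‖ := fun x => mul_nonneg (hw x) (norm_nonneg _)
  rw [integral_complex_ofReal, ← ofReal_norm, Complex.norm_real, Real.norm_of_nonneg
    (integral_nonneg h0), ofReal_integral_eq_lintegral_ofReal _ (Eventually.of_forall h0)]
  refine ⟨hm, ?_⟩
  rw [hasFiniteIntegral_iff_ofReal (Eventually.of_forall h0)]
  exact lt_top_iff_ne_top.2 hfin

lemma enorm_ofReal_mul_unit_le {w : ℝ} (hw : 0 ≤ w) (z : ℂ) :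
    ‖(w : ℂ) * (z / (‖z‖ : ℂ))‖ₑ ≤ ENNReal.ofReal w := by
  rw [← ofReal_norm, norm_mul, Complex.norm_real, Real.norm_of_nonneg hw]
  exact ENNReal.ofReal_le_ofReal (mul_le_of_le_one_right hw (norm_unit_le z))

lemma aestronglyMeasurable_mul_unit {g : V → ℂ} (hg : AEStronglyMeasurable g volume) {W : ℝ → ℝ}
    (hW : Measurable W) :
    AEStronglyMeasurable (fun x => (W ‖g x‖ : ℂ) * (g x / (‖g x‖ : ℂ))) volume := by
  have h1 : AEMeasurable (fun x => W ‖g x‖) volume := hW.comp_aemeasurable hg.norm.aemeasurable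
  have h2 : AEMeasurable (fun x => (W ‖g x‖ : ℂ)) volume :=
    Complex.measurable_ofReal.comp_aemeasurable h1
  have h3 : AEMeasurable (fun x => (‖g x‖ : ℂ)) volume :=
    Complex.measurable_ofReal.comp_aemeasurable hg.norm.aemeasurable
  exact (h2.mul (hg.aemeasurable.div h3)).aestronglyMeasurable

/-- Testing with W(|g|) g/|g| makes the pairing equal to the integral of W(|g|)|g|. The duality
bound is available only for square integrable test functions, hence the integrability demanded of
the weight. -/
lemma lintegral_weight_le_of_duality {q' : ℝ≥0∞} {g : V → ℂ} (hg : AEStronglyMeasurable g volume)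
    {M : ℝ≥0∞}
    (H : ∀ φ : V → ℂ, MemLp φ 2 volume → MemLp φ q' volume →
      ‖∫ x, starRingEnd ℂ (φ x) * g x‖ₑ ≤ M * eLpNorm φ q' volume)
    {W : ℝ → ℝ} (hW : Measurable W) (hW0 : ∀ r, 0 ≤ W r)
    (h2 : MemLp (fun x => W ‖g x‖) 2 volume) (h1 : MemLp (fun x => W ‖g x‖) q' volume)
    (hfin : ∫⁻ x, ENNReal.ofReal (W ‖g x‖) * ‖g x‖ₑ ≠ ⊤) :
    ∫⁻ x, ENNReal.ofReal (W ‖g x‖) * ‖g x‖ₑ ≤ M * eLpNorm (fun x => W ‖g x‖) q' volume := by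
  have hle : ∀ x, ‖(W ‖g x‖ : ℂ) * (g x / (‖g x‖ : ℂ))‖ₑ ≤ ‖W ‖g x‖‖ₑ := fun x =>
    (enorm_ofReal_mul_unit_le (hW0 _) _).trans_eq (Real.enorm_of_nonneg (hW0 _)).symm
  have hle' : ∀ᵐ x, ‖(W ‖g x‖ : ℂ) * (g x / (‖g x‖ : ℂ))‖ ≤ ‖W ‖g x‖‖ :=
    Eventually.of_forall fun x => enorm_le_iff_norm_le.1 (hle x)
  have hm := aestronglyMeasurable_mul_unit hg hW
  have h := H _ (h2.mono hm hle') (h1.mono hm hle')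
  rw [enorm_integral_conj_unit_mul (fun x => hW0 _) _ hfin] at h
  · exact h.trans (by gcongr; exact eLpNorm_mono_ae hle')
  · exact ((hW.comp_aemeasurable hg.norm.aemeasurable).mul hg.norm.aemeasurable).aestronglyMeasurable

/-- If the norm exceeded M, pick c strictly between and test with the indicator of {|g| > c}. This
set has finite measure because g is in L², and positive measure by the choice of c; the bound would
give c ≤ M. -/
lemma eLpNorm_top_le_of_duality {g : V → ℂ} (hg : MemLp g 2 volume) {M : ℝ≥0∞}
    (H : ∀ φ : V → ℂ, MemLp φ 2 volume → MemLp φ 1 volume →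
      ‖∫ x, starRingEnd ℂ (φ x) * g x‖ₑ ≤ M * eLpNorm φ 1 volume) :
    eLpNorm g ⊤ volume ≤ M := by
  by_contra! hlt
  obtain ⟨c, hMc, hc⟩ := ENNReal.lt_iff_exists_nnreal_btwn.1 hlt
  have hc0 : 0 < c := by
    have : (0 : ℝ≥0∞) < c := bot_le.trans_lt hMc
    exact_mod_cast this
  have hc0' : 0 < (c : ℝ) := hc0
  set W : ℝ → ℝ := (Ioi (c : ℝ)).indicator 1 with hWdef
  have hW : Measurable W := measurable_one.indicator measurableSet_Ioi
  have hW0 : ∀ r, 0 ≤ W r := fun r => indicator_nonneg (fun _ _ => zero_le_one) _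
  have hWr : ∀ r, 0 ≤ r → W r ≤ (c : ℝ)⁻¹ * r := by
    intro r hr
    by_cases h : (c : ℝ) < r
    · rw [hWdef, indicator_of_mem (by exact h)]
      simp only [Pi.one_apply]
      rw [inv_mul_eq_div, one_le_div hc0']; exact h.le
    · rw [hWdef, indicator_of_notMem (by exact h)]; positivity
  -- An indicator equals its square, so its square integrability gives integrability.
  have hWsq : ∀ r, W r = W r ^ 2 := by
    intro r
    by_cases h : (c : ℝ) < r
    · rw [hWdef, indicator_of_mem (by exact h)]; simp
    · rw [hWdef, indicator_of_notMem (by exact h)]; simp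
  have hWm : AEStronglyMeasurable (fun x => W ‖g x‖) volume :=
    (hW.comp_aemeasurable hg.1.norm.aemeasurable).aestronglyMeasurable
  have h2 : MemLp (fun x => W ‖g x‖) 2 volume := by
    refine hg.of_le_mul (c := (c : ℝ)⁻¹) hWm (Eventually.of_forall fun x => ?_)
    rw [Real.norm_of_nonneg (hW0 _)]
    exact hWr _ (norm_nonneg _)
  have h1 : MemLp (fun x => W ‖g x‖) 1 volume := by
    rw [memLp_one_iff_integrable]
    have : (fun x => W ‖g x‖) = fun x => W ‖g x‖ ^ 2 := funext fun x => hWsq _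
    rw [this]
    exact h2.integrable_sq
  have hgi : Integrable (fun x => ‖g x‖ ^ 2) volume := hg.integrable_norm_pow (by norm_num)
  have hfin : ∫⁻ x, ENNReal.ofReal (W ‖g x‖) * ‖g x‖ₑ ≠ ⊤ := by
    have hi : Integrable (fun x => W ‖g x‖ * ‖g x‖) volume := by
      refine (hgi.const_mul (c : ℝ)⁻¹).mono' (hWm.mul hg.1.norm) (Eventually.of_forall fun x => ?_)
      rw [Real.norm_of_nonneg (mul_nonneg (hW0 _) (norm_nonneg _))]
      nlinarith [hWr ‖g x‖ (norm_nonneg _), norm_nonneg (g x)]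
    have := hi.lintegral_lt_top.ne
    refine ne_of_eq_of_ne (lintegral_congr fun x => ?_) this
    rw [ENNReal.ofReal_mul (hW0 _), ofReal_norm]
  have key := lintegral_weight_le_of_duality hg.1 H hW hW0 h2 h1 hfin
  set A := ∫⁻ x, ENNReal.ofReal (W ‖g x‖) with hA
  have hAe : eLpNorm (fun x => W ‖g x‖) 1 volume = A := by
    rw [eLpNorm_one_eq_lintegral_enorm]
    exact lintegral_congr fun x => Real.enorm_of_nonneg (hW0 _)
  rw [hAe] at key
  have hAt : A ≠ ⊤ := by rw [← hAe]; exact h1.2.ne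
  have hlow : (c : ℝ≥0∞) * A ≤ ∫⁻ x, ENNReal.ofReal (W ‖g x‖) * ‖g x‖ₑ := by
    rw [hA, ← lintegral_const_mul' _ _ ENNReal.coe_ne_top]
    refine lintegral_mono fun x => ?_
    dsimp only
    by_cases h : (c : ℝ) < ‖g x‖
    · rw [mul_comm]
      gcongr
      rw [← ofReal_norm, ← ENNReal.ofReal_coe_nnreal]
      exact ENNReal.ofReal_le_ofReal h.le
    · have : W ‖g x‖ = 0 := by rw [hWdef, indicator_of_notMem (by exact h)]
      simp [this]
  have hA0 : A ≠ 0 := by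
    intro h0
    have hWE : AEMeasurable (fun x => ENNReal.ofReal (W ‖g x‖)) volume :=
      ENNReal.measurable_ofReal.comp_aemeasurable hWm.aemeasurable
    rw [hA, lintegral_eq_zero_iff' hWE] at h0
    have : eLpNorm g ⊤ volume ≤ c := by
      rw [eLpNorm_exponent_top]
      refine essSup_le_of_ae_le _ ?_
      filter_upwards [h0] with x hx
      by_contra! hcx
      have hcx' : (c : ℝ) < ‖g x‖ := by
        have : (c : ℝ≥0∞) < ‖g x‖₊ := hcx
        exact_mod_cast this
      have : W ‖g x‖ = 1 := by rw [hWdef, indicator_of_mem (by exact hcx')]; rfl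
      simp [this] at hx
    exact absurd (hc.trans_le this) (lt_irrefl _)
  have := (ENNReal.mul_le_mul_iff_left hA0 hAt).1 (hlow.trans key)
  exact absurd (hMc.trans_le this) (lt_irrefl _)

/-- Classical converse of Hölder: test with |g|^{p-1} g/|g|, cut off where |g| > n so that
membership in L² makes everything finite. The integral I then satisfies I ≤ M I^{1/p'}, so I ≤ M^p,
and n → ∞ by monotone convergence. -/
lemma eLpNorm_le_of_duality {q : ℝ≥0∞} (hq : 2 ≤ q) {g : V → ℂ} (hg : MemLp g 2 volume) {M : ℝ≥0∞}
    (H : ∀ φ : V → ℂ, MemLp φ 2 volume → MemLp φ (conjExp q) volume →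
      ‖∫ x, starRingEnd ℂ (φ x) * g x‖ₑ ≤ M * eLpNorm φ (conjExp q) volume) :
    eLpNorm g q volume ≤ M := by
  rcases eq_or_ne q ⊤ with rfl | hqt
  · have : conjExp ⊤ = 1 := by simp [conjExp]
    rw [this] at H
    exact eLpNorm_top_le_of_duality hg H
  obtain ⟨hc1, hc2, hcr⟩ := conjExp_bounds hq
  obtain ⟨hr1, hr2⟩ := toReal_mem hc1 hc2
  set p := q.toReal with hp
  set p' := (conjExp q).toReal with hp'
  have hp2 : 2 ≤ p := by simpa using ENNReal.toReal_mono hqt hq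
  have hp0 : 0 < p := by linarith
  have hconj : p'⁻¹ = 1 - p⁻¹ := by rw [← recip_eq, hcr, recip_eq]
  have hp'0 : 0 < p' := by linarith
  have hpp : (p - 1) * p' = p := by
    have : p' * (p'⁻¹) = p' * (1 - p⁻¹) := by rw [hconj]
    rw [mul_inv_cancel₀ hp'0.ne'] at this
    field_simp at this
    linarith
  have hq0 : q ≠ 0 := (zero_lt_two.trans_le hq).ne'
  have hc0 : conjExp q ≠ 0 := (one_pos.trans_le hc1).ne'
  have hct : conjExp q ≠ ⊤ := (hc2.trans_lt (by simp)).ne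
  have hgm := hg.1.norm.aemeasurable
  have hgi : Integrable (fun x => ‖g x‖ ^ 2) volume := hg.integrable_norm_pow (by norm_num)
  set W : ℕ → ℝ → ℝ := fun n => (Icc (0 : ℝ) n).indicator fun r => r ^ (p - 1) with hWdef
  have hW : ∀ n, Measurable (W n) := fun n =>
    (measurable_id.pow_const _).indicator measurableSet_Icc
  have hW0 : ∀ n r, 0 ≤ W n r := fun n r => indicator_nonneg
    (fun r hr => Real.rpow_nonneg hr.1 _) _
  have hWr : ∀ n r, 0 ≤ r → W n r ≤ (n : ℝ) ^ (p - 2) * r := by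
    intro n r hr
    by_cases h : r ≤ n
    · rw [hWdef]
      simp only
      rw [indicator_of_mem (show r ∈ Icc (0 : ℝ) n from ⟨hr, h⟩)]
      rcases hr.eq_or_lt with rfl | hr'
      · rw [Real.zero_rpow (by linarith)]; simp
      · rw [show p - 1 = (p - 2) + 1 by ring, Real.rpow_add hr', Real.rpow_one]
        gcongr
    · rw [hWdef]
      simp only
      rw [indicator_of_notMem (fun hh => h hh.2)]
      positivity
  have hWm : ∀ n, AEStronglyMeasurable (fun x => W n ‖g x‖) volume := fun n =>
    ((hW n).comp_aemeasurable hgm).aestronglyMeasurable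
  have h2 : ∀ n, MemLp (fun x => W n ‖g x‖) 2 volume := by
    intro n
    refine hg.of_le_mul (c := (n : ℝ) ^ (p - 2)) (hWm n) (Eventually.of_forall fun x => ?_)
    rw [Real.norm_of_nonneg (hW0 _ _)]
    exact hWr n _ (norm_nonneg _)
  have hfin : ∀ n, ∫⁻ x, ENNReal.ofReal (W n ‖g x‖) * ‖g x‖ₑ ≠ ⊤ := by
    intro n
    have hi : Integrable (fun x => W n ‖g x‖ * ‖g x‖) volume := by
      refine (hgi.const_mul ((n : ℝ) ^ (p - 2))).mono' ((hWm n).mul hg.1.norm)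
        (Eventually.of_forall fun x => ?_)
      rw [Real.norm_of_nonneg (mul_nonneg (hW0 _ _) (norm_nonneg _))]
      nlinarith [hWr n ‖g x‖ (norm_nonneg _), norm_nonneg (g x)]
    have := hi.lintegral_lt_top.ne
    refine ne_of_eq_of_ne (lintegral_congr fun x => ?_) this
    rw [ENNReal.ofReal_mul (hW0 _ _), ofReal_norm]
  set I : ℕ → ℝ≥0∞ := fun n => ∫⁻ x, ENNReal.ofReal (W n ‖g x‖) * ‖g x‖ₑ with hI
  have hWpow : ∀ n r, 0 ≤ r → W n r ^ p' = W n r * r := by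
    intro n r hr
    by_cases h : r ≤ n
    · rw [hWdef]
      simp only
      rw [indicator_of_mem (show r ∈ Icc (0 : ℝ) n from ⟨hr, h⟩), ← Real.rpow_mul hr, hpp]
      rcases hr.eq_or_lt with rfl | hr'
      · rw [Real.zero_rpow (by linarith)]; simp
      · rw [show p = (p - 1) + 1 by ring, Real.rpow_add hr', Real.rpow_one]
        ring_nf
    · rw [hWdef]
      simp only
      rw [indicator_of_notMem (fun hh => h hh.2), Real.zero_rpow hp'0.ne', zero_mul]
  have hnorm : ∀ n, eLpNorm (fun x => W n ‖g x‖) (conjExp q) volume = I n ^ p'⁻¹ := by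
    intro n
    rw [eLpNorm_eq_lintegral_rpow_enorm_toReal hc0 hct, ← hp', one_div, hI]
    congr 1
    refine lintegral_congr fun x => ?_
    rw [Real.enorm_of_nonneg (hW0 _ _), ENNReal.ofReal_rpow_of_nonneg (hW0 _ _) hp'0.le,
      hWpow n _ (norm_nonneg _), ENNReal.ofReal_mul (hW0 _ _), ofReal_norm]
  have hbound : ∀ n, I n ≤ M ^ p := by
    intro n
    have h1 : MemLp (fun x => W n ‖g x‖) (conjExp q) volume := by
      refine ⟨hWm n, ?_⟩
      rw [hnorm]
      exact ENNReal.rpow_lt_top_of_nonneg (by positivity) (hfin n)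
    have key := lintegral_weight_le_of_duality hg.1 H (hW n) (hW0 n) (h2 n) h1 (hfin n)
    rw [hnorm] at key
    rcases eq_or_ne (I n) 0 with h0 | h0
    · rw [h0]; exact bot_le
    -- The truncation makes I finite, and it is nonzero in this case, so I^{1/p'} can be cancelled.
    · have hsplit : I n = I n ^ p⁻¹ * I n ^ p'⁻¹ := by
        rw [← ENNReal.rpow_add _ _ h0 (hfin n), hconj]
        simp
      have hIp0 : I n ^ p'⁻¹ ≠ 0 := by
        rw [Ne, ENNReal.rpow_eq_zero_iff]
        rintro (h | h)
        · exact h0 h.1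
        · exact hfin n h.1
      have hIpt : I n ^ p'⁻¹ ≠ ⊤ := (ENNReal.rpow_lt_top_of_nonneg (by positivity) (hfin n)).ne
      have h3 : I n ^ p⁻¹ * I n ^ p'⁻¹ ≤ M * I n ^ p'⁻¹ := by rw [← hsplit]; exact key
      have h4 := (ENNReal.mul_le_mul_iff_left hIp0 hIpt).1 h3
      have h5 := ENNReal.rpow_le_rpow h4 hp0.le
      rwa [← ENNReal.rpow_mul, inv_mul_cancel₀ hp0.ne', ENNReal.rpow_one] at h5
  have hlim : Tendsto I atTop (𝓝 (∫⁻ x, ‖g x‖ₑ ^ p)) := by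
    refine lintegral_tendsto_of_tendsto_of_monotone ?_ ?_ ?_
    · exact fun n => (ENNReal.measurable_ofReal.comp_aemeasurable (hWm n).aemeasurable).mul hg.1.enorm
    · refine Eventually.of_forall fun x => ?_
      intro n n' hnn
      dsimp only
      gcongr
      by_cases h : ‖g x‖ ≤ n
      · have h1 : ‖g x‖ ∈ Icc (0 : ℝ) n := ⟨norm_nonneg _, h⟩
        have h2 : ‖g x‖ ∈ Icc (0 : ℝ) n' := ⟨norm_nonneg _, h.trans (by exact_mod_cast hnn)⟩
        rw [hWdef]
        simp only
        rw [indicator_of_mem h1, indicator_of_mem h2]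
      · have h1 : W n ‖g x‖ = 0 := by
          rw [hWdef]
          simp only
          rw [indicator_of_notMem (fun hh => h hh.2)]
        rw [h1]
        exact hW0 _ _
    · refine Eventually.of_forall fun x => ?_
      refine tendsto_const_nhds.congr' ?_
      obtain ⟨N, hN⟩ := exists_nat_ge ‖g x‖
      filter_upwards [eventually_ge_atTop N] with n hn
      have hmem : ‖g x‖ ∈ Icc (0 : ℝ) n := ⟨norm_nonneg _, hN.trans (by exact_mod_cast hn)⟩
      rw [hWdef]
      simp only
      rw [indicator_of_mem hmem, ← ofReal_norm, ENNReal.ofReal_rpow_of_nonneg (norm_nonneg _) hp0.le,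
        ← ENNReal.ofReal_mul (by positivity)]
      congr 1
      rcases (norm_nonneg (g x)).eq_or_lt with h | h
      · rw [← h, Real.zero_rpow hp0.ne']; simp
      · nth_rewrite 3 [← Real.rpow_one ‖g x‖]
        rw [← Real.rpow_add h]; ring_nf
  have hfinal : ∫⁻ x, ‖g x‖ₑ ^ p ≤ M ^ p := le_of_tendsto' hlim hbound
  rw [eLpNorm_eq_lintegral_rpow_enorm_toReal hq0 hqt, ← hp, one_div]
  have := ENNReal.rpow_le_rpow hfinal (inv_nonneg.2 hp0.le)
  rwa [← ENNReal.rpow_mul, mul_inv_cancel₀ hp0.ne', ENNReal.rpow_one] at this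

/-- Bounding a function in `L^q` by duality on the Fourier side. -/
lemma exists_eLpNorm_le_of_fourier {q : ℝ≥0∞} (hq : 2 ≤ q) {G : V → ℂ} (hG : MemLp G 2 volume)
    {M : ℝ≥0∞}
    (H : ∀ φ φh : V → ℂ, MemLp φ (conjExp q) volume → IsFT φ φh →
      ∫⁻ ξ, ‖G ξ‖ₑ * ‖φh ξ‖ₑ ≤ M * eLpNorm φ (conjExp q) volume) :
    ∃ g : V → ℂ, MemLp g 2 volume ∧ IsFT g G ∧ eLpNorm g q volume ≤ M := by
  obtain ⟨g, hg, hgG⟩ := exists_isFT_eq_of_memLp_two hG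
  refine ⟨g, hg, hgG, eLpNorm_le_of_duality hq hg fun φ h2 hq' => ?_⟩
  obtain ⟨φh, hφh, hφ, -⟩ := exists_isFT_of_memLp_two h2
  rw [hφ.integral_conj_mul hgG h2 hg]
  refine (enorm_integral_le_lintegral_enorm _).trans ((lintegral_congr fun ξ => ?_).trans_le
    (H φ φh hq' hφ))
  rw [enorm_mul, mul_comm]
  congr 1
  rw [← ofReal_norm, ← ofReal_norm, RCLike.norm_conj]

/-! ### Components of vector fields and real test functions -/

/-- The `k`-th component of a vector field as a complex valued function. -/
def cp (f : V → V) (k : Fin 3) (x : V) : ℂ := ((f x k : ℝ) : ℂ)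

lemma continuous_coord (k : Fin 3) : Continuous fun x : V => x k := by fun_prop

lemma norm_coord_le (x : V) (k : Fin 3) : ‖x k‖ ≤ ‖x‖ := PiLp.norm_apply_le x k

lemma norm_cp_le (f : V → V) (k : Fin 3) (x : V) : ‖cp f k x‖ ≤ ‖f x‖ := by
  rw [cp, Complex.norm_real]
  exact norm_coord_le _ _

lemma aestronglyMeasurable_cp {f : V → V} (hf : AEStronglyMeasurable f volume) (k : Fin 3) :
    AEStronglyMeasurable (cp f k) volume :=
  (Complex.continuous_ofReal.comp (continuous_coord k)).comp_aestronglyMeasurable hf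

lemma memLp_cp {p : ℝ≥0∞} {f : V → V} (hf : MemLp f p volume) (k : Fin 3) :
    MemLp (cp f k) p volume :=
  hf.mono (aestronglyMeasurable_cp hf.1 k) (Eventually.of_forall (norm_cp_le f k))

lemma eLpNorm_cp_le {p : ℝ≥0∞} (f : V → V) (k : Fin 3) :
    eLpNorm (cp f k) p volume ≤ eLpNorm f p volume :=
  eLpNorm_mono (norm_cp_le f k)

/-- A real test function as a complex Schwartz function. -/
def toS {η : V → ℝ} (hη : IsTest η) : 𝓢(V, ℂ) :=
  HasCompactSupport.toSchwartzMap (f := fun x => (η x : ℂ)) (hη.2.comp_left (g := ((↑) : ℝ → ℂ)) rfl)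
    (Complex.ofRealCLM.contDiff.comp hη.1)

lemma toS_apply {η : V → ℝ} (hη : IsTest η) (x : V) : toS hη x = (η x : ℂ) := rfl

/-- Partial derivative of a scalar function. -/
def dd (j : Fin 3) (η : V → ℝ) (x : V) : ℝ := fderiv ℝ η x (basisVec j)

lemma IsTest.dd {η : V → ℝ} (hη : IsTest η) (j : Fin 3) : IsTest (dd j η) := by
  refine ⟨?_, hη.2.fderiv_apply ℝ (basisVec j)⟩
  exact (hη.1.fderiv_right (m := ∞) (by exact_mod_cast le_top)).clm_apply contDiff_const

lemma lineDeriv_toS {η : V → ℝ} (hη : IsTest η) (j : Fin 3) :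
    ∂_{basisVec j} (toS hη) = toS (hη.dd j) := by
  ext x
  rw [SchwartzMap.lineDerivOp_apply_eq_fderiv, toS_apply]
  have hd : DifferentiableAt ℝ η x := (hη.1.differentiable (by simp)).differentiableAt
  have : HasFDerivAt (fun x => (η x : ℂ)) (Complex.ofRealCLM.comp (fderiv ℝ η x)) x :=
    Complex.ofRealCLM.hasFDerivAt.comp x hd.hasFDerivAt
  have h2 : fderiv ℝ (toS hη) x = Complex.ofRealCLM.comp (fderiv ℝ η x) := this.fderiv
  rw [h2]
  rfl

lemma iteratedLineDeriv_toS {η : V → ℝ} (hη : IsTest η) {n : ℕ} (m : Fin n → V) (x : V) :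
    (∂^{m} (toS hη)) x = ((iteratedFDeriv ℝ n η x m : ℝ) : ℂ) := by
  rw [SchwartzMap.iteratedLineDerivOp_eq_iteratedFDeriv]
  have h : (toS hη : V → ℂ) = Complex.ofRealCLM ∘ η := rfl
  rw [h, ContinuousLinearMap.iteratedFDeriv_comp_left _ (hη.1.contDiffAt) (mod_cast le_top)]
  rfl

/-- Functionals that agree on real test functions agree. -/
lemma clm_eq_of_eq_on_tests {T S : 𝓢(V, ℂ) →L[ℂ] ℂ}
    (h : ∀ (η : V → ℝ) (hη : IsTest η), T (toS hη) = S (toS hη)) (φ : 𝓢(V, ℂ)) : T φ = S φ := by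
  refine clm_eq_of_eq_on_hasCompactSupport (fun φ hφ => ?_) φ
  have hre : IsTest fun x => (φ x).re :=
    ⟨Complex.reCLM.contDiff.comp (φ.smooth ⊤), hφ.comp_left (g := Complex.re) rfl⟩
  have him : IsTest fun x => (φ x).im :=
    ⟨Complex.imCLM.contDiff.comp (φ.smooth ⊤), hφ.comp_left (g := Complex.im) rfl⟩
  have hφe : φ = toS hre + Complex.I • toS him := by
    ext x
    simp only [add_apply, smul_apply, toS_apply, smul_eq_mul]
    rw [mul_comm, Complex.re_add_im]
  rw [hφe, map_add, map_add, map_smul, map_smul, h _ hre, h _ him]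

/-- Functionals that agree on Fourier transforms of compactly supported functions agree. -/
lemma clm_eq_of_eq_on_fourier {T S : 𝓢(V, ℂ) →L[ℂ] ℂ}
    (h : ∀ ψ : 𝓢(V, ℂ), HasCompactSupport ψ → T (𝓕 ψ) = S (𝓕 ψ)) (φ : 𝓢(V, ℂ)) : T φ = S φ := by
  have h1 := clm_eq_of_eq_on_hasCompactSupport (T := T ∘L FourierTransform.fourierCLM ℂ 𝓢(V, ℂ))
    (S := S ∘L FourierTransform.fourierCLM ℂ 𝓢(V, ℂ)) h (𝓕⁻ φ)
  have h2 : 𝓕 (𝓕⁻ φ) = φ := FourierTransform.fourier_fourierInv_eq φ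
  simp only [ContinuousLinearMap.comp_apply, FourierTransform.fourierCLM_apply] at h1
  rwa [h2] at h1

/-! ### Pairings of L^p functions with Schwartz functions and their derivatives -/

/-- Integration against an `L^p` function as a functional on the Schwartz space. -/
def pairCLM {p : ℝ≥0∞} (hp : 1 ≤ p) {f : V → ℂ} (hf : MemLp f p volume) : 𝓢(V, ℂ) →L[ℂ] ℂ :=
  (exists_clm_of_memLp hp hf).choose

lemma pairCLM_apply {p : ℝ≥0∞} (hp : 1 ≤ p) {f : V → ℂ} (hf : MemLp f p volume) (φ : 𝓢(V, ℂ)) :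
    pairCLM hp hf φ = ∫ x, φ x * f x :=
  (exists_clm_of_memLp hp hf).choose_spec φ

lemma pairCLM_toS {p : ℝ≥0∞} (hp : 1 ≤ p) {f : V → V} (hf : MemLp f p volume) (k : Fin 3)
    {η : V → ℝ} (hη : IsTest η) :
    pairCLM hp (memLp_cp hf k) (toS hη) = ((∫ x, η x * f x k : ℝ) : ℂ) := by
  rw [pairCLM_apply, ← integral_complex_ofReal]
  simp only [toS_apply, cp]
  push_cast
  rfl

lemma pairCLM_fourier {p : ℝ≥0∞} (hp : 1 ≤ p) {f fh : V → ℂ} (hf : MemLp f p volume)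
    (h : IsFT f fh) {ψ : 𝓢(V, ℂ)} (hψ : HasCompactSupport ψ) :
    pairCLM hp hf (𝓕 ψ) = ∫ ξ, ψ ξ * fh ξ := by
  rw [pairCLM_apply, h.2 ψ hψ]

/-- The symbol of `∂_j`. -/
def ds (j : Fin 3) (ξ : V) : ℂ := 2 * Real.pi * Complex.I * (ξ j : ℂ)

lemma continuous_ds (j : Fin 3) : Continuous (ds j) := by
  unfold ds
  exact continuous_const.mul (Complex.continuous_ofReal.comp (continuous_coord j))

lemma norm_ds_le (j : Fin 3) (ξ : V) : ‖ds j ξ‖ ≤ wn ξ := by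
  rw [ds, wn, norm_mul, Complex.norm_real]
  have : ‖(2 * Real.pi * Complex.I : ℂ)‖ = 2 * Real.pi := by
    simp [abs_of_pos Real.pi_pos]
  rw [this]
  gcongr
  exact norm_coord_le _ _

lemma pairCLM_lineDeriv_fourier {p : ℝ≥0∞} (hp : 1 ≤ p) {f fh : V → ℂ} (hf : MemLp f p volume)
    (h : IsFT f fh) {ψ : 𝓢(V, ℂ)} (hψ : HasCompactSupport ψ) (j : Fin 3) :
    pairCLM hp hf (∂_{basisVec j} (𝓕 ψ)) = -∫ ξ, ψ ξ * (ds j ξ * fh ξ) := by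
  rw [lineDeriv_fourier, pairCLM_fourier hp hf h (hasCompactSupport_mulCoord j hψ), ← integral_neg]
  refine integral_congr_ae (Eventually.of_forall fun ξ => ?_)
  simp only [mulCoord_apply, ds]
  ring

lemma pairCLM_lineDeriv_lineDeriv_fourier {p : ℝ≥0∞} (hp : 1 ≤ p) {f fh : V → ℂ}
    (hf : MemLp f p volume) (h : IsFT f fh) {ψ : 𝓢(V, ℂ)} (hψ : HasCompactSupport ψ) (i j : Fin 3) :
    pairCLM hp hf (∂_{basisVec i} (∂_{basisVec j} (𝓕 ψ))) = ∫ ξ, ψ ξ * (ds i ξ * ds j ξ * fh ξ) := by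
  rw [lineDeriv_fourier, lineDeriv_fourier, pairCLM_fourier hp hf h
    (hasCompactSupport_mulCoord i (hasCompactSupport_mulCoord j hψ))]
  refine integral_congr_ae (Eventually.of_forall fun ξ => ?_)
  simp only [mulCoord_apply, ds]
  ring

lemma locallyIntegrable_continuous_mul {a h : V → ℂ} (ha : Continuous a)
    (hh : LocallyIntegrable h volume) : LocallyIntegrable (fun ξ => a ξ * h ξ) volume :=
  locallyIntegrableOn_univ.1 ((locallyIntegrableOn_univ.2 hh).continuousOn_mul ha.continuousOn
    isOpen_univ.isLocallyClosed)

lemma continuous_symb {j : ℕ} (α : Fin j → Fin 3) : Continuous (symb α) :=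
  continuous_finsetProd _ fun i _ => continuous_ds (α i)

lemma norm_symb_le {j : ℕ} (α : Fin j → Fin 3) (ξ : V) : ‖symb α ξ‖ ≤ wn ξ ^ j := by
  rw [symb, norm_prod]
  refine (Finset.prod_le_prod (fun i _ => norm_nonneg _) fun i _ => norm_ds_le (α i) ξ).trans ?_
  simp

/-! ### Weak partial derivatives on the Fourier side -/

lemma pairCLM_iteratedLineDeriv_fourier {p : ℝ≥0∞} (hp : 1 ≤ p) {f fh : V → ℂ}
    (hf : MemLp f p volume) (h : IsFT f fh) {ψ : 𝓢(V, ℂ)} (hψ : HasCompactSupport ψ)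
    {n : ℕ} (α : Fin n → Fin 3) :
    pairCLM hp hf (∂^{fun i => basisVec (α i)} (𝓕 ψ)) =
      (-1) ^ n * ∫ ξ, ψ ξ * (symb α ξ * fh ξ) := by
  obtain ⟨χ, hχ, hχe, hχd⟩ := exists_iteratedLineDeriv_fourier α ψ hψ
  rw [hχd, pairCLM_fourier hp hf h hχ, ← integral_const_mul]
  refine integral_congr_ae (Eventually.of_forall fun ξ => ?_)
  simp only [hχe]
  ring

lemma integral_smul_apply {f : V → V} {η : V → ℝ} (hi : Integrable (fun x => η x • f x) volume)
    (k : Fin 3) : (∫ x, η x • f x) k = ∫ x, η x * f x k := by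
  have := (EuclideanSpace.proj k : V →L[ℝ] ℝ).integral_comp_comm hi
  simpa using this.symm

lemma isTest_iteratedFDeriv {η : V → ℝ} (hη : IsTest η) {n : ℕ} (m : Fin n → V) :
    Continuous (fun x => iteratedFDeriv ℝ n η x m) ∧
      HasCompactSupport fun x => iteratedFDeriv ℝ n η x m := by
  refine ⟨?_, ?_⟩
  · have := hη.1.continuous_iteratedFDeriv (m := n) (mod_cast le_top)
    exact (ContinuousMultilinearMap.apply ℝ (fun _ : Fin n => V) ℝ m).continuous.comp this
  · exact (hη.2.iteratedFDeriv (𝕜 := ℝ) n).comp_left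
      (g := fun L : V [×n]→L[ℝ] ℝ => L m) rfl

/-- The Fourier transform of a weak derivative. -/
lemma IsWeakPartial.fourier_eq {p r : ℝ≥0∞} (hp : 1 ≤ p) (hr : 1 ≤ r) {n : ℕ} {α : Fin n → Fin 3}
    {f g : V → V} (h : IsWeakPartial α f g) (hf : MemLp f p volume) (hg : MemLp g r volume)
    {k : Fin 3} {fh gh : V → ℂ} (hfh : IsFT (cp f k) fh) (hgh : IsFT (cp g k) gh) :
    gh =ᵐ[volume] fun ξ => symb α ξ * fh ξ := by
  have key := clm_eq_of_eq_on_tests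
    (T := pairCLM hp (memLp_cp hf k) ∘L
      LineDeriv.iteratedLineDerivOpCLM ℂ 𝓢(V, ℂ) fun i => basisVec (α i))
    (S := ((-1 : ℂ) ^ n) • pairCLM hr (memLp_cp hg k)) (fun η hη => by
      have h1 := h.2 η hη
      obtain ⟨hc, hs⟩ := isTest_iteratedFDeriv hη fun i => basisVec (α i)
      have h2 := congrArg (fun v : V => v k) h1
      simp only [PiLp.smul_apply, smul_eq_mul] at h2
      rw [integral_smul_apply ((hf.locallyIntegrable hp).integrable_smul_left_of_hasCompactSupport
          hc hs), integral_smul_apply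
          ((hg.locallyIntegrable hr).integrable_smul_left_of_hasCompactSupport
            hη.1.continuous hη.2)] at h2
      simp only [ContinuousLinearMap.comp_apply, smul_apply,
        LineDeriv.iteratedLineDerivOpCLM_apply, smul_eq_mul]
      rw [pairCLM_toS hr hg, pairCLM_apply]
      simp only [iteratedLineDeriv_toS, cp]
      simp only [← Complex.ofReal_mul]
      rw [integral_complex_ofReal, h2]
      push_cast
      rfl)
  refine ae_eq_of_integral_schwartz_mul_eq hgh.1
    (locallyIntegrable_continuous_mul (continuous_symb α) hfh.1) fun ψ hψ => ?_
  -- The identity, extended by density from real test functions to all Schwartz functions, is now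
  -- read on a Fourier transform, which turns both sides into integrals over frequency.
  have h3 := key (𝓕 ψ)
  simp only [ContinuousLinearMap.comp_apply, smul_apply,
    LineDeriv.iteratedLineDerivOpCLM_apply, smul_eq_mul] at h3
  rw [pairCLM_iteratedLineDeriv_fourier hp _ hfh hψ, pairCLM_fourier hr _ hgh hψ] at h3
  exact (mul_left_cancel₀ (pow_ne_zero n (by norm_num)) h3).symm

/-- The vector field with the real parts of given components. -/
def ofRe (g : Fin 3 → V → ℂ) (x : V) : V := WithLp.toLp 2 fun k => (g k x).re

lemma ofRe_apply (g : Fin 3 → V → ℂ) (x : V) (k : Fin 3) : ofRe g x k = (g k x).re := rfl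

lemma aestronglyMeasurable_ofRe {g : Fin 3 → V → ℂ} (hg : ∀ k, AEStronglyMeasurable (g k) volume) :
    AEStronglyMeasurable (ofRe g) volume := by
  have h1 : AEMeasurable (fun x => fun k => (g k x).re) volume :=
    aemeasurable_pi_lambda _ fun k => Complex.measurable_re.comp_aemeasurable (hg k).aemeasurable
  have h2 : Continuous (fun v : Fin 3 → ℝ => (WithLp.toLp 2 v : V)) := PiLp.continuous_toLp 2 _
  exact h2.comp_aestronglyMeasurable h1.aestronglyMeasurable

lemma norm_ofRe_le (g : Fin 3 → V → ℂ) (x : V) : ‖ofRe g x‖ ≤ ∑ k, ‖g k x‖ := by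
  have h : ofRe g x = ∑ k, (g k x).re • basisVec k := by
    ext j
    simp [ofRe_apply, basisVec, Finset.sum_apply, Pi.single_apply]
  rw [h]
  refine (norm_sum_le _ _).trans (Finset.sum_le_sum fun k _ => ?_)
  rw [norm_smul, basisVec]
  simpa using Complex.abs_re_le_norm (g k x)

lemma eLpNorm_ofRe_le {q : ℝ≥0∞} (hq : 1 ≤ q) {g : Fin 3 → V → ℂ}
    (hg : ∀ k, AEStronglyMeasurable (g k) volume) :
    eLpNorm (ofRe g) q volume ≤ ∑ k, eLpNorm (g k) q volume := by
  calc eLpNorm (ofRe g) q volume ≤ eLpNorm (∑ k, fun x => ‖g k x‖) q volume := by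
        refine eLpNorm_mono_real fun x => ?_
        simpa [Finset.sum_apply] using norm_ofRe_le g x
    _ ≤ ∑ k, eLpNorm (fun x => ‖g k x‖) q volume := eLpNorm_sum_le (fun k _ => (hg k).norm) hq
    _ = _ := by simp only [eLpNorm_norm]

lemma memLp_ofRe {q : ℝ≥0∞} (hq : 1 ≤ q) {g : Fin 3 → V → ℂ} (hg : ∀ k, MemLp (g k) q volume) :
    MemLp (ofRe g) q volume :=
  ⟨aestronglyMeasurable_ofRe fun k => (hg k).1,
    (eLpNorm_ofRe_le hq fun k => (hg k).1).trans_lt (ENNReal.sum_lt_top.2 fun k _ => (hg k).2)⟩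

lemma re_pairCLM_toS {g : V → ℂ} {q : ℝ≥0∞} (hq : 1 ≤ q) (hg : MemLp g q volume) {η : V → ℝ}
    (hη : IsTest η) : (pairCLM hq hg (toS hη)).re = ∫ x, η x * (g x).re := by
  have hi := integrable_schwartz_mul hq hg (toS hη)
  rw [pairCLM_apply]
  have := Complex.reCLM.integral_comp_comm hi
  simp only [Complex.reCLM_apply] at this
  rw [← this]
  refine integral_congr_ae (Eventually.of_forall fun x => ?_)
  simp [toS_apply]

/-- A field whose Fourier transform is multiplied by the symbol is a weak derivative. -/
lemma isWeakPartial_of_fourier {n : ℕ} {α : Fin n → Fin 3} {f : V → V} (hf : MemLp f 2 volume)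
    {fh g : Fin 3 → V → ℂ} (hfh : ∀ k, IsFT (cp f k) (fh k)) (hg : ∀ k, MemLp (g k) 2 volume)
    (hgh : ∀ k, IsFT (g k) fun ξ => symb α ξ * fh k ξ) : IsWeakPartial α f (ofRe g) := by
  have h12 : (1 : ℝ≥0∞) ≤ 2 := by norm_num
  have hgm := memLp_ofRe h12 hg
  refine ⟨hgm.locallyIntegrable h12, fun η hη => ?_⟩
  obtain ⟨hc, hs⟩ := isTest_iteratedFDeriv hη fun i => basisVec (α i)
  ext k
  have key := clm_eq_of_eq_on_fourier
    (T := pairCLM h12 (memLp_cp hf k) ∘L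
      LineDeriv.iteratedLineDerivOpCLM ℂ 𝓢(V, ℂ) fun i => basisVec (α i))
    (S := ((-1 : ℂ) ^ n) • pairCLM h12 (hg k)) (fun ψ hψ => by
      simp only [ContinuousLinearMap.comp_apply, smul_apply,
        LineDeriv.iteratedLineDerivOpCLM_apply, smul_eq_mul]
      rw [pairCLM_iteratedLineDeriv_fourier h12 _ (hfh k) hψ, pairCLM_fourier h12 _ (hgh k) hψ])
    (toS hη)
  rw [integral_smul_apply ((hf.locallyIntegrable h12).integrable_smul_left_of_hasCompactSupport
      hc hs), PiLp.smul_apply, integral_smul_apply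
      ((hgm.locallyIntegrable h12).integrable_smul_left_of_hasCompactSupport hη.1.continuous hη.2)]
  -- The test function and `f` are real, so the real part of the identity is the claim for the real
  -- parts of the inverse transforms; their reality need not be proved.
  have h2 := congrArg Complex.re key
  simp only [ContinuousLinearMap.comp_apply, smul_apply,
    LineDeriv.iteratedLineDerivOpCLM_apply, smul_eq_mul] at h2
  rw [show ((-1 : ℂ) ^ n) = (((-1 : ℝ) ^ n : ℝ) : ℂ) by push_cast; rfl, Complex.re_ofReal_mul,
    re_pairCLM_toS, pairCLM_apply] at h2
  simp only [iteratedLineDeriv_toS, cp, ← Complex.ofReal_mul] at h2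
  rw [integral_complex_ofReal, Complex.ofReal_re] at h2
  exact h2

/-! ### Gradient norms on the Fourier side -/

/-- Duality in frequency space for each of the 3^m multi-indices and 3 components, using |symb α| ≤
`wn`^m. The hypothesis `h2` is only qualitative: it ensures that the candidates for the derivatives
are L² functions. -/
lemma gradNorm_le_of_fourier {q : ℝ≥0∞} (hq : 2 ≤ q) {m : ℕ} {f : V → V} (hf : MemLp f 2 volume)
    {fh : Fin 3 → V → ℂ} (hfh : ∀ k, IsFT (cp f k) (fh k))
    (h2 : ∀ k, MemLp (fun ξ => ((wn ξ ^ m : ℝ) : ℂ) * fh k ξ) 2 volume) {M : ℝ≥0∞}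
    (H : ∀ k, ∀ φ φh : V → ℂ, MemLp φ (conjExp q) volume → IsFT φ φh →
      ∫⁻ ξ, ENNReal.ofReal (wn ξ ^ m) * ‖fh k ξ‖ₑ * ‖φh ξ‖ₑ ≤ M * eLpNorm φ (conjExp q) volume) :
    gradNorm m q f ≤ (3 ^ m * 3 : ℕ) * M := by
  have hq1 : (1 : ℝ≥0∞) ≤ q := le_trans (by norm_num) hq
  have hsymb : ∀ (α : Fin m → Fin 3) (ξ : V), ‖symb α ξ‖ₑ ≤ ENNReal.ofReal (wn ξ ^ m) := fun α ξ => by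
    rw [← ofReal_norm]
    exact ENNReal.ofReal_le_ofReal (norm_symb_le α ξ)
  have key : ∀ α : Fin m → Fin 3,
      ⨅ (g : V → V) (_ : IsWeakPartial α f g), eLpNorm g q volume ≤ 3 * M := by
    intro α
    have hG : ∀ k, MemLp (fun ξ => symb α ξ * fh k ξ) 2 volume := fun k => by
      refine (h2 k).mono ((continuous_symb α).aestronglyMeasurable.mul
        (hfh k).1.aestronglyMeasurable) (Eventually.of_forall fun ξ => ?_)
      rw [norm_mul, norm_mul, Complex.norm_real, Real.norm_of_nonneg (pow_nonneg (wn_nonneg ξ) m)]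
      gcongr
      exact norm_symb_le α ξ
    choose g hg2 hgF hgM using fun k => exists_eLpNorm_le_of_fourier hq (hG k) (M := M)
      (fun φ φh hφ hφh => (lintegral_mono fun ξ => by
        rw [enorm_mul]
        gcongr
        exact hsymb α ξ).trans (H k φ φh hφ hφh))
    refine (iInf₂_le (ofRe g) (isWeakPartial_of_fourier hf hfh hg2 hgF)).trans ?_
    refine (eLpNorm_ofRe_le hq1 fun k => (hg2 k).1).trans ((Finset.sum_le_sum fun k _ => hgM k).trans ?_)
    simp
  calc gradNorm m q f ≤ ∑ _α : Fin m → Fin 3, 3 * M := Finset.sum_le_sum fun α _ => key α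
    _ = _ := by
      rw [Finset.sum_const, Finset.card_univ, Fintype.card_fun, Fintype.card_fin, Fintype.card_fin,
        nsmul_eq_mul, ← mul_assoc]
      push_cast
      rfl

lemma wn_le_sum (ξ : V) : wn ξ ≤ ∑ j, ‖ds j ξ‖ := by
  have h : ∀ j, ‖ds j ξ‖ = 2 * Real.pi * |ξ j| := fun j => by
    rw [ds, norm_mul, Complex.norm_real, Real.norm_eq_abs]
    congr 1
    simp [abs_of_pos Real.pi_pos]
  simp only [h, ← Finset.mul_sum, wn]
  gcongr
  have hx : ξ = ∑ k, ξ k • basisVec k := by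
    ext j
    simp [basisVec, Finset.sum_apply, Pi.single_apply]
  nth_rewrite 1 [hx]
  refine (norm_sum_le _ _).trans (Finset.sum_le_sum fun k _ => ?_)
  rw [norm_smul, basisVec]
  simp

/-- The largest coordinate dominates `wn` up to a factor 3; hence the pure derivatives ∂_j^M alone
control the full frequency weight. -/
lemma wn_pow_le (M : ℕ) (ξ : V) : wn ξ ^ (2 * M) ≤ 3 ^ (2 * M) * ∑ j, ‖ds j ξ‖ ^ (2 * M) := by
  obtain ⟨i, -, hi⟩ := Finset.exists_max_image (Finset.univ : Finset (Fin 3)) (fun j => ‖ds j ξ‖)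
    Finset.univ_nonempty
  have h1 : wn ξ ≤ 3 * ‖ds i ξ‖ := by
    refine (wn_le_sum ξ).trans ((Finset.sum_le_sum fun j hj => hi j hj).trans ?_)
    simp
  calc wn ξ ^ (2 * M) ≤ (3 * ‖ds i ξ‖) ^ (2 * M) := pow_le_pow_left₀ (wn_nonneg ξ) h1 _
    _ = 3 ^ (2 * M) * ‖ds i ξ‖ ^ (2 * M) := mul_pow _ _ _
    _ ≤ _ := by
      gcongr
      exact Finset.single_le_sum (f := fun j => ‖ds j ξ‖ ^ (2 * M)) (fun j _ => by positivity)
        (Finset.mem_univ i)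

lemma symb_const (M : ℕ) (j : Fin 3) (ξ : V) : symb (fun _ : Fin M => j) ξ = ds j ξ ^ M := by
  simp [symb, ds]

/-- High frequencies of a function whose derivatives of order `M` are in `L^r`. -/
lemma exists_lintegral_high_grad_le {r : ℝ≥0∞} (hr1 : 1 ≤ r) (hr2 : r ≤ 2) {σ δ : ℝ} (hδ : 0 < δ)
    (hσ : Admissible σ r) (M : ℕ) :
    ∃ C : ℝ, 0 ≤ C ∧ ∀ (p : ℝ≥0∞) (f : V → V) (k : Fin 3) (fh : V → ℂ), 1 ≤ p → p ≤ 2 →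
      MemLp f p volume → IsFT (cp f k) fh →
      ∫⁻ ξ in {ξ : V | δ ≤ wn ξ}, ENNReal.ofReal (wn ξ ^ (2 * ((M : ℝ) - σ))) * ‖fh ξ‖ₑ ^ (2 : ℝ) ≤
        ENNReal.ofReal C * gradNorm M r f ^ (2 : ℝ) := by
  obtain ⟨C₀, hC₀, hhigh⟩ := exists_lintegral_high_le hr1 hr2 hδ hσ
  -- Using C₀ + 1 makes the factor positive, so that the bound is ∞ when the norm of a derivative
  -- is, and division by it is allowed. The factor 3^(2M) is that of `wn_pow_le`, the other 3 counts
  -- the directions.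
  refine ⟨3 ^ (2 * M) * (3 * (C₀ + 1)), by positivity, fun p f k fh hp1 hp2 hf hfh => ?_⟩
  set X : Fin 3 → ℝ≥0∞ := fun j => ∫⁻ ξ in {ξ : V | δ ≤ wn ξ},
    ENNReal.ofReal (wn ξ ^ (-2 * σ)) * ‖ds j ξ ^ M * fh ξ‖ₑ ^ (2 : ℝ) with hX
  have hXm : ∀ j, AEMeasurable (fun ξ => ENNReal.ofReal (wn ξ ^ (-2 * σ)) *
      ‖ds j ξ ^ M * fh ξ‖ₑ ^ (2 : ℝ)) volume := fun j => by
    refine (ENNReal.measurable_ofReal.comp (measurable_wn.pow_const _)).aemeasurable.mul ?_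
    exact ((((continuous_ds j).pow M).aestronglyMeasurable.mul
      hfh.1.aestronglyMeasurable).enorm).pow_const _
  have hXle : ∀ j, X j ≤ ENNReal.ofReal (C₀ + 1) * gradNorm M r f ^ (2 : ℝ) := by
    intro j
    have h1 : ∀ g, IsWeakPartial (fun _ : Fin M => j) f g →
        X j ≤ ENNReal.ofReal (C₀ + 1) * eLpNorm g r volume ^ (2 : ℝ) := by
      intro g hg
      by_cases hgt : eLpNorm g r volume = ⊤
      · rw [hgt, ENNReal.top_rpow_of_pos (by norm_num), ENNReal.mul_top]
        · exact le_top
        · rw [Ne, ENNReal.ofReal_eq_zero, not_le]; linarith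
      · have hgm : MemLp g r volume := ⟨hg.1.aestronglyMeasurable, lt_top_iff_ne_top.2 hgt⟩
        obtain ⟨gh, hgh⟩ := exists_isFT hr1 hr2 (memLp_cp hgm k)
        have he := hg.fourier_eq hp1 hr1 hf hgm hfh hgh
        have h2 := hhigh _ _ (memLp_cp hgm k) hgh
        calc X j = ∫⁻ ξ in {ξ : V | δ ≤ wn ξ},
              ENNReal.ofReal (wn ξ ^ (-2 * σ)) * ‖gh ξ‖ₑ ^ (2 : ℝ) := by
              refine lintegral_congr_ae (ae_restrict_of_ae (he.mono fun ξ hξ => ?_))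
              simp only [hξ, symb_const]
          _ ≤ ENNReal.ofReal C₀ * eLpNorm (cp g k) r volume ^ (2 : ℝ) := h2
          _ ≤ _ := by
              gcongr
              · linarith
              · exact eLpNorm_cp_le g k
    have hC1 : ENNReal.ofReal (C₀ + 1) ≠ 0 := by
      rw [Ne, ENNReal.ofReal_eq_zero, not_le]; linarith
    have hC2 : ENNReal.ofReal (C₀ + 1) ≠ ⊤ := ENNReal.ofReal_ne_top
    -- The estimate is solved for the norm first, so that it passes to the infimum over weak
    -- derivatives, also when that set is empty and the infimum is ∞.
    have h2 : (X j / ENNReal.ofReal (C₀ + 1)) ^ (2 : ℝ)⁻¹ ≤ gradNorm M r f := by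
      have h3 : (X j / ENNReal.ofReal (C₀ + 1)) ^ (2 : ℝ)⁻¹ ≤
          ⨅ (g : V → V) (_ : IsWeakPartial (fun _ : Fin M => j) f g), eLpNorm g r volume := by
        refine le_iInf₂ fun g hg => ?_
        rw [ENNReal.rpow_inv_le_iff (by norm_num)]
        exact ENNReal.div_le_of_le_mul' (h1 g hg)
      exact h3.trans (Finset.single_le_sum (f := fun α : Fin M → Fin 3 =>
        ⨅ (g : V → V) (_ : IsWeakPartial α f g), eLpNorm g r volume) (fun _ _ => bot_le)
        (Finset.mem_univ _))
    rw [ENNReal.rpow_inv_le_iff (by norm_num), ENNReal.div_le_iff_le_mul (Or.inl hC1) (Or.inl hC2)] at h2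
    rwa [mul_comm]
  calc ∫⁻ ξ in {ξ : V | δ ≤ wn ξ}, ENNReal.ofReal (wn ξ ^ (2 * ((M : ℝ) - σ))) * ‖fh ξ‖ₑ ^ (2 : ℝ)
      ≤ ∫⁻ ξ in {ξ : V | δ ≤ wn ξ}, ENNReal.ofReal (3 ^ (2 * M)) * ∑ j,
          ENNReal.ofReal (wn ξ ^ (-2 * σ)) * ‖ds j ξ ^ M * fh ξ‖ₑ ^ (2 : ℝ) := by
        refine setLIntegral_mono' (measurableSet_high δ) fun ξ hξ => ?_
        have hk : 0 < wn ξ := hδ.trans_le hξ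
        have h1 : ∀ j, ‖ds j ξ ^ M * fh ξ‖ₑ ^ (2 : ℝ) =
            ENNReal.ofReal (‖ds j ξ‖ ^ (2 * M)) * ‖fh ξ‖ₑ ^ (2 : ℝ) := fun j => by
          rw [enorm_mul, ENNReal.mul_rpow_of_nonneg _ _ (by norm_num), ← ofReal_norm (ds j ξ ^ M),
            ENNReal.ofReal_rpow_of_nonneg (norm_nonneg _) (by norm_num), norm_pow]
          congr 2
          rw [mul_comm 2 M, pow_mul]
          norm_num
        simp only [h1]
        have h2 : wn ξ ^ (2 * ((M : ℝ) - σ)) = wn ξ ^ (-2 * σ) * wn ξ ^ (2 * M) := by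
          rw [← Real.rpow_natCast, ← Real.rpow_add hk]
          congr 1
          push_cast; ring
        calc ENNReal.ofReal (wn ξ ^ (2 * ((M : ℝ) - σ))) * ‖fh ξ‖ₑ ^ (2 : ℝ)
            ≤ ENNReal.ofReal (wn ξ ^ (-2 * σ) * (3 ^ (2 * M) * ∑ j, ‖ds j ξ‖ ^ (2 * M))) *
                ‖fh ξ‖ₑ ^ (2 : ℝ) := by
              rw [h2]
              gcongr
              exact wn_pow_le M ξ
          _ = _ := by
              rw [mul_left_comm, ENNReal.ofReal_mul (by positivity), ENNReal.ofReal_mul (by positivity),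
                ENNReal.ofReal_sum_of_nonneg (fun _ _ => by positivity), mul_assoc, mul_assoc,
                Finset.sum_mul, Finset.mul_sum]
    _ = ENNReal.ofReal (3 ^ (2 * M)) * ∑ j, X j := by
        rw [lintegral_const_mul' _ _ ENNReal.ofReal_ne_top, lintegral_finsetSum' _
          fun j _ => (hXm j).restrict]
    _ ≤ ENNReal.ofReal (3 ^ (2 * M)) * ∑ _j : Fin 3, ENNReal.ofReal (C₀ + 1) * gradNorm M r f ^ (2 : ℝ) := by
        gcongr with j
        exact hXle j
    _ = _ := by
        rw [ENNReal.ofReal_mul (by positivity), ENNReal.ofReal_mul (by positivity)]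
        simp only [Finset.sum_const, Finset.card_univ, Fintype.card_fin, nsmul_eq_mul]
        rw [ENNReal.ofReal_ofNat]
        push_cast
        ring

/-! ### Curl, divergence and the transverse part on the Fourier side -/

lemma basisVec_apply (k l : Fin 3) : basisVec k l = if l = k then 1 else 0 := by
  simp [basisVec]

lemma isTest_single {η : V → ℝ} (hη : IsTest η) (k : Fin 3) : IsTest fun x => η x • basisVec k :=
  ⟨hη.1.smul contDiff_const, hη.2.smul_right⟩

lemma IsTest.differentiable {F : Type} [NormedAddCommGroup F] [NormedSpace ℝ F] {φ : V → F}
    (hφ : IsTest φ) : Differentiable ℝ φ := hφ.1.differentiable (by simp)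

lemma pd_single {η : V → ℝ} (hη : Differentiable ℝ η) (j k l : Fin 3) (x : V) :
    pd j l (fun x => η x • basisVec k) x = dd j η x * basisVec k l := by
  rw [pd, dd, fderiv_smul_const (hη x)]
  simp

/-- Indices in `Fin 3` are added modulo 3, so one cyclic formula serves for all components. -/
lemma curl_single {η : V → ℝ} (hη : Differentiable ℝ η) (k : Fin 3) (x : V) :
    curl (fun x => η x • basisVec k) x =
      dd (k + 2) η x • basisVec (k + 1) - dd (k + 1) η x • basisVec (k + 2) := by
  simp only [curl, pd_single hη]
  ext l
  fin_cases k <;> fin_cases l <;> simp [basisVec_apply]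

lemma curl_sub {f g : V → V} (hf : Differentiable ℝ f) (hg : Differentiable ℝ g) (x : V) :
    curl (fun x => f x - g x) x = curl f x - curl g x := by
  have h : ∀ j l, pd j l (fun x => f x - g x) x = pd j l f x - pd j l g x := fun j l => by
    simp only [pd, fderiv_fun_sub (hf x) (hg x)]
    simp
  simp only [curl, h]
  ext l
  fin_cases l <;> simp <;> ring

lemma curl_curl_single {η : V → ℝ} (hη : IsTest η) (k : Fin 3) (x : V) :
    curl (curl fun x => η x • basisVec k) x =
      dd k (dd (k + 2) η) x • basisVec (k + 2) + dd k (dd (k + 1) η) x • basisVec (k + 1) -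
        (dd (k + 1) (dd (k + 1) η) x + dd (k + 2) (dd (k + 2) η) x) • basisVec k := by
  have h1 : curl (fun x => η x • basisVec k) = fun x =>
      dd (k + 2) η x • basisVec (k + 1) - dd (k + 1) η x • basisVec (k + 2) :=
    funext fun x => curl_single hη.differentiable k x
  rw [h1, curl_sub (isTest_single (hη.dd _) _).differentiable (isTest_single (hη.dd _) _).differentiable,
    curl_single (hη.dd _).differentiable, curl_single (hη.dd _).differentiable]
  have e1 : k + 1 + 2 = k := by fin_cases k <;> rfl
  have e2 : k + 1 + 1 = k + 2 := by fin_cases k <;> rfl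
  have e3 : k + 2 + 2 = k + 1 := by fin_cases k <;> rfl
  have e4 : k + 2 + 1 = k := by fin_cases k <;> rfl
  rw [e1, e2, e3, e4]
  module

lemma laplacian_single {η : V → ℝ} (hη : IsTest η) (k : Fin 3) (x : V) :
    Laplacian.laplacian (fun x => η x • basisVec k) x =
      (dd 0 (dd 0 η) x + dd 1 (dd 1 η) x + dd 2 (dd 2 η) x) • basisVec k := by
  have hc : ContDiffAt ℝ 2 η x := (contDiff_infty.1 hη.1 2).contDiffAt
  have h := hc.laplacian_CLM_comp_left
    (l := ContinuousLinearMap.smulRight (1 : ℝ →L[ℝ] ℝ) (basisVec k))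
  have h1 : (⇑(ContinuousLinearMap.smulRight (1 : ℝ →L[ℝ] ℝ) (basisVec k)) ∘ η) =
      fun x => η x • basisVec k := by ext; simp
  rw [h1] at h
  rw [h]
  simp only [Function.comp_apply, ContinuousLinearMap.smulRight_apply, one_apply_eq_self]
  congr 1
  rw [InnerProductSpace.laplacian_eq_iteratedFDeriv_orthonormalBasis η
    (EuclideanSpace.basisFun (Fin 3) ℝ)]
  simp only [Fin.sum_univ_three]
  have h2 : ∀ j : Fin 3, iteratedFDeriv ℝ 2 η x
      ![EuclideanSpace.basisFun (Fin 3) ℝ j, EuclideanSpace.basisFun (Fin 3) ℝ j] =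
      dd j (dd j η) x := by
    intro j
    rw [iteratedFDeriv_two_apply]
    have h3 : HasFDerivAt (dd j η) ((ContinuousLinearMap.apply ℝ ℝ (basisVec j)).comp
        (fderiv ℝ (fderiv ℝ η) x)) x :=
      (ContinuousLinearMap.apply ℝ ℝ (basisVec j)).hasFDerivAt.comp x
        ((hη.1.fderiv_right (m := ∞) (by exact_mod_cast le_top)).differentiable (by simp) x).hasFDerivAt
    rw [dd, h3.fderiv]
    simp [basisVec]
  rw [h2, h2, h2]

lemma inner_basisVec_right (v : V) (a : ℝ) (k : Fin 3) : inner ℝ v (a • basisVec k) = a * v k := by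
  rw [inner_smul_right, inner_basisVec]

lemma integrable_test_mul {p : ℝ≥0∞} (hp : 1 ≤ p) {f : V → V} (hf : MemLp f p volume)
    {η : V → ℝ} (hη : IsTest η) (k : Fin 3) : Integrable (fun x => η x * f x k) volume := by
  have h := integrable_schwartz_mul hp (memLp_cp hf k) (toS hη)
  have h2 := Complex.reCLM.integrable_comp h
  simpa [toS_apply, cp] using h2

lemma ofReal_integral_dd {p : ℝ≥0∞} (hp : 1 ≤ p) {f : V → V} (hf : MemLp f p volume)
    {η : V → ℝ} (hη : IsTest η) (j k : Fin 3) :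
    ((∫ x, dd j η x * f x k : ℝ) : ℂ) = pairCLM hp (memLp_cp hf k) (∂_{basisVec j} (toS hη)) := by
  rw [lineDeriv_toS, pairCLM_toS hp hf]

lemma ofReal_integral_dd_dd {p : ℝ≥0∞} (hp : 1 ≤ p) {f : V → V} (hf : MemLp f p volume)
    {η : V → ℝ} (hη : IsTest η) (i j k : Fin 3) :
    ((∫ x, dd i (dd j η) x * f x k : ℝ) : ℂ) =
      pairCLM hp (memLp_cp hf k) (∂_{basisVec i} (∂_{basisVec j} (toS hη))) := by
  rw [lineDeriv_toS, lineDeriv_toS, pairCLM_toS hp hf]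

lemma integral_inner_single (f : V → V) (η : V → ℝ) (k : Fin 3) :
    ∫ x, inner ℝ (f x) (η x • basisVec k) = ∫ x, η x * f x k := by
  simp only [inner_basisVec_right]

lemma integral_inner_curl_single {p : ℝ≥0∞} (hp : 1 ≤ p) {f : V → V} (hf : MemLp f p volume)
    {η : V → ℝ} (hη : IsTest η) (k : Fin 3) :
    ∫ x, inner ℝ (f x) (curl (fun x => η x • basisVec k) x) =
      (∫ x, dd (k + 2) η x * f x (k + 1)) - ∫ x, dd (k + 1) η x * f x (k + 2) := by
  rw [← integral_sub (integrable_test_mul hp hf (hη.dd _) _) (integrable_test_mul hp hf (hη.dd _) _)]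
  simp only [curl_single hη.differentiable, inner_sub_right, inner_basisVec_right]

/-- The functional `φ ↦ ∫ ∂_j φ f`. -/
def pairD {p : ℝ≥0∞} (hp : 1 ≤ p) {f : V → ℂ} (hf : MemLp f p volume) (j : Fin 3) :
    𝓢(V, ℂ) →L[ℂ] ℂ := pairCLM hp hf ∘L LineDeriv.lineDerivOpCLM ℂ 𝓢(V, ℂ) (basisVec j)

lemma pairD_apply {p : ℝ≥0∞} (hp : 1 ≤ p) {f : V → ℂ} (hf : MemLp f p volume) (j : Fin 3)
    (φ : 𝓢(V, ℂ)) : pairD hp hf j φ = pairCLM hp hf (∂_{basisVec j} φ) := rfl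

lemma locallyIntegrable_ds_mul {h : V → ℂ} (hh : LocallyIntegrable h volume) (j : Fin 3) :
    LocallyIntegrable (fun ξ => ds j ξ * h ξ) volume :=
  locallyIntegrable_continuous_mul (continuous_ds j) hh

/-- Test fields with a single nonzero component suffice here; the converse `isWeakCurl_of_fourier`
has to decompose a general test field into components. -/
lemma IsWeakCurl.fourier_eq {p r : ℝ≥0∞} (hp : 1 ≤ p) (hr : 1 ≤ r) {f g : V → V}
    (h : IsWeakCurl f g) (hf : MemLp f p volume) (hg : MemLp g r volume)
    {fh gh : Fin 3 → V → ℂ} (hfh : ∀ k, IsFT (cp f k) (fh k)) (hgh : ∀ k, IsFT (cp g k) (gh k))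
    (k : Fin 3) :
    gh k =ᵐ[volume] fun ξ => ds (k + 1) ξ * fh (k + 2) ξ - ds (k + 2) ξ * fh (k + 1) ξ := by
  have key := clm_eq_of_eq_on_tests (T := pairCLM hr (memLp_cp hg k))
    (S := pairD hp (memLp_cp hf (k + 1)) (k + 2) - pairD hp (memLp_cp hf (k + 2)) (k + 1))
    (fun η hη => by
      have h1 := h.2 _ (isTest_single hη k)
      rw [integral_inner_single, integral_inner_curl_single hp hf hη] at h1
      rw [pairCLM_toS hr hg, sub_apply, pairD_apply, pairD_apply, ← ofReal_integral_dd hp hf hη,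
        ← ofReal_integral_dd hp hf hη, h1]
      push_cast; rfl)
  refine ae_eq_of_integral_schwartz_mul_eq (hgh k).1 ((locallyIntegrable_ds_mul (hfh _).1 _).sub
    (locallyIntegrable_ds_mul (hfh _).1 _)) fun ψ hψ => ?_
  have h3 := key (𝓕 ψ)
  rw [pairCLM_fourier hr _ (hgh k) hψ, sub_apply, pairD_apply, pairD_apply,
    pairCLM_lineDeriv_fourier hp _ (hfh _) hψ, pairCLM_lineDeriv_fourier hp _ (hfh _) hψ] at h3
  simp only [mul_sub]
  rw [h3, integral_sub (integrable_mul_of_hasCompactSupport (locallyIntegrable_ds_mul (hfh _).1 _) ψ hψ)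
    (integrable_mul_of_hasCompactSupport (locallyIntegrable_ds_mul (hfh _).1 _) ψ hψ)]
  ring

lemma IsWeaklyDivFree.fourier_eq {p : ℝ≥0∞} (hp : 1 ≤ p) {f : V → V} (h : IsWeaklyDivFree f)
    (hf : MemLp f p volume) {fh : Fin 3 → V → ℂ} (hfh : ∀ k, IsFT (cp f k) (fh k)) :
    ∀ᵐ ξ, ∑ l, ds l ξ * fh l ξ = 0 := by
  have key := clm_eq_of_eq_on_tests (T := ∑ l, pairD hp (memLp_cp hf l) l) (S := 0)
    (fun η hη => by
      have h1 := h η hη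
      have h2 : ∀ x, fderiv ℝ η x (f x) = ∑ l, dd l η x * f x l := fun x => by
        have hx : f x = ∑ k, f x k • basisVec k := by
          ext j
          simp [basisVec, Finset.sum_apply, Pi.single_apply]
        conv_lhs => rw [hx]
        simp only [map_sum, map_smul, dd, smul_eq_mul, mul_comm]
      simp only [h2] at h1
      rw [integral_finsetSum _ fun l _ => integrable_test_mul hp hf (hη.dd l) l] at h1
      rw [sum_apply, zero_apply]
      simp only [pairD_apply, ← ofReal_integral_dd hp hf hη]
      rw [← Complex.ofReal_sum, h1, Complex.ofReal_zero])
  have := ae_eq_of_integral_schwartz_mul_eq (g := fun ξ => ∑ l, ds l ξ * fh l ξ) (h := 0)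
    (locallyIntegrable_finsetSum _ fun l _ => locallyIntegrable_ds_mul (hfh l).1 l)
    (locallyIntegrable_zero) (fun ψ hψ => by
      have h3 := key (𝓕 ψ)
      rw [sum_apply, zero_apply] at h3
      simp only [pairD_apply, pairCLM_lineDeriv_fourier hp _ (hfh _) hψ] at h3
      simp only [Finset.mul_sum]
      rw [integral_finsetSum _ fun l _ => integrable_mul_of_hasCompactSupport
        (locallyIntegrable_ds_mul (hfh l).1 l) ψ hψ]
      rw [Finset.sum_neg_distrib, neg_eq_zero] at h3
      simpa using h3)
  exact this

lemma IsTransversePart.fourier_eq {p : ℝ≥0∞} (hp : 1 ≤ p) {u w : V → V} (h : IsTransversePart u w)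
    (hu : MemLp u p volume) {uh wh : Fin 3 → V → ℂ} (huh : ∀ k, IsFT (cp u k) (uh k))
    (hwh : ∀ k, IsFT (cp w k) (wh k)) (k : Fin 3) :
    ∀ᵐ ξ, -(ds 0 ξ * ds 0 ξ * wh k ξ + ds 1 ξ * ds 1 ξ * wh k ξ + ds 2 ξ * ds 2 ξ * wh k ξ) =
      ds k ξ * ds (k + 2) ξ * uh (k + 2) ξ + ds k ξ * ds (k + 1) ξ * uh (k + 1) ξ -
        (ds (k + 1) ξ * ds (k + 1) ξ * uh k ξ + ds (k + 2) ξ * ds (k + 2) ξ * uh k ξ) := by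
  have h12 : (1 : ℝ≥0∞) ≤ 2 := by norm_num
  have hw := h.1
  let P (i j l : Fin 3) : 𝓢(V, ℂ) →L[ℂ] ℂ := pairD hp (memLp_cp hu l) i ∘L
    LineDeriv.lineDerivOpCLM ℂ 𝓢(V, ℂ) (basisVec j)
  let Q (i j : Fin 3) : 𝓢(V, ℂ) →L[ℂ] ℂ := pairD h12 (memLp_cp hw k) i ∘L
    LineDeriv.lineDerivOpCLM ℂ 𝓢(V, ℂ) (basisVec j)
  have hP : ∀ i j l φ, P i j l φ = pairCLM hp (memLp_cp hu l) (∂_{basisVec i} (∂_{basisVec j} φ)) :=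
    fun _ _ _ _ => rfl
  have hQ : ∀ i j φ, Q i j φ = pairCLM h12 (memLp_cp hw k) (∂_{basisVec i} (∂_{basisVec j} φ)) :=
    fun _ _ _ => rfl
  have key := clm_eq_of_eq_on_tests (T := -(Q 0 0 + Q 1 1 + Q 2 2))
    (S := P k (k + 2) (k + 2) + P k (k + 1) (k + 1) - (P (k + 1) (k + 1) k + P (k + 2) (k + 2) k))
    (fun η hη => by
      have h1 := h.2 _ (isTest_single hη k)
      have iw : ∀ i j, Integrable (fun x => dd i (dd j η) x * w x k) volume :=
        fun i j => integrable_test_mul h12 hw ((hη.dd j).dd i) k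
      have iu : ∀ i j l, Integrable (fun x => dd i (dd j η) x * u x l) volume :=
        fun i j l => integrable_test_mul hp hu ((hη.dd j).dd i) l
      have e1 : ∫ x, inner ℝ (w x) (-(Laplacian.laplacian (fun x => η x • basisVec k) x)) =
          -((∫ x, dd 0 (dd 0 η) x * w x k) + (∫ x, dd 1 (dd 1 η) x * w x k) +
            ∫ x, dd 2 (dd 2 η) x * w x k) := by
        rw [← integral_add (iw 0 0) (iw 1 1), ← integral_add (f := fun x => _ + _)
          ((iw 0 0).add (iw 1 1)) (iw 2 2), ← integral_neg]
        refine integral_congr_ae (Eventually.of_forall fun x => ?_)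
        simp only [laplacian_single hη, inner_neg_right, inner_basisVec_right]
        ring
      have e2 : ∫ x, inner ℝ (u x) (curl (curl fun x => η x • basisVec k) x) =
          (∫ x, dd k (dd (k + 2) η) x * u x (k + 2)) + (∫ x, dd k (dd (k + 1) η) x * u x (k + 1)) -
            ((∫ x, dd (k + 1) (dd (k + 1) η) x * u x k) + ∫ x, dd (k + 2) (dd (k + 2) η) x * u x k) := by
        rw [← integral_add (iu _ _ _) (iu _ _ _), ← integral_add (iu _ _ _) (iu _ _ _),
          ← integral_sub (f := fun x => _ + _) (g := fun x => _ + _)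
            ((iu _ _ _).add (iu _ _ _)) ((iu _ _ _).add (iu _ _ _))]
        refine integral_congr_ae (Eventually.of_forall fun x => ?_)
        simp only [curl_curl_single hη, inner_sub_right, inner_add_right, inner_basisVec_right]
        ring
      rw [e1, e2] at h1
      have h2 := congrArg (fun a : ℝ => (a : ℂ)) h1
      push_cast at h2
      simp only [ofReal_integral_dd_dd h12 hw hη, ofReal_integral_dd_dd hp hu hη] at h2
      simp only [neg_apply, add_apply, sub_apply, hP, hQ]
      exact h2)
  have lw : ∀ i j, LocallyIntegrable (fun ξ => ds i ξ * ds j ξ * wh k ξ) volume := fun i j =>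
    locallyIntegrable_continuous_mul ((continuous_ds i).mul (continuous_ds j)) (hwh k).1
  have lu : ∀ i j l, LocallyIntegrable (fun ξ => ds i ξ * ds j ξ * uh l ξ) volume := fun i j l =>
    locallyIntegrable_continuous_mul ((continuous_ds i).mul (continuous_ds j)) (huh l).1
  refine ae_eq_of_integral_schwartz_mul_eq (((lw 0 0).add (lw 1 1)).add (lw 2 2)).neg
    (((lu _ _ _).add (lu _ _ _)).sub ((lu _ _ _).add (lu _ _ _))) fun ψ hψ => ?_
  have h3 := key (𝓕 ψ)
  simp only [neg_apply, add_apply, sub_apply, hP, hQ] at h3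
  simp only [pairCLM_lineDeriv_lineDeriv_fourier hp _ (huh _) hψ,
    pairCLM_lineDeriv_lineDeriv_fourier h12 _ (hwh k) hψ] at h3
  have iw : ∀ i j, Integrable (fun ξ => ψ ξ * (ds i ξ * ds j ξ * wh k ξ)) volume := fun i j =>
    integrable_mul_of_hasCompactSupport (lw i j) ψ hψ
  have iu : ∀ i j l, Integrable (fun ξ => ψ ξ * (ds i ξ * ds j ξ * uh l ξ)) volume := fun i j l =>
    integrable_mul_of_hasCompactSupport (lu i j l) ψ hψ
  rw [← integral_add (iw 0 0) (iw 1 1), ← integral_add (f := fun x => _ + _)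
    ((iw 0 0).add (iw 1 1)) (iw 2 2), ← integral_neg, ← integral_add (iu _ _ _) (iu _ _ _), ← integral_add (iu _ _ _) (iu _ _ _),
    ← integral_sub (f := fun x => _ + _) (g := fun x => _ + _)
            ((iu _ _ _).add (iu _ _ _)) ((iu _ _ _).add (iu _ _ _))] at h3
  refine Eq.trans ?_ (h3.trans ?_)
  · refine integral_congr_ae (Eventually.of_forall fun x => ?_)
    beta_reduce; ring
  · refine integral_congr_ae (Eventually.of_forall fun x => ?_)
    beta_reduce; ring

/-! ### The weak curl of an `L²` field -/

lemma pd_eq_dd {φ : V → V} (hφ : Differentiable ℝ φ) (j k : Fin 3) (x : V) :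
    pd j k φ x = dd j (fun x => φ x k) x := by
  have h : HasFDerivAt (fun x => φ x k)
      ((EuclideanSpace.proj k : V →L[ℝ] ℝ).comp (fderiv ℝ φ x)) x :=
    (EuclideanSpace.proj k : V →L[ℝ] ℝ).hasFDerivAt.comp x (hφ x).hasFDerivAt
  rw [pd, dd, h.fderiv]
  rfl

lemma IsTest.coord {φ : V → V} (hφ : IsTest φ) (k : Fin 3) : IsTest fun x => φ x k :=
  ⟨(EuclideanSpace.proj k : V →L[ℝ] ℝ).contDiff.comp hφ.1,
    hφ.2.comp_left (g := fun v : V => v k) rfl⟩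

lemma inner_eq_sum (v w : V) : inner ℝ v w = ∑ k, w k * v k := by
  simp [PiLp.inner_apply]

lemma inner_curl {φ : V → V} (hφ : Differentiable ℝ φ) (v : V) (x : V) :
    inner ℝ v (curl φ x) = ∑ k : Fin 3, (dd (k + 2) (fun x => φ x k) x * v (k + 1) -
      dd (k + 1) (fun x => φ x k) x * v (k + 2)) := by
  simp only [inner_eq_sum, curl, pd_eq_dd hφ, Fin.sum_univ_three]
  simp only [show (0 : Fin 3) + 1 = 1 from rfl, show (0 : Fin 3) + 2 = 2 from rfl,
    show (1 : Fin 3) + 1 = 2 from rfl, show (1 : Fin 3) + 2 = 0 from rfl,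
    show (2 : Fin 3) + 1 = 0 from rfl, show (2 : Fin 3) + 2 = 1 from rfl]
  simp
  ring

lemma isWeakCurl_of_fourier {f : V → V} (hf : MemLp f 2 volume)
    {fh g : Fin 3 → V → ℂ} (hfh : ∀ k, IsFT (cp f k) (fh k)) (hg : ∀ k, MemLp (g k) 2 volume)
    (hgh : ∀ k, IsFT (g k) fun ξ => ds (k + 1) ξ * fh (k + 2) ξ - ds (k + 2) ξ * fh (k + 1) ξ) :
    IsWeakCurl f (ofRe g) := by
  have h12 : (1 : ℝ≥0∞) ≤ 2 := by norm_num
  have hgm := memLp_ofRe h12 hg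
  refine ⟨hgm.locallyIntegrable h12, fun φ hφ => ?_⟩
  simp only [inner_curl hφ.differentiable, inner_eq_sum]
  have hi : ∀ k : Fin 3, Integrable (fun x => dd (k + 2) (fun x => φ x k) x * f x (k + 1) -
      dd (k + 1) (fun x => φ x k) x * f x (k + 2)) volume := fun k =>
    (integrable_test_mul h12 hf ((hφ.coord k).dd _) _).sub
      (integrable_test_mul h12 hf ((hφ.coord k).dd _) _)
  rw [integral_finsetSum _ fun k _ => integrable_test_mul h12 hgm (hφ.coord k) k,
    integral_finsetSum _ fun k _ => hi k]
  refine Finset.sum_congr rfl fun k _ => ?_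
  rw [integral_sub (integrable_test_mul h12 hf ((hφ.coord k).dd _) _)
      (integrable_test_mul h12 hf ((hφ.coord k).dd _) _)]
  have key := clm_eq_of_eq_on_fourier (T := pairCLM h12 (hg k))
    (S := pairD h12 (memLp_cp hf (k + 1)) (k + 2) - pairD h12 (memLp_cp hf (k + 2)) (k + 1))
    (fun ψ hψ => by
      rw [pairCLM_fourier h12 _ (hgh k) hψ, sub_apply, pairD_apply, pairD_apply,
        pairCLM_lineDeriv_fourier h12 _ (hfh _) hψ, pairCLM_lineDeriv_fourier h12 _ (hfh _) hψ]
      simp only [mul_sub]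
      rw [integral_sub
        (integrable_mul_of_hasCompactSupport (locallyIntegrable_ds_mul (hfh _).1 _) ψ hψ)
        (integrable_mul_of_hasCompactSupport (locallyIntegrable_ds_mul (hfh _).1 _) ψ hψ)]
      ring) (toS (hφ.coord k))
  rw [sub_apply, pairD_apply, pairD_apply, ← ofReal_integral_dd h12 hf (hφ.coord k),
    ← ofReal_integral_dd h12 hf (hφ.coord k)] at key
  have h2 := congrArg Complex.re key
  rw [re_pairCLM_toS] at h2
  simpa [ofRe_apply] using h2

lemma IsWeakCurl.unique {f g h : V → V} (hg : IsWeakCurl f g) (hh : IsWeakCurl f h) :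
    g =ᵐ[volume] h := by
  refine ae_eq_of_integral_contDiff_smul_eq hg.1 hh.1 fun η hη hc => ?_
  have hi : ∀ w : V → V, LocallyIntegrable w volume → Integrable (fun x => η x • w x) volume :=
    fun w hw => hw.integrable_smul_left_of_hasCompactSupport hη.continuous hc
  ext k
  rw [integral_smul_apply (hi g hg.1), integral_smul_apply (hi h hh.1), ← integral_inner_single,
    ← integral_inner_single, hg.2 _ (isTest_single ⟨hη, hc⟩ k), hh.2 _ (isTest_single ⟨hη, hc⟩ k)]

/-- `weakCurl` is a choice among weak curls. The one built by inverse Fourier transform shows that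
the choice is not the default 0, and almost everywhere uniqueness transfers its square
integrability. -/
lemma weakCurl_fourier {f : V → V} (hf : MemLp f 2 volume) {fh : Fin 3 → V → ℂ}
    (hfh : ∀ k, IsFT (cp f k) (fh k)) (h2 : ∀ k l, MemLp (fun ξ => ds l ξ * fh k ξ) 2 volume) :
    MemLp (weakCurl f) 2 volume ∧ ∀ k, IsFT (cp (weakCurl f) k) fun ξ =>
      ds (k + 1) ξ * fh (k + 2) ξ - ds (k + 2) ξ * fh (k + 1) ξ := by
  have h12 : (1 : ℝ≥0∞) ≤ 2 := by norm_num
  choose g hg hgh using fun k : Fin 3 =>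
    exists_isFT_eq_of_memLp_two ((h2 (k + 2) (k + 1)).sub (h2 (k + 1) (k + 2)))
  have hc := isWeakCurl_of_fourier hf hfh hg hgh
  have hw : IsWeakCurl f (weakCurl f) := by
    have hex : ∃ g, IsWeakCurl f g := ⟨_, hc⟩
    rw [weakCurl, dif_pos hex]
    exact hex.choose_spec
  have hm : MemLp (weakCurl f) 2 volume := (memLp_congr_ae (hc.unique hw)).1 (memLp_ofRe h12 hg)
  refine ⟨hm, fun k => ?_⟩
  choose gh _ hgh' _ using fun k : Fin 3 => exists_isFT_of_memLp_two (memLp_cp hm k)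
  exact (hgh' k).congr ae_eq_rfl (hw.fourier_eq h12 h12 hf hm hfh hgh' k)

/-! ### Fourier transform of the solenoidal part -/

lemma sum_ds_sq (ξ : V) : ds 0 ξ * ds 0 ξ + ds 1 ξ * ds 1 ξ + ds 2 ξ * ds 2 ξ =
    -((wn ξ ^ 2 : ℝ) : ℂ) := by
  have h : ‖ξ‖ ^ 2 = ξ 0 ^ 2 + ξ 1 ^ 2 + ξ 2 ^ 2 := by
    rw [EuclideanSpace.real_norm_sq_eq, Fin.sum_univ_three]
  rw [wn, mul_pow, h]
  simp only [ds]
  push_cast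
  linear_combination (4 * Real.pi ^ 2 * ((ξ 0 : ℂ) ^ 2 + (ξ 1 : ℂ) ^ 2 + (ξ 2 : ℂ) ^ 2)) *
    Complex.I_sq

lemma ae_wn_pos : ∀ᵐ ξ : V, 0 < wn ξ := by
  have h : ∀ᵐ ξ : V, ξ ≠ 0 := by
    rw [ae_iff]
    simp
  filter_upwards [h] with ξ hξ
  unfold wn
  positivity

/-- In frequency, `wn`² ŵ equals a matrix of products of two symbols applied to û. Contracting with
the symbol of the gradient gives zero, and each product is at most `wn`²; dividing is possible off
the null set ξ = 0. The 2 arises because û_k enters twice. -/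
lemma IsTransversePart.fourier_bounds {p : ℝ≥0∞} (hp : 1 ≤ p) {u w : V → V}
    (h : IsTransversePart u w) (hu : MemLp u p volume) {uh wh : Fin 3 → V → ℂ}
    (huh : ∀ k, IsFT (cp u k) (uh k)) (hwh : ∀ k, IsFT (cp w k) (wh k)) :
    ∀ᵐ ξ, ∑ l, ds l ξ * wh l ξ = 0 ∧ ∀ k, ‖wh k ξ‖ ≤ 2 * ∑ l, ‖uh l ξ‖ := by
  have hk := ae_all_iff.2 (h.fourier_eq hp hu huh hwh)
  filter_upwards [hk, ae_wn_pos] with ξ hξ hpos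
  have hq : 0 < wn ξ ^ 2 := by positivity
  have hq' : ((wn ξ ^ 2 : ℝ) : ℂ) ≠ 0 := by exact_mod_cast hq.ne'
  have hs := sum_ds_sq ξ
  have hξ' : ∀ k, ((wn ξ ^ 2 : ℝ) : ℂ) * wh k ξ =
      ds k ξ * ds (k + 2) ξ * uh (k + 2) ξ + ds k ξ * ds (k + 1) ξ * uh (k + 1) ξ -
        (ds (k + 1) ξ * ds (k + 1) ξ * uh k ξ + ds (k + 2) ξ * ds (k + 2) ξ * uh k ξ) := fun k => by
    rw [← hξ k]
    linear_combination (wh k ξ) * hs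
  refine ⟨?_, fun k => ?_⟩
  · refine mul_left_cancel₀ hq' ?_
    have h0 := hξ' 0
    have h1 := hξ' 1
    have h2 := hξ' 2
    simp only [show (0 : Fin 3) + 1 = 1 from rfl, show (0 : Fin 3) + 2 = 2 from rfl,
      show (1 : Fin 3) + 1 = 2 from rfl, show (1 : Fin 3) + 2 = 0 from rfl,
      show (2 : Fin 3) + 1 = 0 from rfl, show (2 : Fin 3) + 2 = 1 from rfl] at h0 h1 h2
    rw [Fin.sum_univ_three]
    linear_combination ds 0 ξ * h0 + ds 1 ξ * h1 + ds 2 ξ * h2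
  · have hb : ∀ i j l, ‖ds i ξ * ds j ξ * uh l ξ‖ ≤ wn ξ ^ 2 * ‖uh l ξ‖ := fun i j l => by
      rw [norm_mul, norm_mul, pow_two]
      gcongr
      · exact norm_ds_le _ _
      · exact norm_ds_le _ _
    have hn : wn ξ ^ 2 * ‖wh k ξ‖ ≤ wn ξ ^ 2 * (2 * ∑ l, ‖uh l ξ‖) := by
      calc wn ξ ^ 2 * ‖wh k ξ‖ = ‖((wn ξ ^ 2 : ℝ) : ℂ) * wh k ξ‖ := by
            rw [norm_mul, Complex.norm_real, Real.norm_of_nonneg hq.le]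
        _ ≤ (wn ξ ^ 2 * ‖uh (k + 2) ξ‖ + wn ξ ^ 2 * ‖uh (k + 1) ξ‖) +
            (wn ξ ^ 2 * ‖uh k ξ‖ + wn ξ ^ 2 * ‖uh k ξ‖) := by
          rw [hξ' k]
          refine (norm_sub_le _ _).trans (add_le_add ?_ ?_)
          · exact (norm_add_le _ _).trans (add_le_add (hb _ _ _) (hb _ _ _))
          · exact (norm_add_le _ _).trans (add_le_add (hb _ _ _) (hb _ _ _))
        _ = wn ξ ^ 2 * (‖uh k ξ‖ + ‖uh (k + 1) ξ‖ + ‖uh (k + 2) ξ‖ + ‖uh k ξ‖) := by ring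
        _ ≤ wn ξ ^ 2 * (2 * ∑ l, ‖uh l ξ‖) := by
          have hsum : ‖uh k ξ‖ + ‖uh (k + 1) ξ‖ + ‖uh (k + 2) ξ‖ = ∑ l, ‖uh l ξ‖ := by
            rw [Fin.sum_univ_three]
            fin_cases k
            · rfl
            · change ‖uh 1 ξ‖ + ‖uh 2 ξ‖ + ‖uh 0 ξ‖ = _; ring
            · change ‖uh 2 ξ‖ + ‖uh 0 ξ‖ + ‖uh 1 ξ‖ = _; ring
          gcongr
          rw [hsum, two_mul]
          gcongr
          exact Finset.single_le_sum (f := fun l => ‖uh l ξ‖) (fun _ _ => norm_nonneg _)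
            (Finset.mem_univ k)
    exact le_of_mul_le_mul_left hn hq

/-! ### Time-dependent functionals -/

/-- The space of square integrable functions. -/
abbrev L2 : Type := Lp ℂ 2 (volume : Measure V)

/-- The pairing `u ↦ ∫ φ u` on square integrable functions. -/
def pr (φ : 𝓢(V, ℂ)) : L2 →L[ℂ] ℂ :=
  (ContinuousLinearMap.mul ℂ ℂ).lpPairing volume 2 2 (φ.toLp 2 volume)

lemma pr_apply (φ : 𝓢(V, ℂ)) (u : L2) : pr φ u = ∫ x, φ x * u x := by
  rw [pr, ContinuousLinearMap.lpPairing_eq_integral]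
  refine integral_congr_ae ?_
  filter_upwards [φ.coeFn_toLp 2 volume] with x hx
  rw [hx, ContinuousLinearMap.mul_apply']

lemma pr_eq_pairCLM (φ : 𝓢(V, ℂ)) (u : L2) :
    pr φ u = pairCLM (by norm_num : (1 : ℝ≥0∞) ≤ 2) (Lp.memLp u) φ := by
  rw [pr_apply, pairCLM_apply]

lemma pr_fourier {ψ : 𝓢(V, ℂ)} (hψ : HasCompactSupport ψ) (u : L2) :
    pr (𝓕 ψ) u = pr ψ (𝓕 u) := by
  rw [pr_apply, pr_apply, (isFT_fourier u).2 ψ hψ]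

lemma hasDerivAt_pr (φ : 𝓢(V, ℂ)) {f : ℝ → L2} {f' : L2} {t : ℝ} (h : HasDerivAt f f' t) :
    HasDerivAt (fun s => pr φ (f s)) (pr φ f') t :=
  ((pr φ).restrictScalars ℝ).hasFDerivAt.comp_hasDerivAt t h

lemma hasDerivAt_primitive {g : ℝ → L2} (hg : Continuous g) (t : ℝ) :
    HasDerivAt (fun t => ∫ s in (0 : ℝ)..t, g s) (g t) t :=
  intervalIntegral.integral_hasDerivAt_right (hg.intervalIntegrable _ _)
    hg.aestronglyMeasurable.stronglyMeasurableAtFilter hg.continuousAt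

/-- An evolution equation that holds when paired with real test functions holds when paired with
Schwartz functions. -/
lemma hasDerivWithinAt_pr_of_tests {N : ℕ} {f : ℝ → L2} {g : Fin N → ℝ → L2}
    (hg : ∀ i, Continuous (g i)) (T : Fin N → 𝓢(V, ℂ) →L[ℂ] 𝓢(V, ℂ))
    (h : ∀ (η : V → ℝ) (hη : IsTest η) (t : ℝ), 0 ≤ t →
      HasDerivWithinAt (fun s => pr (toS hη) (f s)) (∑ i, pr (T i (toS hη)) (g i t)) (Ici 0) t)
    (φ : 𝓢(V, ℂ)) {t : ℝ} (ht : 0 ≤ t) :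
    HasDerivWithinAt (fun s => pr φ (f s)) (∑ i, pr (T i φ) (g i t)) (Ici 0) t := by
  have h12 : (1 : ℝ≥0∞) ≤ 2 := by norm_num
  -- The derivative itself does not pass to limits of test functions. The equation integrated in
  -- time is an identity between continuous functionals, so it extends from tests to Schwartz
  -- functions; differentiating it gives the claim.
  have key : ∀ s, 0 ≤ s → pr φ (f s) =
      pr φ (f 0) + ∑ i, pr (T i φ) (∫ τ in (0 : ℝ)..s, g i τ) := by
    intro s hs
    have := clm_eq_of_eq_on_tests (T := pairCLM h12 (Lp.memLp (f s)))
      (S := pairCLM h12 (Lp.memLp (f 0)) +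
        ∑ i, pairCLM h12 (Lp.memLp (∫ τ in (0 : ℝ)..s, g i τ)) ∘L T i) (fun η hη => by
        simp only [add_apply, sum_apply, ContinuousLinearMap.comp_apply, ← pr_eq_pairCLM]
        have hd : ∀ τ ∈ Ici (0 : ℝ), HasDerivWithinAt
            (fun s => pr (toS hη) (f s) - ∑ i, pr (T i (toS hη)) (∫ τ in (0 : ℝ)..s, g i τ)) 0
            (Ici 0) τ := by
          intro τ hτ
          have h1 := (h η hη τ hτ).sub (HasDerivWithinAt.fun_sum (u := Finset.univ) fun i _ =>
            (hasDerivAt_pr (T i (toS hη)) (hasDerivAt_primitive (hg i) τ)).hasDerivWithinAt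
              (s := Ici 0))
          rwa [sub_self] at h1
        have hc := (convex_Ici (0 : ℝ)).norm_image_sub_le_of_norm_hasDerivWithin_le (C := 0) hd
          (fun τ _ => by simp) (self_mem_Ici) hs
        simp only [intervalIntegral.integral_same, map_zero, Finset.sum_const_zero, sub_zero,
          zero_mul, norm_le_zero_iff] at hc
        linear_combination hc) φ
    simpa only [add_apply, sum_apply, ContinuousLinearMap.comp_apply, ← pr_eq_pairCLM] using this
  have hd : HasDerivAt (fun s => pr φ (f 0) + ∑ i, pr (T i φ) (∫ τ in (0 : ℝ)..s, g i τ))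
      (∑ i, pr (T i φ) (g i t)) t :=
    (HasDerivAt.fun_sum fun i _ => hasDerivAt_pr (T i φ)
      (hasDerivAt_primitive (hg i) t)).const_add _
  exact hd.hasDerivWithinAt.congr (fun s hs => key s hs) (key t ht)

/-- A continuous curve in `L²` attached to a component of a field in `C([0,∞); L²)`. -/
def curve {f : ℝ → V → V} (hf : ContinuousInL2 f) (k : Fin 3) (t : ℝ) : L2 :=
  (memLp_cp (hf.1 (max t 0) (le_max_right _ _)) k).toLp _

lemma curve_ae_eq {f : ℝ → V → V} (hf : ContinuousInL2 f) (k : Fin 3) {t : ℝ} (ht : 0 ≤ t) :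
    curve hf k t =ᵐ[volume] cp (f t) k := by
  refine (memLp_cp (hf.1 (max t 0) (le_max_right _ _)) k).coeFn_toLp.trans ?_
  rw [max_eq_left ht]

/-- Freezing time at max t 0 extends the curve continuously to negative times, so that primitives
and two-sided derivatives can be used. -/
lemma continuous_curve {f : ℝ → V → V} (hf : ContinuousInL2 f) (k : Fin 3) :
    Continuous (curve hf k) := by
  rw [continuous_iff_continuousAt]
  intro t
  have h1 : Tendsto (fun s : ℝ => max s 0) (𝓝 t) (𝓝[Ici 0] (max t 0)) :=
    tendsto_nhdsWithin_iff.2 ⟨(continuous_id.max continuous_const).continuousAt,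
      Eventually.of_forall fun s => mem_Ici.2 (le_max_right _ _)⟩
  have h2 := (hf.2 (max t 0) (le_max_right _ _)).comp h1
  rw [ContinuousAt, tendsto_iff_edist_tendsto_0]
  refine tendsto_of_tendsto_of_tendsto_of_le_of_le tendsto_const_nhds h2 (fun _ => zero_le)
    fun s => ?_
  rw [curve, curve, Lp.edist_toLp_toLp]
  refine eLpNorm_mono fun x => ?_
  rw [Pi.sub_apply, cp, cp, ← Complex.ofReal_sub, Complex.norm_real]
  exact norm_coord_le (f (max s 0) x - f (max t 0) x) k

lemma pr_toS_curve {f : ℝ → V → V} (hf : ContinuousInL2 f) (k : Fin 3) {t : ℝ} (ht : 0 ≤ t)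
    {η : V → ℝ} (hη : IsTest η) :
    pr (toS hη) (curve hf k t) = ((∫ x, η x * f t x k : ℝ) : ℂ) := by
  rw [← pairCLM_toS (by norm_num) (hf.1 t ht), pr_apply, pairCLM_apply]
  refine integral_congr_ae ?_
  filter_upwards [curve_ae_eq hf k ht] with x hx
  rw [hx]

/-- The equation `EvolvesBy` for complex valued pairings. -/
lemma EvolvesBy.hasDerivWithinAt {a : ℝ} {F G : ℝ → ℝ} (h : EvolvesBy a F G) (ha : a ≠ 0)
    {Fc : ℝ → ℂ} (hF : ∀ t, 0 ≤ t → Fc t = F t) {t : ℝ} (ht : 0 ≤ t) :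
    HasDerivWithinAt Fc ((G t / a : ℝ) : ℂ) (Ici 0) t := by
  obtain ⟨d, hd, hda⟩ := h t ht
  have : G t / a = d := by rw [← hda]; field_simp
  rw [this]
  exact hd.ofReal_comp.congr (fun s hs => hF s hs) (hF t ht)

/-! ### A Taylor expansion -/

/-- Induction on N with n free: the derivative of the remainder of F n with N + 1 terms is the
remainder of F (n + 1) with N terms, and both vanish or compare at t = 0. One-sided derivatives at 0
are enough. -/
lemma norm_sub_taylor_le {F : ℕ → ℝ → ℂ} {K M T : ℝ}
    (hd : ∀ n t, 0 ≤ t → HasDerivWithinAt (F n) (F (n + 1) t) (Ici 0) t)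
    (hb : ∀ n, ∀ t ∈ Icc 0 T, ‖F n t‖ ≤ K * M ^ n) (N : ℕ) :
    ∀ n, ∀ t ∈ Icc 0 T,
      ‖F n t - ∑ j ∈ Finset.range N, ((t ^ j / j.factorial : ℝ) : ℂ) * F (n + j) 0‖ ≤
        K * M ^ (n + N) * (t ^ N / N.factorial) := by
  induction N with
  | zero =>
    intro n t ht
    simpa using hb n t ht
  | succ N ih =>
    intro n
    have hp : ∀ (j : ℕ) (t : ℝ), HasDerivAt (fun t : ℝ => t ^ (j + 1) / ((j + 1).factorial : ℝ))
        (t ^ j / (j.factorial : ℝ)) t := fun j t => by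
      refine ((hasDerivAt_pow (j + 1) t).div_const ((j + 1).factorial : ℝ)).congr_deriv ?_
      rw [Nat.factorial_succ]
      push_cast
      have : (j.factorial : ℝ) ≠ 0 := by positivity
      field_simp
    have hder : ∀ t, 0 ≤ t → HasDerivWithinAt (fun t => F n t - ∑ j ∈ Finset.range (N + 1),
        ((t ^ j / j.factorial : ℝ) : ℂ) * F (n + j) 0)
        (F (n + 1) t - ∑ j ∈ Finset.range N, ((t ^ j / j.factorial : ℝ) : ℂ) * F (n + 1 + j) 0)
        (Ici 0) t := by
      intro t ht
      refine (hd n t ht).sub ?_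
      simp only [Finset.sum_range_succ']
      have hs : HasDerivWithinAt (fun t : ℝ => ∑ j ∈ Finset.range N,
          ((t ^ (j + 1) / (j + 1).factorial : ℝ) : ℂ) * F (n + (j + 1)) 0)
          (∑ j ∈ Finset.range N, ((t ^ j / j.factorial : ℝ) : ℂ) * F (n + 1 + j) 0) (Ici 0) t := by
        refine HasDerivWithinAt.fun_sum fun j _ => ?_
        rw [show n + 1 + j = n + (j + 1) by ring]
        exact ((hp j t).ofReal_comp.mul_const _).hasDerivWithinAt
      simpa using hs.add_const (F (n + 0) 0)
    intro t ht
    refine image_norm_le_of_norm_deriv_right_le_deriv_boundary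
      (B := fun t => K * M ^ (n + (N + 1)) * (t ^ (N + 1) / ((N + 1).factorial : ℝ)))
      (B' := fun t => K * M ^ (n + (N + 1)) * (t ^ N / (N.factorial : ℝ)))
      (fun s hs => ((hder s hs.1).continuousWithinAt).mono Icc_subset_Ici_self)
      (fun s hs => (hder s hs.1).mono (Ici_subset_Ici.2 hs.1)) ?_ ?_ ?_ ht
    · simp [Finset.sum_range_succ']
    · exact fun s => (hp N s).const_mul _
    · intro s hs
      have := ih (n + 1) s ⟨hs.1, hs.2.le⟩
      rwa [show n + 1 + N = n + (N + 1) by ring] at this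

lemma hasSum_taylor {F : ℕ → ℝ → ℂ} {K M T : ℝ}
    (hd : ∀ n t, 0 ≤ t → HasDerivWithinAt (F n) (F (n + 1) t) (Ici 0) t)
    (hb : ∀ n, ∀ t ∈ Icc 0 T, ‖F n t‖ ≤ K * M ^ n) {t : ℝ} (ht : t ∈ Icc 0 T) :
    HasSum (fun j : ℕ => ((t ^ j / j.factorial : ℝ) : ℂ) * F j 0) (F 0 t) := by
  have h0 : (0 : ℝ) ∈ Icc 0 T := ⟨le_rfl, ht.1.trans ht.2⟩
  have hsum : Summable (fun j : ℕ => ((t ^ j / j.factorial : ℝ) : ℂ) * F j 0) := by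
    refine Summable.of_norm_bounded ((Real.summable_pow_div_factorial (M * t)).mul_left K)
      fun j => ?_
    rw [norm_mul, Complex.norm_real, Real.norm_of_nonneg (by have := ht.1; positivity)]
    have := ht.1
    calc t ^ j / j.factorial * ‖F j 0‖ ≤ t ^ j / j.factorial * (K * M ^ j) := by
          gcongr; exact hb j 0 h0
      _ = K * ((M * t) ^ j / j.factorial) := by rw [mul_pow]; ring
  rw [hsum.hasSum_iff_tendsto_nat, tendsto_iff_norm_sub_tendsto_zero]
  refine squeeze_zero (fun _ => norm_nonneg _) (fun N => ?_)
    ((FloorSemiring.tendsto_pow_div_factorial_atTop (M * t)).const_mul K |>.trans (by simp))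
  rw [norm_sub_rev]
  refine (by simpa using norm_sub_taylor_le hd hb N 0 t ht :
    _ ≤ K * M ^ N * (t ^ N / N.factorial)).trans_eq ?_
  rw [mul_pow]; ring

/-! ### The system on the Fourier side -/

/-- Values of the Fourier transform of a state. -/
abbrev X : Type := Fin 4 → Fin 3 → ℂ

/-- The symbol of the curl. -/
def curlS (ξ : V) (b : Fin 3 → ℂ) (k : Fin 3) : ℂ := ds (k + 1) ξ * b (k + 2) - ds (k + 2) ξ * b (k + 1)

/-- The symbol of the generator. -/
def opA (P : Params) (ξ : V) : X →L[ℂ] X :=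
  LinearMap.toContinuousLinearMap
    { toFun := fun x => ![fun k => (P.e / P.mi : ℝ) * x 2 k - P.nui * x 0 k,
        fun k => -((P.e / P.me : ℝ) * x 2 k) - P.nue * x 1 k,
        fun k => P.c * curlS ξ (x 3) k - (4 * Real.pi * P.e : ℝ) * (x 0 k - x 1 k),
        fun k => -(P.c * curlS ξ (x 2) k)]
      map_add' := fun x y => by
        funext a k
        fin_cases a <;> simp [curlS] <;> ring
      map_smul' := fun r x => by
        funext a k
        fin_cases a <;> simp [curlS] <;> ring }

lemma opA_zero (P : Params) (ξ : V) (x : X) (k : Fin 3) :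
    opA P ξ x 0 k = (P.e / P.mi : ℝ) * x 2 k - P.nui * x 0 k := rfl

lemma opA_one (P : Params) (ξ : V) (x : X) (k : Fin 3) :
    opA P ξ x 1 k = -((P.e / P.me : ℝ) * x 2 k) - P.nue * x 1 k := rfl

lemma opA_two (P : Params) (ξ : V) (x : X) (k : Fin 3) : opA P ξ x 2 k =
    P.c * curlS ξ (x 3) k - (4 * Real.pi * P.e : ℝ) * (x 0 k - x 1 k) := rfl

lemma opA_three (P : Params) (ξ : V) (x : X) (k : Fin 3) :
    opA P ξ x 3 k = -(P.c * curlS ξ (x 2) k) := rfl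

lemma continuous_opA (P : Params) : Continuous (opA P) := by
  rw [continuous_clm_apply]
  intro x
  refine continuous_pi fun a => continuous_pi fun k => ?_
  have hd := continuous_ds
  fin_cases a
  · exact continuous_const
  · exact continuous_const
  · simp only [Fin.reduceFinMk, opA_two, curlS]; fun_prop
  · simp only [Fin.reduceFinMk, opA_three, curlS]; fun_prop

/-- A family of test functions, one for each component of a state. -/
abbrev Tests : Type := Fin 4 → Fin 3 → 𝓢(V, ℂ)

/-- The adjoint of the generator on test functions. -/
def adj (P : Params) (θ : Tests) : Tests :=
  ![fun k => (-P.nui : ℂ) • θ 0 k - ((4 * Real.pi * P.e : ℝ) : ℂ) • θ 2 k,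
    fun k => (-P.nue : ℂ) • θ 1 k + ((4 * Real.pi * P.e : ℝ) : ℂ) • θ 2 k,
    fun k => ((P.e / P.mi : ℝ) : ℂ) • θ 0 k - ((P.e / P.me : ℝ) : ℂ) • θ 1 k +
      (P.c : ℂ) • (mulCoord (k + 2) (θ 3 (k + 1)) - mulCoord (k + 1) (θ 3 (k + 2))),
    fun k => (-P.c : ℂ) • (mulCoord (k + 2) (θ 2 (k + 1)) - mulCoord (k + 1) (θ 2 (k + 2)))]

/-- The pointwise pairing. -/
def pt (θ : Tests) (ξ : V) (x : X) : ℂ := ∑ a, ∑ k, θ a k ξ * x a k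

/-- The generator is unbounded in ξ, so it is moved to the test functions; `mulCoord` carries the
opposite sign to `ds`, which accounts for the signs in `adj`. -/
lemma pt_adj (P : Params) (θ : Tests) (ξ : V) (x : X) :
    pt (adj P θ) ξ x = pt θ ξ (opA P ξ x) := by
  simp only [pt, Fin.sum_univ_four, opA_zero, opA_one, opA_two, opA_three, adj, curlS]
  simp only [Fin.sum_univ_three, Matrix.cons_val, add_apply, sub_apply, smul_apply,
    mulCoord_apply, smul_eq_mul, ds]
  simp only [show (0 : Fin 3) + 1 = 1 from rfl, show (0 : Fin 3) + 2 = 2 from rfl,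
    show (1 : Fin 3) + 1 = 2 from rfl, show (1 : Fin 3) + 2 = 0 from rfl,
    show (2 : Fin 3) + 1 = 0 from rfl, show (2 : Fin 3) + 2 = 1 from rfl]
  ring

lemma pt_adj_iterate (P : Params) (θ : Tests) (ξ : V) (n : ℕ) (x : X) :
    pt ((adj P)^[n] θ) ξ x = pt θ ξ ((opA P ξ ^ n) x) := by
  induction n generalizing x with
  | zero => simp
  | succ n ih =>
    rw [Function.iterate_succ_apply', pt_adj, ih, pow_succ, mul_apply_eq_comp]

lemma hasCompactSupport_adj (P : Params) {θ : Tests} (hθ : ∀ a k, HasCompactSupport (θ a k))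
    (a : Fin 4) (k : Fin 3) : HasCompactSupport (adj P θ a k) := by
  have hs : ∀ (c : ℂ) (φ : 𝓢(V, ℂ)), HasCompactSupport φ → HasCompactSupport (c • φ) :=
    fun c φ h => by
      have : ((c • φ : 𝓢(V, ℂ)) : V → ℂ) = fun x => c * φ x := rfl
      rw [this]
      exact h.mul_left
  have ha : ∀ (φ χ : 𝓢(V, ℂ)), HasCompactSupport φ → HasCompactSupport χ →
      HasCompactSupport (φ + χ) := fun φ χ h h' => HasCompactSupport.add h h'
  have hn : ∀ (φ χ : 𝓢(V, ℂ)), HasCompactSupport φ → HasCompactSupport χ →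
      HasCompactSupport (φ - χ) := fun φ χ h h' => HasCompactSupport.sub h h'
  have hm := fun j (φ : 𝓢(V, ℂ)) (h : HasCompactSupport φ) => hasCompactSupport_mulCoord j h
  fin_cases a
  · exact hn _ _ (hs _ _ (hθ _ _)) (hs _ _ (hθ _ _))
  · exact ha _ _ (hs _ _ (hθ _ _)) (hs _ _ (hθ _ _))
  · exact ha _ _ (hn _ _ (hs _ _ (hθ _ _)) (hs _ _ (hθ _ _)))
      (hs _ _ (hn _ _ (hm _ _ (hθ _ _)) (hm _ _ (hθ _ _))))
  · exact hs _ _ (hn _ _ (hm _ _ (hθ _ _)) (hm _ _ (hθ _ _)))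

lemma hasCompactSupport_adj_iterate (P : Params) {θ : Tests}
    (hθ : ∀ a k, HasCompactSupport (θ a k)) (n : ℕ) (a : Fin 4) (k : Fin 3) :
    HasCompactSupport ((adj P)^[n] θ a k) := by
  induction n generalizing a k with
  | zero => exact hθ a k
  | succ n ih =>
    rw [Function.iterate_succ_apply']
    exact hasCompactSupport_adj P ih a k

lemma norm_le_sum (x : X) : ‖x‖ ≤ ∑ b, ∑ l, ‖x b l‖ := by
  refine (pi_norm_le_iff_of_nonneg (by positivity)).2 fun b =>
    (pi_norm_le_iff_of_nonneg (by positivity)).2 fun l => ?_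
  refine (Finset.single_le_sum (f := fun l => ‖x b l‖) (fun _ _ => norm_nonneg _)
    (Finset.mem_univ l)).trans ?_
  exact Finset.single_le_sum (f := fun b => ∑ l, ‖x b l‖) (fun _ _ => by positivity)
    (Finset.mem_univ b)

lemma norm_pt_le (θ : Tests) (ξ : V) (x : X) : ‖pt θ ξ x‖ ≤ (∑ a, ∑ k, ‖θ a k ξ‖) * ‖x‖ := by
  rw [pt, Finset.sum_mul]
  refine (norm_sum_le _ _).trans (Finset.sum_le_sum fun a _ => ?_)
  rw [Finset.sum_mul]
  refine (norm_sum_le _ _).trans (Finset.sum_le_sum fun k _ => ?_)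
  rw [norm_mul]
  gcongr
  exact (norm_le_pi_norm (x a) k).trans (norm_le_pi_norm x a)

/-- `opA` grows with ξ but is continuous, hence bounded by some M on the compact supports of the
tests; elsewhere the pairing vanishes. This geometric growth in n makes the time Taylor series
converge. -/
lemma exists_norm_pt_adj_le (P : Params) {θ : Tests} (hθ : ∀ a k, HasCompactSupport (θ a k)) :
    ∃ M : ℝ, 0 ≤ M ∧ ∀ n ξ (x : X), ‖pt θ ξ ((opA P ξ ^ n) x)‖ ≤
      M ^ n * ((∑ a, ∑ k, ‖θ a k ξ‖) * ‖x‖) := by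
  have hc : IsCompact (⋃ a, ⋃ k, tsupport (θ a k)) :=
    isCompact_iUnion fun a => isCompact_iUnion fun k => (hθ a k)
  obtain ⟨M, hM⟩ := hc.exists_bound_of_continuousOn (continuous_opA P).continuousOn
  refine ⟨max M 0, le_max_right _ _, fun n ξ x => ?_⟩
  by_cases hξ : ξ ∈ ⋃ a, ⋃ k, tsupport (θ a k)
  · refine (norm_pt_le _ _ _).trans ?_
    have h1 : ‖(opA P ξ ^ n) x‖ ≤ (max M 0) ^ n * ‖x‖ := by
      refine (ContinuousLinearMap.le_opNorm _ _).trans ?_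
      gcongr
      refine (norm_pow_le _ n).trans ?_
      gcongr
      exact (hM ξ hξ).trans (le_max_left _ _)
    calc _ ≤ (∑ a, ∑ k, ‖θ a k ξ‖) * ((max M 0) ^ n * ‖x‖) := by gcongr
      _ = _ := by ring
  · have h0 : ∀ a k, θ a k ξ = 0 := fun a k => by
      refine image_eq_zero_of_notMem_tsupport fun h => hξ ?_
      exact mem_iUnion.2 ⟨a, mem_iUnion.2 ⟨k, h⟩⟩
    simp [pt, h0]

/-! ### Representation of solutions on the Fourier side -/

lemma pr_add (φ χ : 𝓢(V, ℂ)) (u : L2) : pr (φ + χ) u = pr φ u + pr χ u := by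
  simp only [pr_eq_pairCLM, map_add]

lemma pr_sub (φ χ : 𝓢(V, ℂ)) (u : L2) : pr (φ - χ) u = pr φ u - pr χ u := by
  simp only [pr_eq_pairCLM, map_sub]

lemma pr_smul (c : ℂ) (φ : 𝓢(V, ℂ)) (u : L2) : pr (c • φ) u = c * pr φ u := by
  simp only [pr_eq_pairCLM, map_smul, smul_eq_mul]

/-- The evolution equations of the Fourier transform, paired with test functions. -/
structure FourierEvolution (P : Params) (v : Fin 4 → Fin 3 → ℝ → L2) : Prop where
  cont : ∀ a k, Continuous (v a k)
  eq_ui : ∀ k (ψ : 𝓢(V, ℂ)), HasCompactSupport ψ → ∀ t, 0 ≤ t →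
    HasDerivWithinAt (fun s => pr ψ (v 0 k s))
      ((P.e / P.mi : ℝ) * pr ψ (v 2 k t) - P.nui * pr ψ (v 0 k t)) (Ici 0) t
  eq_ue : ∀ k (ψ : 𝓢(V, ℂ)), HasCompactSupport ψ → ∀ t, 0 ≤ t →
    HasDerivWithinAt (fun s => pr ψ (v 1 k s))
      (-((P.e / P.me : ℝ) * pr ψ (v 2 k t)) - P.nue * pr ψ (v 1 k t)) (Ici 0) t
  eq_E : ∀ k (ψ : 𝓢(V, ℂ)), HasCompactSupport ψ → ∀ t, 0 ≤ t →
    HasDerivWithinAt (fun s => pr ψ (v 2 k s))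
      (P.c * (pr (mulCoord (k + 2) ψ) (v 3 (k + 1) t) - pr (mulCoord (k + 1) ψ) (v 3 (k + 2) t)) -
        (4 * Real.pi * P.e : ℝ) * (pr ψ (v 0 k t) - pr ψ (v 1 k t))) (Ici 0) t
  eq_B : ∀ k (ψ : 𝓢(V, ℂ)), HasCompactSupport ψ → ∀ t, 0 ≤ t →
    HasDerivWithinAt (fun s => pr ψ (v 3 k s))
      (-(P.c * (pr (mulCoord (k + 2) ψ) (v 2 (k + 1) t) - pr (mulCoord (k + 1) ψ) (v 2 (k + 2) t))))
      (Ici 0) t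

lemma FourierEvolution.hasDerivWithinAt {P : Params} {v : Fin 4 → Fin 3 → ℝ → L2}
    (h : FourierEvolution P v) {θ : Tests} (hθ : ∀ a k, HasCompactSupport (θ a k)) {t : ℝ}
    (ht : 0 ≤ t) :
    HasDerivWithinAt (fun s => ∑ a, ∑ k, pr (θ a k) (v a k s))
      (∑ a, ∑ k, pr (adj P θ a k) (v a k t)) (Ici 0) t := by
  simp only [Fin.sum_univ_four]
  have h0 := HasDerivWithinAt.fun_sum (u := Finset.univ) fun k _ => h.eq_ui k _ (hθ 0 k) t ht
  have h1 := HasDerivWithinAt.fun_sum (u := Finset.univ) fun k _ => h.eq_ue k _ (hθ 1 k) t ht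
  have h2 := HasDerivWithinAt.fun_sum (u := Finset.univ) fun k _ => h.eq_E k _ (hθ 2 k) t ht
  have h3 := HasDerivWithinAt.fun_sum (u := Finset.univ) fun k _ => h.eq_B k _ (hθ 3 k) t ht
  refine (((h0.add h1).add h2).add h3).congr_deriv ?_
  simp only [adj, Matrix.cons_val, pr_add, pr_sub, pr_smul]
  simp only [Fin.sum_univ_three]
  simp only [show (0 : Fin 3) + 1 = 1 from rfl, show (0 : Fin 3) + 2 = 2 from rfl,
    show (1 : Fin 3) + 1 = 2 from rfl, show (1 : Fin 3) + 2 = 0 from rfl,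
    show (2 : Fin 3) + 1 = 0 from rfl, show (2 : Fin 3) + 2 = 1 from rfl]
  ring

/-- Evaluating the pointwise bound at unit vectors isolates one component of the iterated adjoint,
which is thus dominated by Mⁿ times a fixed L² function. -/
lemma exists_norm_pr_adj_le (P : Params) {θ : Tests} (hθ : ∀ a k, HasCompactSupport (θ a k)) :
    ∃ K M : ℝ, 0 ≤ K ∧ 0 ≤ M ∧ ∀ n a k (u : L2), ‖pr ((adj P)^[n] θ a k) u‖ ≤ K * M ^ n * ‖u‖ := by
  obtain ⟨M, hM0, hM⟩ := exists_norm_pt_adj_le P hθ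
  have hm : MemLp (fun ξ => ∑ a, ∑ k, ‖θ a k ξ‖) 2 (volume : Measure V) :=
    memLp_finsetSum _ fun a _ => memLp_finsetSum _ fun k _ => ((θ a k).memLp 2 volume).norm
  refine ⟨‖(ContinuousLinearMap.mul ℂ ℂ).lpPairing (volume : Measure V) 2 2‖ * ‖hm.toLp _‖, M,
    by positivity, hM0, fun n a k u => ?_⟩
  refine (ContinuousLinearMap.le_opNorm₂ _ _ _).trans ?_
  rw [mul_assoc _ ‖hm.toLp _‖ (M ^ n)]
  gcongr
  rw [mul_comm]
  refine Lp.norm_le_mul_norm_of_ae_le_mul ?_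
  filter_upwards [((adj P)^[n] θ a k).coeFn_toLp 2 volume, hm.coeFn_toLp] with ξ h1 h2
  rw [h1, h2, Real.norm_of_nonneg (by positivity)]
  have h3 := hM n ξ (Pi.single a (Pi.single k 1))
  rw [← pt_adj_iterate] at h3
  have h4 : pt ((adj P)^[n] θ) ξ (Pi.single a (Pi.single k 1)) = (adj P)^[n] θ a k ξ := by
    rw [pt, Finset.sum_eq_single a, Finset.sum_eq_single k]
    · simp
    · intro l _ hl; simp [hl]
    · simp
    · intro b _ hb; simp [hb]
    · simp
  rw [h4] at h3
  refine h3.trans ?_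
  have h5 : ‖(Pi.single a (Pi.single k 1) : X)‖ ≤ 1 := by
    rw [Pi.norm_single, Pi.norm_single, norm_one]
  have h6 : 0 ≤ ∑ a, ∑ k, ‖θ a k ξ‖ := by positivity
  gcongr
  exact mul_le_of_le_one_right h6 h5

/-- The value of the solution operator of the ordinary differential equation at frequency `ξ`. -/
def prop (P : Params) (t : ℝ) (ξ : V) : X →L[ℂ] X := NormedSpace.exp ((t : ℂ) • opA P ξ)

lemma continuous_prop (P : Params) (t : ℝ) : Continuous (prop P t) := by
  have : NormedAlgebra ℚ (X →L[ℂ] X) := NormedAlgebra.restrictScalars ℚ ℂ _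
  exact NormedSpace.exp_continuous.comp ((continuous_const_smul (t : ℂ)).comp (continuous_opA P))

lemma smul_clm_pow (c : ℂ) (A : X →L[ℂ] X) (n : ℕ) : (c • A) ^ n = c ^ n • A ^ n := by
  induction n with
  | zero => simp
  | succ n ih =>
    rw [pow_succ, ih, pow_succ c, pow_succ A]
    refine ContinuousLinearMap.ext fun x => ?_
    simp only [mul_apply_eq_comp, smul_apply, map_smul, mul_smul]
    rw [smul_comm]

lemma hasSum_prop (P : Params) (t : ℝ) (θ : Tests) (ξ : V) (x : X) :
    HasSum (fun n : ℕ => ((t ^ n / n.factorial : ℝ) : ℂ) * pt θ ξ ((opA P ξ ^ n) x))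
      (pt θ ξ (prop P t ξ x)) := by
  have h := NormedSpace.exp_series_hasSum_exp' (𝕂 := ℂ) ((t : ℂ) • opA P ξ)
  let l : (X →L[ℂ] X) →L[ℂ] ℂ := LinearMap.toContinuousLinearMap
    { toFun := fun T => pt θ ξ (T x)
      map_add' := fun T S => by simp [pt, mul_add, Finset.sum_add_distrib]
      map_smul' := fun r T => by
        simp only [pt, smul_apply, Pi.smul_apply, smul_eq_mul, mul_left_comm _ r, Finset.mul_sum,
          RingHom.id_apply] }
  have h2 := h.mapL l
  have h3 : ∀ n : ℕ, l ((n.factorial : ℂ)⁻¹ • ((t : ℂ) • opA P ξ) ^ n) =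
      ((t ^ n / n.factorial : ℝ) : ℂ) * pt θ ξ ((opA P ξ ^ n) x) := fun n => by
    rw [smul_clm_pow, map_smul, map_smul, smul_eq_mul, smul_eq_mul]
    change _ * (_ * pt θ ξ ((opA P ξ ^ n) x)) = _
    push_cast
    ring
  simp only [h3] at h2
  exact h2

lemma locallyIntegrable_prop (P : Params) (t : ℝ) {x : V → X}
    (hx : ∀ b l, LocallyIntegrable (fun ξ => x ξ b l) volume) (a : Fin 4) (k : Fin 3) :
    LocallyIntegrable (fun ξ => prop P t ξ (x ξ) a k) volume := by
  have h : (fun ξ => prop P t ξ (x ξ) a k) = fun ξ => ∑ b, ∑ l,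
      prop P t ξ (Pi.single b (Pi.single l 1)) a k * x ξ b l := by
    funext ξ
    have hs : x ξ = ∑ b, ∑ l, x ξ b l • (Pi.single b (Pi.single l 1) : X) := by
      funext b l
      rw [Finset.sum_apply, Finset.sum_apply, Finset.sum_eq_single b, Finset.sum_apply,
        Finset.sum_apply, Finset.sum_eq_single l]
      · simp
      · intro l' _ hl; simp [hl.symm]
      · simp
      · intro b' _ hb; simp [Finset.sum_apply, hb.symm]
      · simp
    conv_lhs => rw [hs]
    simp only [map_sum, map_smul, Finset.sum_apply, Pi.smul_apply, smul_eq_mul]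
    simp only [mul_comm]
  rw [h]
  refine locallyIntegrable_finsetSum _ fun b _ => locallyIntegrable_finsetSum _ fun l _ =>
    locallyIntegrable_continuous_mul ?_ (hx b l)
  have h1 := (continuous_prop P t).clm_apply
    (continuous_const (y := (Pi.single b (Pi.single l 1) : X)))
  exact (continuous_apply k).comp ((continuous_apply a).comp h1)

lemma integrable_pt_pow (P : Params) (θ : Tests) (w : Fin 4 → Fin 3 → L2) (n : ℕ) :
    Integrable (fun ξ => pt θ ξ ((opA P ξ ^ n) (fun b l => w b l ξ))) volume := by
  have he : (fun ξ => pt θ ξ ((opA P ξ ^ n) (fun b l => w b l ξ))) =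
      fun ξ => ∑ b, ∑ l, (adj P)^[n] θ b l ξ * w b l ξ :=
    funext fun ξ => (pt_adj_iterate P θ ξ n _).symm
  rw [he]
  exact integrable_finsetSum _ fun b _ => integrable_finsetSum _ fun l _ =>
    integrable_schwartz_mul (by norm_num) (Lp.memLp _) _

lemma integral_pt_pow (P : Params) (θ : Tests) (w : Fin 4 → Fin 3 → L2) (n : ℕ) :
    ∫ ξ, pt θ ξ ((opA P ξ ^ n) (fun b l => w b l ξ)) =
      ∑ b, ∑ l, pr ((adj P)^[n] θ b l) (w b l) := by
  have he : (fun ξ => pt θ ξ ((opA P ξ ^ n) (fun b l => w b l ξ))) =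
      fun ξ => ∑ b, ∑ l, (adj P)^[n] θ b l ξ * w b l ξ :=
    funext fun ξ => (pt_adj_iterate P θ ξ n _).symm
  have hi : ∀ b l, Integrable (fun ξ => (adj P)^[n] θ b l ξ * w b l ξ) volume := fun b l =>
    integrable_schwartz_mul (by norm_num) (Lp.memLp _) _
  rw [he, integral_finsetSum _ fun b _ => integrable_finsetSum _ fun l _ => hi b l]
  refine Finset.sum_congr rfl fun b _ => ?_
  rw [integral_finsetSum _ fun l _ => hi b l]
  exact Finset.sum_congr rfl fun l _ => (pr_apply _ _).symm

lemma integrable_sum_mul_sum (θ : Tests) (w : Fin 4 → Fin 3 → L2) :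
    Integrable (fun ξ => (∑ b, ∑ l, ‖θ b l ξ‖) * ∑ b, ∑ l, ‖w b l ξ‖) volume := by
  simp only [Finset.sum_mul, Finset.mul_sum, ← norm_mul]
  exact integrable_finsetSum _ fun _ _ => integrable_finsetSum _ fun _ _ =>
    integrable_finsetSum _ fun _ _ => integrable_finsetSum _ fun _ _ =>
      (integrable_schwartz_mul (by norm_num) (Lp.memLp _) _).norm

/-- Existence of a formula and uniqueness at once. Every time derivative of the pairing with a
compactly supported test is again such a pairing, with the iterated adjoint, and these grow at most
geometrically. So the pairing equals its Taylor series, whose coefficients depend on the data at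
time 0 only; summing under the integral produces the exponential. -/
lemma FourierEvolution.ae_eq {P : Params} {v : Fin 4 → Fin 3 → ℝ → L2}
    (h : FourierEvolution P v) {t : ℝ} (ht : 0 ≤ t) (a : Fin 4) (k : Fin 3) :
    v a k t =ᵐ[volume] fun ξ => prop P t ξ (fun b l => v b l 0 ξ) a k := by
  have h12 : (1 : ℝ≥0∞) ≤ 2 := by norm_num
  refine ae_eq_of_integral_schwartz_mul_eq ((Lp.memLp _).locallyIntegrable h12)
    (locallyIntegrable_prop P t (fun b l => (Lp.memLp (v b l 0)).locallyIntegrable h12) a k)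
    fun ψ hψ => ?_
  let θ : Tests := Pi.single a (Pi.single k ψ)
  have hθs : ∀ b l, θ b l = if b = a ∧ l = k then ψ else 0 := fun b l => by
    by_cases hb : b = a
    · subst hb
      by_cases hl : l = k
      · subst hl; simp [θ]
      · simp [θ, hl]
    · simp [θ, hb]
  have hθ : ∀ b l, HasCompactSupport (θ b l) := fun b l => by
    rw [hθs]
    split_ifs
    · exact hψ
    · exact HasCompactSupport.zero
  have hpt : ∀ ξ x, pt θ ξ x = ψ ξ * x a k := fun ξ x => by
    rw [pt, Finset.sum_eq_single a, Finset.sum_eq_single k]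
    · simp [hθs]
    · intro l _ hl; simp [hθs, hl]
    · simp
    · intro b _ hb; simp [hθs, hb]
    · simp
  -- F n is the n-th time derivative of the pairing with ψ in component (a, k).
  let F : ℕ → ℝ → ℂ := fun n s => ∑ b, ∑ l, pr ((adj P)^[n] θ b l) (v b l s)
  have hFd : ∀ n s, 0 ≤ s → HasDerivWithinAt (F n) (F (n + 1) s) (Ici 0) s := fun n s hs => by
    have := h.hasDerivWithinAt (hasCompactSupport_adj_iterate P hθ n) hs
    simp only [F, Function.iterate_succ_apply']
    exact this
  obtain ⟨K, M, hK, hM, hKM⟩ := exists_norm_pr_adj_le P hθ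
  have hvb : ∃ R, ∀ s ∈ Icc 0 t, ‖∑ b, ∑ l, ‖v b l s‖‖ ≤ R := by
    refine isCompact_Icc.exists_bound_of_continuousOn (Continuous.continuousOn ?_)
    exact continuous_finsetSum _ fun b _ => continuous_finsetSum _ fun l _ => (h.cont b l).norm
  obtain ⟨R, hR⟩ := hvb
  have hFb : ∀ n, ∀ s ∈ Icc 0 t, ‖F n s‖ ≤ K * |R| * M ^ n := fun n s hs => by
    calc ‖F n s‖ ≤ ∑ b, ∑ l, K * M ^ n * ‖v b l s‖ := by
          refine (norm_sum_le _ _).trans (Finset.sum_le_sum fun b _ => ?_)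
          refine (norm_sum_le _ _).trans (Finset.sum_le_sum fun l _ => ?_)
          exact hKM n b l (v b l s)
      _ = K * M ^ n * ∑ b, ∑ l, ‖v b l s‖ := by simp only [Finset.mul_sum]
      _ ≤ K * M ^ n * |R| := by
          gcongr
          exact (le_abs_self _).trans ((hR s hs).trans (le_abs_self _))
      _ = _ := by ring
  have hT := hasSum_taylor hFd hFb (right_mem_Icc.2 ht)
  have hF0 : F 0 t = ∫ ξ, ψ ξ * v a k t ξ := by
    rw [← pr_apply]
    simp only [F, Function.iterate_zero, id]
    rw [Finset.sum_eq_single a, Finset.sum_eq_single k]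
    · simp [hθs]
    · intro l _ hl
      simp [hθs, hl, pr_apply]
    · simp
    · intro b _ hb
      simp [hθs, hb, pr_apply]
    · simp
  have hint := integrable_pt_pow P θ fun b l => v b l 0
  have hFn : ∀ n, F n 0 = ∫ ξ, pt θ ξ ((opA P ξ ^ n) (fun b l => v b l 0 ξ)) := fun n =>
    (integral_pt_pow P θ (fun b l => v b l 0) n).symm
  obtain ⟨M', hM0, hM'⟩ := exists_norm_pt_adj_le P hθ
  have hG := integrable_sum_mul_sum θ fun b l => v b l 0
  -- Interchange of sum and integral, dominated by Σ (M't)ⁿ/n! times a fixed integrable function.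
  have hS := hasSum_integral_of_summable_integral_norm
    (F := fun (n : ℕ) ξ => ((t ^ n / n.factorial : ℝ) : ℂ) *
      pt θ ξ ((opA P ξ ^ n) (fun b l => v b l 0 ξ)))
    (fun n => (hint n).const_mul _) (by
      refine Summable.of_nonneg_of_le (fun n => integral_nonneg fun _ => norm_nonneg _)
        (fun n => ?_) ((Real.summable_pow_div_factorial (M' * t)).mul_right
          (∫ ξ, (∑ b, ∑ l, ‖θ b l ξ‖) * ∑ b, ∑ l, ‖v b l 0 ξ‖))
      rw [← integral_const_mul]
      refine integral_mono ((hint n).const_mul _).norm (hG.const_mul _) fun ξ => ?_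
      beta_reduce
      rw [norm_mul, Complex.norm_real, Real.norm_of_nonneg (by positivity), mul_pow, mul_comm (M' ^ n),
        mul_div_right_comm, mul_assoc]
      gcongr
      refine (hM' n ξ _).trans ?_
      gcongr
      exact norm_le_sum _)
  have hS' : (∫ ξ, ∑' n : ℕ, ((t ^ n / n.factorial : ℝ) : ℂ) *
      pt θ ξ ((opA P ξ ^ n) (fun b l => v b l 0 ξ))) =
      ∫ ξ, ψ ξ * prop P t ξ (fun b l => v b l 0 ξ) a k := by
    refine integral_congr_ae (Eventually.of_forall fun ξ => ?_)
    beta_reduce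
    rw [(hasSum_prop P t θ ξ _).tsum_eq, hpt]
  simp only [integral_const_mul, ← hFn] at hS
  rw [hS'] at hS
  rw [← hF0]
  exact hT.unique hS

/-! ### From the weak formulation to the Fourier side -/

/-- Multiplication by a constant on the Schwartz space. -/
def scal (r : ℝ) : 𝓢(V, ℂ) →L[ℂ] 𝓢(V, ℂ) := (r : ℂ) • ContinuousLinearMap.id ℂ 𝓢(V, ℂ)

/-- A constant multiple of a partial derivative on the Schwartz space. -/
def scalD (r : ℝ) (j : Fin 3) : 𝓢(V, ℂ) →L[ℂ] 𝓢(V, ℂ) :=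
  (r : ℂ) • LineDeriv.lineDerivOpCLM ℂ 𝓢(V, ℂ) (basisVec j)

lemma pr_scal (r : ℝ) (φ : 𝓢(V, ℂ)) (u : L2) : pr (scal r φ) u = r * pr φ u := pr_smul _ _ _

lemma pr_scalD (r : ℝ) (j : Fin 3) (φ : 𝓢(V, ℂ)) (u : L2) :
    pr (scalD r j φ) u = r * pr (∂_{basisVec j} φ) u := pr_smul _ _ _

lemma pr_lineDeriv_toS_curve {f : ℝ → V → V} (hf : ContinuousInL2 f) (j k : Fin 3) {t : ℝ}
    (ht : 0 ≤ t) {η : V → ℝ} (hη : IsTest η) :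
    pr (∂_{basisVec j} (toS hη)) (curve hf k t) = ((∫ x, dd j η x * f t x k : ℝ) : ℂ) := by
  rw [lineDeriv_toS, pr_toS_curve hf k ht]

lemma continuous_fourier_L2 : Continuous fun u : L2 => (𝓕 u : L2) :=
  (Lp.fourierTransformₗᵢ V ℂ).continuous

/-- The Fourier transforms of the components of a solution, as curves in `L²`. -/
def IsSolution.hat {P : Params} {U : ℝ → State} (h : IsSolution P U) (a : Fin 4) (k : Fin 3)
    (t : ℝ) : L2 :=
  𝓕 ((![curve h.cont_ui, curve h.cont_ue, curve h.cont_E, curve h.cont_B] :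
    Fin 4 → Fin 3 → ℝ → L2) a k t)

/-- Tests with one nonzero component turn the weak formulation into scalar equations with at most
one space derivative, placed on the test. They extend to Schwartz functions by
`hasDerivWithinAt_pr_of_tests`, and are then evaluated at 𝓕ψ. -/
lemma IsSolution.fourierEvolution {P : Params} {U : ℝ → State} (h : IsSolution P U) :
    FourierEvolution P h.hat := by
  have h12 : (1 : ℝ≥0∞) ≤ 2 := by norm_num
  have cu := continuous_curve h.cont_ui
  have ce := continuous_curve h.cont_ue
  have cE := continuous_curve h.cont_E
  have cB := continuous_curve h.cont_B
  refine ⟨fun a k => ?_, fun k ψ hψ t ht => ?_, fun k ψ hψ t ht => ?_, fun k ψ hψ t ht => ?_,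
    fun k ψ hψ t ht => ?_⟩
  · refine continuous_fourier_L2.comp ?_
    fin_cases a
    · exact cu k
    · exact ce k
    · exact cE k
    · exact cB k
  · have key := hasDerivWithinAt_pr_of_tests (f := curve h.cont_ui k)
      (g := ![curve h.cont_E k, curve h.cont_ui k])
      (fun i => by fin_cases i; exacts [cE k, cu k])
      ![scal (P.e / P.mi), scal (-P.nui)] (fun η hη s hs => by
        refine ((h.eq_ui _ (isTest_single hη k)).hasDerivWithinAt P.mi_pos.ne'
          (Fc := fun s => pr (toS hη) (curve h.cont_ui k s)) (fun τ hτ => ?_) hs).congr_deriv ?_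
        · rw [pr_toS_curve h.cont_ui k hτ, integral_inner_single]
        · have hm : (P.mi : ℂ) ≠ 0 := by exact_mod_cast P.mi_pos.ne'
          simp only [Fin.sum_univ_two, Matrix.cons_val_zero, Matrix.cons_val_one, pr_scal,
            pr_toS_curve h.cont_ui k hs, pr_toS_curve h.cont_E k hs, integral_inner_single]
          push_cast
          field_simp
          ring) (𝓕 ψ) ht
    simp only [Fin.sum_univ_two, Matrix.cons_val_zero, Matrix.cons_val_one, pr_scal,
      pr_fourier hψ] at key
    refine key.congr_deriv ?_
    simp only [IsSolution.hat, Matrix.cons_val]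
    push_cast
    ring
  · have key := hasDerivWithinAt_pr_of_tests (f := curve h.cont_ue k)
      (g := ![curve h.cont_E k, curve h.cont_ue k])
      (fun i => by fin_cases i; exacts [cE k, ce k])
      ![scal (-(P.e / P.me)), scal (-P.nue)] (fun η hη s hs => by
        refine ((h.eq_ue _ (isTest_single hη k)).hasDerivWithinAt P.me_pos.ne'
          (Fc := fun s => pr (toS hη) (curve h.cont_ue k s)) (fun τ hτ => ?_) hs).congr_deriv ?_
        · rw [pr_toS_curve h.cont_ue k hτ, integral_inner_single]
        · have hm : (P.me : ℂ) ≠ 0 := by exact_mod_cast P.me_pos.ne'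
          simp only [Fin.sum_univ_two, Matrix.cons_val_zero, Matrix.cons_val_one, pr_scal,
            pr_toS_curve h.cont_ue k hs, pr_toS_curve h.cont_E k hs, integral_inner_single]
          push_cast
          field_simp
          ring) (𝓕 ψ) ht
    simp only [Fin.sum_univ_two, Matrix.cons_val_zero, Matrix.cons_val_one, pr_scal,
      pr_fourier hψ] at key
    refine key.congr_deriv ?_
    simp only [IsSolution.hat, Matrix.cons_val]
    push_cast
    ring
  · have key := hasDerivWithinAt_pr_of_tests (f := curve h.cont_E k)
      (g := ![curve h.cont_B (k + 1), curve h.cont_B (k + 2), curve h.cont_ui k, curve h.cont_ue k])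
      (fun i => by fin_cases i; exacts [cB _, cB _, cu k, ce k])
      ![scalD P.c (k + 2), scalD (-P.c) (k + 1), scal (-(4 * Real.pi * P.e)),
        scal (4 * Real.pi * P.e)] (fun η hη s hs => by
        refine ((h.eq_E _ (isTest_single hη k)).hasDerivWithinAt one_ne_zero
          (Fc := fun s => pr (toS hη) (curve h.cont_E k s)) (fun τ hτ => ?_) hs).congr_deriv ?_
        · rw [pr_toS_curve h.cont_E k hτ, integral_inner_single]
        · simp only [Fin.sum_univ_four, Matrix.cons_val, pr_scal, pr_scalD,
            pr_toS_curve h.cont_ui k hs, pr_toS_curve h.cont_ue k hs,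
            pr_lineDeriv_toS_curve h.cont_B _ _ hs, integral_inner_single,
            integral_inner_curl_single h12 (h.cont_B.1 s hs) hη]
          push_cast
          ring) (𝓕 ψ) ht
    simp only [Fin.sum_univ_four, Matrix.cons_val, pr_scal, pr_scalD, lineDeriv_fourier,
      pr_fourier hψ, pr_fourier (hasCompactSupport_mulCoord _ hψ)] at key
    refine key.congr_deriv ?_
    simp only [IsSolution.hat, Matrix.cons_val]
    push_cast
    ring
  · have key := hasDerivWithinAt_pr_of_tests (f := curve h.cont_B k)
      (g := ![curve h.cont_E (k + 1), curve h.cont_E (k + 2)])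
      (fun i => by fin_cases i; exacts [cE _, cE _])
      ![scalD (-P.c) (k + 2), scalD P.c (k + 1)] (fun η hη s hs => by
        refine ((h.eq_B _ (isTest_single hη k)).hasDerivWithinAt one_ne_zero
          (Fc := fun s => pr (toS hη) (curve h.cont_B k s)) (fun τ hτ => ?_) hs).congr_deriv ?_
        · rw [pr_toS_curve h.cont_B k hτ, integral_inner_single]
        · simp only [Fin.sum_univ_two, Matrix.cons_val_zero, Matrix.cons_val_one, pr_scalD,
            pr_lineDeriv_toS_curve h.cont_E _ _ hs,
            integral_inner_curl_single h12 (h.cont_E.1 s hs) hη]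
          push_cast
          ring) (𝓕 ψ) ht
    simp only [Fin.sum_univ_two, Matrix.cons_val_zero, Matrix.cons_val_one, pr_scalD,
      lineDeriv_fourier, pr_fourier hψ, pr_fourier (hasCompactSupport_mulCoord _ hψ)] at key
    refine key.congr_deriv ?_
    simp only [IsSolution.hat, Matrix.cons_val]
    push_cast
    ring

/-- The four fields of a state. -/
def State.field (U : State) : Fin 4 → V → V := ![U.ui, U.ue, U.E, U.B]

lemma IsSolution.memLp_field {P : Params} {U : ℝ → State} (h : IsSolution P U) {t : ℝ}
    (ht : 0 ≤ t) (a : Fin 4) : MeasureTheory.MemLp ((U t).field a) 2 volume := by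
  fin_cases a
  exacts [h.cont_ui.1 t ht, h.cont_ue.1 t ht, h.cont_E.1 t ht, h.cont_B.1 t ht]

lemma IsSolution.isFT_hat {P : Params} {U : ℝ → State} (h : IsSolution P U) {t : ℝ}
    (ht : 0 ≤ t) (a : Fin 4) (k : Fin 3) : IsFT (cp ((U t).field a) k) (h.hat a k t) := by
  refine (isFT_fourier _).congr ?_ ae_eq_rfl
  fin_cases a
  exacts [curve_ae_eq h.cont_ui k ht, curve_ae_eq h.cont_ue k ht, curve_ae_eq h.cont_E k ht,
    curve_ae_eq h.cont_B k ht]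

/-- The Fourier transform of a solution is given by the solution operator of the ordinary
differential equation. -/
lemma IsSolution.isFT {P : Params} {U : ℝ → State} (h : IsSolution P U) {x : V → X}
    (hx : ∀ a k, IsFT (cp ((U 0).field a) k) fun ξ => x ξ a k) {t : ℝ} (ht : 0 ≤ t)
    (a : Fin 4) (k : Fin 3) :
    IsFT (cp ((U t).field a) k) fun ξ => prop P t ξ (x ξ) a k := by
  refine (h.isFT_hat ht a k).congr ae_eq_rfl ((h.fourierEvolution.ae_eq ht a k).trans ?_)
  have he : ∀ᵐ ξ, ∀ b l, h.hat b l 0 ξ = x ξ b l :=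
    ae_all_iff.2 fun b => ae_all_iff.2 fun l => (h.isFT_hat le_rfl b l).unique (hx b l)
  filter_upwards [he] with ξ hξ
  have : (fun b l => h.hat b l 0 ξ) = x ξ := funext fun b => funext fun l => hξ b l
  rw [this]

/-! ### The scalar system at a fixed frequency -/

lemma le_exp_mul_of_deriv_le {Q Q' : ℝ → ℝ} {p : ℝ} (hd : ∀ t, HasDerivAt Q (Q' t) t)
    (h : ∀ t, 0 ≤ t → Q' t ≤ -p * Q t) {t : ℝ} (ht : 0 ≤ t) : Q t ≤ Real.exp (-p * t) * Q 0 := by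
  have hd2 : ∀ t, HasDerivAt (fun t => Real.exp (p * t) * Q t)
      (Real.exp (p * t) * (p * 1) * Q t + Real.exp (p * t) * Q' t) t := fun t =>
    (((hasDerivAt_id t).const_mul p).exp).mul (hd t)
  have hanti : AntitoneOn (fun t => Real.exp (p * t) * Q t) (Ici 0) := by
    refine antitoneOn_of_deriv_nonpos (convex_Ici 0)
      (fun t _ => (hd2 t).continuousAt.continuousWithinAt)
      (fun t _ => (hd2 t).differentiableAt.differentiableWithinAt) fun t hmem => ?_
    rw [interior_Ici] at hmem
    rw [(hd2 t).deriv]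
    have h1 := h t (le_of_lt hmem)
    have h2 := Real.exp_pos (p * t)
    nlinarith
  have h3 := hanti (mem_Ici.2 le_rfl) (mem_Ici.2 ht) ht
  simp only [mul_zero, Real.exp_zero, one_mul] at h3
  calc Q t = Real.exp (-p * t) * (Real.exp (p * t) * Q t) := by
        rw [← mul_assoc, ← Real.exp_add]; simp
    _ ≤ _ := by gcongr

/-- Subtracting the particular solution R/(p - r) e^{-rt} reduces this to the unforced Grönwall
inequality. -/
lemma le_of_forced_deriv_le {Q Q' : ℝ → ℝ} {p r R : ℝ} (hR : 0 ≤ R) (hpr : r < p)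
    (hd : ∀ t, HasDerivAt Q (Q' t) t)
    (h : ∀ t, 0 ≤ t → Q' t ≤ -p * Q t + R * Real.exp (-r * t)) {t : ℝ} (ht : 0 ≤ t) :
    Q t ≤ Real.exp (-p * t) * Q 0 + R / (p - r) * Real.exp (-r * t) := by
  have hp : 0 < p - r := by linarith
  have hd2 : ∀ t, HasDerivAt (fun t => Q t - R / (p - r) * Real.exp (-r * t))
      (Q' t - R / (p - r) * (Real.exp (-r * t) * (-r * 1))) t := fun t =>
    (hd t).sub ((((hasDerivAt_id t).const_mul (-r)).exp).const_mul _)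
  have := le_exp_mul_of_deriv_le (p := p) hd2 (fun s hs => by
    have h1 := h s hs
    have h2 : R * Real.exp (-r * s) = R / (p - r) * (p - r) * Real.exp (-r * s) := by
      rw [div_mul_cancel₀ _ hp.ne']
    nlinarith) ht
  simp only [mul_zero, Real.exp_zero, mul_one] at this
  have h3 : 0 ≤ Real.exp (-p * t) * (R / (p - r)) := by positivity
  nlinarith

/-- The system satisfied by one component of the (transverse) Fourier transform at wave number `k`;
`d` is the corresponding component of `k⁻¹ ∇ × B`. -/
structure ScalarSys (P : Params) (k : ℝ) (a b E d : ℝ → ℝ) : Prop where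
  ha : ∀ t, HasDerivAt a (P.e / P.mi * E t - P.nui * a t) t
  hb : ∀ t, HasDerivAt b (-(P.e / P.me * E t) - P.nue * b t) t
  hE : ∀ t, HasDerivAt E (P.c * k * d t - 4 * Real.pi * P.e * (a t - b t)) t
  hd : ∀ t, HasDerivAt d (-(P.c * k * E t)) t

/-- The energy dissipates only a and b. The cross term of weight ε w in a E dissipates E, the one of
weight ε τ in E d dissipates d. The bad terms go by Young's inequality: those in a and b into the
damping, since ε is small; the term c κ² E² of the second cross term into the gain of the first,
since τ c = α/4 and κ² ≤ w. The case w = 1, κ = 0, d = 0 serves for the relaxation to Darcy's law.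
-/
lemma dissipation_le {A B α ν c g τ ε w κ : ℝ} (hα : 0 < α) (hc : 0 < c) (hg : 0 < g) (hτ : 0 < τ)
    (hτc : τ * c = α / 4) (hε : 0 < ε)
    (h1 : ε * (ν ^ 2 / α + c / τ + 2 * g + 2 * τ * (g ^ 2 / c)) ≤ A / 2)
    (h2 : ε * (g + 2 * τ * (g ^ 2 / c)) ≤ B / 2) (hw0 : 0 ≤ w) (hw1 : w ≤ 1) (hκ : κ ^ 2 ≤ w)
    (a b E d : ℝ) :
    -A * a ^ 2 - B * b ^ 2 - ε * (w * (α * E ^ 2 - ν * a * E - g * a * (a - b)) + c * κ * a * d) -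
        ε * τ * (c * κ ^ 2 * d ^ 2 - g * w * κ * (a - b) * d - c * κ ^ 2 * E ^ 2) ≤
      -(A / 2) * a ^ 2 - B / 2 * b ^ 2 - ε * (α / 2) * w * E ^ 2 -
        ε * τ * (c / 2) * κ ^ 2 * d ^ 2 := by
  have t1 : ν * a * E ≤ α * E ^ 2 / 4 + ν ^ 2 / α * a ^ 2 := by
    have : α * E ^ 2 / 4 + ν ^ 2 / α * a ^ 2 - ν * a * E = (α * E / 2 - ν * a) ^ 2 / α := by
      field_simp; ring
    have h : 0 ≤ (α * E / 2 - ν * a) ^ 2 / α := by positivity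
    linarith
  have t1' : w * (ν * a * E) ≤ w * (α * E ^ 2 / 4) + ν ^ 2 / α * a ^ 2 := by
    have h0 : 0 ≤ ν ^ 2 / α * a ^ 2 := by positivity
    nlinarith [mul_le_mul_of_nonneg_left t1 hw0, mul_le_mul_of_nonneg_right hw1 h0]
  have t2 : -(c * κ * a * d) ≤ τ * c * κ ^ 2 * d ^ 2 / 4 + c / τ * a ^ 2 := by
    have : τ * c * κ ^ 2 * d ^ 2 / 4 + c / τ * a ^ 2 + c * κ * a * d =
        c * ((τ * κ * d / 2 + a) ^ 2 / τ) := by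
      field_simp; ring
    have h : 0 ≤ c * ((τ * κ * d / 2 + a) ^ 2 / τ) := by positivity
    linarith
  have t3 : w * (g * a * (a - b)) ≤ g * (2 * a ^ 2 + b ^ 2) := by
    have h3 : a * (a - b) ≤ 2 * a ^ 2 + b ^ 2 := by nlinarith [sq_nonneg (a + b)]
    have h4 : w * (a * (a - b)) ≤ 2 * a ^ 2 + b ^ 2 := by
      have h5 : 0 ≤ 2 * a ^ 2 + b ^ 2 := by positivity
      nlinarith [mul_le_mul_of_nonneg_left h3 hw0, mul_le_mul_of_nonneg_right hw1 h5]
    have h6 := mul_le_mul_of_nonneg_left h4 hg.le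
    linarith
  have t4 : g * w * κ * (a - b) * d ≤ c * κ ^ 2 * d ^ 2 / 4 + g ^ 2 / c * (2 * (a ^ 2 + b ^ 2)) := by
    have h3 : c * κ ^ 2 * d ^ 2 / 4 + g ^ 2 / c * (w ^ 2 * (a - b) ^ 2) - g * w * κ * (a - b) * d =
        (c * κ * d / 2 - g * w * (a - b)) ^ 2 / c := by field_simp; ring
    have h4 : 0 ≤ (c * κ * d / 2 - g * w * (a - b)) ^ 2 / c := by positivity
    have h5 : w ^ 2 * (a - b) ^ 2 ≤ 2 * (a ^ 2 + b ^ 2) := by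
      have h6 : w ^ 2 ≤ 1 := by nlinarith
      nlinarith [mul_le_mul_of_nonneg_right h6 (sq_nonneg (a - b)), sq_nonneg (a + b)]
    have h6 : 0 ≤ g ^ 2 / c := by positivity
    have h7 := mul_le_mul_of_nonneg_left h5 h6
    linarith
  have t5 : τ * (c * κ ^ 2 * E ^ 2) ≤ w * (α * E ^ 2 / 4) := by
    have h3 : τ * (c * κ ^ 2 * E ^ 2) = α / 4 * (κ ^ 2 * E ^ 2) := by rw [← hτc]; ring
    have h4 : α / 4 * (κ ^ 2 * E ^ 2) ≤ α / 4 * (w * E ^ 2) := by gcongr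
    rw [h3]
    linarith
  have t4' := mul_le_mul_of_nonneg_left t4 hτ.le
  have h1' := mul_le_mul_of_nonneg_right h1 (sq_nonneg a)
  have h2' := mul_le_mul_of_nonneg_right h2 (sq_nonneg b)
  have s : w * (ν * a * E) + -(c * κ * a * d) + w * (g * a * (a - b)) +
      τ * (g * w * κ * (a - b) * d) + τ * (c * κ ^ 2 * E ^ 2) ≤
      w * (α * E ^ 2 / 4) + ν ^ 2 / α * a ^ 2 + (τ * c * κ ^ 2 * d ^ 2 / 4 + c / τ * a ^ 2) +
      g * (2 * a ^ 2 + b ^ 2) +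
      τ * (c * κ ^ 2 * d ^ 2 / 4 + g ^ 2 / c * (2 * (a ^ 2 + b ^ 2))) + w * (α * E ^ 2 / 4) := by
    linarith
  have s' := mul_le_mul_of_nonneg_left s hε.le
  linarith

lemma abs_mul_mul_le {w : ℝ} (h0 : 0 ≤ w) (h1 : w ≤ 1) (x y : ℝ) :
    |w * (x * y)| ≤ (x ^ 2 + y ^ 2) / 2 := by
  rw [abs_mul, abs_of_nonneg h0]
  have h2 : |x * y| ≤ (x ^ 2 + y ^ 2) / 2 := by
    rw [abs_le]
    constructor <;> nlinarith [sq_nonneg (x - y), sq_nonneg (x + y)]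
  exact (mul_le_of_le_one_left (abs_nonneg _) h1).trans h2

/-- Young's inequality for the cross terms, whose total weight ε(1 + τ) is at most each diagonal
coefficient; half of it survives below. -/
lemma lyapunov_equiv {mi me p ε τ w w' : ℝ} (hmi : 0 < mi) (hme : 0 < me) (hp : 0 < p) (hε : 0 < ε)
    (hτ : 0 < τ) (h3 : ε * (1 + τ) ≤ mi) (h4 : ε * (1 + τ) ≤ me) (h5 : ε * (1 + τ) ≤ p)
    (hw0 : 0 ≤ w) (hw1 : w ≤ 1) (hw0' : 0 ≤ w') (hw1' : w' ≤ 1) (a b E d : ℝ) :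
    mi * a ^ 2 + me * b ^ 2 + p * (E ^ 2 + d ^ 2) - ε * (w * (a * E)) - ε * τ * (w' * (E * d)) ≤
        2 * (mi + me + p) * (a ^ 2 + b ^ 2 + E ^ 2 + d ^ 2) ∧
      ε * (1 + τ) / 2 * (a ^ 2 + b ^ 2 + E ^ 2 + d ^ 2) ≤
        mi * a ^ 2 + me * b ^ 2 + p * (E ^ 2 + d ^ 2) - ε * (w * (a * E)) -
          ε * τ * (w' * (E * d)) := by
  obtain ⟨e1a, e1b⟩ := abs_le.1 (abs_mul_mul_le hw0 hw1 a E)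
  obtain ⟨e2a, e2b⟩ := abs_le.1 (abs_mul_mul_le hw0' hw1' E d)
  have f1 := mul_le_mul_of_nonneg_left e1a hε.le
  have f2 := mul_le_mul_of_nonneg_left e1b hε.le
  have f3 := mul_le_mul_of_nonneg_left e2a (mul_pos hε hτ).le
  have f4 := mul_le_mul_of_nonneg_left e2b (mul_pos hε hτ).le
  have g1 := mul_le_mul_of_nonneg_right h3 (sq_nonneg a)
  have g2 := mul_le_mul_of_nonneg_right h4 (sq_nonneg b)
  have g3 := mul_le_mul_of_nonneg_right h5 (sq_nonneg E)
  have g4 := mul_le_mul_of_nonneg_right h5 (sq_nonneg d)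
  have y1 : 0 ≤ ε * τ * a ^ 2 := by positivity
  have y2 : 0 ≤ ε * τ * b ^ 2 := by positivity
  have y3 : 0 ≤ ε * d ^ 2 := by positivity
  have y4 : 0 ≤ ε * b ^ 2 := by positivity
  have y5 : 0 ≤ ε * a ^ 2 := by positivity
  have y6 : 0 ≤ ε * E ^ 2 := by positivity
  have y7 : 0 ≤ ε * τ * E ^ 2 := by positivity
  have y8 : 0 ≤ ε * τ * d ^ 2 := by positivity
  have z2 : 0 ≤ me * (2 * a ^ 2 + b ^ 2 + 2 * E ^ 2 + 2 * d ^ 2) := by positivity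
  have z3 : 0 ≤ p * (2 * a ^ 2 + 2 * b ^ 2) := by positivity
  have z5 : 0 ≤ mi * (2 * b ^ 2 + 2 * E ^ 2 + 2 * d ^ 2) := by positivity
  constructor <;> linarith

/-- Admissible parameters for the Lyapunov functionals. -/
lemma exists_lyapunov_params (P : Params) : ∃ τ ε : ℝ, 0 < τ ∧ 0 < ε ∧ τ * P.c = P.e / P.mi / 4 ∧
    ε * (P.nui ^ 2 / (P.e / P.mi) + P.c / τ + 2 * (4 * Real.pi * P.e) +
      2 * τ * ((4 * Real.pi * P.e) ^ 2 / P.c)) ≤ 2 * P.mi * P.nui / 2 ∧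
    ε * (4 * Real.pi * P.e + 2 * τ * ((4 * Real.pi * P.e) ^ 2 / P.c)) ≤ 2 * P.me * P.nue / 2 ∧
    ε * (1 + τ) ≤ P.mi ∧ ε * (1 + τ) ≤ P.me ∧ ε * (1 + τ) ≤ 1 / (4 * Real.pi) := by
  have := P.mi_pos; have := P.me_pos; have := P.nui_pos; have := P.nue_pos
  have := P.e_pos; have := P.c_pos; have := Real.pi_pos
  have key : ∀ x y : ℝ, 0 < x → 0 < y → ∃ ε₀ > 0, ∀ ε ≤ ε₀, ε * x ≤ y := fun x y hx hy =>
    ⟨y / x, by positivity, fun ε hε => by rwa [← le_div_iff₀ hx]⟩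
  set τ := P.e / P.mi / 4 / P.c with hτ
  have hτ0 : 0 < τ := by positivity
  obtain ⟨e1, p1, h1⟩ := key (P.nui ^ 2 / (P.e / P.mi) + P.c / τ + 2 * (4 * Real.pi * P.e) +
      2 * τ * ((4 * Real.pi * P.e) ^ 2 / P.c)) (2 * P.mi * P.nui / 2) (by positivity) (by positivity)
  obtain ⟨e2, p2, h2⟩ := key (4 * Real.pi * P.e + 2 * τ * ((4 * Real.pi * P.e) ^ 2 / P.c))
    (2 * P.me * P.nue / 2) (by positivity) (by positivity)
  obtain ⟨e3, p3, h3⟩ := key (1 + τ) P.mi (by positivity) (by positivity)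
  obtain ⟨e4, p4, h4⟩ := key (1 + τ) P.me (by positivity) (by positivity)
  obtain ⟨e5, p5, h5⟩ := key (1 + τ) (1 / (4 * Real.pi)) (by positivity) (by positivity)
  refine ⟨τ, min e1 (min e2 (min e3 (min e4 e5))), hτ0, by positivity, ?_, h1 _ ?_, h2 _ ?_,
    h3 _ ?_, h4 _ ?_, h5 _ ?_⟩
  · rw [hτ]; field_simp
  all_goals simp

/-- Exponential decay at rate `k² / (1 + k²)²`. -/
lemma exists_scalar_decay (P : Params) : ∃ K c₁ : ℝ, 1 ≤ K ∧ 0 < c₁ ∧ ∀ (k : ℝ) (a b E d : ℝ → ℝ),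
    0 ≤ k → ScalarSys P k a b E d → ∀ t, 0 ≤ t →
    a t ^ 2 + b t ^ 2 + E t ^ 2 + d t ^ 2 ≤ K * Real.exp (-(c₁ * (k / (1 + k ^ 2)) ^ 2) * t) *
      (a 0 ^ 2 + b 0 ^ 2 + E 0 ^ 2 + d 0 ^ 2) := by
  obtain ⟨τ, ε, hτ, hε, hτc, h1, h2, h3, h4, h5⟩ := exists_lyapunov_params P
  have hmi := P.mi_pos; have hme := P.me_pos; have hni := P.nui_pos; have hne := P.nue_pos
  have he := P.e_pos; have hc := P.c_pos; have hpi := Real.pi_pos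
  have hs0 : 0 < ε * (1 + τ) := by positivity
  set m₁ := 2 * (P.mi + P.me + 1 / (4 * Real.pi)) with hm₁
  have hm₁0 : 0 < m₁ := by positivity
  set m₀ := ε * (1 + τ) / 2 with hm₀
  have hm₀0 : 0 < m₀ := by positivity
  set c₀ := min (P.mi * P.nui) (min (P.me * P.nue) (min (ε * (P.e / P.mi / 2)) (ε * τ * (P.c / 2))))
    with hc₀
  have hc₀0 : 0 < c₀ := by positivity
  have q1 : c₀ ≤ P.mi * P.nui := by simp [hc₀]
  have q2 : c₀ ≤ P.me * P.nue := by simp [hc₀]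
  have q3 : c₀ ≤ ε * (P.e / P.mi / 2) := by simp [hc₀]
  have q4 : c₀ ≤ ε * τ * (P.c / 2) := by simp [hc₀]
  have hK : 1 ≤ m₁ / m₀ := by
    rw [le_div_iff₀ hm₀0, one_mul, hm₁, hm₀]
    have : 0 < 1 / (4 * Real.pi) := by positivity
    linarith
  refine ⟨m₁ / m₀, c₀ / m₁, hK, by positivity, fun k a b E d hk hS t ht => ?_⟩
  -- These weights make the functional uniform in k: k w = κ, so the coupling c k of E and d enters
  -- the cross terms only through κ, which is bounded. The dissipation of d then has size κ² and
  -- determines the rate.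
  set w := 1 / (1 + k ^ 2) with hw
  set κ := k / (1 + k ^ 2) with hκ
  have hk1 : 0 < 1 + k ^ 2 := by positivity
  have hw0 : 0 < w := by positivity
  have hw1 : w ≤ 1 := by rw [hw, div_le_one hk1]; nlinarith
  have hκ0 : 0 ≤ κ := by positivity
  have hkw : k * w = κ := by rw [hw, hκ]; ring
  have hκw : κ ^ 2 ≤ w := by
    rw [hw, hκ, div_pow, div_le_div_iff₀ (by positivity) hk1]
    nlinarith [sq_nonneg k, sq_nonneg (k ^ 2)]
  have hκ1 : κ ≤ 1 := by nlinarith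
  -- Physical energy of the mode, in which the couplings cancel, plus the two cross terms of
  -- `dissipation_le`.
  let L : ℝ → ℝ := fun t => P.mi * a t ^ 2 + P.me * b t ^ 2 + (E t ^ 2 + d t ^ 2) / (4 * Real.pi) -
    ε * (w * (a t * E t)) - ε * τ * (w * κ * (E t * d t))
  have hL : ∀ t, HasDerivAt L (-(2 * P.mi * P.nui) * a t ^ 2 - 2 * P.me * P.nue * b t ^ 2 -
      ε * (w * (P.e / P.mi * E t ^ 2 - P.nui * a t * E t - 4 * Real.pi * P.e * a t * (a t - b t)) +
        P.c * κ * a t * d t) -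
      ε * τ * (P.c * κ ^ 2 * d t ^ 2 - 4 * Real.pi * P.e * w * κ * (a t - b t) * d t -
        P.c * κ ^ 2 * E t ^ 2)) t := by
    intro t
    have ha := hS.ha t; have hb := hS.hb t; have hE := hS.hE t; have hd := hS.hd t
    have := (((((ha.pow 2).const_mul P.mi).add ((hb.pow 2).const_mul P.me)).add
      (((hE.pow 2).add (hd.pow 2)).div_const (4 * Real.pi))).sub
      (((ha.mul hE).const_mul w).const_mul ε)).sub
      (((hE.mul hd).const_mul (w * κ)).const_mul (ε * τ))
    refine this.congr_deriv ?_
    rw [← hkw]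
    field_simp
    ring
  have hup : ∀ t, L t ≤ m₁ * (a t ^ 2 + b t ^ 2 + E t ^ 2 + d t ^ 2) ∧
      m₀ * (a t ^ 2 + b t ^ 2 + E t ^ 2 + d t ^ 2) ≤ L t := by
    intro t
    have hwk : w * κ ≤ 1 := mul_le_one₀ hw1 hκ0 hκ1
    have := lyapunov_equiv hmi hme (by positivity : 0 < 1 / (4 * Real.pi)) hε hτ h3 h4 h5 hw0.le hw1
      (mul_nonneg hw0.le hκ0) hwk (a t) (b t) (E t) (d t)
    simpa only [L, hm₁, hm₀, div_mul_eq_mul_div, one_mul] using this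
  have hdec : ∀ t, 0 ≤ t → -(2 * P.mi * P.nui) * a t ^ 2 - 2 * P.me * P.nue * b t ^ 2 -
      ε * (w * (P.e / P.mi * E t ^ 2 - P.nui * a t * E t - 4 * Real.pi * P.e * a t * (a t - b t)) +
        P.c * κ * a t * d t) -
      ε * τ * (P.c * κ ^ 2 * d t ^ 2 - 4 * Real.pi * P.e * w * κ * (a t - b t) * d t -
        P.c * κ ^ 2 * E t ^ 2) ≤ -(c₀ / m₁ * κ ^ 2) * L t := by
    intro t _
    refine (dissipation_le (by positivity) hc (by positivity) hτ hτc hε h1 h2 hw0.le hw1 hκw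
      (a t) (b t) (E t) (d t)).trans ?_
    have hκ2 : κ ^ 2 ≤ 1 := hκw.trans hw1
    have r1 := mul_le_mul_of_nonneg_right
      ((mul_le_of_le_one_right hc₀0.le hκ2).trans q1) (sq_nonneg (a t))
    have r2 := mul_le_mul_of_nonneg_right
      ((mul_le_of_le_one_right hc₀0.le hκ2).trans q2) (sq_nonneg (b t))
    have r3 : c₀ * κ ^ 2 * E t ^ 2 ≤ ε * (P.e / P.mi / 2) * w * E t ^ 2 := by gcongr
    have r4 : c₀ * κ ^ 2 * d t ^ 2 ≤ ε * τ * (P.c / 2) * κ ^ 2 * d t ^ 2 := by gcongr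
    have r5 : c₀ / m₁ * κ ^ 2 * L t ≤
        c₀ / m₁ * κ ^ 2 * (m₁ * (a t ^ 2 + b t ^ 2 + E t ^ 2 + d t ^ 2)) := by
      gcongr; exact (hup t).1
    have r6 : c₀ / m₁ * κ ^ 2 * (m₁ * (a t ^ 2 + b t ^ 2 + E t ^ 2 + d t ^ 2)) =
        c₀ * κ ^ 2 * (a t ^ 2 + b t ^ 2 + E t ^ 2 + d t ^ 2) := by field_simp
    linarith
  have hfin := le_exp_mul_of_deriv_le hL hdec ht
  have hexp := Real.exp_pos (-(c₀ / m₁ * κ ^ 2) * t)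
  have h6 : m₀ * (a t ^ 2 + b t ^ 2 + E t ^ 2 + d t ^ 2) ≤ Real.exp (-(c₀ / m₁ * κ ^ 2) * t) *
      (m₁ * (a 0 ^ 2 + b 0 ^ 2 + E 0 ^ 2 + d 0 ^ 2)) :=
    (hup t).2.trans (hfin.trans (mul_le_mul_of_nonneg_left (hup 0).1 hexp.le))
  rw [← le_div_iff₀' hm₀0] at h6
  refine h6.trans_eq ?_
  ring

/-! ### Low frequencies -/

/-- Coefficient of the ion velocity in Darcy's law. -/
def Params.NA (P : Params) : ℝ :=
  P.c / (4 * Real.pi * P.e) * (P.me * P.nue / (P.mi * P.nui + P.me * P.nue))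

/-- Coefficient of the electron velocity in Darcy's law. -/
def Params.NB (P : Params) : ℝ :=
  -(P.c / (4 * Real.pi * P.e) * (P.mi * P.nui / (P.mi * P.nui + P.me * P.nue)))

/-- Coefficient of the electric field in Darcy's law. -/
def Params.NE (P : Params) : ℝ := P.c / (4 * Real.pi * P.e ^ 2) *
      (P.mi * P.nui * (P.me * P.nue) / (P.mi * P.nui + P.me * P.nue))

lemma Params.sum_pos (P : Params) : 0 < P.mi * P.nui + P.me * P.nue := by
  have := P.mi_pos; have := P.me_pos; have := P.nui_pos; have := P.nue_pos
  positivity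

lemma Params.darcy_ui (P : Params) : P.e / P.mi * P.NE = P.nui * P.NA := by
  have := P.mi_pos.ne'; have := P.e_pos.ne'; have := P.sum_pos.ne'; have := Real.pi_pos.ne'
  rw [Params.NE, Params.NA]; field_simp

lemma Params.darcy_ue (P : Params) : -(P.e / P.me * P.NE) = P.nue * P.NB := by
  have := P.me_pos.ne'; have := P.e_pos.ne'; have := P.sum_pos.ne'; have := Real.pi_pos.ne'
  rw [Params.NE, Params.NB]; field_simp

lemma Params.darcy_E (P : Params) : 4 * Real.pi * P.e * (P.NA - P.NB) = P.c := by
  have := P.e_pos.ne'; have := P.sum_pos.ne'; have := Real.pi_pos.ne'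
  rw [Params.NA, Params.NB]; field_simp; ring

lemma Params.mu2_eq (P : Params) : P.mu2 = P.c * P.NE := by
  have := P.e_pos.ne'; have := P.sum_pos.ne'; have := Real.pi_pos.ne'
  rw [Params.mu2, Params.NE]; field_simp

lemma Params.mu2_pos (P : Params) : 0 < P.mu2 := by
  have := P.mi_pos; have := P.me_pos; have := P.nui_pos; have := P.nue_pos
  have := P.e_pos; have := P.c_pos; have := P.sum_pos; have := Real.pi_pos
  rw [Params.mu2]; positivity

/-! ### Deviation from Darcy's law -/

section Deviation

variable {P : Params} {k : ℝ} {a b E d : ℝ → ℝ}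

/-- The multiples `NA`, `NB`, `NE` of k d form a quasi-stationary state: the right-hand sides of the
first three equations vanish on it. The only forcing left is -k N d' = c k² N E, of second order in
k. -/
lemma ScalarSys.hasDerivAt_za (h : ScalarSys P k a b E d) (t : ℝ) :
    HasDerivAt (fun t => a t - k * P.NA * d t) (P.e / P.mi * (E t - k * P.NE * d t) -
      P.nui * (a t - k * P.NA * d t) + P.c * k ^ 2 * P.NA * E t) t := by
  refine ((h.ha t).sub ((h.hd t).const_mul (k * P.NA))).congr_deriv ?_
  linear_combination k * d t * P.darcy_ui

lemma ScalarSys.hasDerivAt_zb (h : ScalarSys P k a b E d) (t : ℝ) :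
    HasDerivAt (fun t => b t - k * P.NB * d t) (-(P.e / P.me * (E t - k * P.NE * d t)) -
      P.nue * (b t - k * P.NB * d t) + P.c * k ^ 2 * P.NB * E t) t := by
  refine ((h.hb t).sub ((h.hd t).const_mul (k * P.NB))).congr_deriv ?_
  linear_combination k * d t * P.darcy_ue

lemma ScalarSys.hasDerivAt_zE (h : ScalarSys P k a b E d) (t : ℝ) :
    HasDerivAt (fun t => E t - k * P.NE * d t) (-(4 * Real.pi * P.e *
      ((a t - k * P.NA * d t) - (b t - k * P.NB * d t))) + P.c * k ^ 2 * P.NE * E t) t := by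
  refine ((h.hE t).sub ((h.hd t).const_mul (k * P.NE))).congr_deriv ?_
  linear_combination (-(k * d t)) * P.darcy_E

end Deviation

lemma lin_sq_le (p q r x y z : ℝ) :
    (p * x + q * y + r * z) ^ 2 ≤ (p ^ 2 + q ^ 2 + r ^ 2) * (x ^ 2 + y ^ 2 + z ^ 2) := by
  nlinarith [sq_nonneg (p * y - q * x), sq_nonneg (p * z - r * x), sq_nonneg (q * z - r * y)]

lemma deviation_sq_le {k na nb ne : ℝ} (hk0 : 0 ≤ k) (hk : k ≤ 1) (a b E d : ℝ) :
    (a - k * na * d) ^ 2 + (b - k * nb * d) ^ 2 + (E - k * ne * d) ^ 2 ≤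
      2 * (1 + na ^ 2 + nb ^ 2 + ne ^ 2) * (a ^ 2 + b ^ 2 + E ^ 2 + d ^ 2) := by
  have h : ∀ x n : ℝ, (x - k * n * d) ^ 2 ≤ 2 * x ^ 2 + 2 * (n ^ 2 * d ^ 2) := fun x n => by
    have h1 : k ^ 2 ≤ 1 := by nlinarith
    have h2 : k ^ 2 * (n ^ 2 * d ^ 2) ≤ 1 * (n ^ 2 * d ^ 2) := by gcongr
    nlinarith [sq_nonneg (x + k * n * d)]
  have h1 : 0 ≤ (na ^ 2 + nb ^ 2 + ne ^ 2) * (a ^ 2 + b ^ 2 + E ^ 2) := by positivity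
  nlinarith [h a na, h b nb, h E ne, sq_nonneg d]

set_option maxHeartbeats 1000000 in
/-- Decay of the deviation from Darcy's law. -/
lemma exists_deviation_le (P : Params) : ∃ k₀ p C : ℝ, 0 < k₀ ∧ k₀ ≤ 1 ∧ 0 < p ∧ 0 < C ∧
    ∀ (k : ℝ) (a b E d : ℝ → ℝ) (M r : ℝ), 0 ≤ k → k ≤ k₀ → ScalarSys P k a b E d → 0 ≤ M →
    r ≤ p / 2 → (∀ t, 0 ≤ t → a t ^ 2 + b t ^ 2 + E t ^ 2 + d t ^ 2 ≤ M * Real.exp (-r * t)) →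
    ∀ t, 0 ≤ t → (a t - k * P.NA * d t) ^ 2 + (b t - k * P.NB * d t) ^ 2 +
      (E t - k * P.NE * d t) ^ 2 ≤
      C * (Real.exp (-p * t) + k ^ 6 * Real.exp (-r * t)) * M := by
  obtain ⟨τ, ε, hτ, hε, hτc, h1, h2, h3, h4, h5⟩ := exists_lyapunov_params P
  have hmi := P.mi_pos; have hme := P.me_pos; have hni := P.nui_pos; have hne := P.nue_pos
  have he := P.e_pos; have hc := P.c_pos; have hpi := Real.pi_pos
  have hs0 : 0 < ε * (1 + τ) := by positivity
  obtain ⟨m₁, hm₁⟩ : ∃ x, x = 2 * (P.mi + P.me + 1 / (4 * Real.pi)) := ⟨_, rfl⟩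
  have hm₁0 : 0 < m₁ := by rw [hm₁]; positivity
  obtain ⟨m₀, hm₀⟩ : ∃ x, x = ε * (1 + τ) / 2 := ⟨_, rfl⟩
  have hm₀0 : 0 < m₀ := by rw [hm₀]; positivity
  obtain ⟨c₀, hc₀⟩ : ∃ x, x = min (P.mi * P.nui) (min (P.me * P.nue) (ε * (P.e / P.mi / 2))) :=
    ⟨_, rfl⟩
  have hc₀0 : 0 < c₀ := by rw [hc₀]; positivity
  have q1 : c₀ ≤ P.mi * P.nui := by simp [hc₀]
  have q2 : c₀ ≤ P.me * P.nue := by simp [hc₀]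
  have q3 : c₀ ≤ ε * (P.e / P.mi / 2) := by simp [hc₀]
  -- The forcing enters Q' through a linear form l of the deviation; Λ bounds its squared
  -- coefficients.
  obtain ⟨Λ, hΛ⟩ : ∃ x, x = 1 + ((2 * P.mi * P.NA - ε * P.NE) ^ 2 + (2 * P.me * P.NB) ^ 2 +
    (P.NE / (2 * Real.pi) - ε * P.NA) ^ 2) := ⟨_, rfl⟩
  have hΛ0 : 1 ≤ Λ := by
    rw [hΛ]
    exact le_add_of_nonneg_right (by positivity)
  -- For k ≤ k₀ the part of the forcing proportional to the deviation itself is at most c₀/4 of its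
  -- square norm, a quarter of the damping.
  obtain ⟨k₀, hk₀⟩ : ∃ x, x = min 1 (c₀ / (2 * P.c * (1 + Λ))) := ⟨_, rfl⟩
  have hk₀0 : 0 < k₀ := by rw [hk₀]; positivity
  have hk₀1 : k₀ ≤ 1 := by simp [hk₀]
  have hk₀2 : k₀ * (2 * P.c * (1 + Λ)) ≤ c₀ := by
    rw [← le_div_iff₀ (by positivity)]; simp [hk₀]
  obtain ⟨R₀, hR₀⟩ : ∃ x, x = Λ / c₀ * (P.c * P.NE) ^ 2 := ⟨_, rfl⟩
  have hR₀0 : 0 ≤ R₀ := by rw [hR₀]; positivity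
  obtain ⟨p, hp⟩ : ∃ x, x = c₀ / (2 * m₁) := ⟨_, rfl⟩
  have hp0 : 0 < p := by rw [hp]; positivity
  obtain ⟨C₁, hC₁⟩ : ∃ x, x = 2 * (1 + P.NA ^ 2 + P.NB ^ 2 + P.NE ^ 2) := ⟨_, rfl⟩
  have hC₁0 : 0 < C₁ := by rw [hC₁]; positivity
  refine ⟨k₀, p, (m₁ * C₁ + R₀ / (p / 2)) / m₀, hk₀0, hk₀1, hp0, by positivity,
    fun k a b E d M r hk hkk hS hM hr hH t ht => ?_⟩
  have hk1 : k ≤ 1 := hkk.trans hk₀1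
  -- The Lyapunov functional without d and with weight 1: the damped triple alone decays at a rate
  -- independent of k.
  let Q : ℝ → ℝ := fun t => P.mi * (a t - k * P.NA * d t) ^ 2 + P.me * (b t - k * P.NB * d t) ^ 2 +
    1 / (4 * Real.pi) * (E t - k * P.NE * d t) ^ 2 -
    ε * ((a t - k * P.NA * d t) * (E t - k * P.NE * d t))
  obtain ⟨Q', hQ'⟩ : ∃ Q' : ℝ → ℝ, ∀ t, Q' t = -(2 * P.mi * P.nui) * (a t - k * P.NA * d t) ^ 2 -
      2 * P.me * P.nue * (b t - k * P.NB * d t) ^ 2 -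
      ε * (P.e / P.mi * (E t - k * P.NE * d t) ^ 2 -
        P.nui * (a t - k * P.NA * d t) * (E t - k * P.NE * d t) -
        4 * Real.pi * P.e * (a t - k * P.NA * d t) *
          ((a t - k * P.NA * d t) - (b t - k * P.NB * d t))) +
      P.c * k ^ 2 * E t * ((2 * P.mi * P.NA - ε * P.NE) * (a t - k * P.NA * d t) +
        2 * P.me * P.NB * (b t - k * P.NB * d t) +
        (P.NE / (2 * Real.pi) - ε * P.NA) * (E t - k * P.NE * d t)) := ⟨_, fun _ => rfl⟩
  have hQ : ∀ t, HasDerivAt Q (Q' t) t := by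
    intro t
    have ha := hS.hasDerivAt_za t
    have hb := hS.hasDerivAt_zb t
    have hE := hS.hasDerivAt_zE t
    refine ((((((ha.pow 2).const_mul P.mi).add ((hb.pow 2).const_mul P.me)).add
      ((hE.pow 2).const_mul (1 / (4 * Real.pi)))).sub ((ha.mul hE).const_mul ε))).congr_deriv ?_
    rw [hQ']
    generalize a t - k * P.NA * d t = za
    generalize b t - k * P.NB * d t = zb
    generalize E t - k * P.NE * d t = zE
    field_simp
    ring
  have hup : ∀ t, Q t ≤ m₁ * ((a t - k * P.NA * d t) ^ 2 + (b t - k * P.NB * d t) ^ 2 +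
      (E t - k * P.NE * d t) ^ 2) ∧ m₀ * ((a t - k * P.NA * d t) ^ 2 + (b t - k * P.NB * d t) ^ 2 +
      (E t - k * P.NE * d t) ^ 2) ≤ Q t := by
    intro t
    have := lyapunov_equiv hmi hme (by positivity : 0 < 1 / (4 * Real.pi)) hε hτ h3 h4 h5
      zero_le_one le_rfl le_rfl zero_le_one (a t - k * P.NA * d t) (b t - k * P.NB * d t)
      (E t - k * P.NE * d t) 0
    simpa [Q, hm₁, hm₀] using this
  have hdec : ∀ t, 0 ≤ t → Q' t ≤ -p * Q t + R₀ * k ^ 6 * M * Real.exp (-r * t) := by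
    intro t ht
    have hd2 : d t ^ 2 ≤ M * Real.exp (-r * t) := by
      linarith [hH t ht, sq_nonneg (a t), sq_nonneg (b t), sq_nonneg (E t)]
    have hQt := (hup t).1
    have hEt : E t = (E t - k * P.NE * d t) + k * P.NE * d t := by ring
    have hdiss := dissipation_le (by positivity : 0 < P.e / P.mi) hc
      (by positivity : 0 < 4 * Real.pi * P.e) hτ hτc hε h1 h2 zero_le_one le_rfl
      (by norm_num : (0 : ℝ) ^ 2 ≤ 1) (a t - k * P.NA * d t) (b t - k * P.NB * d t)
      (E t - k * P.NE * d t) 0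
    have hl := lin_sq_le (2 * P.mi * P.NA - ε * P.NE) (2 * P.me * P.NB)
      (P.NE / (2 * Real.pi) - ε * P.NA) (a t - k * P.NA * d t) (b t - k * P.NB * d t)
      (E t - k * P.NE * d t)
    rw [hQ']
    rw [hEt]
    simp only [add_sub_cancel_right]
    generalize a t - k * P.NA * d t = za at *
    generalize b t - k * P.NB * d t = zb at *
    generalize E t - k * P.NE * d t = zE at *
    generalize Q t = Qt at *
    generalize (2 * P.mi * P.NA - ε * P.NE) * za + 2 * P.me * P.NB * zb +
      (P.NE / (2 * Real.pi) - ε * P.NA) * zE = l at *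
    have hl' : l ^ 2 ≤ Λ * (za ^ 2 + zb ^ 2 + zE ^ 2) := by
      rw [hΛ]
      linarith [sq_nonneg za, sq_nonneg zb, sq_nonneg zE]
    obtain ⟨N, hN⟩ : ∃ N, N = za ^ 2 + zb ^ 2 + zE ^ 2 := ⟨_, rfl⟩
    have hN0 : 0 ≤ N := by rw [hN]; positivity
    rw [← hN] at hl' hQt
    have w1 : P.c * k ^ 2 * zE * l ≤ c₀ / 4 * N := by
      have e1 : zE * l ≤ (1 + Λ) / 2 * N := by
        have f1 := two_mul_le_add_sq zE l
        have f2 : zE ^ 2 ≤ N := by rw [hN]; linarith only [sq_nonneg za, sq_nonneg zb]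
        linarith only [f1, f2, hl']
      have e2 : P.c * k ^ 2 * (zE * l) ≤ P.c * k ^ 2 * ((1 + Λ) / 2 * N) := by gcongr
      have e3 : k ^ 2 ≤ k₀ := (pow_le_of_le_one hk hk1 two_ne_zero).trans hkk
      have e4 : k ^ 2 * (P.c * ((1 + Λ) / 2 * N)) ≤ k₀ * (P.c * ((1 + Λ) / 2 * N)) := by gcongr
      have e5 := mul_le_mul_of_nonneg_right hk₀2 hN0
      linarith only [e2, e4, e5]
    -- The rest of the forcing is c k³ `NE` d: another quarter of the damping absorbs l, leaving k⁶
    -- d². Half of the damping remains, whence p = c₀/(2m₁).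
    have w2 : P.c * k ^ 2 * (k * P.NE * d t) * l ≤ c₀ / 4 * N + R₀ * k ^ 6 * d t ^ 2 := by
      have e1 : P.c * k ^ 2 * (k * P.NE * d t) * l ≤
          c₀ / (4 * Λ) * l ^ 2 + R₀ * k ^ 6 * d t ^ 2 := by
        have : c₀ / (4 * Λ) * l ^ 2 + R₀ * k ^ 6 * d t ^ 2 - P.c * k ^ 2 * (k * P.NE * d t) * l =
            Λ / c₀ * (c₀ / (2 * Λ) * l - P.c * k ^ 3 * P.NE * d t) ^ 2 := by
          rw [hR₀]; field_simp; ring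
        have h0 : 0 ≤ Λ / c₀ * (c₀ / (2 * Λ) * l - P.c * k ^ 3 * P.NE * d t) ^ 2 := by positivity
        linarith only [this, h0]
      have e2 : c₀ / (4 * Λ) * l ^ 2 ≤ c₀ / (4 * Λ) * (Λ * N) := by gcongr
      have e3 : c₀ / (4 * Λ) * (Λ * N) = c₀ / 4 * N := by field_simp
      linarith only [e1, e2, e3]
    have w3 : R₀ * k ^ 6 * d t ^ 2 ≤ R₀ * k ^ 6 * (M * Real.exp (-r * t)) := by gcongr
    have w4 : p * Qt ≤ c₀ / 2 * N := by
      calc p * Qt ≤ p * (m₁ * N) := by gcongr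
        _ = c₀ / 2 * N := by rw [hp]; field_simp
    have w5 := mul_le_mul_of_nonneg_right q1 (sq_nonneg za)
    have w6 := mul_le_mul_of_nonneg_right q2 (sq_nonneg zb)
    have w7 := mul_le_mul_of_nonneg_right q3 (sq_nonneg zE)
    have w8 : c₀ * N = c₀ * za ^ 2 + c₀ * zb ^ 2 + c₀ * zE ^ 2 := by rw [hN]; ring
    linarith only [hdiss, w1, w2, w3, w4, w5, w6, w7, w8]
  have hfin := le_of_forced_deriv_le (by positivity) (by linarith : r < p) hQ hdec ht
  have hX0 : a 0 ^ 2 + b 0 ^ 2 + E 0 ^ 2 + d 0 ^ 2 ≤ M := by simpa using hH 0 le_rfl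
  have hQ0 : Q 0 ≤ m₁ * C₁ * M := by
    have y1 := deviation_sq_le (na := P.NA) (nb := P.NB) (ne := P.NE) hk hk1 (a 0) (b 0) (E 0) (d 0)
    rw [← hC₁] at y1
    have y2 := mul_le_mul_of_nonneg_left hX0 hC₁0.le
    have y3 := mul_le_mul_of_nonneg_left (y1.trans y2) hm₁0.le
    linarith only [(hup 0).1, y3]
  have hRp : R₀ * k ^ 6 * M / (p - r) ≤ R₀ * k ^ 6 * M / (p / 2) := by
    gcongr
    linarith
  have hfin2 := (hup t).2.trans hfin
  rw [← le_div_iff₀' hm₀0] at hfin2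
  refine hfin2.trans ?_
  have x0 : (m₁ * C₁ + R₀ / (p / 2)) / m₀ * (Real.exp (-p * t) + k ^ 6 * Real.exp (-r * t)) * M =
      ((m₁ * C₁ + R₀ / (p / 2)) * (Real.exp (-p * t) + k ^ 6 * Real.exp (-r * t)) * M) / m₀ := by
    ring
  rw [x0]
  refine div_le_div_of_nonneg_right ?_ hm₀0.le
  have x1 : Real.exp (-p * t) * Q 0 ≤ Real.exp (-p * t) * (m₁ * C₁ * M) := by gcongr
  have x2 : R₀ * k ^ 6 * M / (p - r) * Real.exp (-r * t) ≤
      R₀ * k ^ 6 * M / (p / 2) * Real.exp (-r * t) := by gcongr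
  have x3 : 0 ≤ R₀ / (p / 2) * Real.exp (-p * t) * M := by positivity
  have x4 : 0 ≤ m₁ * C₁ * (k ^ 6 * Real.exp (-r * t)) * M := by positivity
  have x5 : R₀ * k ^ 6 * M / (p / 2) * Real.exp (-r * t) =
      R₀ / (p / 2) * (k ^ 6 * Real.exp (-r * t)) * M := by ring
  linarith only [x1, x2, x3, x4, x5]

/-- Convergence of the magnetic amplitude to the diffusion wave. -/
lemma exists_amplitude_le (P : Params) : ∃ C : ℝ, 0 < C ∧
    ∀ (k c₂ : ℝ) (a b E d : ℝ → ℝ) (M : ℝ), 0 < k → k ≤ 1 → c₂ ≤ P.mu2 / 2 →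
    ScalarSys P k a b E d → 0 ≤ M →
    (∀ t, 0 ≤ t → a t ^ 2 + b t ^ 2 + E t ^ 2 + d t ^ 2 ≤ M * Real.exp (-(c₂ * k ^ 2) * t)) →
    ∀ t, 0 ≤ t → (d t - Real.exp (-(P.mu2 * k ^ 2) * t) * d 0) ^ 2 ≤
      C * k ^ 2 * Real.exp (-(c₂ * k ^ 2) * t) * M := by
  have hni := P.nui_pos; have hne := P.nue_pos
  have hc := P.c_pos; have hpi := Real.pi_pos; have hμ := P.mu2_pos
  -- The row vector (h₁, h₂, -`NE`) solves the adjoint of the damped 3×3 system with right-hand side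
  -- (0, 0, c). The combination y built from it therefore has y' = c z_E + O(k²), where z_E is the
  -- deviation of E.
  obtain ⟨h₁, e₁⟩ : ∃ x, x = 4 * Real.pi * P.e * P.NE / P.nui := ⟨_, rfl⟩
  obtain ⟨h₂, e₂⟩ : ∃ x, x = -(4 * Real.pi * P.e * P.NE / P.nue) := ⟨_, rfl⟩
  obtain ⟨N, hN⟩ : ∃ x, x = P.c * (h₁ * P.NA + h₂ * P.NB - P.NE * P.NE) := ⟨_, rfl⟩
  obtain ⟨H, hH⟩ : ∃ x, x = h₁ ^ 2 + h₂ ^ 2 + (-P.NE) ^ 2 := ⟨_, rfl⟩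
  have hH0 : 0 ≤ H := by rw [hH]; positivity
  obtain ⟨C₁, hC₁⟩ : ∃ x, x = 2 * (1 + P.NA ^ 2 + P.NB ^ 2 + P.NE ^ 2) := ⟨_, rfl⟩
  have hC₁0 : 0 < C₁ := by rw [hC₁]; positivity
  obtain ⟨C₂, hC₂⟩ : ∃ x, x = 2 * P.mu2 ^ 2 * (H * C₁) + 2 * N ^ 2 := ⟨_, rfl⟩
  have hC₂0 : 0 ≤ C₂ := by rw [hC₂]; positivity
  have key1 : h₁ * (P.e / P.mi) - h₂ * (P.e / P.me) = P.c := by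
    have h := P.darcy_E
    have hA := P.darcy_ui
    have hB := P.darcy_ue
    have u1 : h₁ * (P.e / P.mi) = 4 * Real.pi * P.e * P.NA := by
      calc h₁ * (P.e / P.mi) = 4 * Real.pi * P.e / P.nui * (P.e / P.mi * P.NE) := by rw [e₁]; ring
        _ = _ := by rw [hA]; field_simp
    have u2 : h₂ * (P.e / P.me) = 4 * Real.pi * P.e * P.NB := by
      calc h₂ * (P.e / P.me) = 4 * Real.pi * P.e / P.nue * (-(P.e / P.me * P.NE)) := by rw [e₂]; ring
        _ = _ := by rw [hB]; field_simp
    rw [u1, u2, ← h]; ring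
  have key2 : h₁ * P.nui = 4 * Real.pi * P.e * P.NE := by rw [e₁]; field_simp
  have key3 : h₂ * P.nue = -(4 * Real.pi * P.e * P.NE) := by rw [e₂]; field_simp
  refine ⟨2 * (H * C₁ + C₂ / P.mu2 / (P.mu2 / 2)) + 2 * (H * C₁) + 1, by positivity,
    fun k c₂ a b E d M hk hk1 hc₂ hS hM hb t ht => ?_⟩
  obtain ⟨y, hy⟩ : ∃ y : ℝ → ℝ, ∀ t, y t = h₁ * (a t - k * P.NA * d t) +
    h₂ * (b t - k * P.NB * d t) + (-P.NE) * (E t - k * P.NE * d t) := ⟨_, fun _ => rfl⟩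
  have hy' : ∀ t, HasDerivAt y (P.c * (E t - k * P.NE * d t) + k ^ 2 * N * E t) t := by
    intro t
    have h := (((hS.hasDerivAt_za t).const_mul h₁).add ((hS.hasDerivAt_zb t).const_mul h₂)).add
      ((hS.hasDerivAt_zE t).const_mul (-P.NE))
    rw [show y = _ from funext hy]
    refine h.congr_deriv ?_
    rw [hN]
    linear_combination (E t - k * P.NE * d t) * key1 - (a t - k * P.NA * d t) * key2 -
      (b t - k * P.NB * d t) * key3
  have hyb : ∀ t, 0 ≤ t → y t ^ 2 ≤ H * C₁ * (M * Real.exp (-(c₂ * k ^ 2) * t)) := by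
    intro t ht
    rw [hy, mul_assoc H]
    refine (lin_sq_le _ _ _ _ _ _).trans ?_
    rw [← hH]
    refine mul_le_mul_of_nonneg_left ?_ hH0
    refine (deviation_sq_le hk.le hk1 _ _ _ _).trans ?_
    rw [← hC₁]
    exact mul_le_mul_of_nonneg_left (hb t ht) hC₁0.le
  -- From d' = -μ₂k²d - c k z_E, the transient z_E is not small initially. Adding k y cancels it and
  -- leaves a forcing of order k³.
  obtain ⟨D, hD⟩ : ∃ D : ℝ → ℝ, ∀ t, D t = d t - Real.exp (-(P.mu2 * k ^ 2) * t) * d 0 + k * y t :=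
    ⟨_, fun _ => rfl⟩
  have hD' : ∀ t, HasDerivAt D (-(P.mu2 * k ^ 2) * D t + k ^ 3 * (P.mu2 * y t + N * E t)) t := by
    intro t
    have h := ((hS.hd t).sub (((((hasDerivAt_id t).const_mul (-(P.mu2 * k ^ 2))).exp).mul_const
      (d 0)))).add ((hy' t).const_mul k)
    rw [show D = _ from funext hD]
    refine h.congr_deriv ?_
    beta_reduce
    simp only [id, mul_one]
    rw [P.mu2_eq]
    ring
  have hQ' : ∀ t, HasDerivAt (fun t => D t ^ 2)
      (2 * D t * (-(P.mu2 * k ^ 2) * D t + k ^ 3 * (P.mu2 * y t + N * E t))) t := fun t => by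
    refine ((hD' t).pow 2).congr_deriv ?_
    simp
  have hdec : ∀ t, 0 ≤ t → 2 * D t * (-(P.mu2 * k ^ 2) * D t + k ^ 3 * (P.mu2 * y t + N * E t)) ≤
      -(P.mu2 * k ^ 2) * D t ^ 2 + C₂ / P.mu2 * k ^ 4 * M * Real.exp (-(c₂ * k ^ 2) * t) := by
    intro t ht
    have hE2 : E t ^ 2 ≤ M * Real.exp (-(c₂ * k ^ 2) * t) := by
      linarith only [hb t ht, sq_nonneg (a t), sq_nonneg (b t), sq_nonneg (d t)]
    have hf : (P.mu2 * y t + N * E t) ^ 2 ≤ C₂ * (M * Real.exp (-(c₂ * k ^ 2) * t)) := by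
      have u1 := mul_le_mul_of_nonneg_left (hyb t ht) (by positivity : 0 ≤ 2 * P.mu2 ^ 2)
      have u2 := mul_le_mul_of_nonneg_left hE2 (by positivity : 0 ≤ 2 * N ^ 2)
      have u3 := sq_nonneg (P.mu2 * y t - N * E t)
      rw [hC₂]
      linarith only [u1, u2, u3]
    generalize P.mu2 * y t + N * E t = f at hf ⊢
    have u1 : 2 * D t * (k ^ 3 * f) ≤ P.mu2 * k ^ 2 * D t ^ 2 + k ^ 4 / P.mu2 * f ^ 2 := by
      have : P.mu2 * k ^ 2 * D t ^ 2 + k ^ 4 / P.mu2 * f ^ 2 - 2 * D t * (k ^ 3 * f) =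
          k ^ 2 * (P.mu2 * D t - k * f) ^ 2 / P.mu2 := by field_simp; ring
      have h0 : 0 ≤ k ^ 2 * (P.mu2 * D t - k * f) ^ 2 / P.mu2 := by positivity
      linarith only [this, h0]
    have u2 := mul_le_mul_of_nonneg_left hf (by positivity : 0 ≤ k ^ 4 / P.mu2)
    have u3 : k ^ 4 / P.mu2 * (C₂ * (M * Real.exp (-(c₂ * k ^ 2) * t))) =
      C₂ / P.mu2 * k ^ 4 * M * Real.exp (-(c₂ * k ^ 2) * t) := by ring
    linarith only [u1, u2, u3]
  have hk2 : 0 < k ^ 2 := by positivity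
  have hcc : c₂ * k ^ 2 ≤ P.mu2 / 2 * k ^ 2 := by gcongr
  -- The gap between the two rates is itself of order k², so the forcing k⁴ in the equation for D²
  -- contributes k² in the end.
  have hgap : P.mu2 / 2 * k ^ 2 ≤ P.mu2 * k ^ 2 - c₂ * k ^ 2 := by linarith only [hcc]
  have hp2 : 0 < P.mu2 / 2 * k ^ 2 := by positivity
  have hfin := le_of_forced_deriv_le (by positivity) (by linarith only [hgap, hp2] :
    c₂ * k ^ 2 < P.mu2 * k ^ 2) hQ' hdec ht
  have hexp : Real.exp (-(P.mu2 * k ^ 2) * t) ≤ Real.exp (-(c₂ * k ^ 2) * t) := by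
    rw [Real.exp_le_exp, neg_mul, neg_mul, neg_le_neg_iff]
    exact mul_le_mul_of_nonneg_right (by linarith only [hgap, hp2]) ht
  have hD0 : D 0 ^ 2 ≤ k ^ 2 * (H * C₁ * M) := by
    have u := hyb 0 le_rfl
    simp only [mul_zero, Real.exp_zero, mul_one] at u
    have : D 0 = k * y 0 := by rw [hD]; simp
    rw [this, mul_pow]
    gcongr
  have hR : C₂ / P.mu2 * k ^ 4 * M / (P.mu2 * k ^ 2 - c₂ * k ^ 2) ≤
      k ^ 2 * (C₂ / P.mu2 / (P.mu2 / 2) * M) := by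
    calc _ ≤ C₂ / P.mu2 * k ^ 4 * M / (P.mu2 / 2 * k ^ 2) := by gcongr
      _ = _ := by field_simp
  have hDt : D t ^ 2 ≤ k ^ 2 * ((H * C₁ + C₂ / P.mu2 / (P.mu2 / 2)) * M) *
      Real.exp (-(c₂ * k ^ 2) * t) := by
    have v1 : Real.exp (-(P.mu2 * k ^ 2) * t) * D 0 ^ 2 ≤
        Real.exp (-(c₂ * k ^ 2) * t) * (k ^ 2 * (H * C₁ * M)) := by gcongr
    have v2 := mul_le_mul_of_nonneg_right hR (Real.exp_pos (-(c₂ * k ^ 2) * t)).le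
    linarith only [hfin, v1, v2]
  have hδ : (d t - Real.exp (-(P.mu2 * k ^ 2) * t) * d 0) ^ 2 ≤ 2 * D t ^ 2 + 2 * (k ^ 2 * y t ^ 2) := by
    have : d t - Real.exp (-(P.mu2 * k ^ 2) * t) * d 0 = D t - k * y t := by rw [hD]; ring
    rw [this]
    linarith only [sq_nonneg (D t + k * y t)]
  have hyt := mul_le_mul_of_nonneg_left (hyb t ht) hk2.le
  have hlast : 0 ≤ k ^ 2 * Real.exp (-(c₂ * k ^ 2) * t) * M := by positivity
  linarith only [hδ, hyt, hDt, hlast]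

lemma quarter_sq_le {k : ℝ} (hk0 : 0 ≤ k) (hk : k ≤ 1) : k ^ 2 / 4 ≤ (k / (1 + k ^ 2)) ^ 2 := by
  have h1 : k ^ 2 ≤ 1 := pow_le_one₀ hk0 hk
  have h2 : k / 2 ≤ k / (1 + k ^ 2) := by gcongr; linarith
  calc k ^ 2 / 4 = (k / 2) ^ 2 := by ring
    _ ≤ _ := by gcongr

/-- Convergence to the diffusion wave at low frequencies. -/
lemma exists_scalar_low (P : Params) : ∃ k₀ K c₂ p : ℝ, 0 < k₀ ∧ k₀ ≤ 1 ∧ 0 < K ∧ 0 < c₂ ∧ 0 < p ∧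
    ∀ (k : ℝ) (a b E d : ℝ → ℝ), 0 < k → k ≤ k₀ → ScalarSys P k a b E d → ∀ t, 0 ≤ t →
    (d t - Real.exp (-(P.mu2 * k ^ 2) * t) * d 0) ^ 2 ≤ K * (k ^ 2 * Real.exp (-(c₂ * k ^ 2) * t)) *
      (a 0 ^ 2 + b 0 ^ 2 + E 0 ^ 2 + d 0 ^ 2) ∧
    (a t - P.NA * (k * (Real.exp (-(P.mu2 * k ^ 2) * t) * d 0))) ^ 2 +
      (b t - P.NB * (k * (Real.exp (-(P.mu2 * k ^ 2) * t) * d 0))) ^ 2 +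
      (E t - P.NE * (k * (Real.exp (-(P.mu2 * k ^ 2) * t) * d 0))) ^ 2 ≤
      K * (k ^ 4 * Real.exp (-(c₂ * k ^ 2) * t) + Real.exp (-p * t)) *
      (a 0 ^ 2 + b 0 ^ 2 + E 0 ^ 2 + d 0 ^ 2) := by
  obtain ⟨K, c₁, hK, hc₁, H⟩ := exists_scalar_decay P
  obtain ⟨k₀, p, C, hk₀, hk₀1, hp, hC, HZ⟩ := exists_deviation_le P
  obtain ⟨C', hC', HD⟩ := exists_amplitude_le P
  have hμ := P.mu2_pos
  have hK0 : 0 < K := by linarith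
  -- c₁/4 because (k/(1+k²))² ≥ k²/4 for k ≤ 1; p/2 and μ₂/2 are the gaps required by
  -- `exists_deviation_le` and `exists_amplitude_le`.
  obtain ⟨c₂, hc₂⟩ : ∃ x, x = min (c₁ / 4) (min (p / 2) (P.mu2 / 2)) := ⟨_, rfl⟩
  have hc₂0 : 0 < c₂ := by rw [hc₂]; positivity
  have r1 : c₂ ≤ c₁ / 4 := by simp [hc₂]
  have r2 : c₂ ≤ p / 2 := by simp [hc₂]
  have r3 : c₂ ≤ P.mu2 / 2 := by simp [hc₂]
  obtain ⟨N, hN⟩ : ∃ x, x = P.NA ^ 2 + P.NB ^ 2 + P.NE ^ 2 := ⟨_, rfl⟩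
  have hN0 : 0 ≤ N := by rw [hN]; positivity
  refine ⟨k₀, C' * K + 2 * (C * K) + 2 * (N * (C' * K)), c₂, p, hk₀, hk₀1, by positivity, hc₂0, hp,
    fun k a b E d hk hkk hS t ht => ?_⟩
  have hk1 : k ≤ 1 := hkk.trans hk₀1
  obtain ⟨X, hX⟩ : ∃ x, x = a 0 ^ 2 + b 0 ^ 2 + E 0 ^ 2 + d 0 ^ 2 := ⟨_, rfl⟩
  have hX0 : 0 ≤ X := by rw [hX]; positivity
  have hH : ∀ t, 0 ≤ t → a t ^ 2 + b t ^ 2 + E t ^ 2 + d t ^ 2 ≤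
      K * X * Real.exp (-(c₂ * k ^ 2) * t) := by
    intro t ht
    have h1 := H k a b E d hk.le hS t ht
    rw [← hX] at h1
    have h2 : Real.exp (-(c₁ * (k / (1 + k ^ 2)) ^ 2) * t) ≤ Real.exp (-(c₂ * k ^ 2) * t) := by
      rw [Real.exp_le_exp, neg_mul, neg_mul, neg_le_neg_iff]
      refine mul_le_mul_of_nonneg_right ?_ ht
      calc c₂ * k ^ 2 ≤ c₁ / 4 * k ^ 2 := by gcongr
        _ = c₁ * (k ^ 2 / 4) := by ring
        _ ≤ _ := by gcongr; exact quarter_sq_le hk.le hk1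
    calc _ ≤ _ := h1
      _ ≤ K * Real.exp (-(c₂ * k ^ 2) * t) * X := by gcongr
      _ = _ := by ring
  have hk2 : k ^ 2 ≤ 1 := pow_le_one₀ hk.le hk1
  have hr : c₂ * k ^ 2 ≤ p / 2 := (mul_le_of_le_one_right hc₂0.le hk2).trans r2
  have hZ := HZ k a b E d (K * X) (c₂ * k ^ 2) hk.le hkk hS (by positivity) hr hH t ht
  have hD := HD k c₂ a b E d (K * X) hk hk1 r3 hS (by positivity) hH t ht
  rw [← hX]
  generalize Real.exp (-(P.mu2 * k ^ 2) * t) * d 0 = e0 at hD ⊢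
  have e1 := Real.exp_pos (-(c₂ * k ^ 2) * t)
  have e2 := Real.exp_pos (-p * t)
  generalize Real.exp (-(c₂ * k ^ 2) * t) = s at hZ hD e1 ⊢
  generalize Real.exp (-p * t) = s' at hZ hD e2 ⊢
  have n1 : 0 ≤ C * K * (k ^ 2 * s * X) := by positivity
  have n2 : 0 ≤ N * (C' * K) * (k ^ 2 * s * X) := by positivity
  refine ⟨by linarith only [hD, n1, n2], ?_⟩
  -- Replacing the actual d by the heat profile in Darcy's law costs k times an error of order k;
  -- this k² dominates the k³ of the deviation.
  have hs : ∀ x n : ℝ, (x - n * (k * e0)) ^ 2 ≤ 2 * (x - k * n * d t) ^ 2 +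
      2 * (n ^ 2 * (k ^ 2 * (d t - e0) ^ 2)) := fun x n => by
    have : x - n * (k * e0) = (x - k * n * d t) + k * n * (d t - e0) := by ring
    rw [this]
    linarith only [sq_nonneg ((x - k * n * d t) - k * n * (d t - e0))]
  have h1 := hs (a t) P.NA
  have h2 := hs (b t) P.NB
  have h3 := hs (E t) P.NE
  have hD2 := mul_le_mul_of_nonneg_left hD (by positivity : 0 ≤ N * k ^ 2)
  have hk6 : C * (k ^ 6 * s) * (K * X) ≤ C * (k ^ 4 * s) * (K * X) := by
    have : k ^ 6 ≤ k ^ 4 := pow_le_pow_of_le_one hk.le hk1 (by norm_num)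
    gcongr
  have n3 : 0 ≤ C' * K * (k ^ 4 * s * X) := by positivity
  have n4 : 0 ≤ C' * K * (s' * X) := by positivity
  have n5 : 0 ≤ N * (C' * K) * (s' * X) := by positivity
  have hNe : N * (k ^ 2 * (d t - e0) ^ 2) = P.NA ^ 2 * (k ^ 2 * (d t - e0) ^ 2) +
    P.NB ^ 2 * (k ^ 2 * (d t - e0) ^ 2) + P.NE ^ 2 * (k ^ 2 * (d t - e0) ^ 2) := by rw [hN]; ring
  linarith only [h1, h2, h3, hD2, hk6, n3, n4, n5, hNe, hZ]

/-! ### Bounds for the solution operator -/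

/-- The complex version of `ScalarSys`. -/
structure ComplexSys (P : Params) (k : ℝ) (a b E d : ℝ → ℂ) : Prop where
  ha : ∀ t, HasDerivAt a ((P.e / P.mi : ℝ) * E t - P.nui * a t) t
  hb : ∀ t, HasDerivAt b (-((P.e / P.me : ℝ) * E t) - P.nue * b t) t
  hE : ∀ t, HasDerivAt E (P.c * k * d t - (4 * Real.pi * P.e : ℝ) * (a t - b t)) t
  hd : ∀ t, HasDerivAt d (-(P.c * k * E t)) t

lemma hasDerivAt_re {f : ℝ → ℂ} {f' : ℂ} {t : ℝ} (h : HasDerivAt f f' t) :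
    HasDerivAt (fun s => (f s).re) f'.re t :=
  Complex.reCLM.hasFDerivAt.comp_hasDerivAt t h

lemma hasDerivAt_im {f : ℝ → ℂ} {f' : ℂ} {t : ℝ} (h : HasDerivAt f f' t) :
    HasDerivAt (fun s => (f s).im) f'.im t :=
  Complex.imCLM.hasFDerivAt.comp_hasDerivAt t h

section

variable {P : Params} {k : ℝ} {a b E d : ℝ → ℂ}

lemma ComplexSys.re (h : ComplexSys P k a b E d) :
    ScalarSys P k (fun t => (a t).re) (fun t => (b t).re) (fun t => (E t).re) fun t => (d t).re := by
  refine ⟨fun t => (hasDerivAt_re (h.ha t)).congr_deriv ?_,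
    fun t => (hasDerivAt_re (h.hb t)).congr_deriv ?_,
    fun t => (hasDerivAt_re (h.hE t)).congr_deriv ?_,
    fun t => (hasDerivAt_re (h.hd t)).congr_deriv ?_⟩
  all_goals
    simp only [Complex.sub_re, Complex.neg_re, Complex.re_ofReal_mul, mul_assoc (P.c : ℂ)]
  all_goals ring

lemma ComplexSys.im (h : ComplexSys P k a b E d) :
    ScalarSys P k (fun t => (a t).im) (fun t => (b t).im) (fun t => (E t).im) fun t => (d t).im := by
  refine ⟨fun t => (hasDerivAt_im (h.ha t)).congr_deriv ?_,
    fun t => (hasDerivAt_im (h.hb t)).congr_deriv ?_,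
    fun t => (hasDerivAt_im (h.hE t)).congr_deriv ?_,
    fun t => (hasDerivAt_im (h.hd t)).congr_deriv ?_⟩
  all_goals
    simp only [Complex.sub_im, Complex.neg_im, Complex.im_ofReal_mul, mul_assoc (P.c : ℂ)]
  all_goals ring

end

lemma sq_norm_eq (z : ℂ) : ‖z‖ ^ 2 = z.re ^ 2 + z.im ^ 2 := by
  rw [Complex.sq_norm, Complex.normSq_apply]; ring

/-- The system is linear with real coefficients, so real and imaginary parts are estimated
separately and their squares added. -/
lemma exists_complex_decay (P : Params) : ∃ K c₁ : ℝ, 1 ≤ K ∧ 0 < c₁ ∧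
    ∀ (k : ℝ) (a b E d : ℝ → ℂ), 0 ≤ k → ComplexSys P k a b E d → ∀ t, 0 ≤ t →
    ‖a t‖ ^ 2 + ‖b t‖ ^ 2 + ‖E t‖ ^ 2 + ‖d t‖ ^ 2 ≤
      K * Real.exp (-(c₁ * (k / (1 + k ^ 2)) ^ 2) * t) *
        (‖a 0‖ ^ 2 + ‖b 0‖ ^ 2 + ‖E 0‖ ^ 2 + ‖d 0‖ ^ 2) := by
  obtain ⟨K, c₁, hK, hc₁, H⟩ := exists_scalar_decay P
  refine ⟨K, c₁, hK, hc₁, fun k a b E d hk hS t ht => ?_⟩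
  have h1 := H k _ _ _ _ hk hS.re t ht
  have h2 := H k _ _ _ _ hk hS.im t ht
  simp only [sq_norm_eq]
  linarith only [h1, h2]

lemma exists_complex_low (P : Params) : ∃ k₀ K c₂ p : ℝ, 0 < k₀ ∧ k₀ ≤ 1 ∧ 0 < K ∧ 0 < c₂ ∧ 0 < p ∧
    ∀ (k : ℝ) (a b E d : ℝ → ℂ), 0 < k → k ≤ k₀ → ComplexSys P k a b E d → ∀ t, 0 ≤ t →
    ‖d t - Real.exp (-(P.mu2 * k ^ 2) * t) * d 0‖ ^ 2 ≤
      K * (k ^ 2 * Real.exp (-(c₂ * k ^ 2) * t)) *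
        (‖a 0‖ ^ 2 + ‖b 0‖ ^ 2 + ‖E 0‖ ^ 2 + ‖d 0‖ ^ 2) ∧
    ‖a t - P.NA * (k * (Real.exp (-(P.mu2 * k ^ 2) * t) * d 0))‖ ^ 2 +
      ‖b t - P.NB * (k * (Real.exp (-(P.mu2 * k ^ 2) * t) * d 0))‖ ^ 2 +
      ‖E t - P.NE * (k * (Real.exp (-(P.mu2 * k ^ 2) * t) * d 0))‖ ^ 2 ≤
      K * (k ^ 4 * Real.exp (-(c₂ * k ^ 2) * t) + Real.exp (-p * t)) *
        (‖a 0‖ ^ 2 + ‖b 0‖ ^ 2 + ‖E 0‖ ^ 2 + ‖d 0‖ ^ 2) := by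
  obtain ⟨k₀, K, c₂, p, hk₀, hk₀1, hK, hc₂, hp, H⟩ := exists_scalar_low P
  refine ⟨k₀, K, c₂, p, hk₀, hk₀1, hK, hc₂, hp, fun k a b E d hk hkk hS t ht => ?_⟩
  obtain ⟨h1, h2⟩ := H k _ _ _ _ hk hkk hS.re t ht
  obtain ⟨h3, h4⟩ := H k _ _ _ _ hk hkk hS.im t ht
  simp only [sq_norm_eq, Complex.sub_re, Complex.sub_im, Complex.re_ofReal_mul,
    Complex.im_ofReal_mul]
  exact ⟨by linarith only [h1, h3], by linarith only [h2, h4]⟩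

/-! ### The solution operator: propagation of constraints and reduction to the scalar system -/

lemma hasDerivAt_prop (P : Params) (ξ : V) (x : X) (t : ℝ) (a : Fin 4) (l : Fin 3) :
    HasDerivAt (fun s => prop P s ξ x a l) (opA P ξ (prop P t ξ x) a l) t := by
  let ev : (X →L[ℂ] X) →L[ℂ] ℂ := LinearMap.toContinuousLinearMap
    { toFun := fun T => T x a l
      map_add' := fun _ _ => rfl
      map_smul' := fun _ _ => rfl }
  have h := ev.hasFDerivAt.comp_hasDerivAt (t : ℂ) (hasDerivAt_exp_smul_const' (opA P ξ) (t : ℂ))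
  exact h.comp_ofReal

lemma prop_zero (P : Params) (ξ : V) (x : X) : prop P 0 ξ x = x := by
  have h : ((0 : ℝ) : ℂ) • opA P ξ = 0 := ContinuousLinearMap.ext fun x => by
    rw [smul_apply, Complex.ofReal_zero, zero_smul, zero_apply]
  rw [prop, h, NormedSpace.exp_zero, one_apply_eq_self]

/-- The symbol of the divergence. -/
def divS (ξ : V) (b : Fin 3 → ℂ) : ℂ := ∑ l, ds l ξ * b l

lemma divS_eq (ξ : V) (b : Fin 3 → ℂ) :
    divS ξ b = ds 0 ξ * b 0 + ds 1 ξ * b 1 + ds 2 ξ * b 2 := by rw [divS, Fin.sum_univ_three]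

lemma hasDerivAt_curlS (ξ : V) {f : ℝ → Fin 3 → ℂ} {f' : Fin 3 → ℂ} {t : ℝ}
    (h : ∀ l, HasDerivAt (fun s => f s l) (f' l) t) (l : Fin 3) :
    HasDerivAt (fun s => curlS ξ (f s) l) (curlS ξ f' l) t :=
  ((h _).const_mul _).sub ((h _).const_mul _)

lemma curlS_curlS (ξ : V) (b : Fin 3 → ℂ) (l : Fin 3) :
    curlS ξ (curlS ξ b) l = ds l ξ * divS ξ b + ((wn ξ ^ 2 : ℝ) : ℂ) * b l := by
  have h := sum_ds_sq ξ
  rw [divS_eq]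
  fin_cases l
  · change ds 1 ξ * (ds 0 ξ * b 1 - ds 1 ξ * b 0) - ds 2 ξ * (ds 2 ξ * b 0 - ds 0 ξ * b 2) =
      ds 0 ξ * _ + _ * b 0
    linear_combination (-b 0) * h
  · change ds 2 ξ * (ds 1 ξ * b 2 - ds 2 ξ * b 1) - ds 0 ξ * (ds 0 ξ * b 1 - ds 1 ξ * b 0) =
      ds 1 ξ * _ + _ * b 1
    linear_combination (-b 1) * h
  · change ds 0 ξ * (ds 2 ξ * b 0 - ds 0 ξ * b 2) - ds 1 ξ * (ds 1 ξ * b 2 - ds 2 ξ * b 1) =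
      ds 2 ξ * _ + _ * b 2
    linear_combination (-b 2) * h

lemma divS_curlS (ξ : V) (b : Fin 3 → ℂ) : divS ξ (curlS ξ b) = 0 := by
  rw [divS_eq]
  change ds 0 ξ * (ds 1 ξ * b 2 - ds 2 ξ * b 1) + ds 1 ξ * (ds 2 ξ * b 0 - ds 0 ξ * b 2) +
    ds 2 ξ * (ds 0 ξ * b 1 - ds 1 ξ * b 0) = 0
  ring

lemma norm_curlS_le (ξ : V) (b : Fin 3 → ℂ) (l : Fin 3) :
    ‖curlS ξ b l‖ ≤ wn ξ * (‖b (l + 2)‖ + ‖b (l + 1)‖) := by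
  refine (norm_sub_le _ _).trans ?_
  rw [norm_mul, norm_mul, mul_add]
  gcongr <;> exact norm_ds_le _ _

lemma divS_opA (P : Params) (ξ : V) {x : X} (hx : ∀ a, divS ξ (x a) = 0) (a : Fin 4) :
    divS ξ (opA P ξ x a) = 0 := by
  have h0 := hx 0; have h1 := hx 1; have h2 := hx 2
  have c2 := divS_curlS ξ (x 2); have c3 := divS_curlS ξ (x 3)
  rw [divS_eq] at h0 h1 h2 c2 c3 ⊢
  fin_cases a <;> simp only [Fin.reduceFinMk, Fin.zero_eta, Fin.mk_one]
  · simp only [opA_zero]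
    linear_combination ((P.e / P.mi : ℝ) : ℂ) * h2 - P.nui * h0
  · simp only [opA_one]
    linear_combination (-((P.e / P.me : ℝ) : ℂ)) * h2 - P.nue * h1
  · simp only [opA_two]
    linear_combination (P.c : ℂ) * c3 - ((4 * Real.pi * P.e : ℝ) : ℂ) * (h0 - h1)
  · simp only [opA_three]
    linear_combination (-(P.c : ℂ)) * c2

/-- The divergence constraints are propagated. -/
lemma divS_prop (P : Params) (ξ : V) {x : X} (hx : ∀ a, divS ξ (x a) = 0) (t : ℝ)
    (a : Fin 4) : divS ξ (prop P t ξ x a) = 0 := by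
  have hn : ∀ (n : ℕ) a, divS ξ ((opA P ξ ^ n) x a) = 0 := by
    intro n
    induction n with
    | zero => simpa using hx
    | succ n ih =>
      rw [pow_succ', mul_apply_eq_comp]
      exact divS_opA P ξ ih
  let ev : (X →L[ℂ] X) →L[ℂ] ℂ := LinearMap.toContinuousLinearMap
    { toFun := fun T => divS ξ (T x a)
      map_add' := fun T S => by simp only [divS_eq, add_apply, Pi.add_apply]; ring
      map_smul' := fun r T => by
        simp only [divS_eq, smul_apply, Pi.smul_apply, smul_eq_mul, RingHom.id_apply]; ring }
  have h := (NormedSpace.exp_series_hasSum_exp' (𝕂 := ℂ) ((t : ℂ) • opA P ξ)).mapL ev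
  have h3 : ∀ n : ℕ, ev ((n.factorial : ℂ)⁻¹ • ((t : ℂ) • opA P ξ) ^ n) = 0 := fun n => by
    rw [smul_clm_pow, map_smul, map_smul]
    change _ • _ • divS ξ ((opA P ξ ^ n) x a) = 0
    rw [hn, smul_zero, smul_zero]
  simp only [h3] at h
  exact h.unique hasSum_zero

/-- The components of the solution operator solve the scalar system. -/
lemma complexSys_prop (P : Params) {ξ : V} (hξ : 0 < wn ξ) {x : X} (hx : ∀ a, divS ξ (x a) = 0)
    (l : Fin 3) : ComplexSys P (wn ξ) (fun t => prop P t ξ x 0 l) (fun t => prop P t ξ x 1 l)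
      (fun t => prop P t ξ x 2 l) (fun t => curlS ξ (prop P t ξ x 3) l / wn ξ) := by
  have hk : (wn ξ : ℂ) ≠ 0 := by exact_mod_cast hξ.ne'
  refine ⟨fun t => hasDerivAt_prop P ξ x t 0 l, fun t => hasDerivAt_prop P ξ x t 1 l,
    fun t => (hasDerivAt_prop P ξ x t 2 l).congr_deriv ?_, fun t =>
    ((hasDerivAt_curlS ξ (fun l => hasDerivAt_prop P ξ x t 3 l) l).div_const _).congr_deriv ?_⟩
  · rw [opA_two]
    field_simp
  · have h1 := curlS_curlS ξ (prop P t ξ x 2) l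
    rw [divS_prop P ξ hx t 2, mul_zero, zero_add] at h1
    have h2 : curlS ξ (opA P ξ (prop P t ξ x) 3) l =
        -(P.c * curlS ξ (curlS ξ (prop P t ξ x 2)) l) := by
      simp only [curlS, opA_three]; ring
    rw [h2, h1]
    push_cast
    field_simp

lemma sum_sq_le_sq_sum (x : X) (l : Fin 3) :
    ‖x 0 l‖ ^ 2 + ‖x 1 l‖ ^ 2 + ‖x 2 l‖ ^ 2 ≤ (∑ a, ∑ l, ‖x a l‖) ^ 2 ∧
    ‖x 3 (l + 2)‖ + ‖x 3 (l + 1)‖ ≤ ∑ a, ∑ l, ‖x a l‖ := by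
  have h : ∀ a l, ‖x a l‖ ≤ ∑ l, ‖x a l‖ := fun a l =>
    Finset.single_le_sum (f := fun l => ‖x a l‖) (fun _ _ => norm_nonneg _) (Finset.mem_univ l)
  have hs : ∀ a, 0 ≤ ∑ l, ‖x a l‖ := fun a => by positivity
  rw [Fin.sum_univ_four]
  constructor
  · nlinarith [h 0 l, h 1 l, h 2 l, hs 0, hs 1, hs 2, hs 3, norm_nonneg (x 0 l), norm_nonneg (x 1 l),
      norm_nonneg (x 2 l), mul_nonneg (hs 0) (hs 1), mul_nonneg (hs 0) (hs 2),
      mul_nonneg (hs 1) (hs 2), mul_nonneg (hs 0) (hs 3), mul_nonneg (hs 1) (hs 3),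
      mul_nonneg (hs 2) (hs 3), pow_le_pow_left₀ (norm_nonneg _) (h 0 l) 2,
      pow_le_pow_left₀ (norm_nonneg _) (h 1 l) 2, pow_le_pow_left₀ (norm_nonneg _) (h 2 l) 2]
  · have h3 : ‖x 3 (l + 2)‖ + ‖x 3 (l + 1)‖ ≤ ∑ l, ‖x 3 l‖ := by
      rw [Fin.sum_univ_three]
      fin_cases l
      · change ‖x 3 2‖ + ‖x 3 1‖ ≤ _; linarith [norm_nonneg (x 3 0)]
      · change ‖x 3 0‖ + ‖x 3 2‖ ≤ _; linarith [norm_nonneg (x 3 1)]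
      · change ‖x 3 1‖ + ‖x 3 0‖ ≤ _; linarith [norm_nonneg (x 3 2)]
    linarith [hs 0, hs 1, hs 2]

lemma initial_sq_le {ξ : V} (hξ : 0 < wn ξ) (x : X) (l : Fin 3) :
    ‖x 0 l‖ ^ 2 + ‖x 1 l‖ ^ 2 + ‖x 2 l‖ ^ 2 + ‖curlS ξ (x 3) l / wn ξ‖ ^ 2 ≤
      2 * (∑ a, ∑ l, ‖x a l‖) ^ 2 := by
  obtain ⟨h1, h2⟩ := sum_sq_le_sq_sum x l
  have h3 : ‖curlS ξ (x 3) l / wn ξ‖ ≤ ∑ a, ∑ l, ‖x a l‖ := by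
    rw [norm_div, Complex.norm_real, Real.norm_of_nonneg hξ.le, div_le_iff₀' hξ]
    exact (norm_curlS_le ξ (x 3) l).trans (mul_le_mul_of_nonneg_left h2 hξ.le)
  have h4 := pow_le_pow_left₀ (norm_nonneg _) h3 2
  linarith

/-- A divergence-free amplitude is recovered from its curl. -/
lemma norm_le_of_curlS {ξ : V} (hξ : 0 < wn ξ) {b : Fin 3 → ℂ} (hb : divS ξ b = 0) {M : ℝ}
    (h : ∀ l, ‖curlS ξ b l / wn ξ‖ ≤ M) (l : Fin 3) : ‖b l‖ ≤ 2 * M := by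
  have h1 := curlS_curlS ξ b l
  rw [hb, mul_zero, zero_add] at h1
  have h2 : wn ξ ^ 2 * ‖b l‖ ≤ wn ξ ^ 2 * (2 * M) := by
    have h3 : ∀ l, ‖curlS ξ b l‖ ≤ wn ξ * M := fun l => by
      have := h l
      rwa [norm_div, Complex.norm_real, Real.norm_of_nonneg hξ.le, div_le_iff₀' hξ] at this
    calc wn ξ ^ 2 * ‖b l‖ = ‖curlS ξ (curlS ξ b) l‖ := by
          rw [h1, norm_mul, Complex.norm_real, Real.norm_of_nonneg (by positivity)]
      _ ≤ wn ξ * (‖curlS ξ b (l + 2)‖ + ‖curlS ξ b (l + 1)‖) := norm_curlS_le _ _ _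
      _ ≤ wn ξ * (wn ξ * M + wn ξ * M) := by
          gcongr
          · exact h3 _
          · exact h3 _
      _ = _ := by ring
  exact le_of_mul_le_mul_left h2 (by positivity)

/-- The deviation of the solution operator from the asymptotic profile. -/
def dev (P : Params) (t : ℝ) (ξ : V) (x : X) : X :=
  ![fun l => prop P t ξ x 0 l - P.NA * (Real.exp (-(P.mu2 * wn ξ ^ 2) * t) * curlS ξ (x 3) l),
    fun l => prop P t ξ x 1 l - P.NB * (Real.exp (-(P.mu2 * wn ξ ^ 2) * t) * curlS ξ (x 3) l),
    fun l => prop P t ξ x 2 l - P.NE * (Real.exp (-(P.mu2 * wn ξ ^ 2) * t) * curlS ξ (x 3) l),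
    fun l => prop P t ξ x 3 l - Real.exp (-(P.mu2 * wn ξ ^ 2) * t) * x 3 l]

lemma norm_le_of_sq_le {z : ℂ} {M : ℝ} (hM : 0 ≤ M) (h : ‖z‖ ^ 2 ≤ M ^ 2) : ‖z‖ ≤ M :=
  (sq_le_sq₀ (norm_nonneg z) hM).1 h

lemma exists_norm_dev_le (P : Params) : ∃ k₀ K c₂ p : ℝ, 0 < k₀ ∧ 0 < K ∧ 0 < c₂ ∧ 0 < p ∧
    ∀ (ξ : V) (x : X), 0 < wn ξ → wn ξ ≤ k₀ → (∀ a, divS ξ (x a) = 0) → ∀ t, 0 ≤ t → ∀ l,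
    ‖dev P t ξ x 3 l‖ ≤ K * (wn ξ * Real.exp (-(c₂ * wn ξ ^ 2) * t)) * ∑ a, ∑ l, ‖x a l‖ ∧
    ∀ a, a ≠ 3 → ‖dev P t ξ x a l‖ ≤ K * (wn ξ ^ 2 * Real.exp (-(c₂ * wn ξ ^ 2) * t) +
      Real.exp (-p * t)) * ∑ a, ∑ l, ‖x a l‖ := by
  obtain ⟨k₀, K, c₂, p, hk₀, -, hK0, hc₂, hp, H⟩ := exists_complex_low P
  -- The rates are halved by taking square roots, 1 + 2K bounds √(2K), and the outer 2 is the cost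
  -- of recovering B from its curl.
  refine ⟨k₀, 2 * (1 + 2 * K), c₂ / 2, p / 2, hk₀, by positivity, by positivity, by positivity,
    fun ξ x hξ hξk hx t ht l => ?_⟩
  obtain ⟨S, hS⟩ : ∃ S, S = ∑ a, ∑ l, ‖x a l‖ := ⟨_, rfl⟩
  have hS0 : 0 ≤ S := by rw [hS]; positivity
  rw [← hS]
  have hk : (wn ξ : ℂ) ≠ 0 := by exact_mod_cast hξ.ne'
  have hKs : K * 2 ≤ (1 + 2 * K) ^ 2 := by nlinarith
  have he : Real.exp (-(c₂ / 2 * wn ξ ^ 2) * t) ^ 2 = Real.exp (-(c₂ * wn ξ ^ 2) * t) := by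
    rw [← Real.exp_nat_mul]; congr 1; push_cast; ring
  have hep : Real.exp (-(p / 2) * t) ^ 2 = Real.exp (-p * t) := by
    rw [← Real.exp_nat_mul]; congr 1; push_cast; ring
  have e1 := Real.exp_pos (-(c₂ / 2 * wn ξ ^ 2) * t)
  have e2 := Real.exp_pos (-(p / 2) * t)
  have hH : ∀ l, _ := fun l => H (wn ξ) _ _ _ _ hξ hξk (complexSys_prop P hξ hx l) t ht
  simp only [prop_zero, ← he, ← hep] at hH
  have h2 : ∀ l, _ := fun l => initial_sq_le hξ x l
  simp only [← hS] at h2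
  generalize Real.exp (-(c₂ / 2 * wn ξ ^ 2) * t) = s at e1 hH ⊢
  generalize Real.exp (-(p / 2) * t) = s' at e2 hH ⊢
  constructor
  · have hM0 : 0 ≤ (1 + 2 * K) * (wn ξ * s) * S := by positivity
    have hc : ∀ l, curlS ξ (dev P t ξ x 3) l / wn ξ = curlS ξ (prop P t ξ x 3) l / wn ξ -
        Real.exp (-(P.mu2 * wn ξ ^ 2) * t) * (curlS ξ (x 3) l / wn ξ) := fun l => by
      simp only [curlS, dev, Matrix.cons_val]
      ring
    have hd : divS ξ (dev P t ξ x 3) = 0 := by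
      have h3 := divS_prop P ξ hx t 3
      have h4 := hx 3
      rw [divS_eq] at h3 h4 ⊢
      simp only [dev, Matrix.cons_val]
      linear_combination h3 - (Real.exp (-(P.mu2 * wn ξ ^ 2) * t) : ℂ) * h4
    have hn := norm_le_of_curlS hξ hd (M := (1 + 2 * K) * (wn ξ * s) * S) (fun l => by
      refine norm_le_of_sq_le hM0 ?_
      rw [hc]
      refine (hH l).1.trans ((mul_le_mul_of_nonneg_left (h2 l) (by positivity)).trans ?_)
      calc _ = K * 2 * (wn ξ ^ 2 * s ^ 2 * S ^ 2) := by ring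
        _ ≤ (1 + 2 * K) ^ 2 * (wn ξ ^ 2 * s ^ 2 * S ^ 2) := by gcongr
        _ = _ := by ring) l
    linarith only [hn]
  · have hM0 : 0 ≤ (1 + 2 * K) * (wn ξ ^ 2 * s + s') * S := by positivity
    have hc : ∀ r : ℝ, (r : ℂ) * (wn ξ * (Real.exp (-(P.mu2 * wn ξ ^ 2) * t) *
        (curlS ξ (x 3) l / wn ξ))) = r * (Real.exp (-(P.mu2 * wn ξ ^ 2) * t) * curlS ξ (x 3) l) :=
      fun r => by field_simp
    have h3 := (hH l).2
    simp only [hc] at h3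
    have h4 := h3.trans (mul_le_mul_of_nonneg_left (h2 l) (by positivity))
    have h5 : K * (wn ξ ^ 4 * s ^ 2 + s' ^ 2) * (2 * S ^ 2) ≤
        ((1 + 2 * K) * (wn ξ ^ 2 * s + s') * S) ^ 2 := by
      have h6 : wn ξ ^ 4 * s ^ 2 + s' ^ 2 ≤ (wn ξ ^ 2 * s + s') ^ 2 := by
        have : 0 ≤ wn ξ ^ 2 * s * s' := by positivity
        linarith only [this]
      calc _ = K * 2 * ((wn ξ ^ 4 * s ^ 2 + s' ^ 2) * S ^ 2) := by ring
        _ ≤ (1 + 2 * K) ^ 2 * ((wn ξ ^ 2 * s + s') ^ 2 * S ^ 2) := by gcongr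
        _ = _ := by ring
    have h7 := h4.trans h5
    have hfin : ∀ z : ℂ, ‖z‖ ^ 2 ≤ ((1 + 2 * K) * (wn ξ ^ 2 * s + s') * S) ^ 2 →
        ‖z‖ ≤ 2 * (1 + 2 * K) * (wn ξ ^ 2 * s + s') * S := fun z hz => by
      have := norm_le_of_sq_le hM0 hz
      linarith only [this, hM0]
    intro a ha
    have p0 := sq_nonneg ‖dev P t ξ x 0 l‖
    have p1 := sq_nonneg ‖dev P t ξ x 1 l‖
    have p2 := sq_nonneg ‖dev P t ξ x 2 l‖
    refine hfin _ (le_trans ?_ h7)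
    change _ ≤ ‖dev P t ξ x 0 l‖ ^ 2 + ‖dev P t ξ x 1 l‖ ^ 2 + ‖dev P t ξ x 2 l‖ ^ 2
    fin_cases a <;> simp only [Fin.reduceFinMk, Fin.zero_eta, Fin.mk_one]
    · linarith only [p1, p2]
    · linarith only [p0, p2]
    · linarith only [p0, p1]
    · exact absurd rfl ha

lemma exists_norm_prop_le (P : Params) : ∃ K c₁ : ℝ, 0 < K ∧ 0 < c₁ ∧
    ∀ (ξ : V) (x : X), 0 < wn ξ → (∀ a, divS ξ (x a) = 0) → ∀ t, 0 ≤ t → ∀ a l,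
    ‖prop P t ξ x a l‖ ≤ K * Real.exp (-(c₁ * (wn ξ / (1 + wn ξ ^ 2)) ^ 2) * t) *
        ∑ a, ∑ l, ‖x a l‖ := by
  obtain ⟨K, c₁, hK, hc₁, H⟩ := exists_complex_decay P
  have hK0 : 0 < K := by linarith
  -- Square roots again halve the rate; 2K ≥ √(2K) since K ≥ 1, and the outer 2 is needed only for
  -- the magnetic component.
  refine ⟨2 * (2 * K), c₁ / 2, by positivity, by positivity, fun ξ x hξ hx t ht a l => ?_⟩
  obtain ⟨S, hS⟩ : ∃ S, S = ∑ a, ∑ l, ‖x a l‖ := ⟨_, rfl⟩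
  have hS0 : 0 ≤ S := by rw [hS]; positivity
  rw [← hS]
  have hsq : ∀ l, ‖prop P t ξ x 0 l‖ ^ 2 + ‖prop P t ξ x 1 l‖ ^ 2 + ‖prop P t ξ x 2 l‖ ^ 2 +
      ‖curlS ξ (prop P t ξ x 3) l / wn ξ‖ ^ 2 ≤
      (2 * K * Real.exp (-(c₁ / 2 * (wn ξ / (1 + wn ξ ^ 2)) ^ 2) * t) * S) ^ 2 := by
    intro l
    have h1 := H (wn ξ) _ _ _ _ hξ.le (complexSys_prop P hξ hx l) t ht
    simp only [prop_zero] at h1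
    have h2 := initial_sq_le hξ x l
    rw [← hS] at h2
    have he : Real.exp (-(c₁ / 2 * (wn ξ / (1 + wn ξ ^ 2)) ^ 2) * t) ^ 2 =
        Real.exp (-(c₁ * (wn ξ / (1 + wn ξ ^ 2)) ^ 2) * t) := by
      rw [← Real.exp_nat_mul]; congr 1; push_cast; ring
    rw [mul_pow, mul_pow, he]
    have hE := Real.exp_pos (-(c₁ * (wn ξ / (1 + wn ξ ^ 2)) ^ 2) * t)
    refine h1.trans ((mul_le_mul_of_nonneg_left h2 (by positivity)).trans ?_)
    have : K * 2 ≤ (2 * K) ^ 2 := by nlinarith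
    calc _ = K * 2 * (Real.exp (-(c₁ * (wn ξ / (1 + wn ξ ^ 2)) ^ 2) * t) * S ^ 2) := by ring
      _ ≤ (2 * K) ^ 2 * (Real.exp (-(c₁ * (wn ξ / (1 + wn ξ ^ 2)) ^ 2) * t) * S ^ 2) := by gcongr
      _ = _ := by ring
  obtain ⟨M, hM⟩ : ∃ M, M = 2 * K * Real.exp (-(c₁ / 2 * (wn ξ / (1 + wn ξ ^ 2)) ^ 2) * t) * S :=
    ⟨_, rfl⟩
  have hM0 : 0 ≤ M := by rw [hM]; positivity
  rw [← hM] at hsq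
  have hgoal : 2 * (2 * K) * Real.exp (-(c₁ / 2 * (wn ξ / (1 + wn ξ ^ 2)) ^ 2) * t) * S = 2 * M := by
    rw [hM]; ring
  rw [hgoal]
  have q : ∀ z : ℂ, ‖z‖ ^ 2 ≤ M ^ 2 → ‖z‖ ≤ M := fun z hz => norm_le_of_sq_le hM0 hz
  have p0 := sq_nonneg ‖prop P t ξ x 0 l‖
  have p1 := sq_nonneg ‖prop P t ξ x 1 l‖
  have p2 := sq_nonneg ‖prop P t ξ x 2 l‖
  have p3 := sq_nonneg ‖curlS ξ (prop P t ξ x 3) l / wn ξ‖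
  have hl := hsq l
  fin_cases a <;> simp only [Fin.reduceFinMk, Fin.zero_eta, Fin.mk_one]
  · exact (q _ (by linarith)).trans (by linarith)
  · exact (q _ (by linarith)).trans (by linarith)
  · exact (q _ (by linarith)).trans (by linarith)
  · refine norm_le_of_curlS hξ (divS_prop P ξ hx t 3) (fun l => q _ ?_) l
    linarith [hsq l, sq_nonneg ‖prop P t ξ x 0 l‖, sq_nonneg ‖prop P t ξ x 1 l‖,
      sq_nonneg ‖prop P t ξ x 2 l‖]

/-! ### Weighted integrals at low and high frequencies -/

/-- One term of the exponential series at a(1 + y) dominates the power; 1 + y is used so that a real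
exponent can be rounded up to an integer. -/
lemma exists_rpow_mul_exp_le {x a : ℝ} (hx : 0 ≤ x) (ha : 0 < a) :
    ∃ C : ℝ, 0 < C ∧ ∀ y : ℝ, 0 ≤ y → y ^ x * Real.exp (-a * y) ≤ C := by
  obtain ⟨N, hN⟩ := exists_nat_ge x
  refine ⟨N.factorial / a ^ N * Real.exp a, by positivity, fun y hy => ?_⟩
  have h1 : y ^ x ≤ (1 + y) ^ N := by
    calc y ^ x ≤ (1 + y) ^ x := Real.rpow_le_rpow hy (by linarith) hx
      _ ≤ (1 + y) ^ (N : ℝ) := Real.rpow_le_rpow_of_exponent_le (by linarith) hN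
      _ = _ := Real.rpow_natCast _ _
  have h2 := Real.pow_div_factorial_le_exp (a * (1 + y)) (by positivity) N
  rw [mul_pow, div_le_iff₀ (by positivity)] at h2
  have h3 : (1 + y) ^ N ≤ N.factorial / a ^ N * Real.exp (a * (1 + y)) := by
    rw [div_mul_eq_mul_div, le_div_iff₀ (by positivity)]
    linarith
  calc y ^ x * Real.exp (-a * y) ≤ N.factorial / a ^ N * Real.exp (a * (1 + y)) * Real.exp (-a * y) := by
        gcongr; exact h1.trans h3
    _ = _ := by rw [mul_assoc, ← Real.exp_add]; congr 2; ring

lemma exists_pow_mul_exp_le (n : ℕ) {a : ℝ} (ha : 0 < a) :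
    ∃ C : ℝ, 0 < C ∧ ∀ k T : ℝ, 0 ≤ k → 0 < T →
      k ^ n * Real.exp (-(a * k ^ 2) * T) ≤ C * T ^ (-(n : ℝ) / 2) := by
  obtain ⟨C, hC, h⟩ := exists_rpow_mul_exp_le (x := (n : ℝ) / 2) (by positivity) ha
  refine ⟨C, hC, fun k T hk hT => ?_⟩
  have h1 := h (k ^ 2 * T) (by positivity)
  have h2 : (k ^ 2 * T) ^ ((n : ℝ) / 2) = k ^ n * T ^ ((n : ℝ) / 2) := by
    rw [Real.mul_rpow (by positivity) hT.le, ← Real.rpow_natCast k 2, ← Real.rpow_mul hk]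
    congr 1
    rw [← Real.rpow_natCast k n]
    congr 1
    push_cast
    ring
  rw [h2] at h1
  have h3 : T ^ (-(n : ℝ) / 2) = (T ^ ((n : ℝ) / 2))⁻¹ := by
    rw [neg_div, Real.rpow_neg hT.le]
  rw [h3, ← div_eq_mul_inv, le_div_iff₀ (by positivity)]
  calc _ = k ^ n * T ^ ((n : ℝ) / 2) * Real.exp (-a * (k ^ 2 * T)) := by
        rw [mul_right_comm]; congr 2; ring
    _ ≤ C := h1

/-- The mechanism of regularity loss: for k ≥ δ the rate is at least a/k², and e^{-a(1+t)/k²} is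
bounded by a multiple of ((1+t)/k²)^{-ℓ/2}. The factor e^{a/δ²} pays for replacing t by 1 + t. -/
lemma exists_exp_high_le {c δ ℓ : ℝ} (hc : 0 < c) (hδ : 0 < δ) (hℓ : 0 ≤ ℓ) :
    ∃ C : ℝ, 0 < C ∧ ∀ k t : ℝ, δ ≤ k → 0 ≤ t →
      Real.exp (-(c * (k / (1 + k ^ 2)) ^ 2) * t) ≤ C * (1 + t) ^ (-ℓ / 2) * k ^ ℓ := by
  obtain ⟨a, ha⟩ : ∃ x, x = c * (δ ^ 2 / (1 + δ ^ 2)) ^ 2 := ⟨_, rfl⟩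
  have ha0 : 0 < a := by rw [ha]; positivity
  obtain ⟨C, hC, h⟩ := exists_rpow_mul_exp_le (x := ℓ / 2) (by positivity) ha0
  refine ⟨C * Real.exp (a / δ ^ 2), by positivity, fun k t hk ht => ?_⟩
  have hk0 : 0 < k := hδ.trans_le hk
  have h1 := h ((1 + t) / k ^ 2) (by positivity)
  have h2 : ((1 + t) / k ^ 2) ^ (ℓ / 2) = (1 + t) ^ (ℓ / 2) / k ^ ℓ := by
    rw [Real.div_rpow (by positivity) (by positivity), ← Real.rpow_natCast k 2,
      ← Real.rpow_mul hk0.le]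
    congr 2
    push_cast; ring
  have h3 : a / k ^ 2 ≤ c * (k / (1 + k ^ 2)) ^ 2 := by
    have h4 : δ ^ 2 / (1 + δ ^ 2) ≤ k ^ 2 / (1 + k ^ 2) := by
      rw [div_le_div_iff₀ (by positivity) (by positivity)]
      have : δ ^ 2 ≤ k ^ 2 := by gcongr
      linarith
    calc a / k ^ 2 ≤ c * (k ^ 2 / (1 + k ^ 2)) ^ 2 / k ^ 2 := by rw [ha]; gcongr
      _ = _ := by field_simp
  have h5 : Real.exp (-(c * (k / (1 + k ^ 2)) ^ 2) * t) ≤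
      Real.exp (a / δ ^ 2) * Real.exp (-a * ((1 + t) / k ^ 2)) := by
    rw [← Real.exp_add, Real.exp_le_exp]
    have h6 : a / k ^ 2 ≤ a / δ ^ 2 := by gcongr
    have h7 := mul_le_mul_of_nonneg_right h3 ht
    have h8 : -a * ((1 + t) / k ^ 2) = -(a / k ^ 2) - a / k ^ 2 * t := by ring
    rw [h8]
    linarith
  rw [h2, div_mul_eq_mul_div, div_le_iff₀ (by positivity)] at h1
  have h9 : (1 + t) ^ (-ℓ / 2) = ((1 + t) ^ (ℓ / 2))⁻¹ := by
    rw [neg_div, Real.rpow_neg (by positivity)]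
  have h10 : Real.exp (-a * ((1 + t) / k ^ 2)) ≤ C * (1 + t) ^ (-ℓ / 2) * k ^ ℓ := by
    have h11 : 0 < (1 + t) ^ (ℓ / 2) := Real.rpow_pos_of_pos (by linarith) _
    have h12 : C * (1 + t) ^ (-ℓ / 2) * k ^ ℓ = C * k ^ ℓ / (1 + t) ^ (ℓ / 2) := by rw [h9]; ring
    rw [h12, le_div_iff₀ h11]
    linarith
  calc _ ≤ _ := h5
    _ ≤ Real.exp (a / δ ^ 2) * (C * (1 + t) ^ (-ℓ / 2) * k ^ ℓ) := by gcongr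
    _ = _ := by ring

/-- The Cauchy–Schwarz inequality. -/
lemma lintegral_mul_le_of_sq_le {μ : Measure V} {f g : V → ℝ≥0∞} (hf : AEMeasurable f μ)
    (hg : AEMeasurable g μ) {A B : ℝ≥0∞} (hA : ∫⁻ ξ, f ξ ^ (2 : ℝ) ∂μ ≤ A ^ (2 : ℝ))
    (hB : ∫⁻ ξ, g ξ ^ (2 : ℝ) ∂μ ≤ B ^ (2 : ℝ)) : ∫⁻ ξ, f ξ * g ξ ∂μ ≤ A * B := by
  have h := ENNReal.lintegral_mul_le_Lp_mul_Lq μ (Real.HolderConjugate.two_two) hf hg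
  refine h.trans (mul_le_mul' ?_ ?_)
  · rw [one_div, ENNReal.rpow_inv_le_iff two_pos]; exact hA
  · rw [one_div, ENNReal.rpow_inv_le_iff two_pos]; exact hB

lemma IsFT.aemeasurable_enorm {f fh : V → ℂ} (h : IsFT f fh) {μ : Measure V}
    (hμ : μ ≪ volume) : AEMeasurable (fun ξ => ‖fh ξ‖ₑ) μ :=
  (h.1.aestronglyMeasurable.mono_ac hμ).enorm

lemma IsFT.lintegral_half_gauss_le {p : ℝ≥0∞} (hp1 : 1 ≤ p) (hp2 : p ≤ 2) {f fh : V → ℂ}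
    (h : IsFT f fh) (hf : MemLp f p volume) {s : ℝ} (hs : 0 < s) :
    ∫⁻ ξ, (ENNReal.ofReal (Real.exp (-s * wn ξ ^ 2)) * ‖fh ξ‖ₑ) ^ (2 : ℝ) ≤
      (ENNReal.ofReal ((4 * Real.pi * s) ^ (-(3 / 2) * (recip p - 1 / 2))) *
        eLpNorm f p volume) ^ (2 : ℝ) := by
  have hpi := Real.pi_pos
  have h1 := h.lintegral_gauss_le hp1 hp2 hf hs
  rw [ENNReal.mul_rpow_of_nonneg _ _ (by norm_num), ENNReal.ofReal_rpow_of_nonneg (by positivity)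
    (by norm_num), ← Real.rpow_mul (by positivity)]
  convert h1 using 2
  · ext ξ
    rw [ENNReal.mul_rpow_of_nonneg _ _ (by norm_num), ENNReal.ofReal_rpow_of_nonneg (by positivity)
      (by norm_num), ← Real.exp_mul]
    congr 3; ring
  · congr 2; ring

/-- Low frequencies: the heat kernel decay rates. -/
lemma exists_lintegral_low_le {p q : ℝ≥0∞} (hp1 : 1 ≤ p) (hp2 : p ≤ 2) (hq : 2 ≤ q) (n : ℕ)
    {c δ : ℝ} (hc : 0 < c) :
    ∃ C : ℝ, 0 < C ∧ ∀ (f fh φ φh : V → ℂ) (t : ℝ), MemLp f p volume → IsFT f fh →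
      MemLp φ (conjExp q) volume → IsFT φ φh → 0 ≤ t →
      ∫⁻ ξ in {ξ : V | δ ≤ wn ξ}ᶜ, ENNReal.ofReal (wn ξ ^ n * Real.exp (-(c * wn ξ ^ 2) * t)) *
          ‖fh ξ‖ₑ * ‖φh ξ‖ₑ ≤
        ENNReal.ofReal (C * (1 + t) ^ (-(3 / 2) * (recip p - recip q) - (n : ℝ) / 2)) *
          (eLpNorm f p volume * eLpNorm φ (conjExp q) volume) := by
  have hpi := Real.pi_pos
  obtain ⟨hq1, hq2, hq3⟩ := conjExp_bounds hq
  obtain ⟨C₀, hC₀, hexp⟩ := exists_pow_mul_exp_le n (half_pos hc)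
  refine ⟨Real.exp (c * δ ^ 2) * C₀ * (Real.pi * c) ^ (-(3 / 2) * (recip p - recip q)),
    by positivity, fun f fh φ φh t hf hfh hφ hφh ht => ?_⟩
  obtain ⟨T, hT⟩ : ∃ T, T = 1 + t := ⟨_, rfl⟩
  have hT0 : 0 < T := by rw [hT]; linarith
  -- On bounded frequencies t may be replaced by 1 + t. Half of the exponent c k²(1 + t) absorbs kⁿ,
  -- and a quarter goes to each of the two Gaussian-weighted factors of Cauchy–Schwarz.
  obtain ⟨s, hs⟩ : ∃ s, s = c / 4 * T := ⟨_, rfl⟩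
  have hs0 : 0 < s := by rw [hs]; positivity
  have h4s : 4 * Real.pi * s = Real.pi * c * T := by rw [hs]; ring
  have hme : Measurable fun ξ : V => ENNReal.ofReal (Real.exp (-s * wn ξ ^ 2)) :=
    ENNReal.measurable_ofReal.comp (Real.measurable_exp.comp
      (measurable_const.mul (measurable_wn.pow_const 2)))
  have hA := hfh.lintegral_half_gauss_le hp1 hp2 hf hs0
  have hB := hφh.lintegral_half_gauss_le hq1 hq2 hφ hs0
  have hAB := lintegral_mul_le_of_sq_le
    (hme.aemeasurable.mul (hfh.aemeasurable_enorm Measure.AbsolutelyContinuous.rfl))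
    (hme.aemeasurable.mul (hφh.aemeasurable_enorm Measure.AbsolutelyContinuous.rfl)) hA hB
  rw [← hT]
  calc ∫⁻ ξ in {ξ : V | δ ≤ wn ξ}ᶜ, ENNReal.ofReal (wn ξ ^ n * Real.exp (-(c * wn ξ ^ 2) * t)) *
          ‖fh ξ‖ₑ * ‖φh ξ‖ₑ
      ≤ ∫⁻ ξ in {ξ : V | δ ≤ wn ξ}ᶜ, ENNReal.ofReal (Real.exp (c * δ ^ 2) * C₀ * T ^ (-(n : ℝ) / 2)) *
          ((ENNReal.ofReal (Real.exp (-s * wn ξ ^ 2)) * ‖fh ξ‖ₑ) *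
            (ENNReal.ofReal (Real.exp (-s * wn ξ ^ 2)) * ‖φh ξ‖ₑ)) := by
        refine setLIntegral_mono' (measurableSet_high δ).compl fun ξ hξ => ?_
        have hk : wn ξ < δ := not_le.1 hξ
        have hk0 := wn_nonneg ξ
        have h1 := hexp (wn ξ) T hk0 hT0
        have h2 : wn ξ ^ n * Real.exp (-(c * wn ξ ^ 2) * t) ≤
            Real.exp (c * δ ^ 2) * C₀ * T ^ (-(n : ℝ) / 2) *
              (Real.exp (-s * wn ξ ^ 2) * Real.exp (-s * wn ξ ^ 2)) := by
          have h3 : Real.exp (-(c * wn ξ ^ 2) * t) = Real.exp (c * wn ξ ^ 2) *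
              Real.exp (-(c / 2 * wn ξ ^ 2) * T) *
              (Real.exp (-s * wn ξ ^ 2) * Real.exp (-s * wn ξ ^ 2)) := by
            rw [← Real.exp_add, ← Real.exp_add, ← Real.exp_add, hs, hT]
            congr 1; ring
          calc wn ξ ^ n * Real.exp (-(c * wn ξ ^ 2) * t)
              = Real.exp (c * wn ξ ^ 2) * (wn ξ ^ n * Real.exp (-(c / 2 * wn ξ ^ 2) * T)) *
                (Real.exp (-s * wn ξ ^ 2) * Real.exp (-s * wn ξ ^ 2)) := by rw [h3]; ring
            _ ≤ Real.exp (c * δ ^ 2) * (C₀ * T ^ (-(n : ℝ) / 2)) *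
                (Real.exp (-s * wn ξ ^ 2) * Real.exp (-s * wn ξ ^ 2)) := by gcongr
            _ = _ := by ring
        calc _ ≤ ENNReal.ofReal (Real.exp (c * δ ^ 2) * C₀ * T ^ (-(n : ℝ) / 2) *
              (Real.exp (-s * wn ξ ^ 2) * Real.exp (-s * wn ξ ^ 2))) * ‖fh ξ‖ₑ * ‖φh ξ‖ₑ := by
              gcongr
          _ = _ := by
              rw [ENNReal.ofReal_mul (by positivity),
                ENNReal.ofReal_mul (p := Real.exp (-s * wn ξ ^ 2)) (by positivity)]
              ring
    _ ≤ ∫⁻ ξ, ENNReal.ofReal (Real.exp (c * δ ^ 2) * C₀ * T ^ (-(n : ℝ) / 2)) *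
          ((ENNReal.ofReal (Real.exp (-s * wn ξ ^ 2)) * ‖fh ξ‖ₑ) *
            (ENNReal.ofReal (Real.exp (-s * wn ξ ^ 2)) * ‖φh ξ‖ₑ)) := setLIntegral_le_lintegral _ _
    _ ≤ ENNReal.ofReal (Real.exp (c * δ ^ 2) * C₀ * T ^ (-(n : ℝ) / 2)) *
          (ENNReal.ofReal ((4 * Real.pi * s) ^ (-(3 / 2) * (recip p - 1 / 2))) * eLpNorm f p volume *
            (ENNReal.ofReal ((4 * Real.pi * s) ^ (-(3 / 2) * (recip (conjExp q) - 1 / 2))) *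
              eLpNorm φ (conjExp q) volume)) := by
        rw [lintegral_const_mul' _ _ ENNReal.ofReal_ne_top]
        exact mul_le_mul_right hAB _
    _ = _ := by
        have h5 : (Real.exp (c * δ ^ 2) * C₀ * (Real.pi * c) ^ (-(3 / 2) * (recip p - recip q))) *
            T ^ (-(3 / 2) * (recip p - recip q) - (n : ℝ) / 2) =
            Real.exp (c * δ ^ 2) * C₀ * T ^ (-(n : ℝ) / 2) *
            ((4 * Real.pi * s) ^ (-(3 / 2) * (recip p - 1 / 2)) *
              (4 * Real.pi * s) ^ (-(3 / 2) * (recip (conjExp q) - 1 / 2))) := by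
          rw [← Real.rpow_add (by positivity), hq3, h4s, Real.mul_rpow (by positivity) hT0.le,
            sub_eq_add_neg _ ((n : ℝ) / 2), Real.rpow_add hT0, neg_div (2 : ℝ) (n : ℝ), show -(3 / 2) * (recip p - 1 / 2) + -(3 / 2) * (1 - recip q - 1 / 2) =
            -(3 / 2) * (recip p - recip q) by ring]
          ring
        rw [h5, ENNReal.ofReal_mul (q := _ * (4 * Real.pi * s) ^ _) (by positivity),
          ENNReal.ofReal_mul (q := (4 * Real.pi * s) ^ _) (by positivity)]
        ring

/-- The derivative loss is shared between f and the dual function. Outside the endpoint case, floor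
plus one strictly exceeds the required exponent, and half of the surplus makes each share strictly
admissible. When ℓ is an integer and r = q = 2, no surplus is needed, both sides being Plancherel.
-/
lemma exists_lossIndex_eq {r q : ℝ≥0∞} (hr1 : 1 ≤ r) (hr2 : r ≤ 2) (hq : 2 ≤ q) {ℓ : ℝ} :
    ∃ s₁ s₂ : ℝ, Admissible s₁ r ∧ Admissible s₂ (conjExp q) ∧
      (lossIndex ℓ r q : ℝ) = ℓ + s₁ + s₂ := by
  have hq3 := (conjExp_bounds hq).2.2
  rw [lossIndex]
  split_ifs with h
  · obtain ⟨⟨n, rfl⟩, rfl, rfl⟩ := h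
    refine ⟨0, 0, Or.inr ⟨rfl, rfl⟩, Or.inr ⟨rfl, ?_⟩, by simp⟩
    rw [conjExp, ENNReal.one_sub_inv_two, inv_inv]
  · have h1 := Nat.lt_floor_add_one (ℓ + 3 * (recip r - recip q))
    push_cast
    generalize (⌊ℓ + 3 * (recip r - recip q)⌋₊ : ℝ) = N at *
    refine ⟨3 * (recip r - 1 / 2) + (N + 1 - (ℓ + 3 * (recip r - recip q))) / 2,
      3 * (1 / 2 - recip q) + (N + 1 - (ℓ + 3 * (recip r - recip q))) / 2, Or.inl ?_, Or.inl ?_, ?_⟩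
    · linarith
    · rw [hq3]; linarith
    · ring

lemma ofReal_rpow_mul_enorm_sq {k σ : ℝ} (hk : 0 ≤ k) (z : ℂ) :
    (ENNReal.ofReal (k ^ σ) * ‖z‖ₑ) ^ (2 : ℝ) =
      ENNReal.ofReal (k ^ (2 * σ)) * ‖z‖ₑ ^ (2 : ℝ) := by
  rw [ENNReal.mul_rpow_of_nonneg _ _ (by norm_num), ENNReal.ofReal_rpow_of_nonneg (by positivity)
    (by norm_num), ← Real.rpow_mul hk, mul_comm σ 2]

/-- High frequencies: the loss of derivatives. -/
lemma exists_lintegral_high_loss_le {r q : ℝ≥0∞} (hr1 : 1 ≤ r) (hr2 : r ≤ 2) (hq : 2 ≤ q) (n : ℕ)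
    {ℓ δ : ℝ} (hδ : 0 < δ) :
    ∃ C : ℝ, 0 < C ∧ ∀ (p : ℝ≥0∞) (f : V → V) (k : Fin 3) (fh φ φh : V → ℂ), 1 ≤ p → p ≤ 2 →
      MemLp f p volume → IsFT (cp f k) fh → MemLp φ (conjExp q) volume → IsFT φ φh →
      ∫⁻ ξ in {ξ : V | δ ≤ wn ξ}, ENNReal.ofReal (wn ξ ^ ((n : ℝ) + ℓ)) * ‖fh ξ‖ₑ * ‖φh ξ‖ₑ ≤
        ENNReal.ofReal C * (gradNorm (n + lossIndex ℓ r q) r f * eLpNorm φ (conjExp q) volume) := by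
  obtain ⟨hq1, hq2, hq3⟩ := conjExp_bounds hq
  obtain ⟨s₁, s₂, hs₁, hs₂, hs⟩ := exists_lossIndex_eq (ℓ := ℓ) hr1 hr2 hq
  obtain ⟨C₁, hC₁, h₁⟩ := exists_lintegral_high_grad_le hr1 hr2 hδ hs₁ (n + lossIndex ℓ r q)
  obtain ⟨C₂, hC₂, h₂⟩ := exists_lintegral_high_le hq1 hq2 hδ hs₂
  have hsq : ∀ x : ℝ, 0 ≤ x → ENNReal.ofReal x = ENNReal.ofReal (√x) ^ (2 : ℝ) := fun x hx => by
    rw [ENNReal.ofReal_rpow_of_nonneg (by positivity) (by norm_num)]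
    norm_num [Real.sq_sqrt hx]
  refine ⟨√C₁ * √C₂ + 1, by positivity, fun p f k fh φ φh hp1 hp2 hf hfh hφ hφh => ?_⟩
  have hac : (volume : Measure V).restrict {ξ : V | δ ≤ wn ξ} ≪ volume :=
    Measure.absolutelyContinuous_of_le Measure.restrict_le_self
  have hm : ∀ σ : ℝ, Measurable fun ξ : V => ENNReal.ofReal (wn ξ ^ σ) := fun σ =>
    ENNReal.measurable_ofReal.comp (measurable_wn.pow_const _)
  -- The weight k^{n+ℓ} is split as k^{M-s₁} for f, matching M = n + `lossIndex ℓ r q` derivatives,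
  -- times k^{-s₂} for φ.
  have hAB := lintegral_mul_le_of_sq_le (μ := volume.restrict {ξ : V | δ ≤ wn ξ})
    (f := fun ξ => ENNReal.ofReal (wn ξ ^ (((n + lossIndex ℓ r q : ℕ) : ℝ) - s₁)) * ‖fh ξ‖ₑ)
    (g := fun ξ => ENNReal.ofReal (wn ξ ^ (-s₂)) * ‖φh ξ‖ₑ)
    (A := ENNReal.ofReal (√C₁) * gradNorm (n + lossIndex ℓ r q) r f)
    (B := ENNReal.ofReal (√C₂) * eLpNorm φ (conjExp q) volume)
    ((hm _).aemeasurable.mul (hfh.aemeasurable_enorm hac))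
    ((hm _).aemeasurable.mul (hφh.aemeasurable_enorm hac)) ?_ ?_
  · calc _ = ∫⁻ ξ in {ξ : V | δ ≤ wn ξ},
          ENNReal.ofReal (wn ξ ^ (((n + lossIndex ℓ r q : ℕ) : ℝ) - s₁)) * ‖fh ξ‖ₑ *
            (ENNReal.ofReal (wn ξ ^ (-s₂)) * ‖φh ξ‖ₑ) := by
          refine setLIntegral_congr_fun (measurableSet_high δ) fun ξ hξ => ?_
          have hk : 0 < wn ξ := hδ.trans_le hξ
          have h3 : (n : ℝ) + ℓ = (((n + lossIndex ℓ r q : ℕ) : ℝ) - s₁) + -s₂ := by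
            push_cast; rw [hs]; ring
          rw [h3, Real.rpow_add hk, ENNReal.ofReal_mul (by positivity)]
          ring
      _ ≤ _ := hAB
      _ = ENNReal.ofReal (√C₁ * √C₂) *
          (gradNorm (n + lossIndex ℓ r q) r f * eLpNorm φ (conjExp q) volume) := by
          rw [ENNReal.ofReal_mul (by positivity)]; ring
      _ ≤ _ := by gcongr; linarith
  · simp only [ofReal_rpow_mul_enorm_sq (wn_nonneg _)]
    rw [ENNReal.mul_rpow_of_nonneg _ _ (by norm_num), ← hsq _ hC₁]
    exact h₁ p f k fh hp1 hp2 hf hfh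
  · simp only [ofReal_rpow_mul_enorm_sq (wn_nonneg _)]
    rw [ENNReal.mul_rpow_of_nonneg _ _ (by norm_num), ← hsq _ hC₂]
    simpa only [mul_neg, neg_mul] using h₂ φ φh hφ hφh

/-! ### From pointwise bounds of the symbol to the decay estimate -/

lemma State.memLp_field {U : State} {p : ℝ≥0∞} (h : U.MemLp p) (a : Fin 4) :
    MeasureTheory.MemLp (U.field a) p volume := by
  fin_cases a
  exacts [h.1, h.2.1, h.2.2.1, h.2.2.2]

lemma State.sum_eLpNorm_field_le (U : State) (p : ℝ≥0∞) :
    ∑ i : Fin 4 × Fin 3, eLpNorm (cp (U.field i.1) i.2) p volume ≤ 3 * U.lpNorm p := by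
  refine (Finset.sum_le_sum fun i _ => eLpNorm_cp_le (U.field i.1) i.2).trans_eq ?_
  rw [Fintype.sum_prod_type, Fin.sum_univ_four]
  simp only [Finset.sum_const, Finset.card_univ, Fintype.card_fin, nsmul_eq_mul, State.lpNorm]
  simp only [State.field, Matrix.cons_val]
  push_cast
  ring

lemma State.sum_gradNorm_field (U : State) (M : ℕ) (r : ℝ≥0∞) :
    ∑ i : Fin 4 × Fin 3, EulerMaxwell.gradNorm M r (U.field i.1) = 3 * U.gradNorm M r := by
  rw [Fintype.sum_prod_type, Fin.sum_univ_four]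
  simp only [Finset.sum_const, Finset.card_univ, Fintype.card_fin, nsmul_eq_mul, State.gradNorm]
  simp only [State.field, Matrix.cons_val]
  push_cast
  ring

lemma enorm_le_of_norm_le_mul_sum {ι : Type*} [Fintype ι] {z : ℂ} {u : ι → ℂ} {W : ℝ} (hW : 0 ≤ W)
    (h : ‖z‖ ≤ W * ∑ i, ‖u i‖) : ‖z‖ₑ ≤ ENNReal.ofReal W * ∑ i, ‖u i‖ₑ := by
  rw [← ofReal_norm]
  refine (ENNReal.ofReal_le_ofReal h).trans_eq ?_
  rw [ENNReal.ofReal_mul hW, ENNReal.ofReal_sum_of_nonneg fun _ _ => norm_nonneg _]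
  simp only [ofReal_norm]

lemma lintegral_le_sum_add_sum {ι ι' : Type*} [Fintype ι] [Fintype ι'] {μ : Measure V}
    {F : V → ℝ≥0∞} {G : ι → V → ℝ≥0∞} {H : ι' → V → ℝ≥0∞} (hG : ∀ i, AEMeasurable (G i) μ)
    (hH : ∀ i, AEMeasurable (H i) μ) (h : ∀ᵐ ξ ∂μ, F ξ ≤ ∑ i, G i ξ + ∑ j, H j ξ)
    {X : ι → ℝ≥0∞} {Y : ι' → ℝ≥0∞} (hX : ∀ i, ∫⁻ ξ, G i ξ ∂μ ≤ X i)
    (hY : ∀ j, ∫⁻ ξ, H j ξ ∂μ ≤ Y j) : ∫⁻ ξ, F ξ ∂μ ≤ ∑ i, X i + ∑ j, Y j := by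
  refine (lintegral_mono_ae h).trans ?_
  rw [lintegral_add_left' (Finset.aemeasurable_fun_sum _ fun i _ => hG i),
    lintegral_finsetSum' _ fun i _ => hG i, lintegral_finsetSum' _ fun i _ => hH i]
  gcongr with i _ j _
  · exact hX i
  · exact hY j

lemma aemeasurable_weight {μ : Measure V} (hμ : μ ≪ volume) {w : V → ℝ} (hw : Measurable w)
    {f fh φ φh : V → ℂ} (hf : IsFT f fh) (hφ : IsFT φ φh) :
    AEMeasurable (fun ξ => ENNReal.ofReal (w ξ) * ‖fh ξ‖ₑ * ‖φh ξ‖ₑ) μ :=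
  ((ENNReal.measurable_ofReal.comp hw).aemeasurable.mul (hf.aemeasurable_enorm hμ)).mul
    (hφ.aemeasurable_enorm hμ)

/-- The pointwise bounds which lead to the decay estimate. -/
structure SymbolBound (k₀ K c₁ c₂ κ : ℝ) (a b : ℕ) (uh : Fin 4 → Fin 3 → V → ℂ) (t : ℝ)
    (D : V → ℂ) : Prop where
  low : ∀ᵐ ξ, wn ξ < k₀ → ‖D ξ‖ ≤ K * (wn ξ ^ a * Real.exp (-(c₁ * wn ξ ^ 2) * t) +
    Real.exp (-κ * t)) * ∑ i : Fin 4 × Fin 3, ‖uh i.1 i.2 ξ‖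
  high : ∀ᵐ ξ, k₀ ≤ wn ξ → ‖D ξ‖ ≤
    K * Real.exp (-(c₂ * (wn ξ / (1 + wn ξ ^ 2)) ^ 2) * t) *
      ∑ i : Fin 4 × Fin 3, ‖uh i.1 i.2 ξ‖ +
    K * Real.exp (-κ * t) * wn ξ ^ b * ∑ l, ‖uh 3 l ξ‖

/-- The factor k^{m+a} with a Gaussian in time gives the algebraic rate. The e^{-κt} term needs no
decay from the frequency integral, only boundedness. -/
lemma exists_lintegral_low_symbol_le {p q : ℝ≥0∞} (hp1 : 1 ≤ p) (hp2 : p ≤ 2) (hq : 2 ≤ q)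
    (m a b : ℕ) {k₀ K c₁ c₂ κ : ℝ} (hK : 0 < K) (hc₁ : 0 < c₁) :
    ∃ C : ℝ, 0 < C ∧ ∀ (U₀ : State) (uh : Fin 4 → Fin 3 → V → ℂ) (D : V → ℂ) (t : ℝ), U₀.MemLp p →
      (∀ a l, IsFT (cp (U₀.field a) l) (uh a l)) → 0 ≤ t →
      SymbolBound k₀ K c₁ c₂ κ a b uh t D →
      ∀ φ φh : V → ℂ, MemLp φ (conjExp q) volume → IsFT φ φh →
        ∫⁻ ξ in {ξ : V | k₀ ≤ wn ξ}ᶜ, ENNReal.ofReal (wn ξ ^ m) * ‖D ξ‖ₑ * ‖φh ξ‖ₑ ≤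
          (ENNReal.ofReal (C * (1 + t) ^ (-(3 / 2) * (recip p - recip q) - ((m : ℝ) + a) / 2)) *
              U₀.lpNorm p +
            ENNReal.ofReal (C * Real.exp (-κ * t)) * U₀.lpNorm p) *
          eLpNorm φ (conjExp q) volume := by
  obtain ⟨C₁, hC₁, h₁⟩ := exists_lintegral_low_le hp1 hp2 hq (m + a) (δ := k₀) hc₁
  obtain ⟨C₂, hC₂, h₂⟩ := exists_lintegral_low_le hp1 hp2 hq m (δ := k₀) hc₁
  refine ⟨3 * K * (C₁ + C₂), by positivity, fun U₀ uh D t hU huh ht hD φ φh hφ hφh => ?_⟩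
  have hac : (volume : Measure V).restrict {ξ : V | k₀ ≤ wn ξ}ᶜ ≪ volume :=
    Measure.absolutelyContinuous_of_le Measure.restrict_le_self
  have hw1 : Measurable fun ξ : V => wn ξ ^ (m + a) * Real.exp (-(c₁ * wn ξ ^ 2) * t) :=
    (measurable_wn.pow_const _).mul (Real.measurable_exp.comp
      (((measurable_wn.pow_const 2).const_mul c₁).neg.mul_const t))
  have hw2 : Measurable fun ξ : V => wn ξ ^ m * Real.exp (-(c₁ * wn ξ ^ 2) * 0) :=
    (measurable_wn.pow_const _).mul (Real.measurable_exp.comp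
      (((measurable_wn.pow_const 2).const_mul c₁).neg.mul_const 0))
  have key := lintegral_le_sum_add_sum (ι := Fin 4 × Fin 3) (ι' := Fin 4 × Fin 3)
    (μ := volume.restrict {ξ : V | k₀ ≤ wn ξ}ᶜ)
    (F := fun ξ => ENNReal.ofReal (wn ξ ^ m) * ‖D ξ‖ₑ * ‖φh ξ‖ₑ)
    (G := fun i ξ => ENNReal.ofReal K *
      (ENNReal.ofReal (wn ξ ^ (m + a) * Real.exp (-(c₁ * wn ξ ^ 2) * t)) *
        ‖uh i.1 i.2 ξ‖ₑ * ‖φh ξ‖ₑ))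
    (H := fun i ξ => ENNReal.ofReal (K * Real.exp (-κ * t)) *
      (ENNReal.ofReal (wn ξ ^ m * Real.exp (-(c₁ * wn ξ ^ 2) * 0)) * ‖uh i.1 i.2 ξ‖ₑ * ‖φh ξ‖ₑ))
    (fun i => (aemeasurable_weight hac hw1 (huh i.1 i.2) hφh).const_mul _)
    (fun i => (aemeasurable_weight hac hw2 (huh i.1 i.2) hφh).const_mul _) ?_
    (X := fun i => ENNReal.ofReal K * (ENNReal.ofReal (C₁ * (1 + t) ^
      (-(3 / 2) * (recip p - recip q) - ((m + a : ℕ) : ℝ) / 2)) *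
        (eLpNorm (cp (U₀.field i.1) i.2) p volume * eLpNorm φ (conjExp q) volume)))
    (Y := fun i => ENNReal.ofReal (K * Real.exp (-κ * t)) * (ENNReal.ofReal C₂ *
        (eLpNorm (cp (U₀.field i.1) i.2) p volume * eLpNorm φ (conjExp q) volume))) ?_ ?_
  · refine key.trans ?_
    simp only [← mul_assoc]
    rw [← Finset.sum_mul, ← Finset.sum_mul, ← Finset.mul_sum, ← Finset.mul_sum, ← add_mul]
    have hs := U₀.sum_eLpNorm_field_le p
    refine mul_le_mul_left (add_le_add ?_ ?_) _
    · refine (mul_le_mul_right hs _).trans ?_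
      rw [← mul_assoc, ← ENNReal.ofReal_mul hK.le, ← ENNReal.ofReal_ofNat 3,
        ← ENNReal.ofReal_mul (by positivity)]
      refine mul_le_mul_left (ENNReal.ofReal_le_ofReal ?_) _
      push_cast
      calc _ = 3 * K * C₁ * (1 + t) ^ (-(3 / 2) * (recip p - recip q) - ((m : ℝ) + a) / 2) := by
            ring
        _ ≤ _ := by gcongr; linarith
    · refine (mul_le_mul_right hs _).trans ?_
      rw [← mul_assoc, ← ENNReal.ofReal_mul (by positivity), ← ENNReal.ofReal_ofNat 3,
        ← ENNReal.ofReal_mul (by positivity)]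
      refine mul_le_mul_left (ENNReal.ofReal_le_ofReal ?_) _
      calc _ = 3 * K * C₂ * Real.exp (-κ * t) := by ring
        _ ≤ _ := by gcongr; linarith
  · filter_upwards [ae_restrict_of_ae hD.low, ae_restrict_mem (measurableSet_high k₀).compl]
      with ξ h hξ
    have hk0 := wn_nonneg ξ
    have h3 := enorm_le_of_norm_le_mul_sum (by positivity) (h (not_le.1 hξ))
    calc ENNReal.ofReal (wn ξ ^ m) * ‖D ξ‖ₑ * ‖φh ξ‖ₑ
        ≤ ENNReal.ofReal (wn ξ ^ m) * (ENNReal.ofReal (K * (wn ξ ^ a *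
          Real.exp (-(c₁ * wn ξ ^ 2) * t) + Real.exp (-κ * t))) *
          ∑ i : Fin 4 × Fin 3, ‖uh i.1 i.2 ξ‖ₑ) * ‖φh ξ‖ₑ := by gcongr
      _ = _ := by
        rw [← Finset.mul_sum, ← Finset.mul_sum, ← Finset.sum_mul, ← Finset.sum_mul,
          ← Finset.mul_sum, ← Finset.mul_sum, ← mul_assoc, ← mul_assoc, ← mul_assoc, ← mul_assoc,
          ← mul_assoc, ← add_mul, ← add_mul,
          ← ENNReal.ofReal_mul (by positivity), ← ENNReal.ofReal_mul (by positivity),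
          ← ENNReal.ofReal_mul (by positivity), ← ENNReal.ofReal_add (by positivity) (by positivity)]
        congr 3
        rw [mul_zero, Real.exp_zero, pow_add]
        ring
  · intro i
    rw [lintegral_const_mul' _ _ ENNReal.ofReal_ne_top]
    exact mul_le_mul_right (h₁ _ _ _ _ t (memLp_cp (State.memLp_field hU i.1) i.2) (huh i.1 i.2)
      hφ hφh ht) _
  · intro i
    rw [lintegral_const_mul' _ _ ENNReal.ofReal_ne_top]
    -- At time 0 the low-frequency estimate is just a bound for the weight k^m, with constant C₂.
    have h3 := h₂ _ _ _ _ 0 (memLp_cp (State.memLp_field hU i.1) i.2) (huh i.1 i.2) hφ hφh le_rfl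
    rw [add_zero, Real.one_rpow, mul_one] at h3
    exact mul_le_mul_right h3 _

/-- The solution's part of the symbol is treated with loss ℓ, the profile's part with loss 0 and b
extra derivatives on B₀. -/
lemma exists_lintegral_high_symbol_le {r q : ℝ≥0∞} (hr1 : 1 ≤ r) (hr2 : r ≤ 2) (hq : 2 ≤ q)
    (m a b : ℕ) {ℓ k₀ K c₁ c₂ κ : ℝ} (hℓ : 0 ≤ ℓ) (hk₀ : 0 < k₀) (hK : 0 < K) (hc₂ : 0 < c₂) :
    ∃ C : ℝ, 0 < C ∧ ∀ (p : ℝ≥0∞) (U₀ : State) (uh : Fin 4 → Fin 3 → V → ℂ) (D : V → ℂ) (t : ℝ),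
      1 ≤ p → p ≤ 2 → U₀.MemLp p →
      (∀ a l, IsFT (cp (U₀.field a) l) (uh a l)) → 0 ≤ t →
      SymbolBound k₀ K c₁ c₂ κ a b uh t D →
      ∀ φ φh : V → ℂ, MemLp φ (conjExp q) volume → IsFT φ φh →
        ∫⁻ ξ in {ξ : V | k₀ ≤ wn ξ}, ENNReal.ofReal (wn ξ ^ m) * ‖D ξ‖ₑ * ‖φh ξ‖ₑ ≤
          (ENNReal.ofReal (C * (1 + t) ^ (-ℓ / 2)) * U₀.gradNorm (m + lossIndex ℓ r q) r +
            ENNReal.ofReal (C * Real.exp (-κ * t)) * gradNorm (m + b + lossIndex 0 r q) r U₀.B) *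
          eLpNorm φ (conjExp q) volume := by
  obtain ⟨C₁, hC₁, h₁⟩ := exists_lintegral_high_loss_le hr1 hr2 hq m (ℓ := ℓ) hk₀
  obtain ⟨C₂, hC₂, h₂⟩ := exists_lintegral_high_loss_le hr1 hr2 hq (m + b) (ℓ := 0) hk₀
  obtain ⟨C₃, hC₃, h₃⟩ := exists_exp_high_le hc₂ hk₀ hℓ
  refine ⟨3 * K * (C₃ * C₁ + C₂), by positivity,
    fun p U₀ uh D t hp1 hp2 hU huh ht hD φ φh hφ hφh => ?_⟩
  have hac : (volume : Measure V).restrict {ξ : V | k₀ ≤ wn ξ} ≪ volume :=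
    Measure.absolutelyContinuous_of_le Measure.restrict_le_self
  have h1t : 0 < 1 + t := by linarith
  have hw : ∀ x : ℝ, Measurable fun ξ : V => wn ξ ^ x := fun x => measurable_wn.pow_const _
  have key := lintegral_le_sum_add_sum (ι := Fin 4 × Fin 3) (ι' := Fin 3)
    (μ := volume.restrict {ξ : V | k₀ ≤ wn ξ})
    (F := fun ξ => ENNReal.ofReal (wn ξ ^ m) * ‖D ξ‖ₑ * ‖φh ξ‖ₑ)
    (G := fun i ξ => ENNReal.ofReal (K * (C₃ * (1 + t) ^ (-ℓ / 2))) *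
      (ENNReal.ofReal (wn ξ ^ ((m : ℝ) + ℓ)) * ‖uh i.1 i.2 ξ‖ₑ * ‖φh ξ‖ₑ))
    (H := fun l ξ => ENNReal.ofReal (K * Real.exp (-κ * t)) *
      (ENNReal.ofReal (wn ξ ^ (((m + b : ℕ) : ℝ) + 0)) * ‖uh 3 l ξ‖ₑ * ‖φh ξ‖ₑ))
    (fun i => (aemeasurable_weight hac (hw _) (huh i.1 i.2) hφh).const_mul _)
    (fun l => (aemeasurable_weight hac (hw _) (huh 3 l) hφh).const_mul _) ?_
    (X := fun i => ENNReal.ofReal (K * (C₃ * (1 + t) ^ (-ℓ / 2))) * (ENNReal.ofReal C₁ *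
        (gradNorm (m + lossIndex ℓ r q) r (U₀.field i.1) * eLpNorm φ (conjExp q) volume)))
    (Y := fun l => ENNReal.ofReal (K * Real.exp (-κ * t)) * (ENNReal.ofReal C₂ *
        (gradNorm (m + b + lossIndex 0 r q) r U₀.B * eLpNorm φ (conjExp q) volume))) ?_ ?_
  · refine key.trans ?_
    simp only [← mul_assoc]
    rw [← Finset.sum_mul, ← Finset.sum_mul, ← Finset.mul_sum, ← Finset.mul_sum, ← add_mul,
      U₀.sum_gradNorm_field, Finset.sum_const, Finset.card_univ, Fintype.card_fin, nsmul_eq_mul]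
    refine mul_le_mul_left (add_le_add ?_ ?_) _
    · rw [← mul_assoc, ← ENNReal.ofReal_mul (by positivity), ← ENNReal.ofReal_ofNat 3,
        ← ENNReal.ofReal_mul (by positivity)]
      refine mul_le_mul_left (ENNReal.ofReal_le_ofReal ?_) _
      calc _ = 3 * K * (C₃ * C₁) * (1 + t) ^ (-ℓ / 2) := by ring
        _ ≤ _ := by gcongr; linarith
    · rw [← mul_assoc, ← ENNReal.ofReal_mul (by positivity), Nat.cast_ofNat,
        ← ENNReal.ofReal_ofNat 3, ← ENNReal.ofReal_mul (by positivity)]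
      refine mul_le_mul_left (ENNReal.ofReal_le_ofReal ?_) _
      calc _ = 3 * K * C₂ * Real.exp (-κ * t) := by ring
        _ ≤ _ := by gcongr; exact le_add_of_nonneg_left (by positivity)
  · filter_upwards [ae_restrict_of_ae hD.high, ae_restrict_mem (measurableSet_high k₀)] with ξ h hξ
    have hk : 0 < wn ξ := hk₀.trans_le hξ
    have h4 := h hξ
    have h5 : ‖D ξ‖ₑ ≤ ENNReal.ofReal (K * (C₃ * (1 + t) ^ (-ℓ / 2)) * wn ξ ^ ℓ) *
        ∑ i : Fin 4 × Fin 3, ‖uh i.1 i.2 ξ‖ₑ +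
        ENNReal.ofReal (K * Real.exp (-κ * t) * wn ξ ^ b) * ∑ l, ‖uh 3 l ξ‖ₑ := by
      rw [← ofReal_norm]
      refine (ENNReal.ofReal_le_ofReal h4).trans ?_
      rw [ENNReal.ofReal_add (by positivity) (by positivity), ENNReal.ofReal_mul (by positivity),
        ENNReal.ofReal_mul (p := K * Real.exp (-κ * t) * wn ξ ^ b) (by positivity),
        ENNReal.ofReal_sum_of_nonneg fun _ _ => norm_nonneg _,
        ENNReal.ofReal_sum_of_nonneg fun _ _ => norm_nonneg _]
      simp only [ofReal_norm]
      gcongr ?_ * _ + _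
      refine ENNReal.ofReal_le_ofReal ?_
      rw [mul_assoc]
      gcongr
      exact h₃ _ t hξ ht
    calc ENNReal.ofReal (wn ξ ^ m) * ‖D ξ‖ₑ * ‖φh ξ‖ₑ
        ≤ ENNReal.ofReal (wn ξ ^ m) *
          (ENNReal.ofReal (K * (C₃ * (1 + t) ^ (-ℓ / 2)) * wn ξ ^ ℓ) *
            ∑ i : Fin 4 × Fin 3, ‖uh i.1 i.2 ξ‖ₑ +
          ENNReal.ofReal (K * Real.exp (-κ * t) * wn ξ ^ b) * ∑ l, ‖uh 3 l ξ‖ₑ) * ‖φh ξ‖ₑ := by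
          gcongr
      _ = _ := by
        rw [← Finset.mul_sum, ← Finset.mul_sum, ← Finset.sum_mul, ← Finset.sum_mul,
          ← Finset.mul_sum, ← Finset.mul_sum, add_zero, Real.rpow_natCast, pow_add,
          Real.rpow_add hk, Real.rpow_natCast, ENNReal.ofReal_mul (q := wn ξ ^ ℓ) (by positivity),
          ENNReal.ofReal_mul (q := wn ξ ^ b) (by positivity),
          ENNReal.ofReal_mul (q := wn ξ ^ ℓ) (by positivity),
          ENNReal.ofReal_mul (q := wn ξ ^ b) (by positivity)]
        ring
  · intro i
    rw [lintegral_const_mul' _ _ ENNReal.ofReal_ne_top]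
    exact mul_le_mul_right (h₁ p _ _ _ _ _ hp1 hp2 (State.memLp_field hU i.1) (huh i.1 i.2)
      hφ hφh) _
  · intro l
    rw [lintegral_const_mul' _ _ ENNReal.ofReal_ne_top]
    exact mul_le_mul_right (h₂ p _ _ _ _ _ hp1 hp2 hU.2.2.2 (huh 3 l) hφ hφh) _

lemma decayBound_mono {C C' : ℝ} (h : C ≤ C') (κ : ℝ) (m : ℕ) (p r q : ℝ≥0∞) (ℓ : ℝ) (a b : ℕ)
    (U₀ : State) {t : ℝ} (ht : 0 ≤ t) :
    decayBound C κ m p r q ℓ a b U₀ t ≤ decayBound C' κ m p r q ℓ a b U₀ t := by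
  have h1t : 0 ≤ 1 + t := by linarith
  unfold decayBound
  gcongr

lemma mul_decayBound {n : ℝ} (hn : 0 ≤ n) (C κ : ℝ) (m : ℕ) (p r q : ℝ≥0∞) (ℓ : ℝ) (a b : ℕ)
    (U₀ : State) (t : ℝ) :
    ENNReal.ofReal n * decayBound C κ m p r q ℓ a b U₀ t =
      decayBound (n * C) κ m p r q ℓ a b U₀ t := by
  simp only [decayBound, mul_assoc n C, ENNReal.ofReal_mul hn]
  ring

lemma exists_lintegral_symbol_le {p r q : ℝ≥0∞} (hp1 : 1 ≤ p) (hp2 : p ≤ 2) (hr1 : 1 ≤ r)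
    (hr2 : r ≤ 2) (hq : 2 ≤ q) (m a b : ℕ) {ℓ k₀ K c₁ c₂ κ : ℝ} (hℓ : 0 ≤ ℓ) (hk₀ : 0 < k₀)
    (hK : 0 < K) (hc₁ : 0 < c₁) (hc₂ : 0 < c₂) :
    ∃ C : ℝ, 0 < C ∧ ∀ (U₀ : State) (uh : Fin 4 → Fin 3 → V → ℂ) (D : V → ℂ) (t : ℝ), U₀.MemLp p →
      (∀ a l, IsFT (cp (U₀.field a) l) (uh a l)) → 0 ≤ t →
      SymbolBound k₀ K c₁ c₂ κ a b uh t D →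
      ∀ φ φh : V → ℂ, MemLp φ (conjExp q) volume → IsFT φ φh →
        ∫⁻ ξ, ENNReal.ofReal (wn ξ ^ m) * ‖D ξ‖ₑ * ‖φh ξ‖ₑ ≤
          decayBound C κ m p r q ℓ a b U₀ t * eLpNorm φ (conjExp q) volume := by
  obtain ⟨C₁, hC₁, h₁⟩ := exists_lintegral_low_symbol_le hp1 hp2 hq m a b (k₀ := k₀) (c₂ := c₂)
    (κ := κ) hK hc₁
  obtain ⟨C₂, hC₂, h₂⟩ := exists_lintegral_high_symbol_le hr1 hr2 hq m a b (c₁ := c₁) (κ := κ)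
    hℓ hk₀ hK hc₂
  refine ⟨C₁ + C₂, by positivity, fun U₀ uh D t hU huh ht hD φ φh hφ hφh => ?_⟩
  have h1t : 0 ≤ 1 + t := by linarith
  rw [← lintegral_add_compl _ (measurableSet_high k₀), add_comm]
  refine (add_le_add (h₁ U₀ uh D t hU huh ht hD φ φh hφ hφh)
    (h₂ p U₀ uh D t hp1 hp2 hU huh ht hD φ φh hφ hφh)).trans ?_
  rw [← add_mul, ← add_assoc, decayBound]
  gcongr <;> linarith

/-! ### Square integrability -/

/-- The index exceeds s₁ by ℓ + s₂ ≥ 0, so the controlled weight is at least k^{2n} up to a power of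
δ. -/
lemma memLp_high {r q : ℝ≥0∞} (hr1 : 1 ≤ r) (hr2 : r ≤ 2) (hq : 2 ≤ q) (n : ℕ) {ℓ δ : ℝ}
    (hℓ : 0 ≤ ℓ) (hδ : 0 < δ) {p : ℝ≥0∞} (hp1 : 1 ≤ p) (hp2 : p ≤ 2) {f : V → V} {k : Fin 3}
    {fh : V → ℂ} (hf : MemLp f p volume) (hfh : IsFT (cp f k) fh)
    (hfin : gradNorm (n + lossIndex ℓ r q) r f ≠ ⊤) :
    MemLp ({ξ : V | δ ≤ wn ξ}.indicator fun ξ => ((wn ξ ^ n : ℝ) : ℂ) * fh ξ) 2 volume := by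
  obtain ⟨hq1, hq2, -⟩ := conjExp_bounds hq
  obtain ⟨s₁, s₂, hs₁, hs₂, hs⟩ := exists_lossIndex_eq (ℓ := ℓ) hr1 hr2 hq
  have hs₂0 := hs₂.nonneg hq1 hq2
  obtain ⟨C, hC, h⟩ := exists_lintegral_high_grad_le hr1 hr2 hδ hs₁ (n + lossIndex ℓ r q)
  have hfh1 := h p f k fh hp1 hp2 hf hfh
  have hm : AEStronglyMeasurable (fun ξ => ((wn ξ ^ n : ℝ) : ℂ) * fh ξ) volume :=
    (Complex.measurable_ofReal.comp (measurable_wn.pow_const n)).aestronglyMeasurable.mul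
      hfh.1.aestronglyMeasurable
  rw [memLp_indicator_iff_restrict (measurableSet_high δ)]
  refine ⟨hm.restrict, ?_⟩
  rw [eLpNorm_lt_top_iff_lintegral_rpow_enorm_lt_top (by norm_num) (by norm_num)]
  simp only [ENNReal.toReal_ofNat]
  obtain ⟨e, he⟩ : ∃ e, e = 2 * (((n + lossIndex ℓ r q : ℕ) : ℝ) - s₁) - 2 * n := ⟨_, rfl⟩
  have he0 : 0 ≤ e := by rw [he]; push_cast; linarith
  rw [show 2 * (((n + lossIndex ℓ r q : ℕ) : ℝ) - s₁) = e + 2 * n by rw [he]; ring] at hfh1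
  calc ∫⁻ ξ in {ξ : V | δ ≤ wn ξ}, ‖((wn ξ ^ n : ℝ) : ℂ) * fh ξ‖ₑ ^ (2 : ℝ)
      ≤ ∫⁻ ξ in {ξ : V | δ ≤ wn ξ}, ENNReal.ofReal (δ ^ (-e)) *
          (ENNReal.ofReal (wn ξ ^ (e + 2 * n)) * ‖fh ξ‖ₑ ^ (2 : ℝ)) := by
        refine setLIntegral_mono' (measurableSet_high δ) fun ξ hξ => ?_
        have hk : 0 < wn ξ := hδ.trans_le hξ
        have h1 : (wn ξ ^ n) ^ (2 : ℝ) ≤ δ ^ (-e) * wn ξ ^ (e + 2 * n) := by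
          have h2 : (wn ξ ^ n) ^ (2 : ℝ) = wn ξ ^ (-e) * wn ξ ^ (e + 2 * n) := by
            rw [← Real.rpow_add hk, ← Real.rpow_natCast, ← Real.rpow_mul hk.le]
            congr 1; ring
          rw [h2]
          gcongr ?_ * _
          exact Real.rpow_le_rpow_of_nonpos hδ hξ (by linarith)
        rw [enorm_mul, ENNReal.mul_rpow_of_nonneg _ _ (by norm_num),
          ← ofReal_norm ((wn ξ ^ n : ℝ) : ℂ), Complex.norm_real, Real.norm_of_nonneg (by positivity),
          ENNReal.ofReal_rpow_of_nonneg (by positivity) (by norm_num), ← mul_assoc,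
          ← ENNReal.ofReal_mul (by positivity)]
        gcongr
    _ ≤ ENNReal.ofReal (δ ^ (-e)) *
          (ENNReal.ofReal C * gradNorm (n + lossIndex ℓ r q) r f ^ (2 : ℝ)) := by
        rw [lintegral_const_mul' _ _ ENNReal.ofReal_ne_top]
        exact mul_le_mul_right hfh1 _
    _ < ⊤ := by finiteness

/-- Supplies the qualitative square integrability demanded by `gradNorm_le_of_fourier`: below k₀ the
factor k^m is bounded and D is in L², above k₀ the finite gradient norms take over. -/
lemma SymbolBound.memLp {p r q : ℝ≥0∞} (hp1 : 1 ≤ p) (hp2 : p ≤ 2) (hr1 : 1 ≤ r) (hr2 : r ≤ 2)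
    (hq : 2 ≤ q) {m a b : ℕ} {ℓ k₀ K c₁ c₂ κ t : ℝ} (hℓ : 0 ≤ ℓ) (hk₀ : 0 < k₀) (hK : 0 < K)
    (hc₂ : 0 < c₂) {U₀ : State} {uh : Fin 4 → Fin 3 → V → ℂ} {D : V → ℂ} (hU : U₀.MemLp p)
    (huh : ∀ a l, IsFT (cp (U₀.field a) l) (uh a l)) (ht : 0 ≤ t)
    (hD : SymbolBound k₀ K c₁ c₂ κ a b uh t D) (hD2 : MemLp D 2 volume)
    (hfin : ∀ a, gradNorm (m + lossIndex ℓ r q) r (U₀.field a) ≠ ⊤)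
    (hfinB : gradNorm (m + b + lossIndex 0 r q) r U₀.B ≠ ⊤) :
    MemLp (fun ξ => ((wn ξ ^ m : ℝ) : ℂ) * D ξ) 2 volume := by
  have hG := fun i : Fin 4 × Fin 3 => memLp_high hr1 hr2 hq m hℓ hk₀ hp1 hp2
    (State.memLp_field hU i.1) (huh i.1 i.2) (hfin i.1)
  have hH := fun l : Fin 3 => memLp_high hr1 hr2 hq (m + b) le_rfl hk₀ hp1 hp2
    hU.2.2.2 (huh 3 l) hfinB
  have hm : AEStronglyMeasurable (fun ξ => ((wn ξ ^ m : ℝ) : ℂ) * D ξ) volume :=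
    (Complex.measurable_ofReal.comp (measurable_wn.pow_const m)).aestronglyMeasurable.mul hD2.1
  have hg := ((hD2.norm.const_mul (k₀ ^ m)).add
    ((memLp_finsetSum Finset.univ fun i _ => (hG i).norm).const_mul K)).add
    ((memLp_finsetSum Finset.univ fun l _ => (hH l).norm).const_mul (K * Real.exp (-κ * t)))
  refine hg.mono' hm ?_
  filter_upwards [hD.high] with ξ h
  have hk := wn_nonneg ξ
  simp only [Pi.add_apply]
  rw [norm_mul, Complex.norm_real, Real.norm_of_nonneg (by positivity)]
  by_cases hξ : k₀ ≤ wn ξ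
  · have h1 := h hξ
    have hmem : ξ ∈ {ξ : V | k₀ ≤ wn ξ} := hξ
    simp only [indicator_of_mem hmem, norm_mul, Complex.norm_real]
    simp only [norm_pow, Real.norm_of_nonneg hk, ← Finset.mul_sum]
    have h2 : Real.exp (-(c₂ * (wn ξ / (1 + wn ξ ^ 2)) ^ 2) * t) ≤ 1 := by
      rw [Real.exp_le_one_iff]
      have : 0 ≤ c₂ * (wn ξ / (1 + wn ξ ^ 2)) ^ 2 * t := by positivity
      linarith
    calc wn ξ ^ m * ‖D ξ‖ ≤ wn ξ ^ m * (K * 1 * ∑ i : Fin 4 × Fin 3, ‖uh i.1 i.2 ξ‖ +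
          K * Real.exp (-κ * t) * wn ξ ^ b * ∑ l, ‖uh 3 l ξ‖) := by
          gcongr
          refine h1.trans ?_
          gcongr
      _ = K * (wn ξ ^ m * ∑ i : Fin 4 × Fin 3, ‖uh i.1 i.2 ξ‖) +
          K * Real.exp (-κ * t) * (wn ξ ^ (m + b) * ∑ l, ‖uh 3 l ξ‖) := by rw [pow_add]; ring
      _ ≤ _ := by
          have : 0 ≤ k₀ ^ m * ‖D ξ‖ := by positivity
          linarith
  · have hξ' := not_le.1 hξ
    have h3 : wn ξ ^ m * ‖D ξ‖ ≤ k₀ ^ m * ‖D ξ‖ := by gcongr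
    have h4 : 0 ≤ K * ∑ i : Fin 4 × Fin 3, ‖({ξ : V | k₀ ≤ wn ξ}.indicator fun ξ =>
      ((wn ξ ^ m : ℝ) : ℂ) * uh i.1 i.2 ξ) ξ‖ := by positivity
    have h5 : 0 ≤ K * Real.exp (-κ * t) * ∑ l, ‖({ξ : V | k₀ ≤ wn ξ}.indicator fun ξ =>
      ((wn ξ ^ (m + b) : ℝ) : ℂ) * uh 3 l ξ) ξ‖ := by positivity
    linarith

/-- All prefactors are positive, so a finite right-hand side forces the gradient norms of the data
to be finite; if it is infinite there is nothing to prove. -/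
lemma gradNorm_ne_top_of_decayBound {C κ : ℝ} (hC : 0 < C) {m : ℕ} {p r q : ℝ≥0∞} {ℓ : ℝ}
    {a b : ℕ} {U₀ : State} {t : ℝ} (ht : 0 ≤ t) (h : decayBound C κ m p r q ℓ a b U₀ t ≠ ⊤) :
    (∀ a, gradNorm (m + lossIndex ℓ r q) r (U₀.field a) ≠ ⊤) ∧
      gradNorm (m + b + lossIndex 0 r q) r U₀.B ≠ ⊤ := by
  have h1t : 0 < 1 + t := by linarith
  have hmul : ∀ {x : ℝ} {y : ℝ≥0∞}, 0 < x → ENNReal.ofReal x * y ≠ ⊤ → y ≠ ⊤ := by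
    rintro x y hx h rfl
    exact h (ENNReal.mul_top (ENNReal.ofReal_pos.2 hx).ne')
  rw [decayBound, ENNReal.add_ne_top, ENNReal.add_ne_top] at h
  have h1 := hmul (by positivity) h.1.2
  refine ⟨fun a => ?_, hmul (by positivity) h.2⟩
  simp only [State.gradNorm, ENNReal.add_ne_top] at h1
  fin_cases a
  exacts [h1.1.1.1, h1.1.1.2, h1.1.2, h1.2]

/-- The information about `f` is required only when the last norm of B₀ is finite: at t = 0 the
profile contains the curl of B₀, which need not exist in L² otherwise. -/
lemma exists_gradNorm_le {p r q : ℝ≥0∞} (hp1 : 1 ≤ p) (hp2 : p ≤ 2) (hr1 : 1 ≤ r)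
    (hr2 : r ≤ 2) (hq : 2 ≤ q) (m a b : ℕ) {ℓ k₀ K c₁ c₂ κ : ℝ} (hℓ : 0 ≤ ℓ) (hk₀ : 0 < k₀)
    (hK : 0 < K) (hc₁ : 0 < c₁) (hc₂ : 0 < c₂) :
    ∃ C : ℝ, 0 < C ∧ ∀ (U₀ : State) (uh : Fin 4 → Fin 3 → V → ℂ) (f : V → V) (t : ℝ), U₀.MemLp p →
      (∀ a l, IsFT (cp (U₀.field a) l) (uh a l)) → 0 ≤ t →
      (gradNorm (m + b + lossIndex 0 r q) r U₀.B ≠ ⊤ → MemLp f 2 volume ∧ ∃ D : Fin 3 → V → ℂ,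
        (∀ l, IsFT (cp f l) (D l)) ∧ ∀ l, SymbolBound k₀ K c₁ c₂ κ a b uh t (D l)) →
      gradNorm m q f ≤ decayBound C κ m p r q ℓ a b U₀ t := by
  obtain ⟨C, hC, h⟩ := exists_lintegral_symbol_le hp1 hp2 hr1 hr2 hq m a b (κ := κ) hℓ hk₀ hK hc₁ hc₂
  refine ⟨(3 ^ m * 3 : ℕ) * C, by positivity, fun U₀ uh f t hU huh ht hf => ?_⟩
  rw [← mul_decayBound (by positivity), ENNReal.ofReal_natCast]
  by_cases hfin : decayBound C κ m p r q ℓ a b U₀ t = ⊤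
  · rw [hfin, ENNReal.mul_top (by simp)]
    exact le_top
  · obtain ⟨h1, h2⟩ := gradNorm_ne_top_of_decayBound hC ht hfin
    obtain ⟨hf2, D, hD, hDb⟩ := hf h2
    exact gradNorm_le_of_fourier hq hf2 hD
      (fun l => (hDb l).memLp hp1 hp2 hr1 hr2 hq hℓ hk₀ hK hc₂ hU huh ht
        ((hD l).memLp_two (memLp_cp hf2 l)) h1 h2)
      (fun l φ φh hφ hφh => h U₀ uh (D l) t hU huh ht (hDb l) φ φh hφ hφh)

/-! ### The asymptotic profile in Fourier space -/

lemma cp_Bbar {P : Params} {B : V → V} (hB : MemLp B 2 volume) {t : ℝ} (ht : 0 < t) (k : Fin 3) :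
    cp (Bbar P B t) k = heat (P.mu2 * t) (cp B k) := by
  have hs : 0 < P.mu2 * t := mul_pos P.mu2_pos ht
  have h12 : (1 : ℝ≥0∞) ≤ 2 := by norm_num
  ext x
  have hgk : Continuous fun y => gk (P.mu2 * t) (x - y) :=
    (continuous_gk _).comp (continuous_const.sub continuous_id)
  have hi : Integrable (fun y => gk (P.mu2 * t) (x - y) • B y) volume := by
    have h1 := integrable_gk_mul hs h12 le_rfl (hB.norm.ofReal (K := ℂ)) x
    refine h1.mono (hgk.aestronglyMeasurable.smul hB.1) (Eventually.of_forall fun y => ?_)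
    rw [norm_smul, norm_mul, Complex.norm_real]
    simp
  simp only [cp, heat, Bbar, if_pos ht, heatKernel_eq_gk]
  rw [integral_smul_apply hi, ← integral_complex_ofReal]
  simp only [Complex.ofReal_mul]

lemma memLp_of_cp {p : ℝ≥0∞} {f : V → V} (h : ∀ k, MemLp (cp f k) p volume) :
    MemLp f p volume :=
  MemLp.of_eval_piLp fun k => by simpa [cp] using (h k).re

lemma Bbar_fourier {P : Params} {B : V → V} (hB : MemLp B 2 volume) {bh : Fin 3 → V → ℂ}
    (hbh : ∀ k, IsFT (cp B k) (bh k)) {t : ℝ} (ht : 0 ≤ t) :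
    MemLp (Bbar P B t) 2 volume ∧ ∀ k, IsFT (cp (Bbar P B t) k) fun ξ =>
      (Real.exp (-(P.mu2 * wn ξ ^ 2) * t) : ℂ) * bh k ξ := by
  have h12 : (1 : ℝ≥0∞) ≤ 2 := by norm_num
  rcases ht.eq_or_lt with rfl | ht
  · have h : Bbar P B 0 = B := by ext x : 1; simp [Bbar]
    rw [h]
    exact ⟨hB, fun k => by simpa using hbh k⟩
  · have hs : 0 < P.mu2 * t := mul_pos P.mu2_pos ht
    refine ⟨memLp_of_cp fun k => ?_, fun k => ?_⟩
    · rw [cp_Bbar hB ht]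
      exact memLp_heat hs h12 le_rfl (memLp_cp hB k)
    · rw [cp_Bbar hB ht]
      refine ((hbh k).heat hs h12 le_rfl (memLp_cp hB k)).congr ae_eq_rfl
        (Eventually.of_forall fun ξ => ?_)
      dsimp only
      rw [Complex.ofReal_exp]
      congr 3
      push_cast; ring

/-- Ensures that the curl of B̄ is square integrable. The heat factor is merely bounded by 1, so
that t = 0 is included: frequencies below 1 use B₀ in L², those above use k ≤ k^{m+1} and the finite
gradient norm. -/
lemma memLp_ds_mul {r q : ℝ≥0∞} (hr1 : 1 ≤ r) (hr2 : r ≤ 2) (hq : 2 ≤ q) {m : ℕ} {p : ℝ≥0∞}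
    (hp1 : 1 ≤ p) (hp2 : p ≤ 2) {B : V → V} (hBp : MemLp B p volume) (hB : MemLp B 2 volume)
    {k l : Fin 3} {bh : V → ℂ} (hbh : IsFT (cp B k) bh)
    (hfin : gradNorm (m + 1 + lossIndex 0 r q) r B ≠ ⊤) {c t : ℝ} (hc : 0 ≤ c) (ht : 0 ≤ t) :
    MemLp (fun ξ => ds l ξ * ((Real.exp (-(c * wn ξ ^ 2) * t) : ℂ) * bh ξ)) 2 volume := by
  have h1 := memLp_high hr1 hr2 hq (m + 1) le_rfl one_pos hp1 hp2 hBp hbh hfin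
  have h2 := hbh.memLp_two (memLp_cp hB k)
  have hm : Continuous fun ξ : V => ds l ξ * (Real.exp (-(c * wn ξ ^ 2) * t) : ℂ) := by
    have h3 := continuous_wn
    have h4 := continuous_ds l
    fun_prop
  refine (h2.norm.add h1.norm).mono' ?_ (Eventually.of_forall fun ξ => ?_)
  · simp only [← mul_assoc]
    exact hm.aestronglyMeasurable.mul h2.1
  · have hk := wn_nonneg ξ
    have h3 : Real.exp (-(c * wn ξ ^ 2) * t) ≤ 1 := by
      rw [Real.exp_le_one_iff]
      have : 0 ≤ c * wn ξ ^ 2 * t := by positivity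
      linarith
    have h4 : ‖ds l ξ * ((Real.exp (-(c * wn ξ ^ 2) * t) : ℂ) * bh ξ)‖ ≤ wn ξ * ‖bh ξ‖ := by
      rw [norm_mul, norm_mul, Complex.norm_real, Real.norm_of_nonneg (Real.exp_pos _).le]
      calc _ ≤ wn ξ * (1 * ‖bh ξ‖) := by gcongr; exact norm_ds_le l ξ
        _ = _ := by rw [one_mul]
    refine h4.trans ?_
    simp only [Pi.add_apply]
    by_cases hξ : 1 ≤ wn ξ
    · have hmem : ξ ∈ {ξ : V | 1 ≤ wn ξ} := hξ
      rw [indicator_of_mem hmem, norm_mul, Complex.norm_real, Real.norm_of_nonneg (by positivity)]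
      have h5 : wn ξ ≤ wn ξ ^ (m + 1) := le_self_pow₀ hξ (by omega)
      have h6 : wn ξ * ‖bh ξ‖ ≤ wn ξ ^ (m + 1) * ‖bh ξ‖ := by gcongr
      linarith [norm_nonneg (bh ξ)]
    · have h5 : wn ξ * ‖bh ξ‖ ≤ 1 * ‖bh ξ‖ := by gcongr; exact (not_le.1 hξ).le
      have h6 : 0 ≤ ‖({ξ : V | 1 ≤ wn ξ}.indicator fun ξ => ((wn ξ ^ (m + 1) : ℝ) : ℂ) * bh ξ) ξ‖ :=
        norm_nonneg _
      linarith

/-- The difference between a field and a multiple of a profile, in Fourier space. -/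
lemma sub_smul_fourier {f g : V → V} (hf : MemLp f 2 volume) (hg : MemLp g 2 volume)
    {fh gh : Fin 3 → V → ℂ} (hfh : ∀ k, IsFT (cp f k) (fh k)) (hgh : ∀ k, IsFT (cp g k) (gh k))
    (N : ℝ) : MemLp (f - N • g) 2 volume ∧
      ∀ k, IsFT (cp (f - N • g) k) fun ξ => fh k ξ - N * gh k ξ := by
  refine ⟨hf.sub (hg.const_smul N), fun k => ?_⟩
  have h := (hfh k).sub (by norm_num) (memLp_cp hf k) ((memLp_cp hg k).const_mul (N : ℂ))
    ((hgh k).const_mul N)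
  convert h using 1
  ext x
  simp [cp]

/-! ### Bounds of the deviation from the profile -/

/-- A crude triangle inequality, for high frequencies only, where solution and profile are small
separately. The curl in the profile is the origin of the extra derivative of B₀. -/
lemma norm_dev_le_of_ne (P : Params) (t : ℝ) (ξ : V) (x : X) {a : Fin 4} (ha : a ≠ 3) (l : Fin 3) :
    ‖dev P t ξ x a l‖ ≤ ‖prop P t ξ x a l‖ + (|P.NA| + |P.NB| + |P.NE|) *
      (Real.exp (-(P.mu2 * wn ξ ^ 2) * t) * ‖curlS ξ (x 3) l‖) := by
  have key : ∀ (z : ℂ) (N : ℝ), |N| ≤ |P.NA| + |P.NB| + |P.NE| →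
      ‖z - N * (Real.exp (-(P.mu2 * wn ξ ^ 2) * t) * curlS ξ (x 3) l)‖ ≤
        ‖z‖ + (|P.NA| + |P.NB| + |P.NE|) *
          (Real.exp (-(P.mu2 * wn ξ ^ 2) * t) * ‖curlS ξ (x 3) l‖) := by
    intro z N hN
    refine (norm_sub_le _ _).trans ?_
    rw [norm_mul, norm_mul, Complex.norm_real, Complex.norm_real,
      Real.norm_of_nonneg (Real.exp_pos _).le, Real.norm_eq_abs]
    gcongr
  have h1 := abs_nonneg P.NA
  have h2 := abs_nonneg P.NB
  have h3 := abs_nonneg P.NE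
  fin_cases a
  · exact key _ _ (by linarith)
  · exact key _ _ (by linarith)
  · exact key _ _ (by linarith)
  · exact absurd rfl ha

lemma norm_dev_three_le (P : Params) (t : ℝ) (ξ : V) (x : X) (l : Fin 3) :
    ‖dev P t ξ x 3 l‖ ≤ ‖prop P t ξ x 3 l‖ + Real.exp (-(P.mu2 * wn ξ ^ 2) * t) * ‖x 3 l‖ := by
  refine (norm_sub_le (prop P t ξ x 3 l) _).trans ?_
  rw [norm_mul, Complex.norm_real, Real.norm_of_nonneg (Real.exp_pos _).le]

/-- Passes from the solenoidal data to the given data: three components with factor 2 give the 6. -/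
lemma sum_norm_le {x : X} {u : Fin 4 → Fin 3 → ℂ} (h : ∀ a, a ≠ 3 → ∀ k, ‖x a k‖ ≤ 2 * ∑ l, ‖u a l‖)
    (h3 : ∀ k, x 3 k = u 3 k) :
    ∑ a, ∑ k, ‖x a k‖ ≤ 6 * ∑ i : Fin 4 × Fin 3, ‖u i.1 i.2‖ := by
  rw [Fintype.sum_prod_type, Finset.mul_sum]
  refine Finset.sum_le_sum fun a _ => ?_
  have h0 : 0 ≤ ∑ l, ‖u a l‖ := by positivity
  by_cases ha : a = 3
  · subst ha
    simp only [h3]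
    linarith
  · calc ∑ k, ‖x a k‖ ≤ ∑ _k : Fin 3, 2 * ∑ l, ‖u a l‖ := Finset.sum_le_sum fun k _ => h a ha k
      _ = _ := by
        simp only [Finset.sum_const, Finset.card_univ, Fintype.card_fin, nsmul_eq_mul]
        push_cast; ring

lemma exists_symbolBound_dev (P : Params) : ∃ k₀ K c₁ c₂ κ : ℝ, 0 < k₀ ∧ 0 < K ∧ 0 < c₁ ∧ 0 < c₂ ∧
    0 < κ ∧ ∀ (uh : Fin 4 → Fin 3 → V → ℂ) (x : V → X), (∀ᵐ ξ, ∀ a, divS ξ (x ξ a) = 0) →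
      (∀ᵐ ξ, ∀ a, a ≠ 3 → ∀ k, ‖x ξ a k‖ ≤ 2 * ∑ l, ‖uh a l ξ‖) →
      (∀ᵐ ξ, ∀ k, x ξ 3 k = uh 3 k ξ) → ∀ t, 0 ≤ t → ∀ l,
      SymbolBound k₀ K c₁ c₂ κ 1 0 uh t (fun ξ => dev P t ξ (x ξ) 3 l) ∧
      ∀ a, a ≠ 3 → SymbolBound k₀ K c₁ c₂ κ 2 1 uh t (fun ξ => dev P t ξ (x ξ) a l) := by
  obtain ⟨k₀, K, c₁, p, hk₀, hK, hc₁, hp, hlow⟩ := exists_norm_dev_le P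
  obtain ⟨K', c₂, hK', hc₂, hhigh⟩ := exists_norm_prop_le P
  have hμ := P.mu2_pos
  obtain ⟨N, hN⟩ : ∃ N, N = |P.NA| + |P.NB| + |P.NE| := ⟨_, rfl⟩
  have hN0 : 0 ≤ N := by rw [hN]; positivity
  obtain ⟨L, hL⟩ : ∃ L, L = 6 * K + 6 * K' + 2 * N + 1 := ⟨_, rfl⟩
  have hL1 : K * 6 ≤ L := by linarith
  have hL2 : K' * 6 ≤ L := by linarith
  have hL3 : 2 * N ≤ L := by linarith
  have hL4 : 1 ≤ L := by linarith
  -- The smaller of the relaxation rate p to Darcy's law and the decay rate μ₂k₀² of the profile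
  -- above k₀; both depend on the physical constants only.
  obtain ⟨κ, hκ⟩ : ∃ κ, κ = min p (P.mu2 * k₀ ^ 2) := ⟨_, rfl⟩
  have hκ1 : κ ≤ p := hκ ▸ min_le_left _ _
  have hκ2 : κ ≤ P.mu2 * k₀ ^ 2 := hκ ▸ min_le_right _ _
  refine ⟨k₀, L, c₁, c₂, κ, hk₀, by linarith, hc₁, hc₂, by rw [hκ]; positivity,
    fun uh x hdiv hx hx3 t ht l => ?_⟩
  have hp' : Real.exp (-p * t) ≤ Real.exp (-κ * t) := by gcongr
  have hμ' : ∀ {k : ℝ}, k₀ ≤ k → κ ≤ P.mu2 * k ^ 2 := fun hk => hκ2.trans (by gcongr)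
  refine ⟨⟨?_, ?_⟩, fun a ha => ⟨?_, ?_⟩⟩
  · filter_upwards [hdiv, hx, hx3, ae_wn_pos] with ξ h1 h2 h3 hξ hlt
    have h4 := sum_norm_le h2 h3
    calc _ ≤ K * (wn ξ * Real.exp (-(c₁ * wn ξ ^ 2) * t)) * ∑ a, ∑ l, ‖x ξ a l‖ :=
          (hlow ξ (x ξ) hξ hlt.le h1 t ht l).1
      _ ≤ K * (wn ξ ^ 1 * Real.exp (-(c₁ * wn ξ ^ 2) * t) + Real.exp (-κ * t)) *
          (6 * ∑ i : Fin 4 × Fin 3, ‖uh i.1 i.2 ξ‖) := by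
          gcongr
          rw [pow_one]
          exact le_add_of_nonneg_right (Real.exp_pos _).le
      _ = K * 6 * (wn ξ ^ 1 * Real.exp (-(c₁ * wn ξ ^ 2) * t) + Real.exp (-κ * t)) *
          ∑ i : Fin 4 × Fin 3, ‖uh i.1 i.2 ξ‖ := by ring
      _ ≤ _ := by gcongr
  · filter_upwards [hdiv, hx, hx3, ae_wn_pos] with ξ h1 h2 h3 hξ hle
    have h4 := sum_norm_le h2 h3
    have h5 : ‖x ξ 3 l‖ ≤ ∑ l, ‖uh 3 l ξ‖ := by
      rw [h3]
      exact Finset.single_le_sum (f := fun l => ‖uh 3 l ξ‖) (fun _ _ => norm_nonneg _)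
        (Finset.mem_univ l)
    refine (norm_dev_three_le P t ξ (x ξ) l).trans (add_le_add ?_ ?_)
    · calc _ ≤ K' * Real.exp (-(c₂ * (wn ξ / (1 + wn ξ ^ 2)) ^ 2) * t) * ∑ a, ∑ l, ‖x ξ a l‖ :=
            hhigh ξ (x ξ) hξ h1 t ht 3 l
        _ ≤ K' * Real.exp (-(c₂ * (wn ξ / (1 + wn ξ ^ 2)) ^ 2) * t) *
            (6 * ∑ i : Fin 4 × Fin 3, ‖uh i.1 i.2 ξ‖) := by gcongr
        _ = K' * 6 * Real.exp (-(c₂ * (wn ξ / (1 + wn ξ ^ 2)) ^ 2) * t) *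
            ∑ i : Fin 4 × Fin 3, ‖uh i.1 i.2 ξ‖ := by ring
        _ ≤ _ := by gcongr
    · rw [pow_zero, mul_one]
      calc _ ≤ 1 * Real.exp (-κ * t) * ∑ l, ‖uh 3 l ξ‖ := by
            rw [one_mul]
            gcongr
            exact hμ' hle
        _ ≤ _ := by gcongr
  · filter_upwards [hdiv, hx, hx3, ae_wn_pos] with ξ h1 h2 h3 hξ hlt
    have h4 := sum_norm_le h2 h3
    calc _ ≤ K * (wn ξ ^ 2 * Real.exp (-(c₁ * wn ξ ^ 2) * t) + Real.exp (-p * t)) *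
            ∑ a, ∑ l, ‖x ξ a l‖ := (hlow ξ (x ξ) hξ hlt.le h1 t ht l).2 a ha
      _ ≤ K * (wn ξ ^ 2 * Real.exp (-(c₁ * wn ξ ^ 2) * t) + Real.exp (-κ * t)) *
          (6 * ∑ i : Fin 4 × Fin 3, ‖uh i.1 i.2 ξ‖) := by gcongr
      _ = K * 6 * (wn ξ ^ 2 * Real.exp (-(c₁ * wn ξ ^ 2) * t) + Real.exp (-κ * t)) *
          ∑ i : Fin 4 × Fin 3, ‖uh i.1 i.2 ξ‖ := by ring
      _ ≤ _ := by gcongr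
  · filter_upwards [hdiv, hx, hx3, ae_wn_pos] with ξ h1 h2 h3 hξ hle
    have h4 := sum_norm_le h2 h3
    have h5 : ∀ l, ‖x ξ 3 l‖ ≤ ∑ l, ‖uh 3 l ξ‖ := fun l => by
      rw [h3]
      exact Finset.single_le_sum (f := fun l => ‖uh 3 l ξ‖) (fun _ _ => norm_nonneg _)
        (Finset.mem_univ l)
    refine (norm_dev_le_of_ne P t ξ (x ξ) ha l).trans (add_le_add ?_ ?_)
    · calc _ ≤ K' * Real.exp (-(c₂ * (wn ξ / (1 + wn ξ ^ 2)) ^ 2) * t) * ∑ a, ∑ l, ‖x ξ a l‖ :=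
            hhigh ξ (x ξ) hξ h1 t ht a l
        _ ≤ K' * Real.exp (-(c₂ * (wn ξ / (1 + wn ξ ^ 2)) ^ 2) * t) *
            (6 * ∑ i : Fin 4 × Fin 3, ‖uh i.1 i.2 ξ‖) := by gcongr
        _ = K' * 6 * Real.exp (-(c₂ * (wn ξ / (1 + wn ξ ^ 2)) ^ 2) * t) *
            ∑ i : Fin 4 × Fin 3, ‖uh i.1 i.2 ξ‖ := by ring
        _ ≤ _ := by gcongr
    · rw [← hN, pow_one]
      calc N * (Real.exp (-(P.mu2 * wn ξ ^ 2) * t) * ‖curlS ξ (x ξ 3) l‖)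
          ≤ N * (Real.exp (-κ * t) * (wn ξ * (∑ l, ‖uh 3 l ξ‖ + ∑ l, ‖uh 3 l ξ‖))) := by
            gcongr
            · exact hμ' hle
            · refine (norm_curlS_le ξ (x ξ 3) l).trans ?_
              gcongr
              · exact h5 _
              · exact h5 _
        _ = 2 * N * Real.exp (-κ * t) * wn ξ * ∑ l, ‖uh 3 l ξ‖ := by ring
        _ ≤ _ := by gcongr

/-! ### The decay estimate -/

/-- The magnetic component is free of conditions, while the other three involve the curl of B̄ and
need it to be in L². -/
lemma dev_fourier {P : Params} {U : ℝ → State} (hU : IsSolution P U) {x : V → X}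
    (hx : ∀ a k, IsFT (cp ((U 0).field a) k) fun ξ => x ξ a k) {B : V → V} (hB : MemLp B 2 volume)
    (hxB : ∀ k, IsFT (cp B k) fun ξ => x ξ 3 k) {t : ℝ} (ht : 0 ≤ t) :
    (MemLp ((U t).field 3 - (profile P B t).field 3) 2 volume ∧
      ∀ l, IsFT (cp ((U t).field 3 - (profile P B t).field 3) l) fun ξ => dev P t ξ (x ξ) 3 l) ∧
    ((∀ k l, MemLp (fun ξ => ds l ξ * ((Real.exp (-(P.mu2 * wn ξ ^ 2) * t) : ℂ) * x ξ 3 k))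
        2 volume) → ∀ a, a ≠ 3 →
      MemLp ((U t).field a - (profile P B t).field a) 2 volume ∧
      ∀ l, IsFT (cp ((U t).field a - (profile P B t).field a) l) fun ξ => dev P t ξ (x ξ) a l) := by
  have hB1 := Bbar_fourier (P := P) hB hxB ht
  refine ⟨?_, fun h2 => ?_⟩
  · have h := sub_smul_fourier (hU.memLp_field ht 3) hB1.1 (hU.isFT hx ht 3) hB1.2 1
    simp only [one_smul, Complex.ofReal_one, one_mul] at h
    exact h
  · have hc := weakCurl_fourier hB1.1 hB1.2 h2
    have hc2 : ∀ k, IsFT (cp (weakCurl (Bbar P B t)) k) fun ξ =>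
        (Real.exp (-(P.mu2 * wn ξ ^ 2) * t) : ℂ) * curlS ξ (x ξ 3) k := fun k => by
      refine (hc.2 k).congr ae_eq_rfl (Eventually.of_forall fun ξ => ?_)
      dsimp only [curlS]
      ring
    intro a ha
    fin_cases a
    · exact sub_smul_fourier (hU.memLp_field ht 0) hc.1 (hU.isFT hx ht 0) hc2 P.NA
    · exact sub_smul_fourier (hU.memLp_field ht 1) hc.1 (hU.isFT hx ht 1) hc2 P.NB
    · exact sub_smul_fourier (hU.memLp_field ht 2) hc.1 (hU.isFT hx ht 2) hc2 P.NE
    · exact absurd rfl ha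

/-- Fourier transforms of the initial data of a solution. -/
lemma HasInitialData.exists_fourier {P : Params} {U : ℝ → State} {U₀ : State} {p : ℝ≥0∞}
    (hp1 : 1 ≤ p) (hp2 : p ≤ 2) (hU : IsSolution P U) (h0 : HasInitialData U U₀) (hp : U₀.MemLp p)
    (hdiv : IsWeaklyDivFree U₀.B) :
    ∃ (uh : Fin 4 → Fin 3 → V → ℂ) (x : V → X), (∀ a l, IsFT (cp (U₀.field a) l) (uh a l)) ∧
      (∀ a k, IsFT (cp ((U 0).field a) k) fun ξ => x ξ a k) ∧
      (∀ k, IsFT (cp U₀.B k) fun ξ => x ξ 3 k) ∧ (∀ᵐ ξ, ∀ a, divS ξ (x ξ a) = 0) ∧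
      (∀ᵐ ξ, ∀ a, a ≠ 3 → ∀ k, ‖x ξ a k‖ ≤ 2 * ∑ l, ‖uh a l ξ‖) ∧
      ∀ᵐ ξ, ∀ k, x ξ 3 k = uh 3 k ξ := by
  choose uh huh using fun a l => exists_isFT hp1 hp2 (memLp_cp (State.memLp_field hp a) l)
  have hx : ∀ a k, IsFT (cp ((U 0).field a) k) (hU.hat a k 0) := hU.isFT_hat le_rfl
  have hB : ∀ k, IsFT (cp U₀.B k) (hU.hat 3 k 0) := fun k =>
    (hx 3 k).congr (h0.B.mono fun y hy => by
      change cp (U 0).B k y = _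
      simp only [cp, hy]) ae_eq_rfl
  have ht : ∀ a, a ≠ 3 → IsTransversePart (U₀.field a) ((U 0).field a) := by
    intro a ha
    fin_cases a
    exacts [h0.ui, h0.ue, h0.E, absurd rfl ha]
  have hbd : ∀ᵐ ξ, ∀ a, a ≠ 3 → ∑ l, ds l ξ * hU.hat a l 0 ξ = 0 ∧
      ∀ k, ‖hU.hat a k 0 ξ‖ ≤ 2 * ∑ l, ‖uh a l ξ‖ := by
    refine ae_all_iff.2 fun a => ?_
    by_cases ha : a = 3
    · exact Eventually.of_forall fun ξ h => absurd ha h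
    · exact ((ht a ha).fourier_bounds hp1 (State.memLp_field hp a) (huh a) (hx a)).mono
        fun ξ h _ => h
  refine ⟨uh, fun ξ a k => hU.hat a k 0 ξ, huh, hx, hB, ?_, ?_, ?_⟩
  · filter_upwards [hbd, hdiv.fourier_eq hp1 hp.2.2.2 hB] with ξ h1 h2 a
    by_cases ha : a = 3
    · subst ha; exact h2
    · exact (h1 a ha).1
  · filter_upwards [hbd] with ξ h a ha k using (h a ha).2 k
  · exact ae_all_iff.2 fun k => (hB k).unique (huh 3 k)

/-- Decay of all four fields towards the asymptotic profile. -/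
theorem exists_gradNorm_sub_profile_le (P : Params) : ∃ κ : ℝ, 0 < κ ∧
    ∀ (m : ℕ) (p r q : ℝ≥0∞) (ℓ : ℝ), 1 ≤ p → p ≤ 2 → 1 ≤ r → r ≤ 2 → 2 ≤ q → 0 ≤ ℓ →
    ∃ C : ℝ, 0 < C ∧ ∀ (U₀ : State) (U : ℝ → State), U₀.MemLp p → IsWeaklyDivFree U₀.B →
      IsSolution P U → HasInitialData U U₀ → ∀ t : ℝ, 0 ≤ t →
      (∀ a, a ≠ 3 → gradNorm m q ((U t).field a - (profile P U₀.B t).field a) ≤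
        decayBound C κ m p r q ℓ 2 1 U₀ t) ∧
      gradNorm m q ((U t).field 3 - (profile P U₀.B t).field 3) ≤
        decayBound C κ m p r q ℓ 1 0 U₀ t := by
  obtain ⟨k₀, K, c₁, c₂, κ, hk₀, hK, hc₁, hc₂, hκ, hdev⟩ := exists_symbolBound_dev P
  refine ⟨κ, hκ, fun m p r q ℓ hp1 hp2 hr1 hr2 hq hℓ => ?_⟩
  obtain ⟨C₁, hC₁, h₁⟩ := exists_gradNorm_le hp1 hp2 hr1 hr2 hq m 2 1 (κ := κ) hℓ hk₀ hK hc₁ hc₂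
  obtain ⟨C₂, hC₂, h₂⟩ := exists_gradNorm_le hp1 hp2 hr1 hr2 hq m 1 0 (κ := κ) hℓ hk₀ hK hc₁ hc₂
  refine ⟨C₁ + C₂, by positivity, fun U₀ U hp hdiv hU h0 t ht => ?_⟩
  obtain ⟨uh, x, huh, hx, hxB, hxdiv, hxbd, hx3⟩ := h0.exists_fourier hp1 hp2 hU hp hdiv
  -- The data are assumed only in L^p; B₀ is also square integrable because it agrees almost
  -- everywhere with the solution at time 0.
  have hB : MemLp U₀.B 2 volume := (memLp_congr_ae h0.B).1 (hU.memLp_field le_rfl 3)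
  have hS := hdev uh x hxdiv hxbd hx3 t ht
  obtain ⟨hF3, hF⟩ := dev_fourier hU hx hB hxB ht
  refine ⟨fun a ha => ?_, ?_⟩
  · refine (h₁ U₀ uh _ t hp huh ht fun hfin => ?_).trans
      (decayBound_mono (by linarith) κ m p r q ℓ 2 1 U₀ ht)
    have h2 := hF (fun k l => memLp_ds_mul hr1 hr2 hq hp1 hp2 hp.2.2.2 hB (hxB k) hfin
      P.mu2_pos.le ht) a ha
    exact ⟨h2.1, _, h2.2, fun l => (hS l).2 a ha⟩
  · refine (h₂ U₀ uh _ t hp huh ht fun _ => ?_).trans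
      (decayBound_mono (by linarith) κ m p r q ℓ 1 0 U₀ ht)
    exact ⟨hF3.1, _, hF3.2, fun l => (hS l).1⟩

end EulerMaxwell

end

theorem theorem4p2 (P : EulerMaxwell.Params) :
    ∃ κ : ℝ, 0 < κ ∧
      ∀ (m : ℕ) (p r q : ℝ≥0∞) (ℓ : ℝ), 1 ≤ m → 1 ≤ p → p ≤ 2 → 1 ≤ r → r ≤ 2 → 2 ≤ q → 0 ≤ ℓ →
      ∃ C : ℝ, 0 < C ∧
        ∀ (U₀ : EulerMaxwell.State) (U : ℝ → EulerMaxwell.State),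
          U₀.MemLp p → EulerMaxwell.IsWeaklyDivFree U₀.B →
          EulerMaxwell.IsSolution P U → EulerMaxwell.HasInitialData U U₀ →
          ∀ t : ℝ, 0 ≤ t →
            EulerMaxwell.gradNorm m q ((U t).ui - (EulerMaxwell.profile P U₀.B t).ui) ≤
                EulerMaxwell.decayBound C κ m p r q ℓ 2 1 U₀ t ∧
            EulerMaxwell.gradNorm m q ((U t).ue - (EulerMaxwell.profile P U₀.B t).ue) ≤
                EulerMaxwell.decayBound C κ m p r q ℓ 2 1 U₀ t ∧
            EulerMaxwell.gradNorm m q ((U t).E - (EulerMaxwell.profile P U₀.B t).E) ≤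
                EulerMaxwell.decayBound C κ m p r q ℓ 2 1 U₀ t ∧
            EulerMaxwell.gradNorm m q ((U t).B - (EulerMaxwell.profile P U₀.B t).B) ≤
                EulerMaxwell.decayBound C κ m p r q ℓ 1 0 U₀ t := by
  obtain ⟨κ, hκ, h⟩ := EulerMaxwell.exists_gradNorm_sub_profile_le P
  refine ⟨κ, hκ, fun m p r q ℓ _ hp1 hp2 hr1 hr2 hq hℓ => ?_⟩
  obtain ⟨C, hC, h⟩ := h m p r q ℓ hp1 hp2 hr1 hr2 hq hℓ
  refine ⟨C, hC, fun U₀ U hp hdiv hU h0 t ht => ?_⟩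
  have hb := h U₀ U hp hdiv hU h0 t ht
  exact ⟨hb.1 0 (by decide), hb.1 1 (by decide), hb.1 2 (by decide), hb.2⟩
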